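/- Let $X$ be a smooth separated (for instance smooth quasi-projective) surface over $\mathbb C$, let $k\ge 0$, and let $E_1,\dots,E_k$ be locally free sheaves of finite rank on $X$. Write $[m]=\{1,\dots,m\}$. **The sheaves $K_\ell$ and the maps $\varphi_\ell$.** For $n\ge 0$ let $\mathrm{pr}_i\colon X^n\to X$ be the projections, for $1\le i<j\le n$ let $\iota_{ij}\colon\Delta_{ij}\hookrightarrow X^n$ be the diagonal where $\mathrm{pr}_i=\mathrm{pr}_j$, $\mathcal I_{ij}$ its ideal sheaf, and $N_{ij}^\vee=\iota_{ij}^*\mathcal I_{ij}$ its conormal sheaf. Put $K_0=\bigoplus_{c\colon[k]\to[n]}\bigotimes_{t=1}^k\mathrm{pr}_{c(t)}^*E_t$, and for $\ell\ge1$ $$T_\ell=\bigoplus_{(M;i,j;a)}\ \iota_{ij*}\Bigl(S^{\ell-1}N_{ij}^\vee\otimes\bigotimes_{t\in M}\iota_{ij}^*\mathrm{pr}_i^*E_t\otimes\bigotimes_{t\notin M}\iota_{ij}^*\mathrm{pr}_{a(t)}^*E_t\Bigr),$$ the sum running over all $M\subseteq[k]$ with $|M|=\ell$, all $1\le i<j\le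 n$ and all $a\colon[k]\setminus M\to[n]$. There are subsheaves $K_0\supseteq K_1\supseteq\dots\supseteq K_k$ and morphisms $\varphi_\ell\colon K_{\ell-1}\to T_\ell$ with $K_\ell=\ker\varphi_\ell$ for $\ell=1,\dots,k$, where $\varphi_\ell$ is the unique morphism with the following property: whenever one trivialises the $E_t$ over open subsets of $X$ and uses the induced trivialisations on $X^n$ (pulling back the same trivialisation of $E_t$ along $\mathrm{pr}_i$ and along $\mathrm{pr}_j$), then, coefficientwise, $$\varphi_\ell(s)(M;i,j;a)=\sum_{b\colon M\to\{i,j\}}(-1)^{\#b^{-1}(j)}\,s(a\uplus b)\ \bmod \mathcal I_{ij}^{\ell},$$ where the sum lies in $\mathcal I_{ij}^{\ell-1}$ and $\mathcal I_{ij}^{\ell-1}/\mathcal I_{ij}^\ell=S^{\ell-1}N_{ij}^\vee$. **The complexes on $X^2$.** For $M\subseteq[k]$ let $\rho_M\subset\mathbb C^k$ be the space of vectors with coordinate sum $0$ that are supported in $M$. If $M=\{t_1<\dots<t_m\}$, let $\zeta_M^r=e_{t_r}-e_{t_{r+1}}$, and for $t\in M$ let $\varepsilon_{t,M}=(-1)^{\#\{u\in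 M\mid u<t\}}$. For $\ell\ge1$ and $i\ge0$ let $$R_\ell^i=\bigoplus_{\substack{M\subseteq[k],\ |M|=\ell+i\\ a\colon[k]\setminus M\to\{1,2\}}}\wedge^{\ell-1}\rho_M,\qquad d(s)(M;a)=\sum_{t\in M}\varepsilon_{t,M}\bigl(s(M\setminus\{t\};a,t\mapsto1)-s(M\setminus\{t\};a,t\mapsto2)\bigr),$$ using the inclusions $\wedge^{\ell-1}\rho_{M\setminus\{t\}}\subseteq\wedge^{\ell-1}\rho_M$. Let $\delta\colon X\to X^2$ be the diagonal, $H_\ell=\delta_*(S^{\ell-1}\Omega_X\otimes E_1\otimes\dots\otimes E_k)$ and $T_\ell^\bullet=H_\ell\otimes_{\mathbb C}R_\ell^\bullet$. For $n=2$ identify $T_\ell$ with $T_\ell^0$ by sending $1$ in the summand $(M;a)$ to $\zeta_M^1\wedge\dots\wedge\zeta_M^{\ell-1}$. Then for every $\ell=1,\dots,k$ the sequence of sheaves on $X^2$ $$0\to K_\ell\to K_{\ell-1}\xrightarrow{\varphi_\ell}T_\ell^0\to T_\ell^1\to\dots\to T_\ell^{k-\ell}\to0$$ is exact, and it remains exact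 after tensoring with $L^{\boxtimes2}=\mathrm{pr}_1^*L\otimes\mathrm{pr}_2^*L$ for every line bundle $L$ on $X$. **The open sets $X^n_{**}$.** For every $n$ let $X^n_{**}\subseteq X^n$ be the complement of the union of all intersections of two different diagonals $\Delta_{ij}$ ($i<j$). On $X^n$ put $$T_\ell^\bullet=\bigoplus_{\substack{1\le i<j\le n,\ \hat M\subseteq[k]\\ a\colon[k]\setminus\hat M\to[n]\setminus\{i,j\}}}\iota_{ij*}\Bigl(S^{\ell-1}N_{ij}^\vee\otimes\bigotimes_{t\in\hat M}\iota_{ij}^*\mathrm{pr}_i^*E_t\otimes\bigotimes_{t\notin\hat M}\iota_{ij}^*\mathrm{pr}_{a(t)}^*E_t\Bigr)\otimes_{\mathbb C}R_\ell^\bullet(\hat M),$$ where $R_\ell^\bullet(\hat M)$ is defined as above with $\hat M$ instead of $[k]$, and identify $T_\ell$ with $T_\ell^0$ as before. Then for every $\ell=1,\dots,k$ the restriction to $X^n_{**}$ of the sequence $$0\to K_\ell\to K_{\ell-1}\xrightarrow{\varphi_\ell}T_\ell^0\to T_\ell^1\to\dots\to T_\ell^{k-\ell}\to0$$ is exact.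 -/

import Mathlib

open CategoryTheory Limits AlgebraicGeometry MonoidalCategory Opposite TensorProduct

noncomputable section

namespace LongDiag

section Algebra

variable {R S T : Type} [CommRing R] [CommRing S] [CommRing T]

variable {ι : Type} {M N P : ι → Type}
  [∀ t, AddCommGroup (M t)] [∀ t, Module R (M t)]
  [∀ t, AddCommGroup (N t)] [∀ t, Module S (N t)]

/-- The map `⨂_R M_t → ⨂_S N_t` induced by a family of semilinear maps. -/
def piMap (σ : R →+* S) (f : ∀ t, M t →ₛₗ[σ] N t) :
    (⨂[R] t, M t) →+ (⨂[S] t, N t) :=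
  letI : Module R (⨂[S] t, N t) := Module.compHom _ σ
  (PiTensorProduct.lift
    { toFun := fun v => PiTensorProduct.tprod S fun t => f t (v t)
      map_update_add' := by
        intro _ v t x y
        have h : ∀ z, (fun s => f s (Function.update v t z s)) =
            Function.update (fun s => f s (v s)) t (f t z) := fun z => by
          ext s; by_cases hs : s = t
          · subst hs; simp
          · simp [hs]
        simp [h]
      map_update_smul' := by
        intro _ v t r x
        have h : ∀ z, (fun s => f s (Function.update v t z s)) =
            Function.update (fun s => f s (v s)) t (f t z) := fun z => by
          ext s; by_cases hs : s = t
          · subst hs; simp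
          · simp [hs]
        simp only [h, map_smulₛₗ, MultilinearMap.map_update_smul]
        rfl } : (⨂[R] t, M t) →ₗ[R] (⨂[S] t, N t)).toAddMonoidHom

lemma piMap_tprod (σ : R →+* S) (f : ∀ t, M t →ₛₗ[σ] N t) (v : ∀ t, M t) :
    piMap σ f (PiTensorProduct.tprod R v) = PiTensorProduct.tprod S fun t => f t (v t) := by
  let _ : Module R (⨂[S] t, N t) := Module.compHom _ σ
  exact PiTensorProduct.lift.tprod v

lemma piMap_smul (σ : R →+* S) (f : ∀ t, M t →ₛₗ[σ] N t) (r : R) (x : ⨂[R] t, M t) :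
    piMap σ f (r • x) = σ r • piMap σ f x := by
  let _ : Module R (⨂[S] t, N t) := Module.compHom _ σ
  unfold piMap
  exact LinearMap.map_smul (PiTensorProduct.lift _ : (⨂[R] t, M t) →ₗ[R] (⨂[S] t, N t)) r x

/-- An additive map out of a tensor product that is semilinear is determined by pure tensors. -/
lemma pi_ext {A : Type} [AddCommGroup A] [Module S A] (σ : R →+* S) (f g : (⨂[R] t, M t) →+ A)
    (hf : ∀ (r : R) x, f (r • x) = σ r • f x) (hg : ∀ (r : R) x, g (r • x) = σ r • g x)
    (h : ∀ v, f (PiTensorProduct.tprod R v) = g (PiTensorProduct.tprod R v)) (x) : f x = g x := by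
  induction x using PiTensorProduct.induction_on with
  | smul_tprod r v => rw [hf, hg, h]
  | add x y hx hy => rw [map_add, map_add, hx, hy]

variable {A B : Type} [AddCommGroup A] [Module R A] [AddCommGroup B] [Module S B]

/-- The map `Sym^m_R A → Sym^m_S B` induced by a semilinear map. -/
def symMap (m : ℕ) (σ : R →+* S) (f : A →ₛₗ[σ] B) :
    SymmetricPower R (Fin m) A →+ SymmetricPower S (Fin m) B :=
  AddCon.lift _ (((SymmetricPower.mk S (Fin m) B).toAddMonoidHom).comp (piMap σ fun _ => f)) (by
    refine AddCon.addConGen_le.2 ?_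
    rintro _ _ ⟨e, v⟩
    change SymmetricPower.mk S (Fin m) B (piMap σ (fun _ => f) _) =
      SymmetricPower.mk S (Fin m) B (piMap σ (fun _ => f) _)
    rw [piMap_tprod, piMap_tprod]
    exact (SymmetricPower.tprod_equiv (R := S) e fun i => f (v i)).symm)

lemma symMap_mk (m : ℕ) (σ : R →+* S) (f : A →ₛₗ[σ] B) (x : ⨂[R] _ : Fin m, A) :
    symMap m σ f (SymmetricPower.mk R (Fin m) A x) =
      SymmetricPower.mk S (Fin m) B (piMap σ (fun _ => f) x) := rfl

lemma mk_surjective (m : ℕ) : Function.Surjective (SymmetricPower.mk R (Fin m) A) :=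
  LinearMap.range_eq_top.1 (SymmetricPower.range_mk R (Fin m) A)

lemma symMap_smul (m : ℕ) (σ : R →+* S) (f : A →ₛₗ[σ] B) (r : R)
    (x : SymmetricPower R (Fin m) A) : symMap m σ f (r • x) = σ r • symMap m σ f x := by
  obtain ⟨x, rfl⟩ := mk_surjective m x
  rw [← map_smul, symMap_mk, piMap_smul, map_smul, symMap_mk]

end Algebra

/-- Presheaves of `𝒪_Y`-modules. -/
abbrev PreMod (Y : Scheme.{0}) := PresheafOfModules.{0} (Y.presheaf ⋙ forget₂ CommRingCat RingCat)

variable {Y : Scheme.{0}}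


/-- The structure presheaf, as a presheaf of rings. -/
abbrev OO (Y : Scheme.{0}) : Y.Opensᵒᵖ ⥤ RingCat := Y.presheaf ⋙ forget₂ CommRingCat RingCat

lemma OO_id (U : Y.Opensᵒᵖ) (r : (OO Y).obj U) : ((OO Y).map (𝟙 U)).hom r = r := by
  rw [(OO Y).map_id]; rfl

lemma OO_comp {U V W : Y.Opensᵒᵖ} (f : U ⟶ V) (g : V ⟶ W) (r : (OO Y).obj U) :
    ((OO Y).map (f ≫ g)).hom r = ((OO Y).map g).hom (((OO Y).map f).hom r) := by
  rw [(OO Y).map_comp]; rfl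

lemma res_id (P : PreMod Y) (U : Y.Opensᵒᵖ) (x : P.obj U) : P.restrictₛₗ (𝟙 U) x = x :=
  ConcreteCategory.congr_hom (P.presheaf.map_id U) x

lemma res_comp (P : PreMod Y) {U V W : Y.Opensᵒᵖ} (f : U ⟶ V) (g : V ⟶ W) (x : P.obj U) :
    P.restrictₛₗ (f ≫ g) x = P.restrictₛₗ g (P.restrictₛₗ f x) :=
  ConcreteCategory.congr_hom (P.presheaf.map_comp f g) x

lemma piMap_id {ι : Type} (M : ι → PreMod Y) (U : Y.Opensᵒᵖ) (x) :
    piMap _ (fun t => (M t).restrictₛₗ (𝟙 U)) x = x :=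
  pi_ext _ _ (AddMonoidHom.id _) (piMap_smul _ _)
    (fun r x => by simp only [AddMonoidHom.id_apply]; rw [OO_id])
    (fun v => by
      rw [piMap_tprod, AddMonoidHom.id_apply]
      exact congrArg _ (funext fun t => res_id (M t) U (v t))) x

lemma piMap_comp {ι : Type} (M : ι → PreMod Y) {U V W : Y.Opensᵒᵖ} (f : U ⟶ V) (g : V ⟶ W) (x) :
    piMap _ (fun t => (M t).restrictₛₗ (f ≫ g)) x =
      piMap _ (fun t => (M t).restrictₛₗ g) (piMap _ (fun t => (M t).restrictₛₗ f) x) :=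
  pi_ext _ _ ((piMap _ (fun t => (M t).restrictₛₗ g)).comp (piMap _ (fun t => (M t).restrictₛₗ f)))
    (piMap_smul _ _)
    (fun r x => by
      simp only [AddMonoidHom.comp_apply, piMap_smul]; rw [OO_comp])
    (fun v => by
      rw [AddMonoidHom.comp_apply, piMap_tprod, piMap_tprod, piMap_tprod]
      exact congrArg _ (funext fun t => res_comp (M t) f g (v t))) x

/-- The presheaf `U ↦ ⨂_t M_t(U)`. -/
def piTensor {ι : Type} (M : ι → PreMod Y) : PreMod Y :=
  PresheafOfModules.ofPresheaf (R := OO Y)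
    { obj := fun U => AddCommGrpCat.of (⨂[(OO Y).obj U] t, (M t).obj U)
      map := fun f => AddCommGrpCat.ofHom (piMap _ fun t => (M t).restrictₛₗ f)
      map_id := fun U => by
        ext x; exact piMap_id M U x
      map_comp := fun f g => by
        ext x; exact piMap_comp M f g x }
    (fun _ _ f r x => piMap_smul _ (fun t => (M t).restrictₛₗ f) r x)

/-- The presheaf `U ↦ Sym^m M(U)`. -/
def symPow (m : ℕ) (M : PreMod Y) : PreMod Y :=
  PresheafOfModules.ofPresheaf (R := OO Y)
    { obj := fun U => AddCommGrpCat.of (SymmetricPower ((OO Y).obj U) (Fin m) (M.obj U))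
      map := fun f => AddCommGrpCat.ofHom (symMap m _ (M.restrictₛₗ f))
      map_id := fun U => by
        ext x
        obtain ⟨x, rfl⟩ := mk_surjective m x
        exact congrArg _ (piMap_id (fun _ => M) U x)
      map_comp := fun f g => by
        ext x
        obtain ⟨x, rfl⟩ := mk_surjective m x
        exact congrArg _ (piMap_comp (fun _ => M) f g x) }
    (fun _ _ f r x => symMap_smul m _ (M.restrictₛₗ f) r x)

/-- A section `⊗_t x_t` of the tensor product presheaf. -/
def pureTensor {ι : Type} (M : ι → PreMod Y) {U : Y.Opensᵒᵖ} (x : ∀ t, (M t).obj U) :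
    (piTensor M).obj U :=
  PiTensorProduct.tprod ((OO Y).obj U) x

/-- A product `x_1 ⋯ x_m` of sections. -/
def symProd {m : ℕ} (M : PreMod Y) {U : Y.Opensᵒᵖ} (x : Fin m → M.obj U) : (symPow m M).obj U :=
  SymmetricPower.tprod ((OO Y).obj U) x

variable (s : Y ⟶ Spec (.of ℂ))

/-- The constants: the ring homomorphism `ℂ → 𝒪_Y(U)` given by the structure morphism. -/
def const (U : Y.Opensᵒᵖ) : ℂ →+* (OO Y).obj U :=
  ((Y.presheaf.map (homOfLE le_top : unop U ⟶ ⊤).op).hom.comp s.appTop.hom).comp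
    (Scheme.ΓSpecIso (.of ℂ)).inv.hom

lemma map_const {U V : Y.Opensᵒᵖ} (f : U ⟶ V) (z : ℂ) :
    ((OO Y).map f).hom (const s U z) = const s V z := by
  have := ConcreteCategory.congr_hom
    (Y.presheaf.map_comp (homOfLE le_top : unop U ⟶ ⊤).op f)
  exact (this _).symm

/-- `M(U)`, regarded as a complex vector space. -/
def CMod (_ : Y ⟶ Spec (.of ℂ)) (M : PreMod Y) (U : Y.Opensᵒᵖ) : Type := M.obj U

instance (M : PreMod Y) (U : Y.Opensᵒᵖ) : AddCommGroup (CMod s M U) :=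
  inferInstanceAs (AddCommGroup (M.obj U))

instance (M : PreMod Y) (U : Y.Opensᵒᵖ) : Module ((OO Y).obj U) (CMod s M U) :=
  inferInstanceAs (Module ((OO Y).obj U) (M.obj U))

instance (M : PreMod Y) (U : Y.Opensᵒᵖ) : Module ℂ (CMod s M U) :=
  Module.compHom (CMod s M U) (const s U)

lemma CMod.smul_def (M : PreMod Y) (U : Y.Opensᵒᵖ) (z : ℂ) (x : CMod s M U) :
    z • x = const s U z • x := rfl

instance (M : PreMod Y) (U : Y.Opensᵒᵖ) : SMulCommClass ℂ ((OO Y).obj U) (CMod s M U) :=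
  ⟨fun z r x => by rw [CMod.smul_def, CMod.smul_def, ← mul_smul, ← mul_smul, mul_comm]⟩

/-- The restriction maps are complex linear. -/
def cRes (M : PreMod Y) {U V : Y.Opensᵒᵖ} (f : U ⟶ V) : CMod s M U →ₗ[ℂ] CMod s M V where
  toFun := M.restrictₛₗ f
  map_add' := map_add (M.restrictₛₗ f)
  map_smul' := fun z x => by
    refine ((M.restrictₛₗ f).map_smulₛₗ (const s U z) x).trans ?_
    rw [map_const]
    rfl

section

variable (M : PreMod Y) (V W : Type) [AddCommGroup V] [Module ℂ V] [AddCommGroup W] [Module ℂ W]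

/-- The `𝒪_Y(U)`-module `M(U) ⊗_ℂ V`. -/
abbrev ScTensor (U : Y.Opensᵒᵖ) : Type := CMod s M U ⊗[ℂ] V

variable {M V} in
/-- The element `x ⊗ v`. -/
def scTmul {U : Y.Opensᵒᵖ} (x : M.obj U) (v : V) : ScTensor s M V U :=
  (show CMod s M U from x) ⊗ₜ[ℂ] v

lemma smul_scTmul {U : Y.Opensᵒᵖ} (r : (OO Y).obj U) (x : M.obj U) (v : V) :
    r • scTmul s x v = scTmul s (r • x) v := rfl

variable {M V} in
@[elab_as_elim]
lemma ScTensor.induction {U : Y.Opensᵒᵖ} {p : ScTensor s M V U → Prop} (x : ScTensor s M V U)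
    (h : ∀ x v, p (scTmul s x v)) (h' : ∀ x y, p x → p y → p (x + y)) : p x :=
  TensorProduct.induction_on x
    (by have h₀ := h 0 0; rwa [scTmul, TensorProduct.tmul_zero] at h₀) h h'

variable {M V W} in
/-- The map `M(U) ⊗ V → M(U') ⊗ W` induced by restriction and a linear map `V → W`. -/
def ScTensor.map {U U' : Y.Opensᵒᵖ} (f : U ⟶ U') (g : V →ₗ[ℂ] W) :
    ScTensor s M V U →+ ScTensor s M W U' :=
  (TensorProduct.map (cRes s M f) g).toAddMonoidHom

variable {M V W}

lemma ScTensor.map_tmul {U U' : Y.Opensᵒᵖ} (f : U ⟶ U') (g : V →ₗ[ℂ] W) (x : M.obj U) (v : V) :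
    ScTensor.map s f g (scTmul s x v) = scTmul s (M.restrictₛₗ f x) (g v) := rfl

lemma ScTensor.map_smul {U U' : Y.Opensᵒᵖ} (f : U ⟶ U') (g : V →ₗ[ℂ] W) (r : (OO Y).obj U)
    (x : ScTensor s M V U) :
    ScTensor.map s f g (r • x) = ((OO Y).map f).hom r • ScTensor.map s f g x := by
  induction x using ScTensor.induction with
  | h x v =>
    rw [smul_scTmul, map_tmul, map_tmul, smul_scTmul]
    exact congrArg (fun y => scTmul s y (g v)) ((M.restrictₛₗ f).map_smulₛₗ r x)
  | h' x y hx hy => simp only [smul_add, map_add, hx, hy]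

lemma ScTensor.map_id {U : Y.Opensᵒᵖ} (x : ScTensor s M V U) :
    ScTensor.map s (𝟙 U) LinearMap.id x = x := by
  induction x using ScTensor.induction with
  | h x v =>
    rw [map_tmul]
    exact congrArg (fun y => scTmul s y v) (res_id M U x)
  | h' x y hx hy => simp only [map_add, hx, hy]

lemma ScTensor.map_comp {V' : Type} [AddCommGroup V'] [Module ℂ V'] {U U' U'' : Y.Opensᵒᵖ}
    (f : U ⟶ U') (f' : U' ⟶ U'') (g : V →ₗ[ℂ] W) (g' : W →ₗ[ℂ] V') (x : ScTensor s M V U) :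
    ScTensor.map s f' g' (ScTensor.map s f g x) = ScTensor.map s (f ≫ f') (g' ∘ₗ g) x := by
  induction x using ScTensor.induction with
  | h x v =>
    simp only [map_tmul]
    exact congrArg (fun y => scTmul s y (g' (g v))) (res_comp M f f' x).symm
  | h' x y hx hy => simp only [map_add, hx, hy]

variable (M V) in
/-- The presheaf `U ↦ M(U) ⊗_ℂ V`. -/
def scPre : PreMod Y :=
  PresheafOfModules.ofPresheaf (R := OO Y)
    { obj := fun U => AddCommGrpCat.of (ScTensor s M V U)
      map := fun f => AddCommGrpCat.ofHom (ScTensor.map s f LinearMap.id)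
      map_id := fun U => by
        ext x; exact ScTensor.map_id s x
      map_comp := fun f g => by
        ext x; exact (ScTensor.map_comp s f g LinearMap.id LinearMap.id x).symm }
    (fun _ _ f r x => ScTensor.map_smul s f _ r x)

variable (M) in
/-- The map `M ⊗_ℂ V → M ⊗_ℂ W` of presheaves induced by a linear map `V → W`. -/
def scPreMap (g : V →ₗ[ℂ] W) : scPre s M V ⟶ scPre s M W :=
  PresheafOfModules.homMk
    { app := fun U => AddCommGrpCat.ofHom (ScTensor.map s (𝟙 U) g)
      naturality := fun U U' f => by
        ext x
        refine (ScTensor.map_comp s f (𝟙 U') LinearMap.id g x).trans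
          (Eq.trans ?_ (ScTensor.map_comp s (𝟙 U) f g LinearMap.id x).symm)
        rw [Category.comp_id, Category.id_comp]; rfl }
    (fun U r x => by
      refine (ScTensor.map_smul s (𝟙 U) g r x).trans ?_
      rw [OO_id]; rfl)

end

/-- The sheaf of modules associated to a presheaf of modules. -/
def sheafify (Y : Scheme.{0}) : PreMod Y ⥤ Y.Modules :=
  (PresheafOfModules.sheafification (𝟙 Y.ringCatSheaf.obj) :)

/-- The sheaf of modules associated to a presheaf of modules. -/
abbrev shf (P : PreMod Y) : Y.Modules := (sheafify Y).obj P

/-- The underlying presheaf of modules of a sheaf of modules. -/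
def pre (M : Y.Modules) : PreMod Y := M.val

/-- The section of the associated sheaf given by a section of a presheaf. -/
def toShf (P : PreMod Y) {U : Y.Opens} (x : P.obj (op U)) : Γ(shf P, U) :=
  ((PresheafOfModules.sheafificationAdjunction (𝟙 Y.ringCatSheaf.obj)).unit.app P).app (op U) x

/-- Restriction of sections to a smaller open subset. -/
def rst {M : Y.Modules} {U V : Y.Opens} (h : V ≤ U) (x : Γ(M, U)) : Γ(M, V) :=
  M.presheaf.map (homOfLE h).op x

/-- Restriction of functions to a smaller open subset. -/
def rstO {U V : Y.Opens} (h : V ≤ U) (x : Γ(Y, U)) : Γ(Y, V) :=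
  Y.presheaf.map (homOfLE h).op x

/-- The functor `M ↦ M ⊗ N` on sheaves of modules. -/
def tensorFunctor (N : Y.Modules) : Y.Modules ⥤ Y.Modules :=
  Scheme.Modules.toPresheafOfModules Y ⋙ (show PreMod Y ⥤ PreMod Y from tensorRight (pre N)) ⋙
    sheafify Y

section Geometry

variable {Z : Scheme.{0}}

/-- The pullback `f^*x`, restricted to `U`, of a section `x` over `V`. -/
def pull (f : Z ⟶ Y) (M : Y.Modules) {V : Y.Opens} (x : Γ(M, V)) {U : Z.Opens}
    (h : U ≤ f ⁻¹ᵁ V) : Γ((Scheme.Modules.pullback f).obj M, U) :=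
  rst h (((Scheme.Modules.pullbackPushforwardAdjunction f).unit.app M).app V x)

/-- The ideal sheaf of `ι : Z → Y`: the kernel of `𝒪_Y → ι_* 𝒪_Z`. -/
def idealSheaf (ι : Z ⟶ Y) : Y.Modules :=
  kernel (C := Y.Modules) (SheafOfModules.unitToPushforwardObjUnit ι.toRingCatSheafHom)

/-- A section of the ideal sheaf, as a function. -/
def idealFun (ι : Z ⟶ Y) {U : Y.Opens} (u : Γ(idealSheaf ι, U)) : Γ(Y, U) :=
  Scheme.Modules.Hom.app (kernel.ι (C := Y.Modules)
    (SheafOfModules.unitToPushforwardObjUnit ι.toRingCatSheafHom)) U u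

/-- The conormal sheaf `ι^* I = I / I²`. -/
def conormal (ι : Z ⟶ Y) : Z.Modules := (Scheme.Modules.pullback ι).obj (idealSheaf ι)

/-- The sections `e` of `E` over `V` form a frame: they trivialise `E` over `V`. -/
def IsFrame (E : Y.Modules) {V : Y.Opens} {r : ℕ} (e : Fin r → Γ(E, V)) : Prop :=
  ∀ (U : Y.Opens) (h : U ≤ V), LinearIndependent Γ(Y, U) (fun α => rst h (e α)) ∧
    Submodule.span Γ(Y, U) (Set.range fun α => rst h (e α)) = ⊤

/-- Locally free sheaves of finite rank. -/
def IsLocFree (E : Y.Modules) : Prop :=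
  ∀ y : Y, ∃ (V : Y.Opens) (r : ℕ) (e : Fin r → Γ(E, V)), y ∈ V ∧ IsFrame E e

/-- Line bundles. -/
def IsLineBundle (E : Y.Modules) : Prop :=
  ∀ y : Y, ∃ (V : Y.Opens) (e : Fin 1 → Γ(E, V)), y ∈ V ∧ IsFrame E e

end Geometry

instance (Y : Scheme.{0}) : HasFiniteBiproducts Y.Modules := Abelian.hasFiniteBiproducts

variable {X : Scheme.{0}} (s : X ⟶ Spec (.of ℂ))

/-- The `n`-fold fibre product `X^n` over `ℂ`. -/
abbrev Pow (n : ℕ) : Scheme.{0} := widePullback (Spec (.of ℂ)) (fun _ : Fin n => X) (fun _ => s)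

/-- The projection `X^n → X` to a factor. -/
def pr (n : ℕ) (i : Fin n) : Pow s n ⟶ X := WidePullback.π (fun _ : Fin n => s) i

/-- The structure morphism of `X^n`. -/
def str (n : ℕ) : Pow s n ⟶ Spec (.of ℂ) := WidePullback.base (fun _ : Fin n => s)

/-- The diagonal embedding `δ : X → X²`. -/
def diag : X ⟶ Pow s 2 := WidePullback.lift s (fun _ => 𝟙 X) (by simp)

/-- The pairwise diagonal `Δ_ij ⊆ X^n` is the closed subscheme where the projections agree. -/
abbrev Delta (n : ℕ) (i j : Fin n) : Scheme.{0} := equalizer (pr s n i) (pr s n j)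

/-- The inclusion of the pairwise diagonal. -/
abbrev deltaι (n : ℕ) (i j : Fin n) : Delta s n i j ⟶ Pow s n := equalizer.ι (pr s n i) (pr s n j)

lemma isClosed_delta [IsSeparated s] (n : ℕ) (i j : Fin n) :
    IsClosed (Set.range (deltaι s n i j)) := by
  have : X.IsSeparated := ⟨by
    rw [← terminal.comp_from s]
    infer_instance⟩
  exact (IsClosedImmersion.isClosedEmbedding (deltaι s n i j)).isClosed_range

/-- The open subset `X^n_{**}` of `X^n`, the complement of all the intersections of two different
pairwise diagonals. -/
def openStar [IsSeparated s] (n : ℕ) : (Pow s n).Opens where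
  carrier := (⋃ p : {p : (Fin n × Fin n) × (Fin n × Fin n) //
      p.1.1 < p.1.2 ∧ p.2.1 < p.2.2 ∧ p.1 ≠ p.2},
    Set.range (deltaι s n p.1.1.1 p.1.1.2) ∩ Set.range (deltaι s n p.1.2.1 p.1.2.2))ᶜ
  is_open' := (isClosed_iUnion_of_finite fun _ =>
    (isClosed_delta s n _ _).inter (isClosed_delta s n _ _)).isOpen_compl

section Rep

variable {k : ℕ}

/-- The sign `ε_{m,M} = (-1)^{#{j ∈ M | j < m}}`. -/
def signIn (m : Fin k) (M : Finset (Fin k)) : ℂ := (-1) ^ (M.filter (· < m)).card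

/-- The pairs `(M; a)` with `M ⊆ S`, `|M| = r` and `a : S \ M → {1, 2}`
(the values `1`, `2` are represented by the elements `0`, `1` of `Fin 2`). -/
def Idx (S : Finset (Fin k)) (r : ℕ) : Type :=
  {x : (M : Finset (Fin k)) × ({t : Fin k // t ∈ S \ M} → Fin 2) // x.1 ⊆ S ∧ x.1.card = r}

instance (S : Finset (Fin k)) (r : ℕ) : Fintype (Idx S r) :=
  inferInstanceAs (Fintype {x : (M : Finset (Fin k)) × ({t : Fin k // t ∈ S \ M} → Fin 2) //
    x.1 ⊆ S ∧ x.1.card = r})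

instance (S : Finset (Fin k)) (r : ℕ) : DecidableEq (Idx S r) := Classical.decEq _

/-- The set `M` of `(M; a)`. -/
def Idx.M {S : Finset (Fin k)} {r : ℕ} (x : Idx S r) : Finset (Fin k) := x.1.1

/-- The map `a` of `(M; a)`. -/
def Idx.a {S : Finset (Fin k)} {r : ℕ} (x : Idx S r) : {t : Fin k // t ∈ S \ x.M} → Fin 2 := x.1.2

/-- The pair `(M \ {m}; a, m ↦ v)`. -/
def Idx.erase {S : Finset (Fin k)} {r : ℕ} (x : Idx S (r + 1)) (m : {m : Fin k // m ∈ x.M})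
    (v : Fin 2) : Idx S r :=
  ⟨⟨x.M.erase m, fun t => if h : t.1 = m then v else x.a ⟨t.1, by
      have := t.2
      simp only [Finset.mem_sdiff, Finset.mem_erase] at this ⊢
      tauto⟩⟩,
    (Finset.erase_subset _ _).trans x.2.1, by
      have h : x.M.card = r + 1 := x.2.2
      simp [Finset.card_erase_of_mem m.2, h]⟩

/-- The map `a ⊎ b : S → {1, 2}` for `b : M → {1, 2}`. -/
def Idx.glue {S : Finset (Fin k)} {r : ℕ} (x : Idx S r) (b : {t : Fin k // t ∈ x.M} → Fin 2) :
    {t : Fin k // t ∈ S} → Fin 2 :=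
  fun t => if h : t.1 ∈ x.M then b ⟨t.1, h⟩ else x.a ⟨t.1, Finset.mem_sdiff.2 ⟨t.2, h⟩⟩

/-- The standard representation `ρ_M`, as a subspace of `ℂ^k`. -/
def rho (M : Finset (Fin k)) : Submodule ℂ (Fin k → ℂ) where
  carrier := {v | (∀ t, t ∉ M → v t = 0) ∧ ∑ t, v t = 0}
  zero_mem' := by simp
  add_mem' := fun {v w} hv hw =>
    ⟨fun t ht => by simp [hv.1 t ht, hw.1 t ht], by simp [Finset.sum_add_distrib, hv.2, hw.2]⟩
  smul_mem' := fun z v hv =>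
    ⟨fun t ht => by simp [hv.1 t ht], by simp [← Finset.mul_sum, hv.2]⟩

lemma rho_mono {M N : Finset (Fin k)} (h : M ⊆ N) : rho M ≤ rho N :=
  fun _ hv => ⟨fun t ht => hv.1 t fun ht' => ht (h ht'), hv.2⟩

/-- The vector `ζ = e_t - e_u` of `ρ_M`, for `t, u ∈ M`. -/
def zeta {M : Finset (Fin k)} (t u : {t : Fin k // t ∈ M}) : rho M :=
  ⟨Pi.single t.1 1 - Pi.single u.1 1, fun v hv => by
    have h₁ : v ≠ t.1 := fun h => hv (h ▸ t.2)
    have h₂ : v ≠ u.1 := fun h => hv (h ▸ u.2)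
    simp [h₁, h₂], by simp⟩

/-- The vector space `R_ℓ^i = ⨁_{(M; a)} ∧^{ℓ-1} ρ_M` over all `(M; a)` with `|M| = ℓ + i`. -/
abbrev R (S : Finset (Fin k)) (ℓ i : ℕ) : Type :=
  (x : Idx S (ℓ + i)) → ⋀[ℂ]^(ℓ - 1) (rho x.M)

/-- The differential `R_ℓ^i → R_ℓ^{i+1}`,
`d(s)(M; a) = ∑_{m ∈ M} ε_{m,M} (s(M \ m; a, m ↦ 1) - s(M \ m; a, m ↦ 2))`. -/
def dR (S : Finset (Fin k)) (ℓ i : ℕ) : R S ℓ i →ₗ[ℂ] R S ℓ (i + 1) :=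
  LinearMap.pi fun x => ∑ m : {m : Fin k // m ∈ x.M}, signIn m.1 x.M •
    ((exteriorPower.map (ℓ - 1) (Submodule.inclusion (rho_mono (Finset.erase_subset m.1 x.M)))) ∘ₗ
        LinearMap.proj (Idx.erase (r := ℓ + i) x m 0) -
      (exteriorPower.map (ℓ - 1) (Submodule.inclusion (rho_mono (Finset.erase_subset m.1 x.M)))) ∘ₗ
        LinearMap.proj (Idx.erase (r := ℓ + i) x m 1))

/-- The vector `e_{(M; a)} = ζ_M^1 ∧ ⋯ ∧ ζ_M^{ℓ-1}` of the summand of `R_ℓ^0` at `(M; a)`, where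
`ζ_M^r = e_{t_r} - e_{t_{r+1}}` and `M = {t_1 < ⋯ < t_ℓ}`. -/
def eR (S : Finset (Fin k)) (ℓ : ℕ) (x : Idx S ℓ) : R S ℓ 0 :=
  Pi.single (M := fun x : Idx S (ℓ + 0) => ⋀[ℂ]^(ℓ - 1) (rho x.M)) x
    (exteriorPower.ιMulti ℂ (ℓ - 1) fun r : Fin (ℓ - 1) =>
      zeta (x.M.orderIsoOfFin x.2.2 ⟨r.1, by omega⟩) (x.M.orderIsoOfFin x.2.2 ⟨r.1 + 1, by omega⟩))

end Rep

section Complex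

variable {k : ℕ} (E : Fin k → X.Modules)

/-- The sheaf `K_0 = ⨁_{c : [k] → [n]} ⨂_t pr_{c(t)}^* E_t` on `X^n`. -/
def K₀ (n : ℕ) : (Pow s n).Modules :=
  ⨁ fun c : Fin k → Fin n =>
    shf (piTensor fun t => pre ((Scheme.Modules.pullback (pr s n (c t))).obj (E t)))

/-- The section `s(c)` of the summand of `K_0` at `c`. -/
def comp (n : ℕ) (c : Fin k → Fin n) {U : (Pow s n).Opens} (x : Γ(K₀ s E n, U)) :
    Γ(shf (piTensor fun t => pre ((Scheme.Modules.pullback (pr s n (c t))).obj (E t))), U) :=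
  Scheme.Modules.Hom.app (biproduct.π (fun c : Fin k → Fin n =>
    shf (piTensor fun t => pre ((Scheme.Modules.pullback (pr s n (c t))).obj (E t)))) c) U x

/-- The data which single out one block of the complexes `T_ℓ`: a subscheme `ι : Z → X^n` (the
diagonal `Δ_ij`), indices `i` and `j`, a set `S` of factors and a map `c : [k] → [n]` with value `i`
on `S`; the factors in `S` are distributed to the indices `i` and `j`, and the others are placed
according to `c`. The maps `q t : Z → X` are the restrictions of `pr_{c(t)}` to `Z`. -/
structure Block (k n : ℕ) where
  /-- the diagonal -/
  Z : Scheme.{0}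
  /-- its inclusion -/
  ι : Z ⟶ Pow s n
  /-- the projections from the diagonal -/
  q : Fin k → (Z ⟶ X)
  /-- the first index -/
  i : Fin n
  /-- the second index -/
  j : Fin n
  /-- the set of factors on the diagonal -/
  S : Finset (Fin k)
  /-- the position of the other factors -/
  c : Fin k → Fin n

variable {s}

namespace Block

variable {n : ℕ} (B : Block s k n)

/-- The presheaf tensor product `S^m(I/I²) ⊗ ⨂_t q_t^* E_t` on the diagonal. -/
def HPre (m : ℕ) : PreMod B.Z :=
  tensorObj (C := PreMod B.Z) (symPow m (pre (conormal B.ι)))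
    (piTensor fun t => pre ((Scheme.Modules.pullback (B.q t)).obj (E t)))

/-- The sheaf `ι_*(S^m(I/I²) ⊗ ⨂_t q_t^* E_t)` on `X^n`. -/
def H (m : ℕ) : (Pow s n).Modules :=
  (Scheme.Modules.pushforward B.ι).obj (shf (B.HPre E m))

/-- The sheaf `H ⊗_ℂ V`. -/
def HV (m : ℕ) (V : Type) [AddCommGroup V] [Module ℂ V] : (Pow s n).Modules :=
  shf (scPre (str s n) (pre (B.H E m)) V)

/-- The sheaf `T_ℓ^i = H ⊗_ℂ R_ℓ^i` with `H = ι_*(S^{ℓ-1}(I/I²) ⊗ ⨂_t q_t^* E_t)`. -/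
def T (ℓ i : ℕ) : (Pow s n).Modules := B.HV E (ℓ - 1) (R B.S ℓ i)

/-- The differential `T_ℓ^i → T_ℓ^{i+1}`. -/
def d (ℓ i : ℕ) : B.T E ℓ i ⟶ B.T E ℓ (i + 1) :=
  (sheafify _).map (scPreMap (str s n) (pre (B.H E (ℓ - 1))) (dR B.S ℓ i))

variable {E} in
/-- The section of `H` over `W` given by the product `u_1 ⋯ u_m ⊗ v_1 ⊗ ⋯ ⊗ v_k`. -/
def hSec {m : ℕ} {W : (Pow s n).Opens} (u : Fin m → Γ(conormal B.ι, B.ι ⁻¹ᵁ W))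
    (v : ∀ t, Γ((Scheme.Modules.pullback (B.q t)).obj (E t), B.ι ⁻¹ᵁ W)) : Γ(B.H E m, W) :=
  toShf (B.HPre E m)
    (symProd (pre (conormal B.ι)) u ⊗ₜ[(OO B.Z).obj (op (B.ι ⁻¹ᵁ W))] 
      pureTensor (fun t => pre ((Scheme.Modules.pullback (B.q t)).obj (E t))) v)

/-- The class in the conormal sheaf of a section of the ideal sheaf. -/
def cls {W : (Pow s n).Opens} (u : Γ(idealSheaf B.ι, W)) : Γ(conormal B.ι, B.ι ⁻¹ᵁ W) :=
  pull B.ι (idealSheaf B.ι) u le_rfl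

/-- The section `h ⊗ v` of `H ⊗_ℂ V`. -/
def tmul {m : ℕ} {V : Type} [AddCommGroup V] [Module ℂ V] {W : (Pow s n).Opens}
    (h : Γ(B.H E m, W)) (v : V) : Γ(B.HV E m V, W) :=
  toShf (scPre (str s n) (pre (B.H E m)) V) (scTmul (M := pre (B.H E m)) (str s n) h v)

/-- The map `[k] → [n]` which extends `c` on the complement of `S` by sending `t ∈ S` to `i` or to
`j`, according to the value of `g` at `t`. -/
def col (g : {t : Fin k // t ∈ B.S} → Fin 2) (t : Fin k) : Fin n :=
  if h : t ∈ B.S then (if g ⟨t, h⟩ = 0 then B.i else B.j) else B.c t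

/-- The sections `⨂_t pr_{c(t)}^* e_t` of a summand of `K_0`, where `c` is the map given by `g`. -/
def pureSec {V : Fin k → X.Opens} {W : (Pow s n).Opens} (e : ∀ t, Γ(E t, V t)) (c : Fin k → Fin n)
    (hW : ∀ t, W ≤ pr s n (c t) ⁻¹ᵁ V t) :
    Γ(shf (piTensor fun t => pre ((Scheme.Modules.pullback (pr s n (c t))).obj (E t))), W) :=
  toShf _ (pureTensor _ fun t => pull (pr s n (c t)) (E t) (e t) (hW t))

/-- The defining property of the block of `φ_ℓ`, as a map from a subsheaf `K` of `K_0` to `T_ℓ^0`.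

Choose local trivialisations of the `E_t` by frames `e_t` on open subsets `V_t` of `X`, and let `x`
be a section of `K` over an open subset `W` on which the pullbacks of these frames are defined.
Let `f c α` be the coordinates of the components of `x` with respect to the induced frames (the
frame `e_t` is pulled back along `pr_i` and along `pr_j` for `t ∈ S`). Then, for every
`(M; a)` with `M ⊆ S`, `|M| = ℓ`, and every `α`, the function
`∑_{b : M → {i, j}} (-1)^{#b⁻¹(j)} f (a ⊎ b) α` is locally a section of `I^{ℓ-1}`, and `φ_ℓ(x)` is
the tuple of the classes of these functions in `I^{ℓ-1}/I^ℓ = S^{ℓ-1}(I/I²)`, in terms of the frames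
induced by the `e_t`. Here, a function in `I^{ℓ-1}` is written as a sum of functions
`c u_1 ⋯ u_{ℓ-1}` with `u_p` in `I`, and its class is the corresponding sum of products of the
classes of the `u_p` in `I/I²`. The summand of `T_ℓ^0 = H ⊗ R_ℓ^0` at `(M; a)` is identified with
`H` by `e_{(M; a)}`. (The condition `hZ` is a consequence of `hW` for the blocks below.) -/
def IsPhi (ℓ : ℕ) {K : (Pow s n).Modules} (j : K ⟶ K₀ s E n) (ψ : K ⟶ B.T E ℓ 0) : Prop :=
  ∀ (V : Fin k → X.Opens) (r : Fin k → ℕ) (e : ∀ t, Fin (r t) → Γ(E t, V t)),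
  (∀ t, IsFrame (E t) (e t)) →
  ∀ (W : (Pow s n).Opens) (hW : ∀ g t, W ≤ pr s n (B.col g t) ⁻¹ᵁ V t)
    (hZ : ∀ t, B.ι ⁻¹ᵁ W ≤ B.q t ⁻¹ᵁ V t)
    (x : Γ(K, W))
    (f : ({t : Fin k // t ∈ B.S} → Fin 2) → (∀ t, Fin (r t)) → Γ(Pow s n, W)),
  (∀ g, comp s E n (B.col g) (Scheme.Modules.Hom.app j W x) =
    ∑ α, f g α • pureSec E (fun t => e t (α t)) (B.col g) (hW g)) →
  ∀ y ∈ W, ∃ (W' : (Pow s n).Opens) (h : W' ≤ W) (N : ℕ)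
    (c : Idx B.S ℓ → (∀ t, Fin (r t)) → Fin N → Γ(Pow s n, W'))
    (u : Idx B.S ℓ → (∀ t, Fin (r t)) → Fin N → Fin (ℓ - 1) → Γ(idealSheaf B.ι, W')),
    y ∈ W' ∧
    (∀ ξ α, ∑ b : {t : Fin k // t ∈ ξ.M} → Fin 2,
        (-1) ^ (Finset.univ.filter fun t => b t = 1).card * rstO h (f (ξ.glue b) α) =
      ∑ ν, c ξ α ν * ∏ p, idealFun B.ι (u ξ α ν p)) ∧
    rst h (Scheme.Modules.Hom.app ψ W x) =
      ∑ ξ, ∑ α, B.tmul E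
        (∑ ν, c ξ α ν • B.hSec (fun p => B.cls (u ξ α ν p)) fun t =>
          pull (B.q t) (E t) (e t (α t))
            (le_trans (show B.ι ⁻¹ᵁ W' ≤ B.ι ⁻¹ᵁ W from fun _ hz => h hz) (hZ t)))
        (eR B.S ℓ ξ)

end Block

section Tower

variable {C : Type*} [Category* C] [Abelian C] {K : C} {T : ℕ → C}
  (P : ∀ (ℓ : ℕ) (A : Over K), (A.left ⟶ T ℓ) → Prop)

open Classical in
/-- The morphism with the property `P`, if there is one. -/
def pick {A B : C} (P : (A ⟶ B) → Prop) : A ⟶ B :=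
  if h : ∃ ψ, P ψ then h.choose else 0

/-- The subobjects `K_ℓ → K_0 = K` with `K_{ℓ+1} = ker (φ_{ℓ+1} : K_ℓ → T_{ℓ+1})`, where
`φ_{ℓ+1}` is the morphism with the property `P`. -/
def tower : ℕ → Over K
  | 0 => Over.mk (𝟙 K)
  | ℓ + 1 => Over.mk (kernel.ι (pick (P (ℓ + 1) (tower ℓ))) ≫ (tower ℓ).hom)

/-- The morphism `φ_{ℓ+1} : K_ℓ → T_{ℓ+1}`. -/
def towerφ (ℓ : ℕ) : (tower P ℓ).left ⟶ T (ℓ + 1) := pick (P (ℓ + 1) (tower P ℓ))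

/-- The inclusion `K_{ℓ+1} → K_ℓ`. -/
def towerι (ℓ : ℕ) : (tower P (ℓ + 1)).left ⟶ (tower P ℓ).left :=
  kernel.ι (pick (P (ℓ + 1) (tower P ℓ)))

/-- The sequence `0 → A → B → T^0 → T^1 → ⋯ → T^N → 0` is exact. (The objects `T^i` are defined for
all `i ≥ 0`; the end of the sequence is expressed by `T^{N+1} = 0`.) -/
structure IsLongExact {A B : C} {T : ℕ → C} (j : A ⟶ B) (φ : B ⟶ T 0)
    (d : ∀ i, T i ⟶ T (i + 1)) (N : ℕ) : Prop where
  mono : Mono j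
  exact_left : ∃ w : j ≫ φ = 0, (ShortComplex.mk j φ w).Exact
  exact_zero : ∃ w : φ ≫ d 0 = 0, (ShortComplex.mk φ (d 0) w).Exact
  exact_succ : ∀ i < N, ∃ w : d i ≫ d (i + 1) = 0, (ShortComplex.mk (d i) (d (i + 1)) w).Exact
  isZero : IsZero (T (N + 1))

/-- The sequence is exact after application of a functor. -/
def IsLongExactAfter {D : Type*} [Category* D] [Abelian D] (F : C ⥤ D) {A B : C} {T : ℕ → C}
    (j : A ⟶ B) (φ : B ⟶ T 0) (d : ∀ i, T i ⟶ T (i + 1)) (N : ℕ) : Prop :=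
  IsLongExact (T := fun i => F.obj (T i)) (F.map j) (F.map φ) (fun i => F.map (d i)) N

end Tower

variable (s)

/-- The block on `X²` given by the diagonal `δ : X → X²`. -/
def diagBlock (k : ℕ) : Block s k 2 where
  Z := X
  ι := diag s
  q := fun _ => 𝟙 X
  i := 0
  j := 1
  S := Finset.univ
  c := fun _ => 0

/-- The labels of the blocks on `X^n`: indices `i < j` and a map `c : [k] → [n]` which does not take
the value `j`. They correspond to the tuples `(M̂; i, j; a)` with `M̂ ⊆ [k]` and
`a : [k] \ M̂ → [n] \ {i, j}`, where `M̂ = c⁻¹(i)` and `a` is the restriction of `c`. -/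
def Label (k n : ℕ) : Type :=
  {x : (Fin n × Fin n) × (Fin k → Fin n) // x.1.1 < x.1.2 ∧ ∀ t, x.2 t ≠ x.1.2}

instance (k n : ℕ) : Finite (Label k n) :=
  inferInstanceAs (Finite
    {x : (Fin n × Fin n) × (Fin k → Fin n) // x.1.1 < x.1.2 ∧ ∀ t, x.2 t ≠ x.1.2})

/-- The block on `X^n` with a given label. -/
def block {k n : ℕ} (x : Label k n) : Block s k n where
  Z := Delta s n x.1.1.1 x.1.1.2
  ι := deltaι s n x.1.1.1 x.1.1.2
  q := fun t => deltaι s n x.1.1.1 x.1.1.2 ≫ pr s n (x.1.2 t)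
  i := x.1.1.1
  j := x.1.1.2
  S := Finset.univ.filter fun t => x.1.2 t = x.1.1.1
  c := x.1.2

/-- The complexes `T_ℓ^• = H_ℓ ⊗_ℂ R_ℓ^•` on `X²`, with
`H_ℓ = δ_*(S^{ℓ-1} Ω_X ⊗ E_1 ⊗ ⋯ ⊗ E_k)`; the sheaf of differentials is the conormal sheaf of the
diagonal. -/
def T₂ (ℓ i : ℕ) : (Pow s 2).Modules := (diagBlock s k).T E ℓ i

/-- The differentials of `T_ℓ^•` on `X²`. -/
def d₂ (ℓ i : ℕ) : T₂ s E ℓ i ⟶ T₂ s E ℓ (i + 1) := (diagBlock s k).d E ℓ i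

/-- The defining property of `φ_ℓ` on `X²`. -/
def IsPhi₂ (ℓ : ℕ) (K : Over (K₀ s E 2)) (ψ : K.left ⟶ T₂ s E ℓ 0) : Prop :=
  (diagBlock s k).IsPhi E ℓ K.hom ψ

/-- The complexes `T_ℓ^•` on `X^n`: the direct sums of the blocks. -/
def Tₙ (n ℓ i : ℕ) : (Pow s n).Modules := ⨁ fun x : Label k n => (block s x).T E ℓ i

/-- The differentials of `T_ℓ^•` on `X^n`. -/
def dₙ (n ℓ i : ℕ) : Tₙ s E n ℓ i ⟶ Tₙ s E n ℓ (i + 1) :=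
  biproduct.map fun x : Label k n => (block s x).d E ℓ i

/-- The defining property of `φ_ℓ` on `X^n`. -/
def IsPhiₙ (n ℓ : ℕ) (K : Over (K₀ s E n)) (ψ : K.left ⟶ Tₙ s E n ℓ 0) : Prop :=
  ∀ x : Label k n, (block s x).IsPhi E ℓ K.hom
    (ψ ≫ biproduct.π (fun x : Label k n => (block s x).T E ℓ 0) x)

/-- The line bundle `L^{⊠2} = pr_1^* L ⊗ pr_2^* L` on `X²`. -/
def boxSq (L : X.Modules) : (Pow s 2).Modules :=
  shf (piTensor fun i : Fin 2 => pre ((Scheme.Modules.pullback (pr s 2 i)).obj L))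

end Complex

end LongDiag

end

open LongDiag

/-! Fix one block: a diagonal with ideal `I` and a set `S` of factors to be distributed over `i` and
`j`. After a choice of frames of the `E_t`, the part of a section of `K_0` that the block sees is,
for each multiindex, a function on the vertices of the cube `{i,j}^S`, and `φ_ℓ` consists of its
alternating sums over the faces of dimension `ℓ`. The claim behind everything is that `K_ℓ` is the
sheaf of those families whose alternating sums over all faces of dimension `r ≤ ℓ` lie in `I^r`, for
every block (`FilAt`, `Block.InFil`, `IsBlockSum.towerSpec`).

Existence and uniqueness of `φ_ℓ`. An alternating sum over an `ℓ`-face is a difference of two such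
sums over `(ℓ-1)`-faces, so on `K_{ℓ-1}` it lies in `I^{ℓ-1}`. A change of frames multiplies the
family by products of functions of single coordinates whose two values agree modulo `I`. By a
discrete Leibniz rule this multiplies each alternating sum over an `ℓ`-face, modulo `I^ℓ`, by the
value at one vertex (`FilAt.D_prod_mul_sub_mem`). Hence the local definitions agree and glue.

The target is written with `S^{ℓ-1}(I/I²)` and not with `I^{ℓ-1}/I^ℓ`, so two comparison maps are
needed. Smoothness of the diagonal and of `X^n` makes the class of a function of `I^m` in
`S^m(I/I²)` well defined: the map `I → I/I²` extends to a derivation `D`, the homomorphism `p ↦ q(p)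
+ D(p)` into the symmetric algebra modulo the square of the augmentation ideal lifts to all orders,
and the component of degree `m` of a lift is the class map (`exists_classMap`). In the other
direction `S^m(I/I²)` maps to the associated graded ring, so a function of `I^m` with class zero
lies in `I^{m+1}` (`Block.IsVal.mem_of_eq_zero`). Thus `ker φ_ℓ` is cut out by the next filtration
condition.

The part to the right of `K_{ℓ-1}` is linear algebra. Since `T_ℓ^•` is `H ⊗_ℂ R_ℓ^•` block by block,
and complex vector spaces are flat, it suffices that the functions on the vertices of the cube,
followed by `R_ℓ^0 → R_ℓ^1 → ⋯`, form an exact sequence. Here `∧^p ρ_M` is the kernel of the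
contraction `ctr` with the sum of the coordinates on `∧^p ℂ^M`. The complex built from the spaces
`∧^p ℂ^M` is exact at the words with more than `p` stars, by homotopies in the single directions of
the cube (`Cube.exists_dW_eq`). The sequences `0 → ∧^p ρ_M → ∧^p ℂ^M → ∧^{p-1} ρ_M → 0` transfer
this to `R_ℓ^•` by induction on `p` (`exact_dR`, `exact_Theta`).

For exactness at `T_ℓ^0`, a section killed by the differential is locally `∑ h_g ⊗ Theta(δ_g)` over
the vertices `g`, and the `h_g` are classes of functions in `I^{ℓ-1}`. A family with all its values
in `I^{ℓ-1}` satisfies every condition of order at most `ℓ-1`, so it lies in `K_{ℓ-1}` and is a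
preimage. With several blocks these local preimages are added. Over `X^n_{**}` this is harmless,
because a point lies on at most one diagonal and different blocks of one diagonal involve disjoint
sets of summands of `K_0` (`IsBlockSum.locExactOn_towerφ`).

Stalks of associated sheaves and of pullbacks are replaced by semilinear functionals at a point
(`PFun`), that is, by morphisms to skyscraper sheaves, which extend along both constructions by
adjunction. -/

noncomputable section

namespace LongDiag

/-! ### Sections of sheaves of modules: restriction, locality, gluing. -/

section Sections

variable {Y : Scheme.{0}} {M N : Y.Modules} {U V W : Y.Opens}

lemma rst_rst (h : V ≤ U) (h' : W ≤ V) (x : Γ(M, U)) : rst h' (rst h x) = rst (h'.trans h) x := by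
  have := ConcreteCategory.congr_hom (M.presheaf.map_comp (homOfLE h).op (homOfLE h').op) x
  exact this.symm

lemma rst_self (h : U ≤ U) (x : Γ(M, U)) : rst h x = x :=
  ConcreteCategory.congr_hom (M.presheaf.map_id (op U)) x

lemma rstO_rstO (h : V ≤ U) (h' : W ≤ V) (x : Γ(Y, U)) :
    rstO h' (rstO h x) = rstO (h'.trans h) x := by
  have := ConcreteCategory.congr_hom (Y.presheaf.map_comp (homOfLE h).op (homOfLE h').op) x
  exact this.symm

/-- Restriction of functions, as a ring homomorphism. -/
def rstHom (h : V ≤ U) : Γ(Y, U) →+* Γ(Y, V) := (Y.presheaf.map (homOfLE h).op).hom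

lemma rstHom_apply (h : V ≤ U) (x : Γ(Y, U)) : rstHom h x = rstO h x := rfl

@[simp] lemma rst_add (h : V ≤ U) (x y : Γ(M, U)) : rst h (x + y) = rst h x + rst h y :=
  map_add (M.presheaf.map (homOfLE h).op).hom x y

@[simp] lemma rst_zero (h : V ≤ U) : rst h (0 : Γ(M, U)) = 0 :=
  map_zero (M.presheaf.map (homOfLE h).op).hom

@[simp] lemma rst_sum (h : V ≤ U) {ι : Type*} (s : Finset ι) (x : ι → Γ(M, U)) :
    rst h (∑ i ∈ s, x i) = ∑ i ∈ s, rst h (x i) :=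
  map_sum (M.presheaf.map (homOfLE h).op).hom x s

@[simp] lemma rst_smul (h : V ≤ U) (r : Γ(Y, U)) (x : Γ(M, U)) :
    rst h (r • x) = rstO h r • rst h x :=
  Scheme.Modules.map_smul M (homOfLE h) r x

@[simp] lemma rstO_add (h : V ≤ U) (x y : Γ(Y, U)) : rstO h (x + y) = rstO h x + rstO h y :=
  map_add (rstHom h) x y
@[simp] lemma rstO_mul (h : V ≤ U) (x y : Γ(Y, U)) : rstO h (x * y) = rstO h x * rstO h y :=
  map_mul (rstHom h) x y
@[simp] lemma rstO_zero (h : V ≤ U) : rstO h (0 : Γ(Y, U)) = 0 := map_zero (rstHom h)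

lemma app_rst (φ : M ⟶ N) (h : V ≤ U) (x : Γ(M, U)) :
    Scheme.Modules.Hom.app φ V (rst h x) = rst h (Scheme.Modules.Hom.app φ U x) :=
  ConcreteCategory.congr_hom ((Scheme.Modules.Hom.mapPresheaf φ).naturality (homOfLE h).op) x

lemma app_add (φ : M ⟶ N) (x y : Γ(M, U)) : Scheme.Modules.Hom.app φ U (x + y) =
    Scheme.Modules.Hom.app φ U x + Scheme.Modules.Hom.app φ U y :=
  map_add (Scheme.Modules.Hom.app φ U).hom x y

lemma app_sum (φ : M ⟶ N) {ι : Type*} (s : Finset ι) (x : ι → Γ(M, U)) :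
    Scheme.Modules.Hom.app φ U (∑ i ∈ s, x i) = ∑ i ∈ s, Scheme.Modules.Hom.app φ U (x i) :=
  map_sum (Scheme.Modules.Hom.app φ U).hom x s

lemma app_zero (φ : M ⟶ N) : Scheme.Modules.Hom.app φ U 0 = 0 :=
  map_zero (Scheme.Modules.Hom.app φ U).hom

lemma app_comp {K : Y.Modules} (φ : M ⟶ N) (ψ : N ⟶ K) (x : Γ(M, U)) :
    Scheme.Modules.Hom.app (φ ≫ ψ) U x =
      Scheme.Modules.Hom.app ψ U (Scheme.Modules.Hom.app φ U x) := rfl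

/-- Sections which agree locally are equal. -/
lemma section_ext {x y : Γ(M, U)}
    (h : ∀ p ∈ U, ∃ (V : Y.Opens) (hV : V ≤ U), p ∈ V ∧ rst hV x = rst hV y) : x = y :=
  TopCat.Presheaf.IsSheaf.section_ext M.isSheaf (U := op U) h

lemma section_extO {x y : Γ(Y, U)}
    (h : ∀ p ∈ U, ∃ (V : Y.Opens) (hV : V ≤ U), p ∈ V ∧ rstO hV x = rstO hV y) : x = y :=
  TopCat.Presheaf.IsSheaf.section_ext Y.sheaf.2 (U := op U) h

lemma section_extO_germ {x y : Γ(Y, U)}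
    (h : ∀ p (hp : p ∈ U), Y.presheaf.germ U p hp x = Y.presheaf.germ U p hp y) : x = y := by
  refine section_extO fun p hp => ?_
  obtain ⟨V, hV, i, j, e⟩ := Y.presheaf.germ_eq p hp hp x y (h p hp)
  exact ⟨V, i.le, hV, e⟩

/-- Gluing of sections. -/
lemma exists_gluing {ι : Type} {U : Y.Opens} (V : ι → Y.Opens) (hV : ∀ i, V i ≤ U)
    (hU : ∀ p ∈ U, ∃ i, p ∈ V i) (x : ∀ i, Γ(M, V i))
    (hx : ∀ i j (W : Y.Opens) (hi : W ≤ V i) (hj : W ≤ V j), rst hi (x i) = rst hj (x j)) :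
    ∃ y : Γ(M, U), ∀ i, rst (hV i) y = x i := by
  have hU' : U = iSup V := le_antisymm (fun p hp => by
    obtain ⟨i, hi⟩ := hU p hp
    exact TopologicalSpace.Opens.mem_iSup.2 ⟨i, hi⟩) (iSup_le hV)
  subst hU'
  obtain ⟨y, hy, -⟩ := TopCat.Sheaf.existsUnique_gluing (⟨M.presheaf, M.isSheaf⟩ : TopCat.Sheaf Ab _)
    V x (fun i j => hx i j _ _ _)
  exact ⟨y, hy⟩

end Sections

/-! ### Sections of the associated sheaf, compared locally with the presheaf. -/

section Sheafification

variable {Y : Scheme.{0}} (P : PreMod Y) {U V : Y.Opens}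

lemma toShf_add (x y : P.obj (op U)) : toShf P (x + y) = toShf P x + toShf P y :=
  map_add (((PresheafOfModules.sheafificationAdjunction (𝟙 Y.ringCatSheaf.obj)).unit.app P).app
    (op U)).hom x y

lemma toShf_zero : toShf P (0 : P.obj (op U)) = 0 :=
  map_zero (((PresheafOfModules.sheafificationAdjunction (𝟙 Y.ringCatSheaf.obj)).unit.app P).app
    (op U)).hom

lemma toShf_sum {ι : Type*} (s : Finset ι) (x : ι → P.obj (op U)) :
    toShf P (∑ i ∈ s, x i) = ∑ i ∈ s, toShf P (x i) :=
  map_sum (((PresheafOfModules.sheafificationAdjunction (𝟙 Y.ringCatSheaf.obj)).unit.app P).app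
    (op U)).hom x s

lemma toShf_smul (r : Γ(Y, U)) (x : P.obj (op U)) :
    toShf P ((show (OO Y).obj (op U) from r) • x) = r • toShf P x :=
  (ModuleCat.Hom.hom (((PresheafOfModules.sheafificationAdjunction
    (𝟙 Y.ringCatSheaf.obj)).unit.app P).app (op U))).map_smul (show (OO Y).obj (op U) from r) x

lemma toShf_rst (h : V ≤ U) (x : P.obj (op U)) :
    rst h (toShf P x) = toShf P (P.restrictₛₗ (homOfLE h).op x) :=
  (PresheafOfModules.naturality_apply
    ((PresheafOfModules.sheafificationAdjunction (𝟙 Y.ringCatSheaf.obj)).unit.app P)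
    (homOfLE h).op x).symm

lemma toShf_locally_surjective (x : Γ(shf P, U)) (p : Y) (hp : p ∈ U) :
    ∃ (V : Y.Opens) (hV : V ≤ U) (x' : P.obj (op V)), p ∈ V ∧ rst hV x = toShf P x' := by
  have := CategoryTheory.Presheaf.imageSieve_mem (Opens.grothendieckTopology Y)
    (CategoryTheory.toSheafify (Opens.grothendieckTopology Y) P.presheaf) (U := op U) x
  obtain ⟨V, f, ⟨x', hx'⟩, hV⟩ := this p hp
  exact ⟨V, f.le, x', hV, hx'.symm⟩

lemma toShf_locally_injective (x : P.obj (op U)) (hx : toShf P x = 0) (p : Y) (hp : p ∈ U) :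
    ∃ (V : Y.Opens) (hV : V ≤ U), p ∈ V ∧ P.restrictₛₗ (homOfLE hV).op x = 0 := by
  have := CategoryTheory.Presheaf.equalizerSieve_mem (Opens.grothendieckTopology Y)
    (CategoryTheory.toSheafify (Opens.grothendieckTopology Y) P.presheaf) (X := op U) x
    (0 : P.presheaf.obj (op U)) (by
      refine Eq.trans hx ?_
      exact (toShf_zero P).symm)
  obtain ⟨V, f, hf, hV⟩ := this p hp
  refine ⟨V, f.le, hV, ?_⟩
  have h2 : P.presheaf.map f.op x = P.presheaf.map f.op 0 := hf
  rw [map_zero] at h2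
  exact h2

/-- The action of a morphism of presheaves on associated sheaves. -/
lemma sheafify_map_toShf {P Q : PreMod Y} (φ : P ⟶ Q) (x : P.obj (op U)) :
    Scheme.Modules.Hom.app ((sheafify Y).map φ) U (toShf P x) = toShf Q (φ.app (op U) x) := by
  have := (PresheafOfModules.sheafificationAdjunction (𝟙 Y.ringCatSheaf.obj)).unit.naturality φ
  have h2 := congrArg (fun ψ => ψ.app (op U) x) this
  exact h2.symm

end Sheafification

/-! ### Morphisms of sheaves constructed from sections. -/

section Morphisms

variable {Y : Scheme.{0}} {M N : Y.Modules}

/-- A morphism of sheaves of modules, given by its action on sections. -/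
def homOfSections (φ : ∀ U : Y.Opens, Γ(M, U) →+ Γ(N, U))
    (hs : ∀ (U : Y.Opens) (r : Γ(Y, U)) x, φ U (r • x) = r • φ U x)
    (hr : ∀ (U V : Y.Opens) (h : V ≤ U) x, φ V (rst h x) = rst h (φ U x)) : M ⟶ N :=
  (⟨PresheafOfModules.homMk (M₁ := M.val) (M₂ := N.val)
    { app := fun U => AddCommGrpCat.ofHom (φ U.unop)
      naturality := fun U V f => by
        ext x
        exact hr U.unop V.unop f.unop.le x } (fun U r x => hs U.unop r x)⟩ :
    SheafOfModules.Hom M N)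

lemma hom_ext_sections {φ ψ : M ⟶ N} (h : ∀ (U : Y.Opens) (x : Γ(M, U)),
    Scheme.Modules.Hom.app φ U x = Scheme.Modules.Hom.app ψ U x) : φ = ψ :=
  Scheme.Modules.hom_ext _ _ fun U => by ext x; exact h U x

/-- A local, linear, functional and locally total relation between the sections of two sheaves is
the graph of a morphism. -/
lemma exists_hom_of_relation (Rel : ∀ W : Y.Opens, Γ(M, W) → Γ(N, W) → Prop)
    (hres : ∀ W V (h : V ≤ W) x z, Rel W x z → Rel V (rst h x) (rst h z))
    (htot : ∀ W x, ∀ p ∈ W, ∃ (V : Y.Opens) (h : V ≤ W), p ∈ V ∧ ∃ z, Rel V (rst h x) z)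
    (hfun : ∀ W x z z', Rel W x z → Rel W x z' → z = z')
    (hadd : ∀ W x x' z z', Rel W x z → Rel W x' z' → Rel W (x + x') (z + z'))
    (hsmul : ∀ W (r : Γ(Y, W)) x z, Rel W x z → Rel W (r • x) (r • z)) :
    ∃ ψ : M ⟶ N, ∀ W x z, Rel W x z → Scheme.Modules.Hom.app ψ W x = z := by
  -- The value at a section is glued from locally related values. They agree on overlaps because the
  -- relation is functional, and for the same reason the result restricts to any related value.
  have key : ∀ (W : Y.Opens) (x : Γ(M, W)), ∃ z : Γ(N, W), ∀ V (h : V ≤ W) w,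
      Rel V (rst h x) w → rst h z = w := by
    intro W x
    choose V hV hp z hz using htot W x
    obtain ⟨y, hy⟩ := exists_gluing (M := N) (U := W) (ι := {p // p ∈ W})
      (fun p => V p.1 p.2) (fun p => hV _ _) (fun p hp' => ⟨⟨p, hp'⟩, hp p hp'⟩)
      (fun p => z p.1 p.2) (fun i j W' hi hj => hfun W' (rst (hi.trans (hV _ _)) x) _ _
        (by simpa only [rst_rst] using hres _ _ hi _ _ (hz i.1 i.2))
        (by simpa only [rst_rst] using hres _ _ hj _ _ (hz j.1 j.2)))
    refine ⟨y, fun V' h w hw => section_ext fun p hp' => ?_⟩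
    refine ⟨V' ⊓ V p (h hp'), inf_le_left, ⟨hp', hp _ _⟩, ?_⟩
    refine hfun _ (rst (inf_le_left.trans h) x) _ _ ?_ ?_
    · rw [rst_rst, ← rst_rst (hV p (h hp')) inf_le_right y, hy ⟨p, h hp'⟩]
      simpa only [rst_rst] using hres _ _ (inf_le_right : V' ⊓ V p (h hp') ≤ _) _ _ (hz p (h hp'))
    · simpa only [rst_rst] using hres _ _ (inf_le_left : V' ⊓ V p (h hp') ≤ _) _ _ hw
  choose ψ hψ using key
  -- A value is recognised by being related locally. Additivity, linearity and compatibility with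
  -- restriction are checked through this criterion.
  have hloc : ∀ (W : Y.Opens) (x : Γ(M, W)) (z : Γ(N, W)),
      (∀ p ∈ W, ∃ (V : Y.Opens) (h : V ≤ W), p ∈ V ∧ Rel V (rst h x) (rst h z)) → ψ W x = z := by
    intro W x z h
    refine section_ext fun p hp => ?_
    obtain ⟨V, hV, hpV, hR⟩ := h p hp
    exact ⟨V, hV, hpV, hψ W x V hV _ hR⟩
  have hloc' : ∀ (W : Y.Opens) (x : Γ(M, W)),
      ∀ p ∈ W, ∃ (V : Y.Opens) (h : V ≤ W), p ∈ V ∧ Rel V (rst h x) (rst h (ψ W x)) := by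
    intro W x p hp
    obtain ⟨V, hV, hpV, z, hz⟩ := htot W x p hp
    exact ⟨V, hV, hpV, by rwa [hψ W x V hV z hz]⟩
  have hadd' : ∀ (W : Y.Opens) (x x' : Γ(M, W)), ψ W (x + x') = ψ W x + ψ W x' := by
    intro W x x'
    refine hloc _ _ _ fun p hp => ?_
    obtain ⟨V, hV, hpV, h1⟩ := hloc' W x p hp
    obtain ⟨V', hV', hpV', h2⟩ := hloc' W x' p hp
    refine ⟨V ⊓ V', inf_le_left.trans hV, ⟨hpV, hpV'⟩, ?_⟩
    rw [rst_add, rst_add]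
    refine hadd _ _ _ _ _ ?_ ?_
    · simpa only [rst_rst] using hres _ _ (inf_le_left : V ⊓ V' ≤ _) _ _ h1
    · simpa only [rst_rst] using hres _ _ (inf_le_right : V ⊓ V' ≤ _) _ _ h2
  refine ⟨homOfSections (fun U => AddMonoidHom.mk' (ψ U) (hadd' U)) (fun W r x => ?_)
    (fun W W' h x => ?_), fun W x z hz => ?_⟩
  · refine hloc _ _ _ fun p hp => ?_
    obtain ⟨V, hV, hpV, h1⟩ := hloc' W x p hp
    refine ⟨V, hV, hpV, ?_⟩
    rw [rst_smul, AddMonoidHom.mk'_apply, rst_smul]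
    exact hsmul _ _ _ _ h1
  · refine hloc _ _ _ fun p hp => ?_
    obtain ⟨V, hV, hpV, h1⟩ := hloc' W x p (h hp)
    refine ⟨V ⊓ W', inf_le_right, ⟨hpV, hp⟩, ?_⟩
    rw [rst_rst, AddMonoidHom.mk'_apply, rst_rst]
    simpa only [rst_rst] using hres _ _ (inf_le_left : V ⊓ W' ≤ _) _ _ h1
  · refine hloc _ _ _ fun p hp => ⟨W, le_rfl, hp, ?_⟩
    rwa [rst_self, rst_self]

end Morphisms

/-! ### Exactness in terms of sections. -/

section Exactness

variable {Y : Scheme.{0}} {A B C : Y.Modules}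

/-- Sections over `U`, as a functor. -/
def secFunctor (U : Y.Opens) : Y.Modules ⥤ Ab :=
  Scheme.Modules.toPresheaf Y ⋙ (evaluation _ _).obj (op U)

instance (U : Y.Opens) : PreservesLimitsOfSize.{0, 0} (secFunctor U) := by
  have : PreservesLimitsOfSize.{0, 0} (Scheme.Modules.toPresheaf Y) :=
    inferInstanceAs (PreservesLimits (Scheme.Modules.toPresheaf Y))
  have : PreservesLimitsOfSize.{0, 0}
      ((evaluation (TopologicalSpace.Opens Y)ᵒᵖ Ab.{0}).obj (op U)) :=
    ⟨fun {_ _} => inferInstance⟩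
  exact comp_preservesLimits (Scheme.Modules.toPresheaf Y) ((evaluation _ _).obj (op U))

lemma injective_of_mono (f : A ⟶ B) [Mono f] (U : Y.Opens) :
    Function.Injective (Scheme.Modules.Hom.app f U) := by
  have : Mono ((secFunctor U).map f) := inferInstance
  exact (AddCommGrpCat.mono_iff_injective _).1 this

lemma mono_of_injective_sections (f : A ⟶ B)
    (h : ∀ U : Y.Opens, Function.Injective (Scheme.Modules.Hom.app f U)) : Mono f :=
  ⟨fun g g' e => hom_ext_sections fun U x => h U (by
    rw [← app_comp, ← app_comp, e])⟩

instance (U : Y.Opens) : (secFunctor (Y := Y) U).PreservesZeroMorphisms where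
  map_zero _ _ := rfl

lemma exists_kernel_section (g : B ⟶ C) {U : Y.Opens} (x : Γ(B, U))
    (hx : Scheme.Modules.Hom.app g U x = 0) :
    ∃ x' : Γ((kernel g : Y.Modules), U), Scheme.Modules.Hom.app (kernel.ι g) U x' = x := by
  have h := KernelFork.mapIsLimit _ (kernelIsKernel g) (secFunctor U)
  have e := ShortComplex.exact_of_f_is_kernel
    (ShortComplex.mk ((secFunctor U).map (kernel.ι g)) ((secFunctor U).map g)
      (by rw [← Functor.map_comp, kernel.condition, Functor.map_zero])) h
  exact (ShortComplex.ab_exact_iff _).1 e x hx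

lemma kernel_ι_app (g : B ⟶ C) {U : Y.Opens} (x : Γ((kernel g : Y.Modules), U)) :
    Scheme.Modules.Hom.app g U (Scheme.Modules.Hom.app (kernel.ι g) U x) = 0 := by
  rw [← app_comp, kernel.condition]; rfl

lemma epi_of_locally_surjective (f : A ⟶ B)
    (h : ∀ (U : Y.Opens) (x : Γ(B, U)), ∀ p ∈ U, ∃ (V : Y.Opens) (hV : V ≤ U),
      p ∈ V ∧ ∃ y, Scheme.Modules.Hom.app f V y = rst hV x) : Epi f :=
  ⟨fun g g' e => hom_ext_sections fun U x => section_ext fun p hp => by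
    obtain ⟨V, hV, hpV, y, hy⟩ := h U x p hp
    refine ⟨V, hV, hpV, ?_⟩
    rw [← app_rst, ← app_rst, ← hy, ← app_comp, ← app_comp, e]⟩

/-- Exactness of `A → B → C` over the open subset `O`, in terms of sections. -/
def LocExactOn (O : Y.Opens) (f : A ⟶ B) (g : B ⟶ C) : Prop :=
  (∀ U ≤ O, ∀ x : Γ(A, U), Scheme.Modules.Hom.app g U (Scheme.Modules.Hom.app f U x) = 0) ∧
  ∀ U ≤ O, ∀ x : Γ(B, U), Scheme.Modules.Hom.app g U x = 0 → ∀ p ∈ U,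
    ∃ (V : Y.Opens) (hV : V ≤ U), p ∈ V ∧ ∃ y, Scheme.Modules.Hom.app f V y = rst hV x

/-- The local lifts make the morphism from `A` to the kernel of `g` locally surjective, hence an
epimorphism. -/
lemma LocExactOn.exact {f : A ⟶ B} {g : B ⟶ C} (h : LocExactOn ⊤ f g) :
    ∃ w : f ≫ g = 0, (ShortComplex.mk f g w).Exact := by
  have w : f ≫ g = 0 := hom_ext_sections fun U x => h.1 U le_top x
  refine ⟨w, ?_⟩
  rw [ShortComplex.exact_iff_epi_kernel_lift]
  refine epi_of_locally_surjective _ fun U x p hp => ?_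
  obtain ⟨V, hV, hpV, y, hy⟩ := h.2 U le_top (Scheme.Modules.Hom.app (kernel.ι g) U x)
    (kernel_ι_app g x) p hp
  refine ⟨V, hV, hpV, y, injective_of_mono (kernel.ι g) V ?_⟩
  rw [← app_comp, app_rst, ← hy]
  exact congrArg (fun φ => Scheme.Modules.Hom.app φ V y) (kernel.lift_ι g f w)

lemma isZero_of_sections (h : ∀ (U : Y.Opens) (x : Γ(A, U)), x = 0) : IsZero A :=
  (IsZero.iff_id_eq_zero A).2 (hom_ext_sections fun U x => h U x)

lemma LocExactOn.mono {f : A ⟶ B} {g : B ⟶ C} {O O' : Y.Opens} (h : LocExactOn O f g)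
    (hO : O' ≤ O) : LocExactOn O' f g :=
  ⟨fun U hU => h.1 U (hU.trans hO), fun U hU => h.2 U (hU.trans hO)⟩

lemma LocExactOn.restrict {f : A ⟶ B} {g : B ⟶ C} {O : Y.Opens} (h : LocExactOn O f g) :
    LocExactOn ⊤ ((Scheme.Modules.restrictFunctor O.ι).map f)
      ((Scheme.Modules.restrictFunctor O.ι).map g) := by
  have hO : ∀ U : O.toScheme.Opens, O.ι ''ᵁ U ≤ O := fun U => by
    rintro _ ⟨x, -, rfl⟩; exact x.2
  refine ⟨fun U _ x => h.1 (O.ι ''ᵁ U) (hO U) x, fun U _ x hx p hp => ?_⟩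
  obtain ⟨V, hV, hpV, y, hy⟩ := h.2 (O.ι ''ᵁ U) (hO U) x hx (O.ι p) ⟨p, hp, rfl⟩
  have e : O.ι ''ᵁ (O.ι ⁻¹ᵁ V) ≤ V := by
    rintro _ ⟨x, hx, rfl⟩; exact hx
  have e2 : O.ι ⁻¹ᵁ V ≤ U := fun x hx => by
    obtain ⟨x', hx', e⟩ := hV hx
    have : x' = x := Subtype.ext e
    rwa [← this]
  refine ⟨O.ι ⁻¹ᵁ V, e2, hpV, rst (M := A) e y, ?_⟩
  refine (app_rst f e y).trans ?_
  rw [hy]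
  exact rst_rst (M := B) (U := O.ι ''ᵁ U) hV e x

end Exactness

/-! ### Functionals at a point and skyscraper sheaves. -/

section Germs

variable {Y : Scheme.{0}} {y : Y} {G : Type} [CommRing G] (ρ : Y.presheaf.stalk y →+* G)

/-- The ring homomorphism `𝒪(U) → G` given by a homomorphism from the stalk. -/
def atStalk (U : Y.Opensᵒᵖ) (h : y ∈ unop U) : (OO Y).obj U →+* G :=
  ρ.comp (Y.presheaf.germ (unop U) y h).hom

lemma atStalk_apply (U : Y.Opens) (h : y ∈ U) (r : Γ(Y, U)) :
    atStalk ρ (op U) h r = ρ (Y.presheaf.germ U y h r) := rfl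

lemma germ_rstO {U V : Y.Opens} (h : V ≤ U) (hy : y ∈ V) (r : Γ(Y, U)) :
    Y.presheaf.germ V y hy (rstO h r) = Y.presheaf.germ U y (h hy) r :=
  TopCat.Presheaf.germ_res_apply Y.presheaf (homOfLE h) y hy r

lemma atStalk_map {U V : Y.Opensᵒᵖ} (f : U ⟶ V) (h : y ∈ unop V) (r : (OO Y).obj U) :
    atStalk ρ V h (((OO Y).map f).hom r) = atStalk ρ U (f.unop.le h) r :=
  congrArg ρ (TopCat.Presheaf.germ_res_apply Y.presheaf f.unop y h r)

/-- A linear functional at the point `y` on a presheaf of modules, with values in a ring `G` over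
the local ring at `y`. -/
structure PFun (P : PreMod Y) where
  /-- the maps `P(U) → G` -/
  toFun (U : Y.Opensᵒᵖ) (h : y ∈ unop U) : P.obj U →ₛₗ[atStalk ρ U h] G
  /-- compatibility with restriction -/
  res {U V : Y.Opensᵒᵖ} (f : U ⟶ V) (h : y ∈ unop V) (x : P.obj U) :
    toFun V h (P.restrictₛₗ f x) = toFun U (f.unop.le h) x

variable (y G) in
/-- The sections of the skyscraper sheaf. -/
abbrev SkSec (U : Y.Opensᵒᵖ) : Type := PLift (y ∈ unop U) → G

/-- The module structure on the sections of the skyscraper sheaf. -/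
abbrev skModule (U : Y.Opensᵒᵖ) : Module ((OO Y).obj U) (SkSec y G U) where
  smul r x := fun h => atStalk ρ U h.down r * x h
  one_smul x := funext fun h => by
    change atStalk ρ U h.down 1 * x h = _
    rw [map_one, one_mul]
  mul_smul r r' x := funext fun h => by
    change atStalk ρ U h.down (r * r') * x h = atStalk ρ U h.down r * (atStalk ρ U h.down r' * x h)
    rw [map_mul, mul_assoc]
  smul_zero r := funext fun h => mul_zero _
  smul_add r x x' := funext fun h => mul_add _ _ _
  add_smul r r' x := funext fun h => by
    change atStalk ρ U h.down (r + r') * x h = atStalk ρ U h.down r * x h + atStalk ρ U h.down r' * x h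
    rw [map_add, add_mul]
  zero_smul x := funext fun h => by
    change atStalk ρ U h.down 0 * x h = _
    rw [map_zero, zero_mul]; rfl

/-- The skyscraper sheaf at `y`, as a presheaf of modules. -/
def skPre : PreMod Y :=
  letI := fun U => skModule ρ U
  PresheafOfModules.ofPresheaf (R := OO Y)
    { obj := fun U => AddCommGrpCat.of (SkSec y G U)
      map := fun f => AddCommGrpCat.ofHom
        { toFun := fun x h => x ⟨f.unop.le h.down⟩
          map_zero' := rfl
          map_add' := fun _ _ => rfl }
      map_id := fun U => rfl
      map_comp := fun f g => rfl }
    (fun U V f r x => funext fun h => by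
      change atStalk ρ U _ r * _ = atStalk ρ V _ _ * _
      rw [← atStalk_map ρ f h.down]
      rfl)

lemma skPre_isSheaf : TopCat.Presheaf.IsSheaf (skPre ρ).presheaf := by
  rw [TopCat.Presheaf.isSheaf_iff_isSheafUniqueGluing]
  intro ι U sf hsf
  have hex : ∀ h : PLift (y ∈ iSup U), ∃ i, y ∈ U i :=
    fun h => TopologicalSpace.Opens.mem_iSup.1 h.down
  refine ⟨fun h => (sf (hex h).choose : SkSec y G (op (U (hex h).choose))) ⟨(hex h).choose_spec⟩,
    fun i => funext fun h => ?_, fun x hx => funext fun h => ?_⟩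
  · exact congrFun (hsf (hex ⟨TopologicalSpace.Opens.mem_iSup.2 ⟨i, h.down⟩⟩).choose i)
      ⟨⟨(hex ⟨TopologicalSpace.Opens.mem_iSup.2 ⟨i, h.down⟩⟩).choose_spec, h.down⟩⟩
  · exact congrFun (hx (hex h).choose) ⟨(hex h).choose_spec⟩

/-- The skyscraper sheaf at `y`. -/
def sk : Y.Modules := ⟨skPre ρ, skPre_isSheaf ρ⟩

variable {ρ}

/-- A functional as a morphism to the skyscraper sheaf. -/
def PFun.toSk {P : PreMod Y} (φ : PFun ρ P) : P ⟶ skPre ρ :=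
  PresheafOfModules.homMk
    { app := fun U => AddCommGrpCat.ofHom
        { toFun := fun x => (fun h => φ.toFun U h.down x : SkSec y G U)
          map_zero' := funext fun h => map_zero (φ.toFun U h.down)
          map_add' := fun x x' => funext fun h => map_add (φ.toFun U h.down) x x' }
      naturality := fun U V f => by
        ext x
        exact funext fun h => φ.res f h.down x }
    (fun U r x => funext fun h => (φ.toFun U h.down).map_smulₛₗ r x)

/-- The functional given by a morphism to the skyscraper sheaf. -/
def PFun.ofSk {P : PreMod Y} (φ : P ⟶ skPre ρ) : PFun ρ P where
  toFun U h :=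
    { toFun := fun x => (show SkSec y G U from φ.app U x) ⟨h⟩
      map_add' := fun x x' => congrFun (map_add (φ.app U).hom x x') ⟨h⟩
      map_smul' := fun r x => congrFun ((φ.app U).hom.map_smul r x) ⟨h⟩ }
  res f h x := congrFun (PresheafOfModules.naturality_apply φ f x) ⟨h⟩

/-- The extension of a functional to the associated sheaf. -/
def PFun.shf {P : PreMod Y} (φ : PFun ρ P) : PFun ρ (pre (LongDiag.shf P)) :=
  PFun.ofSk (((PresheafOfModules.sheafificationAdjunction (𝟙 Y.ringCatSheaf.obj)).homEquiv
    P (sk ρ)).symm φ.toSk).val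

/-- The skyscraper presheaf is already a sheaf, so a functional factors through the unit of
sheafification. Together with `PFun.pullback_pull` this allows functionals to be evaluated without
computing any stalk. -/
lemma PFun.shf_toShf {P : PreMod Y} (φ : PFun ρ P) {U : Y.Opens} (h : y ∈ U) (x : P.obj (op U)) :
    φ.shf.toFun (op U) h (toShf P x) = φ.toFun (op U) h x := by
  have e := (PresheafOfModules.sheafificationAdjunction (𝟙 Y.ringCatSheaf.obj)).homEquiv_unit
    (X := P) (Y := sk ρ) (f := ((PresheafOfModules.sheafificationAdjunction
      (𝟙 Y.ringCatSheaf.obj)).homEquiv P (sk ρ)).symm φ.toSk)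
  have e' := ((PresheafOfModules.sheafificationAdjunction (𝟙 Y.ringCatSheaf.obj)).homEquiv
    P (sk ρ)).apply_symm_apply φ.toSk
  exact (congrFun (congrArg (fun ψ => ψ.app (op U) x) (e'.symm.trans e)) ⟨h⟩).symm

variable {Z : Scheme.{0}} {f : Y ⟶ Z} {E : Z.Modules}

/-- A functional at `f y` as a morphism to the direct image of the skyscraper sheaf at `y`. -/
def PFun.toPush (φ : PFun (ρ.comp (f.stalkMap y).hom) (pre E)) :
    E ⟶ (Scheme.Modules.pushforward f).obj (sk ρ) :=
  homOfSections (fun V =>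
    { toFun := fun x => (fun h => φ.toFun (op V) h.down x : SkSec y G (op (f ⁻¹ᵁ V)))
      map_zero' := funext fun h => map_zero (φ.toFun (op V) h.down)
      map_add' := fun x x' => funext fun h => map_add (φ.toFun (op V) h.down) x x' })
    (fun U r x => funext fun h => by
      refine ((φ.toFun (op U) h.down).map_smulₛₗ r x).trans ?_
      change _ = atStalk ρ (op (f ⁻¹ᵁ U)) h.down _ * _
      refine congrArg (· * _) ?_
      refine congrArg ρ ?_
      exact Scheme.Hom.germ_stalkMap_apply f U y h.down r)
    (fun U V i x => funext fun h => φ.res (homOfLE i).op h.down x)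

/-- The functional at `y` on the pullback of a sheaf given by a functional at `f y`. -/
def PFun.pullback (φ : PFun (ρ.comp (f.stalkMap y).hom) (pre E)) :
    PFun ρ (pre ((Scheme.Modules.pullback f).obj E)) :=
  PFun.ofSk (((Scheme.Modules.pullbackPushforwardAdjunction f).homEquiv E (sk ρ)).symm
    φ.toPush).val

lemma PFun.pullback_pull (φ : PFun (ρ.comp (f.stalkMap y).hom) (pre E)) {V : Z.Opens}
    (x : Γ(E, V)) {U : Y.Opens} (hU : U ≤ f ⁻¹ᵁ V) (h : y ∈ U) :
    φ.pullback.toFun (op U) h (pull f E x hU) = φ.toFun (op V) (hU h) x := by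
  unfold pull
  refine (φ.pullback.res (homOfLE hU).op h _).trans ?_
  have e := (Scheme.Modules.pullbackPushforwardAdjunction f).homEquiv_unit
    (X := E) (Y := sk ρ) (f := ((Scheme.Modules.pullbackPushforwardAdjunction f).homEquiv E
      (sk ρ)).symm φ.toPush)
  rw [Equiv.apply_symm_apply] at e
  exact (congrFun (congrArg (fun ψ => Scheme.Modules.Hom.app ψ V x) e) ⟨hU h⟩).symm

end Germs

/-! ### Pullbacks are locally generated by pulled back sections. -/

section Pull

variable {Y Z : Scheme.{0}} (f : Y ⟶ Z) {E : Z.Modules}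

lemma pull_add {V : Z.Opens} {U : Y.Opens} (h : U ≤ f ⁻¹ᵁ V) (x x' : Γ(E, V)) :
    pull f E (x + x') h = pull f E x h + pull f E x' h := by
  unfold pull; rw [app_add]; exact rst_add _ _ _

lemma pull_sum {V : Z.Opens} {U : Y.Opens} (h : U ≤ f ⁻¹ᵁ V) {ι : Type*} (s : Finset ι)
    (x : ι → Γ(E, V)) : pull f E (∑ i ∈ s, x i) h = ∑ i ∈ s, pull f E (x i) h := by
  unfold pull; rw [app_sum]; exact rst_sum _ _ _

lemma pull_smul {V : Z.Opens} {U : Y.Opens} (h : U ≤ f ⁻¹ᵁ V) (r : Γ(Z, V)) (x : Γ(E, V)) :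
    pull f E (r • x) h = (f.appLE V U h).hom r • pull f E x h := by
  unfold pull
  rw [Scheme.Modules.Hom.app_smul]
  refine (rst_smul h (M := (Scheme.Modules.pullback f).obj E) (U := f ⁻¹ᵁ V) ((f.app V).hom r)
    _).trans ?_
  congr 1

lemma rst_pull {V : Z.Opens} {U U' : Y.Opens} (h : U ≤ f ⁻¹ᵁ V) (h' : U' ≤ U) (x : Γ(E, V)) :
    rst h' (pull f E x h) = pull f E x (h'.trans h) := by
  unfold pull
  exact rst_rst (M := (Scheme.Modules.pullback f).obj E) (U := f ⁻¹ᵁ V) _ _ _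

lemma pull_rst {V V' : Z.Opens} {U : Y.Opens} (hV : V' ≤ V) (h : U ≤ f ⁻¹ᵁ V') (x : Γ(E, V)) :
    pull f E (rst hV x) h = pull f E x (h.trans fun _ hx => hV hx) := by
  unfold pull
  rw [app_rst]
  exact rst_rst (M := (Scheme.Modules.pullback f).obj E) (U := f ⁻¹ᵁ V) (V := f ⁻¹ᵁ V')
    (fun _ hx => hV hx) h _

/-- The submodule of sections over `U` spanned by pullbacks of sections. -/
def pullSpan (E : Z.Modules) (U : Y.Opens) :
    Submodule Γ(Y, U) Γ((Scheme.Modules.pullback f).obj E, U) :=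
  Submodule.span _ {x | ∃ (V : Z.Opens) (h : U ≤ f ⁻¹ᵁ V) (e : Γ(E, V)), x = pull f E e h}

lemma rst_mem_pullSpan {U U' : Y.Opens} (h : U' ≤ U) {x : Γ((Scheme.Modules.pullback f).obj E, U)}
    (hx : x ∈ pullSpan f E U) : rst h x ∈ pullSpan f E U' := by
  induction hx using Submodule.span_induction with
  | mem x hx =>
    obtain ⟨V, h', e, rfl⟩ := hx
    exact Submodule.subset_span ⟨V, h.trans h', e, rst_pull f h' h e⟩
  | zero => rw [rst_zero]; exact Submodule.zero_mem _
  | add x y _ _ hx hy => rw [rst_add]; exact Submodule.add_mem _ hx hy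
  | smul r x _ hx => rw [rst_smul]; exact Submodule.smul_mem _ _ hx

/-- The sections which are locally combinations of pullbacks of sections. -/
def LocPull {U : Y.Opens} (x : Γ((Scheme.Modules.pullback f).obj E, U)) : Prop :=
  ∀ p ∈ U, ∃ (V : Y.Opens) (hV : V ≤ U), p ∈ V ∧ rst hV x ∈ pullSpan f E V

variable {f} in
lemma LocPull.zero {U : Y.Opens} : LocPull f (0 : Γ((Scheme.Modules.pullback f).obj E, U)) :=
  fun p hp => ⟨U, le_rfl, hp, by rw [rst_zero]; exact Submodule.zero_mem _⟩

variable {f} in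
lemma LocPull.add {U : Y.Opens} {x y : Γ((Scheme.Modules.pullback f).obj E, U)}
    (hx : LocPull f x) (hy : LocPull f y) : LocPull f (x + y) := fun p hp => by
  obtain ⟨V, hV, hpV, h⟩ := hx p hp
  obtain ⟨V', hV', hpV', h'⟩ := hy p hp
  refine ⟨V ⊓ V', inf_le_left.trans hV, ⟨hpV, hpV'⟩, ?_⟩
  rw [rst_add]
  refine Submodule.add_mem _ ?_ ?_
  · rw [← rst_rst hV inf_le_left]; exact rst_mem_pullSpan f _ h
  · rw [← rst_rst hV' inf_le_right]; exact rst_mem_pullSpan f _ h'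

variable {f} in
lemma LocPull.smul {U : Y.Opens} {x : Γ((Scheme.Modules.pullback f).obj E, U)}
    (hx : LocPull f x) (r : Γ(Y, U)) : LocPull f (r • x) := fun p hp => by
  obtain ⟨V, hV, hpV, h⟩ := hx p hp
  exact ⟨V, hV, hpV, by rw [rst_smul]; exact Submodule.smul_mem _ _ h⟩

variable {f} in
lemma LocPull.rst {U U' : Y.Opens} {x : Γ((Scheme.Modules.pullback f).obj E, U)}
    (hx : LocPull f x) (hU : U' ≤ U) : LocPull f (rst hU x) := fun p hp => by
  obtain ⟨V, hV, hpV, h⟩ := hx p (hU hp)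
  refine ⟨V ⊓ U', inf_le_right, ⟨hpV, hp⟩, ?_⟩
  rw [rst_rst, ← rst_rst hV inf_le_left]; exact rst_mem_pullSpan f _ h

/-- The subsheaf of sections which are locally combinations of pullbacks of sections. -/
def pullGenSub (E : Z.Modules) :
    PresheafOfModules.Submodule (pre ((Scheme.Modules.pullback f).obj E)) where
  obj U :=
    { carrier := {x | LocPull f (U := unop U) x}
      zero_mem' := LocPull.zero
      add_mem' := fun hx hy => LocPull.add hx hy
      smul_mem' := fun r _ hx => LocPull.smul hx r }
  map {U _} i := fun _ hx => LocPull.rst (U := unop U) hx i.unop.le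

/-- Membership is a local condition, so a glued section of the pullback satisfies it as soon as its
pieces do. -/
lemma pullGenSub_isSheaf (E : Z.Modules) :
    TopCat.Presheaf.IsSheaf (pullGenSub f E).toPresheafOfModules.presheaf := by
  rw [TopCat.Presheaf.isSheaf_iff_isSheafUniqueGluing]
  intro ι U sf hsf
  let sf' : ∀ i, Γ((Scheme.Modules.pullback f).obj E, U i) := fun i =>
    (show ↥((pullGenSub f E).obj (op (U i))) from sf i).1
  have hg := TopCat.Sheaf.existsUnique_gluing (⟨((Scheme.Modules.pullback f).obj E).presheaf,
    ((Scheme.Modules.pullback f).obj E).isSheaf⟩ : TopCat.Sheaf Ab _) U sf'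
    (fun i j => congrArg Subtype.val (hsf i j))
  obtain ⟨y, hy, huniq⟩ := hg
  refine ⟨(⟨y, fun p hp => ?_⟩ : (pullGenSub f E).obj (op (iSup U))), fun i => ?_, fun z hz => ?_⟩
  · obtain ⟨i, hi⟩ := TopologicalSpace.Opens.mem_iSup.1 hp
    obtain ⟨V, hV, hpV, h⟩ := (show ↥((pullGenSub f E).obj (op (U i))) from sf i).2 p hi
    refine ⟨V, hV.trans (le_iSup U i), hpV, ?_⟩
    have e : rst (le_iSup U i) y = sf' i := hy i
    refine Eq.mpr (congrArg (· ∈ _) ((rst_rst (le_iSup U i) hV y).symm.trans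
      (congrArg (rst hV) e))) ?_
    exact h
  · exact Subtype.ext (hy i)
  · exact Subtype.ext (huniq _ fun i => congrArg Subtype.val (hz i))

lemma pull_mem_pullGenSub {V : Z.Opens} (x : Γ(E, V)) :
    Scheme.Modules.Hom.app ((Scheme.Modules.pullbackPushforwardAdjunction f).unit.app E) V x ∈
      (pullGenSub f E).obj (op (f ⁻¹ᵁ V)) :=
  fun _ hp => ⟨f ⁻¹ᵁ V, le_rfl, hp, Submodule.subset_span ⟨V, le_rfl, x, rfl⟩⟩

/-- Locally, every section of a pullback is a combination of pullbacks of sections. -/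
lemma exists_mem_pullSpan {U : Y.Opens} (x : Γ((Scheme.Modules.pullback f).obj E, U)) (p : Y)
    (hp : p ∈ U) : ∃ (V : Y.Opens) (hV : V ≤ U), p ∈ V ∧ rst hV x ∈ pullSpan f E V := by
  let G : Y.Modules := ⟨(pullGenSub f E).toPresheafOfModules, pullGenSub_isSheaf f E⟩
  let i : G ⟶ (Scheme.Modules.pullback f).obj E :=
    (⟨(pullGenSub f E).ι⟩ : SheafOfModules.Hom _ _)
  let adj := Scheme.Modules.pullbackPushforwardAdjunction f
  let a : E ⟶ (Scheme.Modules.pushforward f).obj G := homOfSections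
    (fun V =>
      { toFun := fun x => (⟨Scheme.Modules.Hom.app (adj.unit.app E) V x, pull_mem_pullGenSub f x⟩ :
          (pullGenSub f E).obj (op (f ⁻¹ᵁ V)))
        map_zero' := Subtype.ext (app_zero _)
        map_add' := fun x x' => Subtype.ext (app_add _ x x') })
    (fun U r x => Subtype.ext (Scheme.Modules.Hom.app_smul (adj.unit.app E) r x))
    (fun U V h x => Subtype.ext (app_rst (adj.unit.app E) h x))
  -- The unit `E → f_* f^* E` has its values in `f_* G`. By adjunction the identity of `f^* E` then
  -- factors through the subsheaf `G`, so `G` is everything.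
  have e : (adj.homEquiv E G).symm a ≫ i = 𝟙 _ := by
    apply (adj.homEquiv _ _).injective
    rw [adj.homEquiv_naturality_right, Equiv.apply_symm_apply, adj.homEquiv_id]
    exact hom_ext_sections fun U x => rfl
  have h2 := congrArg (fun φ => Scheme.Modules.Hom.app φ U x) e
  have h3 : Scheme.Modules.Hom.app i U (Scheme.Modules.Hom.app ((adj.homEquiv E G).symm a) U x) = x :=
    h2
  rw [← h3]
  exact (Scheme.Modules.Hom.app ((adj.homEquiv E G).symm a) U x :
    (pullGenSub f E).obj (op U)).2 p hp

end Pull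

/-! ### Frames, their coordinates, and their pullbacks. -/

section Frames

variable {Y : Scheme.{0}}

namespace PFun

variable {y : Y} {G : Type} [CommRing G] {ρ : Y.presheaf.stalk y →+* G} {M : Y.Modules}
  (φ : PFun ρ (pre M)) {U V : Y.Opens}

/-- The value of a functional at a section of a sheaf. -/
def ev (h : y ∈ U) : Γ(M, U) →+ G := (φ.toFun (op U) h).toAddMonoidHom

lemma ev_smul (h : y ∈ U) (r : Γ(Y, U)) (x : Γ(M, U)) :
    φ.ev h (r • x) = ρ (Y.presheaf.germ U y h r) * φ.ev h x :=
  (φ.toFun (op U) h).map_smulₛₗ r x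

lemma ev_rst (hV : V ≤ U) (h : y ∈ V) (x : Γ(M, U)) : φ.ev h (LongDiag.rst hV x) = φ.ev (hV h) x :=
  φ.res (homOfLE hV).op h x

lemma ev_shf_toShf {P : PreMod Y} (φ : PFun ρ P) (h : y ∈ U) (x : P.obj (op U)) :
    φ.shf.ev h (toShf P x) = φ.toFun (op U) h x := φ.shf_toShf h x

lemma ev_pullback_pull {Z : Scheme.{0}} {f : Y ⟶ Z} {E : Z.Modules}
    (φ : PFun (ρ.comp (f.stalkMap y).hom) (pre E)) {V : Z.Opens} (x : Γ(E, V))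
    (hU : U ≤ f ⁻¹ᵁ V) (h : y ∈ U) :
    φ.pullback.ev h (LongDiag.pull f E x hU) = φ.ev (hU h) x := φ.pullback_pull x hU h

end PFun

/-- Sections which form a frame: over every smaller open subset, every section has unique
coordinates. -/
def IsFrameOn {κ : Type} [Fintype κ] (M : Y.Modules) {V : Y.Opens} (e : κ → Γ(M, V)) : Prop :=
  ∀ (U : Y.Opens) (h : U ≤ V) (x : Γ(M, U)), ∃! c : κ → Γ(Y, U), x = ∑ α, c α • rst h (e α)

lemma IsFrame.isFrameOn {M : Y.Modules} {V : Y.Opens} {r : ℕ} {e : Fin r → Γ(M, V)}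
    (h : IsFrame M e) : IsFrameOn M e := by
  intro U hU x
  obtain ⟨hi, hs⟩ := h U hU
  have hx : x ∈ Submodule.span Γ(Y, U) (Set.range fun α => rst hU (e α)) := hs ▸ Submodule.mem_top
  obtain ⟨c, hc⟩ := (Submodule.mem_span_range_iff_exists_fun _).1 hx
  refine ⟨c, hc.symm, fun c' hc' => ?_⟩
  have : ∑ α, (c' α - c α) • rst hU (e α) = 0 := by
    simp only [sub_smul, Finset.sum_sub_distrib]
    rw [hc]; exact sub_eq_zero.2 hc'.symm
  exact funext fun α => sub_eq_zero.1 (Fintype.linearIndependent_iff.1 hi _ this α)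

/-- A criterion for frames: local generation and linear independence. -/
lemma isFrameOn_of_local {κ : Type} [Fintype κ] {M : Y.Modules} {V : Y.Opens} {e : κ → Γ(M, V)}
    (hgen : ∀ (U : Y.Opens) (_ : U ≤ V) (x : Γ(M, U)), ∀ p ∈ U, ∃ (W : Y.Opens) (hW : W ≤ U)
      (h : W ≤ V) (c : κ → Γ(Y, W)), p ∈ W ∧ rst hW x = ∑ α, c α • rst h (e α))
    (hind : ∀ (U : Y.Opens) (h : U ≤ V) (c : κ → Γ(Y, U)),
      ∑ α, c α • LongDiag.rst h (e α) = 0 → c = 0) : IsFrameOn M e := by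
  have huniq : ∀ (U : Y.Opens) (h : U ≤ V) (c c' : κ → Γ(Y, U)),
      ∑ α, c α • LongDiag.rst h (e α) = ∑ α, c' α • LongDiag.rst h (e α) → c = c' := by
    intro U h c c' hc
    refine sub_eq_zero.1 (hind U h (c - c') ?_)
    simp only [Pi.sub_apply, sub_smul, Finset.sum_sub_distrib, hc, sub_self]
  intro U hU x
  choose W hW hWV c hp hc using hgen U hU x
  -- By independence the local coordinates agree on overlaps, so they glue to functions on `U`.
  have hg : ∀ α, ∃ y : Γ(Y, U), ∀ p : {p // p ∈ U}, rstO (hW p.1 p.2) y = c p.1 p.2 α := by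
    intro α
    have hU' : U = iSup fun p : {p // p ∈ U} => W p.1 p.2 := le_antisymm
      (fun p hp' => TopologicalSpace.Opens.mem_iSup.2 ⟨⟨p, hp'⟩, hp p hp'⟩)
      (iSup_le fun p => hW p.1 p.2)
    have key : ∀ (U' : Y.Opens) (hU'' : U' = iSup fun p : {p // p ∈ U} => W p.1 p.2)
        (hle : ∀ p : {p // p ∈ U}, W p.1 p.2 ≤ U'), ∃ y : Γ(Y, U'),
        ∀ p : {p // p ∈ U}, rstO (hle p) y = c p.1 p.2 α := by
      intro U' hU'' hle
      subst hU''
      obtain ⟨y, hy, -⟩ := TopCat.Sheaf.existsUnique_gluing Y.sheaf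
        (fun p : {p // p ∈ U} => W p.1 p.2) (fun p => c p.1 p.2 α) (fun p q => by
          have := huniq (W p.1 p.2 ⊓ W q.1 q.2) (inf_le_left.trans (hWV p.1 p.2))
            (fun α => rstO inf_le_left (c p.1 p.2 α)) (fun α => rstO inf_le_right (c q.1 q.2 α)) (by
              have h1 := congrArg (LongDiag.rst (inf_le_left : W p.1 p.2 ⊓ W q.1 q.2 ≤ _))
                (hc p.1 p.2)
              have h2 := congrArg (LongDiag.rst (inf_le_right : W p.1 p.2 ⊓ W q.1 q.2 ≤ _))
                (hc q.1 q.2)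
              simp only [rst_rst, rst_sum, rst_smul] at h1 h2
              exact h1.symm.trans h2)
          exact congrFun this α)
      exact ⟨y, hy⟩
    exact key U hU' fun p => hW p.1 p.2
  choose y hy using hg
  have hx : x = ∑ α, y α • LongDiag.rst hU (e α) := by
    refine section_ext fun p hp' => ⟨W p hp', hW p hp', hp p hp', ?_⟩
    rw [hc p hp', rst_sum]
    refine Finset.sum_congr rfl fun α _ => ?_
    rw [rst_smul, rst_rst, hy α ⟨p, hp'⟩]
  exact ⟨y, hx, fun c' hc' => huniq U hU _ _ (hc'.symm.trans hx)⟩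

namespace IsFrameOn

variable {κ : Type} [Fintype κ] {M : Y.Modules} {V : Y.Opens} {e : κ → Γ(M, V)}
  (he : IsFrameOn M e)
include he

/-- The coordinates of a section with respect to a frame. -/
def coord {U : Y.Opens} (h : U ≤ V) (x : Γ(M, U)) : κ → Γ(Y, U) := (he U h x).choose

lemma eq_sum {U : Y.Opens} (h : U ≤ V) (x : Γ(M, U)) :
    x = ∑ α, he.coord h x α • LongDiag.rst h (e α) := (he U h x).choose_spec.1

lemma coord_eq {U : Y.Opens} (h : U ≤ V) (x : Γ(M, U)) (c : κ → Γ(Y, U))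
    (hc : x = ∑ α, c α • LongDiag.rst h (e α)) : he.coord h x = c :=
  ((he U h x).choose_spec.2 c hc).symm

lemma coord_add {U : Y.Opens} (h : U ≤ V) (x x' : Γ(M, U)) :
    he.coord h (x + x') = he.coord h x + he.coord h x' := by
  refine he.coord_eq h _ _ ?_
  conv_lhs => rw [he.eq_sum h x, he.eq_sum h x']
  simp only [Pi.add_apply, add_smul, Finset.sum_add_distrib]

lemma coord_smul {U : Y.Opens} (h : U ≤ V) (r : Γ(Y, U)) (x : Γ(M, U)) :
    he.coord h (r • x) = fun α => r * he.coord h x α := by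
  refine he.coord_eq h _ _ ?_
  conv_lhs => rw [he.eq_sum h x]
  simp only [mul_smul, Finset.smul_sum]

lemma coord_rst {U U' : Y.Opens} (h : U ≤ V) (h' : U' ≤ U) (x : Γ(M, U)) :
    he.coord (h'.trans h) (LongDiag.rst h' x) = fun α => rstO h' (he.coord h x α) := by
  refine he.coord_eq _ _ _ ?_
  conv_lhs => rw [he.eq_sum h x]
  simp only [rst_sum, rst_smul, rst_rst]

lemma coord_frame [DecidableEq κ] {U : Y.Opens} (h : U ≤ V) (α : κ) :
    he.coord h (LongDiag.rst h (e α)) = Pi.single α 1 := by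
  refine he.coord_eq _ _ _ ?_
  rw [Finset.sum_eq_single α]
  · simp
  · intro β _ hβ; simp [hβ]
  · simp

/-- The coordinate functionals at a point of a sheaf with a frame. -/
def pfun {y : Y} (hy : y ∈ V) {G : Type} [CommRing G] (ρ : Y.presheaf.stalk y →+* G) (α : κ) :
    PFun ρ (pre M) where
  toFun U h :=
    -- The functional has to be defined over every open set containing `y`, but the frame only
    -- exists over `V`; hence the passage to `unop U ⊓ V` before taking coordinates.
    { toFun := fun x => ρ (Y.presheaf.germ (unop U ⊓ V) y ⟨h, hy⟩
        (he.coord inf_le_right (LongDiag.rst (M := M) (U := unop U) inf_le_left x) α))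
      map_add' := fun x x' => by
        have e1 := rst_add (M := M) (inf_le_left : unop U ⊓ V ≤ _) x x'
        have e2 := congrFun (congrArg (he.coord inf_le_right) e1) α
        rw [coord_add] at e2
        refine (congrArg (fun z => ρ (Y.presheaf.germ (unop U ⊓ V) y ⟨h, hy⟩ z)) e2).trans ?_
        rw [Pi.add_apply, map_add, map_add]
      map_smul' := fun r x => by
        have e1 := rst_smul (M := M) (inf_le_left : unop U ⊓ V ≤ _) r x
        have e2 := congrFun (congrArg (he.coord inf_le_right) e1) α
        rw [coord_smul] at e2
        refine (congrArg (fun z => ρ (Y.presheaf.germ (unop U ⊓ V) y ⟨h, hy⟩ z)) e2).trans ?_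
        rw [map_mul, map_mul]
        exact congrArg (fun z => ρ z * _) (germ_rstO (U := unop U) inf_le_left ⟨h, hy⟩ r) }
  res {U U'} f h x := by
    have e1 : LongDiag.rst (M := M) (inf_le_left : unop U' ⊓ V ≤ _) ((pre M).restrictₛₗ f x) =
        LongDiag.rst (M := M) (inf_le_inf_right V f.unop.le)
          (LongDiag.rst (M := M) (inf_le_left : unop U ⊓ V ≤ _) x) :=
      (rst_rst (M := M) f.unop.le (inf_le_left : unop U' ⊓ V ≤ _) x).trans
        (rst_rst (M := M) (inf_le_left : unop U ⊓ V ≤ _) (inf_le_inf_right V f.unop.le) x).symm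
    have e2 := congrFun (congrArg (he.coord inf_le_right) e1) α
    rw [show he.coord (inf_le_right : unop U' ⊓ V ≤ _) (LongDiag.rst (M := M) _ _) = _ from
      he.coord_rst (inf_le_right : unop U ⊓ V ≤ _) (inf_le_inf_right V f.unop.le) _] at e2
    refine (congrArg (fun z => ρ (Y.presheaf.germ (unop U' ⊓ V) y ⟨h, hy⟩ z)) e2).trans ?_
    exact congrArg ρ (germ_rstO _ _ _)

lemma pfun_frame [DecidableEq κ] {y : Y} (hy : y ∈ V) {G : Type} [CommRing G]
    (ρ : Y.presheaf.stalk y →+* G) (α β : κ) {U : Y.Opens} (hU : U ≤ V) (h : y ∈ U) :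
    (he.pfun hy ρ α).ev h (LongDiag.rst hU (e β)) = if α = β then 1 else 0 := by
  change ρ (Y.presheaf.germ (U ⊓ V) y _ (he.coord inf_le_right
    (LongDiag.rst (M := M) inf_le_left (LongDiag.rst hU (e β))) α)) = _
  rw [rst_rst, coord_frame, Pi.single_apply]
  split_ifs <;> simp

end IsFrameOn

/-- Independence of sections which are separated by functionals. -/
lemma independent_of_pfun {κ : Type} [Fintype κ] [DecidableEq κ] {M : Y.Modules} {U : Y.Opens}
    (e : κ → Γ(M, U))
    (h : ∀ y (hy : y ∈ U) (α : κ), ∃ φ : PFun (RingHom.id (Y.presheaf.stalk y)) (pre M),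
      ∀ β, φ.ev hy (e β) = if α = β then 1 else 0)
    (c : κ → Γ(Y, U)) (hc : ∑ α, c α • e α = 0) : c = 0 := by
  funext α
  refine section_extO_germ fun y hy => ?_
  obtain ⟨φ, hφ⟩ := h y hy α
  have e1 := congrArg (φ.ev hy) hc
  rw [map_sum, map_zero] at e1
  simp only [PFun.ev_smul, hφ, mul_ite, mul_one, mul_zero, Finset.sum_ite_eq, Finset.mem_univ,
    if_true] at e1
  rw [show Y.presheaf.germ U y hy (c α) = 0 from e1, Pi.zero_apply, map_zero]

/-- Generation holds because sections of the pullback are locally combinations of pulled back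
sections, which are expanded in the frame. Independence is detected by the pullbacks of the
coordinate functionals. -/
lemma IsFrameOn.pull {Z : Scheme.{0}} (f : Y ⟶ Z) {E : Z.Modules} {κ : Type} [Fintype κ]
    {V : Z.Opens} {e : κ → Γ(E, V)} (he : IsFrameOn E e) {U : Y.Opens} (hU : U ≤ f ⁻¹ᵁ V) :
    IsFrameOn ((Scheme.Modules.pullback f).obj E) fun α => LongDiag.pull f E (e α) hU := by
  classical
  refine isFrameOn_of_local (fun U' hU' x p hp => ?_) (fun U' hU' c hc => ?_)
  · obtain ⟨W, hW, hpW, hx⟩ := exists_mem_pullSpan f x p hp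
    have hle : pullSpan f E W ≤ Submodule.span _ (Set.range fun α =>
        LongDiag.rst (hW.trans hU') (LongDiag.pull f E (e α) hU)) := by
      refine Submodule.span_le.2 ?_
      rintro _ ⟨V', h, e', rfl⟩
      have h' : W ≤ f ⁻¹ᵁ (V' ⊓ V) := le_inf h ((hW.trans hU').trans hU)
      have e1 := he.eq_sum inf_le_right (LongDiag.rst (inf_le_left : V' ⊓ V ≤ V') e')
      have e2 := congrArg (fun z => LongDiag.pull f E z h') e1
      simp only [pull_rst, pull_sum, pull_smul] at e2
      rw [SetLike.mem_coe, e2]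
      refine Submodule.sum_mem _ fun α _ => Submodule.smul_mem _ _ (Submodule.subset_span ⟨α, ?_⟩)
      exact rst_pull f _ _ _
    obtain ⟨c, hc⟩ := (Submodule.mem_span_range_iff_exists_fun _).1 (hle hx)
    exact ⟨W, hW, hW.trans hU', c, hpW, hc.symm⟩
  · refine independent_of_pfun _ (fun y hy α => ?_) c hc
    refine ⟨(he.pfun (y := f y) (hU (hU' hy)) ((RingHom.id _).comp (f.stalkMap y).hom) α).pullback,
      fun β => ?_⟩
    rw [rst_pull, PFun.ev_pullback_pull]
    have := he.pfun_frame (y := f y) (hU (hU' hy)) ((RingHom.id _).comp (f.stalkMap y).hom) α β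
      le_rfl (hU (hU' hy))
    rwa [rst_self] at this

end Frames

/-! ### Products of semilinear functionals on tensor and symmetric powers. -/

section ProductFunctionals

variable {R G : Type} [CommRing R] [CommRing G] {σ : R →+* G}

/-- The product map `⨂_G G → G`. -/
def mulAll (G : Type) [CommRing G] (ι : Type) [Fintype ι] : (⨂[G] _ : ι, G) →ₗ[G] G :=
  PiTensorProduct.lift (MultilinearMap.mkPiAlgebra G ι G)

lemma mulAll_tprod {ι : Type} [Fintype ι] (v : ι → G) :
    mulAll G ι (PiTensorProduct.tprod G v) = ∏ i, v i := by
  simp [mulAll]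

/-- The product of semilinear functionals. -/
def piFun {ι : Type} [Fintype ι] {M : ι → Type} [∀ t, AddCommGroup (M t)] [∀ t, Module R (M t)]
    (φ : ∀ t, M t →ₛₗ[σ] G) : (⨂[R] t, M t) →ₛₗ[σ] G where
  toFun x := mulAll G ι (piMap σ φ x)
  map_add' x y := by rw [map_add, map_add]
  map_smul' r x := by rw [piMap_smul, map_smul]

lemma piFun_tprod {ι : Type} [Fintype ι] {M : ι → Type} [∀ t, AddCommGroup (M t)]
    [∀ t, Module R (M t)] (φ : ∀ t, M t →ₛₗ[σ] G) (v : ∀ t, M t) :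
    piFun φ (PiTensorProduct.tprod R v) = ∏ t, φ t (v t) := by
  change mulAll G ι (piMap σ φ (PiTensorProduct.tprod R v)) = _
  rw [piMap_tprod, mulAll_tprod]

/-- The product map `Sym^m_G G → G`. -/
def symMulAll (G : Type) [CommRing G] (m : ℕ) : SymmetricPower G (Fin m) G →+ G :=
  AddCon.lift _ (mulAll G (Fin m)).toAddMonoidHom (by
    refine AddCon.addConGen_le.2 ?_
    rintro _ _ ⟨e, v⟩
    refine (AddCon.ker_rel _).2 ?_
    refine (mulAll_tprod v).trans (Eq.trans ?_ (mulAll_tprod fun i => v (e i)).symm)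
    exact (Equiv.prod_comp e v).symm)

lemma symMulAll_mk (m : ℕ) (x : ⨂[G] _ : Fin m, G) :
    symMulAll G m (SymmetricPower.mk G (Fin m) G x) = mulAll G (Fin m) x := rfl

variable {A B : Type} [AddCommGroup A] [Module R A] [AddCommGroup B] [Module R B]

/-- The product of a semilinear functional, on a symmetric power. -/
def symFun (m : ℕ) (φ : A →ₛₗ[σ] G) : SymmetricPower R (Fin m) A →ₛₗ[σ] G where
  toFun x := symMulAll G m (symMap m σ φ x)
  map_add' x y := by rw [map_add, map_add]
  map_smul' r x := by
    rw [symMap_smul]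
    obtain ⟨z, hz⟩ := mk_surjective m (symMap m σ φ x)
    rw [← hz, ← map_smul, symMulAll_mk, symMulAll_mk, map_smul]

lemma symFun_tprod (m : ℕ) (φ : A →ₛₗ[σ] G) (v : Fin m → A) :
    symFun m φ (SymmetricPower.tprod R v) = ∏ i, φ (v i) :=
  piFun_tprod (fun _ : Fin m => φ) v

/-- The product of two semilinear functionals. -/
def tenFun (φ : A →ₛₗ[σ] G) (ψ : B →ₛₗ[σ] G) : A ⊗[R] B →ₛₗ[σ] G :=
  letI : Module R G := Module.compHom G σ
  { toFun := fun x => (TensorProduct.lift (LinearMap.mk₂ R (fun a b => φ a * ψ b)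
      (fun _ _ _ => by rw [map_add, add_mul]) (fun r a b => by
        rw [map_smulₛₗ, smul_mul_assoc]; rfl) (fun _ _ _ => by rw [map_add, mul_add])
      (fun r a b => by rw [map_smulₛₗ, mul_smul_comm]; rfl)) : A ⊗[R] B →ₗ[R] G) x
    map_add' := fun x y => map_add _ x y
    map_smul' := fun r x => map_smul _ r x }

lemma tenFun_tmul (φ : A →ₛₗ[σ] G) (ψ : B →ₛₗ[σ] G) (a : A) (b : B) :
    tenFun φ ψ (a ⊗ₜ b) = φ a * ψ b := rfl

lemma tenFun_res {R' : Type} [CommRing R'] {τ : R →+* R'} {σ' : R' →+* G} {A' B' : Type}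
    [AddCommGroup A'] [Module R' A'] [AddCommGroup B'] [Module R' B']
    (φ : A →ₛₗ[σ] G) (ψ : B →ₛₗ[σ] G) (φ' : A' →ₛₗ[σ'] G) (ψ' : B' →ₛₗ[σ'] G)
    (a : A →ₛₗ[τ] A') (b : B →ₛₗ[τ] B') (c : A ⊗[R] B →ₛₗ[τ] A' ⊗[R'] B')
    (hc : ∀ x y, c (x ⊗ₜ y) = a x ⊗ₜ b y) (hφ : ∀ x, φ' (a x) = φ x) (hψ : ∀ x, ψ' (b x) = ψ x)
    (x : A ⊗[R] B) : tenFun φ' ψ' (c x) = tenFun φ ψ x := by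
  induction x using TensorProduct.induction_on with
  | zero => rw [map_zero, map_zero, map_zero]
  | add x y hx hy => rw [map_add, map_add, map_add, hx, hy]
  | tmul x y => rw [hc, tenFun_tmul, tenFun_tmul, hφ, hψ]

end ProductFunctionals

/-! ### Functionals at a point on tensor products, symmetric powers and direct images. -/

section PFunConstructions

variable {Y : Scheme.{0}} {y : Y} {G : Type} [CommRing G] {ρ : Y.presheaf.stalk y →+* G}

/-- The product of functionals, on a tensor product of presheaves. -/
def PFun.pi {ι : Type} [Fintype ι] {M : ι → PreMod Y} (φ : ∀ t, PFun ρ (M t)) :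
    PFun ρ (piTensor M) where
  toFun U h := piFun fun t => (φ t).toFun U h
  res {U V} f h x := by
    refine congrArg (mulAll G ι) ?_
    refine pi_ext (atStalk ρ U (f.unop.le h))
      ((piMap (atStalk ρ V h) fun t => (φ t).toFun V h).comp
        (piMap _ fun t => (M t).restrictₛₗ f))
      (piMap (atStalk ρ U (f.unop.le h)) fun t => (φ t).toFun U (f.unop.le h))
      (fun r x => ?_) (piMap_smul _ _) (fun v => ?_) x
    · rw [AddMonoidHom.comp_apply, piMap_smul, piMap_smul, AddMonoidHom.comp_apply]
      exact congrArg (· • _) (atStalk_map ρ f h r)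
    · rw [AddMonoidHom.comp_apply, piMap_tprod, piMap_tprod, piMap_tprod]
      exact congrArg _ (funext fun t => (φ t).res f h (v t))

lemma PFun.pi_pureTensor {ι : Type} [Fintype ι] {M : ι → PreMod Y} (φ : ∀ t, PFun ρ (M t))
    {U : Y.Opensᵒᵖ} (h : y ∈ unop U) (x : ∀ t, (M t).obj U) :
    (PFun.pi φ).toFun U h (pureTensor M x) = ∏ t, (φ t).toFun U h (x t) :=
  piFun_tprod (fun t => (φ t).toFun U h) x

/-- The product of a functional, on a symmetric power. -/
def PFun.sym (m : ℕ) {M : PreMod Y} (φ : PFun ρ M) : PFun ρ (symPow m M) where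
  toFun U h := symFun m (φ.toFun U h)
  res {U V} f h x := by
    obtain ⟨x, rfl⟩ := mk_surjective m x
    exact (PFun.pi fun _ : Fin m => φ).res f h x

lemma PFun.sym_symProd (m : ℕ) {M : PreMod Y} (φ : PFun ρ M) {U : Y.Opensᵒᵖ} (h : y ∈ unop U)
    (x : Fin m → M.obj U) : (φ.sym m).toFun U h (symProd M x) = ∏ i, φ.toFun U h (x i) :=
  symFun_tprod m (φ.toFun U h) x

/-- The product of two functionals, on the tensor product of two presheaves. -/
def PFun.tensor {P Q : PreMod Y} (φ : PFun ρ P) (ψ : PFun ρ Q) :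
    PFun ρ (tensorObj (C := PreMod Y) P Q) where
  toFun U h := tenFun (R := Γ(Y, unop U)) (A := P.obj U) (B := Q.obj U)
    (φ.toFun U h) (ψ.toFun U h)
  res {U V} f h x := tenFun_res (R := Γ(Y, unop U)) (R' := Γ(Y, unop V)) (A := P.obj U)
    (B := Q.obj U) (A' := P.obj V) (B' := Q.obj V)
    (φ.toFun U (f.unop.le h)) (ψ.toFun U (f.unop.le h)) (φ.toFun V h) (ψ.toFun V h)
    (P.restrictₛₗ f) (Q.restrictₛₗ f) ((tensorObj (C := PreMod Y) P Q).restrictₛₗ f)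
    (fun _ _ => rfl) (φ.res f h) (ψ.res f h) x

lemma PFun.tensor_tmul {P Q : PreMod Y} (φ : PFun ρ P) (ψ : PFun ρ Q) {U : Y.Opensᵒᵖ}
    (h : y ∈ unop U) (a : P.obj U) (b : Q.obj U) :
    (φ.tensor ψ).toFun U h (a ⊗ₜ[(OO Y).obj U] b) = φ.toFun U h a * ψ.toFun U h b := rfl

section

variable (s : Y ⟶ Spec (.of ℂ)) {M : PreMod Y} {V : Type} [AddCommGroup V] [Module ℂ V]
  {U : Y.Opensᵒᵖ} {σ : (OO Y).obj U →+* G}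

/-- The functional on `M(U) ⊗ V` given by a functional on `M(U)` and a linear form. -/
def scFunAdd (φ : M.obj U →ₛₗ[σ] G) (l : V →ₗ[ℂ] ℂ) : ScTensor s M V U →+ G :=
  letI : Module ℂ G := Module.compHom G (σ.comp (const s U))
  (TensorProduct.lift (LinearMap.mk₂ ℂ
      (fun (a : CMod s M U) (v : V) => σ (const s U (l v)) * φ a)
      (fun a b v => by
        rw [← mul_add]; exact congrArg _ (map_add φ a b))
      (fun z a v => by
        refine (congrArg (_ * ·) (φ.map_smulₛₗ (const s U z) a)).trans ?_
        exact mul_left_comm _ _ _)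
      (fun a v w => by rw [map_add, map_add, map_add, add_mul])
      (fun z a v => by
        rw [map_smul, smul_eq_mul, map_mul, map_mul, mul_assoc]; rfl)) :
    ScTensor s M V U →ₗ[ℂ] G).toAddMonoidHom

lemma scFunAdd_scTmul (φ : M.obj U →ₛₗ[σ] G) (l : V →ₗ[ℂ] ℂ) (x : M.obj U) (v : V) :
    scFunAdd s φ l (scTmul s x v) = σ (const s U (l v)) * φ x := rfl

lemma scFunAdd_smul (φ : M.obj U →ₛₗ[σ] G) (l : V →ₗ[ℂ] ℂ) (r : (OO Y).obj U)
    (x : ScTensor s M V U) : scFunAdd s φ l (r • x) = σ r * scFunAdd s φ l x := by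
  induction x using ScTensor.induction with
  | h x v =>
    rw [smul_scTmul, scFunAdd_scTmul, scFunAdd_scTmul, map_smulₛₗ, smul_eq_mul]
    exact mul_left_comm _ _ _
  | h' x y hx hy => rw [smul_add, map_add, map_add, hx, hy, mul_add]

lemma scFunAdd_map {U' : Y.Opensᵒᵖ} {σ' : (OO Y).obj U' →+* G} (φ : M.obj U →ₛₗ[σ] G)
    (φ' : M.obj U' →ₛₗ[σ'] G) (l : V →ₗ[ℂ] ℂ) (f : U ⟶ U')
    (hσ : ∀ r, σ' (((OO Y).map f).hom r) = σ r) (hφ : ∀ x, φ' (M.restrictₛₗ f x) = φ x)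
    (x : ScTensor s M V U) :
    scFunAdd s φ' l (ScTensor.map s f LinearMap.id x) = scFunAdd s φ l x := by
  induction x using ScTensor.induction with
  | h x v =>
    rw [ScTensor.map_tmul, scFunAdd_scTmul, scFunAdd_scTmul, hφ, ← hσ, map_const]
    rfl
  | h' x y hx hy => rw [map_add, map_add, map_add, hx, hy]

end

/-- The functional on the tensor product with a complex vector space given by a linear form. -/
def PFun.scal {M : PreMod Y} (s : Y ⟶ Spec (.of ℂ)) (φ : PFun ρ M) {V : Type} [AddCommGroup V]
    [Module ℂ V] (l : V →ₗ[ℂ] ℂ) : PFun ρ (scPre s M V) where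
  toFun U h :=
    { toFun := fun x => scFunAdd s (φ.toFun U h) l x
      map_add' := fun x y => map_add (scFunAdd s (φ.toFun U h) l) x y
      map_smul' := fun r x => scFunAdd_smul s (φ.toFun U h) l r x }
  res {U V} f h x := scFunAdd_map s (φ.toFun U (f.unop.le h)) (φ.toFun V h) l f
    (atStalk_map ρ f h) (φ.res f h) x

lemma PFun.scal_scTmul {M : PreMod Y} (s : Y ⟶ Spec (.of ℂ)) (φ : PFun ρ M) {V : Type}
    [AddCommGroup V] [Module ℂ V] (l : V →ₗ[ℂ] ℂ) {U : Y.Opensᵒᵖ} (h : y ∈ unop U) (x : M.obj U)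
    (v : V) : (φ.scal s l).toFun U h (scTmul s x v) =
      atStalk ρ U h (const s U (l v)) * φ.toFun U h x := rfl

/-- A functional at `y` as a functional at `f y` on the direct image. -/
def PFun.push {Z : Scheme.{0}} (f : Y ⟶ Z) {M : Y.Modules} (φ : PFun ρ (pre M)) :
    PFun (ρ.comp (f.stalkMap y).hom) (pre ((Scheme.Modules.pushforward f).obj M)) where
  toFun U h :=
    { toFun := fun x => φ.toFun (op (f ⁻¹ᵁ unop U)) h x
      map_add' := fun x x' => map_add (φ.toFun (op (f ⁻¹ᵁ unop U)) h) x x'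
      map_smul' := fun r x => by
        refine ((φ.toFun (op (f ⁻¹ᵁ unop U)) h).map_smulₛₗ ((f.app (unop U)).hom r) x).trans ?_
        refine congrArg (· * _) (congrArg ρ ?_)
        exact (Scheme.Hom.germ_stalkMap_apply f (unop U) y h r).symm }
  res {U V} i h x := φ.res ((TopologicalSpace.Opens.map f.base).map i.unop).op h x

end PFunConstructions
-- Frames of tensor products of sheaves.
section TensorFrames

variable {Y : Scheme.{0}}

lemma pureTensor_restrict {ι : Type} (M : ι → PreMod Y) {U V : Y.Opensᵒᵖ} (f : U ⟶ V)
    (x : ∀ t, (M t).obj U) : (piTensor M).restrictₛₗ f (pureTensor M x) =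
      pureTensor M fun t => (M t).restrictₛₗ f (x t) :=
  piMap_tprod _ (fun t => (M t).restrictₛₗ f) x

variable {ι : Type} {M : ι → Y.Modules}

lemma rst_toShf_pureTensor {U V : Y.Opens} (h : V ≤ U) (x : ∀ t, Γ(M t, U)) :
    rst h (toShf (piTensor fun t => pre (M t)) (pureTensor (U := op U) (fun t => pre (M t)) x)) =
      toShf (piTensor fun t => pre (M t))
        (pureTensor (U := op V) (fun t => pre (M t)) fun t => rst h (x t)) :=
  (toShf_rst _ h _).trans (congrArg (toShf _) (pureTensor_restrict (fun t => pre (M t))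
    (homOfLE h).op x))

lemma tprod_mem_span {ι : Type} [Fintype ι] [DecidableEq ι] {R : Type} [CommRing R] {A : ι → Type} [∀ t, AddCommGroup (A t)]
    [∀ t, Module R (A t)] {κ : ι → Type} [∀ t, Fintype (κ t)] (e : ∀ t, κ t → A t)
    (he : ∀ t, ∀ x : A t, ∃ c : κ t → R, x = ∑ α, c α • e t α) (x : ⨂[R] t, A t) :
    ∃ c : (∀ t, κ t) → R, x = ∑ α, c α • PiTensorProduct.tprod R fun t => e t (α t) := by
  suffices h : x ∈ Submodule.span R (Set.range fun α : (∀ t, κ t) =>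
      PiTensorProduct.tprod R fun t => e t (α t)) by
    obtain ⟨c, hc⟩ := (Submodule.mem_span_range_iff_exists_fun _).1 h
    exact ⟨c, hc.symm⟩
  induction x using PiTensorProduct.induction_on with
  | smul_tprod r v =>
    refine Submodule.smul_mem _ _ ?_
    choose c hc using fun t => he t (v t)
    have : v = fun t => ∑ α, c t α • e t α := funext hc
    rw [this, MultilinearMap.map_sum]
    refine Submodule.sum_mem _ fun α _ => ?_
    rw [MultilinearMap.map_smul_univ]
    exact Submodule.smul_mem _ _ (Submodule.subset_span ⟨α, rfl⟩)
  | add x y hx hy => exact Submodule.add_mem _ hx hy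

/-- Sections of the associated sheaf come locally from the presheaf, where multilinearity gives
generation. The products of the coordinate functionals of the factors separate the pure tensors. -/
lemma isFrameOn_pureTensor [Fintype ι] [DecidableEq ι] {κ : ι → Type} [∀ t, Fintype (κ t)] {W : Y.Opens}
    (e : ∀ t, κ t → Γ(M t, W)) (he : ∀ t, IsFrameOn (M t) (e t)) :
    IsFrameOn (shf (piTensor fun t => pre (M t))) fun α : (∀ t, κ t) =>
      toShf (piTensor fun t => pre (M t))
        (pureTensor (U := op W) (fun t => pre (M t)) fun t => e t (α t)) := by
  classical
  refine isFrameOn_of_local (fun U hU x p hp => ?_) (fun U hU c hc => ?_)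
  · obtain ⟨V, hV, x', hpV, hx⟩ := toShf_locally_surjective _ x p hp
    obtain ⟨c, hc⟩ := tprod_mem_span (R := Γ(Y, V)) (A := fun t => Γ(M t, V))
      (fun t α => rst (hV.trans hU) (e t α)) (fun t x => (he t V (hV.trans hU) x).exists) x'
    refine ⟨V, hV, hV.trans hU, c, hpV, hx.trans ?_⟩
    refine (congrArg (toShf _) hc).trans ((toShf_sum _ _ _).trans ?_)
    refine Finset.sum_congr rfl fun α _ => ?_
    rw [rst_toShf_pureTensor]
    exact toShf_smul (piTensor fun t => pre (M t)) (c α) _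
  · refine independent_of_pfun _ (fun y hy α => ?_) c hc
    refine ⟨(PFun.pi fun t => (he t).pfun (hU hy) (RingHom.id _) (α t)).shf, fun β => ?_⟩
    rw [rst_toShf_pureTensor, PFun.ev_shf_toShf]
    refine (PFun.pi_pureTensor (M := fun t => pre (M t)) _ _ _).trans ?_
    have := fun t => (he t).pfun_frame (hU hy) (RingHom.id _) (α t) (β t) hU hy
    refine (Finset.prod_congr rfl fun t _ => this t).trans ?_
    rw [Finset.prod_ite_zero, Finset.prod_const_one]
    simp only [Finset.mem_univ, true_implies, funext_iff]

end TensorFrames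

/-! ### The exterior algebra of `ℂ^k`: monomial basis, projections to coordinates, contraction. -/

section ExteriorModel

variable {k : ℕ}

/-- The exterior algebra of `ℂ^k`. -/
abbrev Ext (k : ℕ) : Type := ExteriorAlgebra ℂ (Fin k → ℂ)

/-- The basis vectors, in the exterior algebra. -/
def eV (t : Fin k) : Ext k := ExteriorAlgebra.ι ℂ (Pi.single t 1)

lemma eV_mul_self (t : Fin k) : eV t * eV t = 0 := ExteriorAlgebra.ι_sq_zero _

/-- The basis vectors of the exterior algebra. -/
def eM (M : Finset (Fin k)) : Ext k := ((M.sort (· ≤ ·)).map eV).prod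

lemma eM_empty : eM (∅ : Finset (Fin k)) = 1 := by simp [eM]

lemma eM_insert {a : Fin k} {M : Finset (Fin k)} (h : ∀ b ∈ M, a < b) :
    eM (insert a M) = eV a * eM M := by
  rw [eM, Finset.sort_insert _ (fun b hb => (h b hb).le) fun ha => lt_irrefl _ (h a ha)]
  simp [eM]

/-- Identifies the standard basis of the exterior power with the ordered monomials. This is the
source of both the expansion `exists_sum_eM` and the independence `sum_eM_eq_zero`. -/
lemma coe_basis_exteriorPower (p : ℕ) (A : Set.powersetCard (Fin k) p) :
    ((Pi.basisFun ℂ (Fin k)).exteriorPower p A : Ext k) = eM A.1 := by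
  rw [exteriorPower.basis_apply, exteriorPower.ιMulti_family_apply_coe,
    ExteriorAlgebra.ιMulti_family, ExteriorAlgebra.ιMulti_apply, eM]
  congr 1
  rw [← Finset.listMap_orderEmbOfFin_finRange A.1 A.2, List.map_map, ← List.ofFn_eq_map]
  congr 1
  funext i
  simp [eV, Set.powersetCard.ofFinEmbEquiv_symm_apply]

lemma exists_sum_eM {p : ℕ} {x : Ext k} (hx : x ∈ ⋀[ℂ]^p (Fin k → ℂ)) :
    ∃ c : Set.powersetCard (Fin k) p → ℂ, x = ∑ A, c A • eM A.1 := by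
  refine ⟨((Pi.basisFun ℂ (Fin k)).exteriorPower p).repr ⟨x, hx⟩, ?_⟩
  have := congrArg Subtype.val (((Pi.basisFun ℂ (Fin k)).exteriorPower p).sum_repr ⟨x, hx⟩)
  refine this.symm.trans ?_
  rw [AddSubmonoidClass.coe_finsetSum]
  simp only [Submodule.coe_smul, coe_basis_exteriorPower]

lemma sum_eM_eq_zero {p : ℕ} {c : Set.powersetCard (Fin k) p → ℂ} (h : ∑ A, c A • eM A.1 = 0) :
    c = 0 := by
  have := Fintype.linearIndependent_iff.1 ((Pi.basisFun ℂ (Fin k)).exteriorPower p).linearIndependent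
    c (Subtype.ext (by
      rw [AddSubmonoidClass.coe_finsetSum]
      simp only [Submodule.coe_smul, coe_basis_exteriorPower]
      exact h))
  exact funext this

lemma eM_ne_zero (M : Finset (Fin k)) : eM M ≠ 0 := by
  classical
  intro h
  have := sum_eM_eq_zero (p := M.card) (c := Pi.single ⟨M, rfl⟩ 1) (by
    rw [Finset.sum_eq_single ⟨M, rfl⟩] <;> simp +contextual [h])
  simpa using congrFun this ⟨M, rfl⟩

lemma eM_mem (M : Finset (Fin k)) : eM M ∈ ⋀[ℂ]^M.card (Fin k → ℂ) := by
  rw [← coe_basis_exteriorPower M.card ⟨M, rfl⟩]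
  exact Subtype.prop _

/-- The projection of `ℂ^k` to the vectors supported in `M`. -/
def projM (M : Finset (Fin k)) : (Fin k → ℂ) →ₗ[ℂ] (Fin k → ℂ) :=
  LinearMap.pi fun t => if t ∈ M then LinearMap.proj t else 0

lemma projM_apply (M : Finset (Fin k)) (v : Fin k → ℂ) (t : Fin k) :
    projM M v t = if t ∈ M then v t else 0 := by
  rw [projM, LinearMap.pi_apply]; split_ifs <;> rfl

/-- The projection of the exterior algebra to the elements supported in `M`. -/
def pm (M : Finset (Fin k)) : Ext k →ₐ[ℂ] Ext k := ExteriorAlgebra.map (projM M)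

lemma pm_pm (M N : Finset (Fin k)) (x : Ext k) : pm M (pm N x) = pm (M ∩ N) x := by
  rw [pm, pm, pm, ← AlgHom.comp_apply, ExteriorAlgebra.map_comp_map]
  congr 2
  ext v t
  simp [projM_apply, ← ite_and]

lemma pm_eV (M : Finset (Fin k)) (t : Fin k) : pm M (eV t) = if t ∈ M then eV t else 0 := by
  rw [pm, eV, ExteriorAlgebra.map_apply_ι]
  split_ifs with h
  · congr 1
    ext u
    rw [projM_apply]
    rcases eq_or_ne u t with rfl | hu
    · simp [h]
    · simp [hu]
  · rw [← map_zero (ExteriorAlgebra.ι ℂ)]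
    congr 1
    ext u
    rw [projM_apply]
    rcases eq_or_ne u t with rfl | hu
    · simp [h]
    · simp [hu]

lemma pm_eM (M A : Finset (Fin k)) : pm M (eM A) = if A ⊆ M then eM A else 0 := by
  induction A using Finset.induction_on_min with
  | empty => simp [eM_empty]
  | insert a A h ih =>
    rw [eM_insert h, map_mul, ih, pm_eV]
    simp only [Finset.insert_subset_iff]
    split_ifs <;> simp_all

lemma pm_mem (M : Finset (Fin k)) {p : ℕ} {x : Ext k} (hx : x ∈ ⋀[ℂ]^p (Fin k → ℂ)) :
    pm M x ∈ ⋀[ℂ]^p (Fin k → ℂ) := by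
  obtain ⟨c, rfl⟩ := exists_sum_eM hx
  rw [map_sum]
  refine Submodule.sum_mem _ fun A _ => ?_
  rw [map_smul, pm_eM]
  refine Submodule.smul_mem _ _ ?_
  split_ifs
  · convert eM_mem A.1; exact A.2.symm
  · exact Submodule.zero_mem _

/-- A monomial `e_A` of degree `p < |M|` misses some `t ∈ M`, hence survives the projection that
kills `e_t`. Its coefficient therefore vanishes. -/
lemma eq_zero_of_pm_compl {p : ℕ} {x : Ext k} (hx : x ∈ ⋀[ℂ]^p (Fin k → ℂ)) (M : Finset (Fin k))
    (hM : p < M.card) (h : ∀ t ∈ M, pm {t}ᶜ x = 0) : x = 0 := by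
  classical
  obtain ⟨c, rfl⟩ := exists_sum_eM hx
  refine Finset.sum_eq_zero fun A _ => ?_
  obtain ⟨t, ht, htA⟩ : ∃ t ∈ M, t ∉ A.1 := by
    by_contra! hA
    exact absurd (Finset.card_le_card hA) (by rw [A.2]; omega)
  have h1 := h t ht
  simp only [map_sum, map_smul, pm_eM] at h1
  have := congrFun (sum_eM_eq_zero (c := fun A => if A.1 ⊆ {t}ᶜ then c A else 0) (by
    rw [← h1]
    refine Finset.sum_congr rfl fun B _ => ?_
    split_ifs <;> simp)) A
  rw [Pi.zero_apply, if_pos (show A.1 ⊆ {t}ᶜ from fun u hu => by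
    rw [Finset.mem_compl, Finset.mem_singleton]; rintro rfl; exact htA hu)] at this
  rw [this, zero_smul]

/-- There are no monomials of degree `p` in fewer than `p` variables. -/
lemma eq_zero_of_card_lt {p : ℕ} {x : Ext k} (hx : x ∈ ⋀[ℂ]^p (Fin k → ℂ)) (M : Finset (Fin k))
    (hM : M.card < p) (h : pm M x = x) : x = 0 := by
  obtain ⟨c, rfl⟩ := exists_sum_eM hx
  rw [← h, map_sum]
  refine Finset.sum_eq_zero fun A _ => ?_
  rw [map_smul, pm_eM, if_neg, smul_zero]
  intro hA
  exact absurd (Finset.card_le_card hA) (by rw [A.2]; omega)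

/-- The sum of the coordinates. -/
def sumForm (k : ℕ) : Module.Dual ℂ (Fin k → ℂ) := ∑ t, LinearMap.proj t

lemma sumForm_apply (v : Fin k → ℂ) : sumForm k v = ∑ t, v t := by simp [sumForm]

/-- The contraction with the sum of the coordinates. -/
def ctr : Ext k →ₗ[ℂ] Ext k := CliffordAlgebra.contractLeft (Q := 0) (sumForm k)

lemma ctr_ι_mul (v : Fin k → ℂ) (x : Ext k) : ctr (ExteriorAlgebra.ι ℂ v * x) =
    sumForm k v • x - ExteriorAlgebra.ι ℂ v * ctr x := CliffordAlgebra.contractLeft_ι_mul (Q := 0) (d := sumForm k) v x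

lemma ctr_eV_mul (t : Fin k) (x : Ext k) : ctr (eV t * x) = x - eV t * ctr x := by
  rw [eV, ctr_ι_mul, sumForm_apply]; simp

lemma ctr_algebraMap (z : ℂ) : ctr (algebraMap ℂ (Ext k) z) = 0 :=
  CliffordAlgebra.contractLeft_algebraMap (Q := 0) (d := sumForm k) z

lemma ctr_one : ctr (1 : Ext k) = 0 := CliffordAlgebra.contractLeft_one (Q := 0) (d := sumForm k)

lemma ctr_ctr (x : Ext k) : ctr (ctr x) = 0 := CliffordAlgebra.contractLeft_contractLeft _ _

/-- The signs of the contraction are exactly the signs `ε_{t,M}` of the differential of the cube;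
the identity `dW_omegaW` rests on this. -/
lemma ctr_eM (M : Finset (Fin k)) : ctr (eM M) = ∑ t ∈ M, signIn t M • eM (M.erase t) := by
  induction M using Finset.induction_on_min with
  | empty => simp [eM_empty, ctr_one]
  | insert a M h ih =>
    have ha : a ∉ M := fun h' => lt_irrefl _ (h a h')
    rw [eM_insert h, ctr_eV_mul, ih, Finset.sum_insert ha, Finset.erase_insert ha]
    have h0 : signIn a (insert a M) = 1 := by
      rw [signIn, Finset.filter_false_of_mem, Finset.card_empty, pow_zero]
      intro b hb
      rcases Finset.mem_insert.1 hb with rfl | hb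
      · exact lt_irrefl _
      · exact (h b hb).not_gt
    rw [h0, one_smul, sub_eq_add_neg, Finset.mul_sum, ← Finset.sum_neg_distrib]
    congr 1
    refine Finset.sum_congr rfl fun t ht => ?_
    have h1 : signIn t (insert a M) = - signIn t M := by
      rw [signIn, Finset.filter_insert, if_pos (h t ht), Finset.card_insert_of_notMem (by simp [ha]),
        pow_succ, signIn]
      ring
    have hat : a ≠ t := (h t ht).ne
    rw [h1, neg_smul, Finset.erase_insert_of_ne hat,
      eM_insert fun b hb => h b (Finset.mem_of_mem_erase hb), mul_smul_comm]

lemma ctr_mem {p : ℕ} {x : Ext k} (hx : x ∈ ⋀[ℂ]^(p + 1) (Fin k → ℂ)) :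
    ctr x ∈ ⋀[ℂ]^p (Fin k → ℂ) := by
  obtain ⟨c, rfl⟩ := exists_sum_eM hx
  rw [map_sum]
  refine Submodule.sum_mem _ fun A _ => ?_
  rw [map_smul, ctr_eM]
  refine Submodule.smul_mem _ _ (Submodule.sum_mem _ fun t ht => Submodule.smul_mem _ _ ?_)
  convert eM_mem (A.1.erase t)
  have : A.1.card = p + 1 := A.2
  rw [Finset.card_erase_of_mem ht, this]; rfl

lemma ctr_eq_zero {x : Ext k} (hx : x ∈ ⋀[ℂ]^0 (Fin k → ℂ)) : ctr x = 0 := by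
  obtain ⟨z, rfl⟩ : ∃ z, algebraMap ℂ (Ext k) z = x := by simpa [Submodule.mem_one] using hx
  exact ctr_algebraMap z

lemma eV_mul_mem (t : Fin k) {p : ℕ} {x : Ext k} (hx : x ∈ ⋀[ℂ]^p (Fin k → ℂ)) :
    eV t * x ∈ ⋀[ℂ]^(p + 1) (Fin k → ℂ) := by
  rw [ExteriorAlgebra.exteriorPower, pow_succ']
  exact Submodule.mul_mem_mul ⟨_, rfl⟩ hx

/-- The projection intertwines the contraction with the sum of the coordinates and the contraction
with the sum of the coordinates in `M`. So the contraction of an element supported in `M` lies in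
the image of the projection. -/
lemma pm_ctr (M : Finset (Fin k)) {x : Ext k} (hx : pm M x = x) : pm M (ctr x) = ctr x := by
  have key : ∀ y : Ext k, ctr (pm M y) =
      pm M (CliffordAlgebra.contractLeft (Q := 0) ((sumForm k).comp (projM M)) y) := by
    intro y
    induction y using CliffordAlgebra.left_induction with
    | algebraMap r =>
      rw [AlgHom.commutes, ctr_algebraMap, CliffordAlgebra.contractLeft_algebraMap, map_zero]
    | add x y hx hy => simp only [map_add, hx, hy]
    | ι_mul x v hx =>
      have h1 : pm M (CliffordAlgebra.ι 0 v * x) = ExteriorAlgebra.ι ℂ (projM M v) * pm M x := by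
        rw [map_mul]
        exact congrArg (· * _) (ExteriorAlgebra.map_apply_ι _ _)
      rw [CliffordAlgebra.contractLeft_ι_mul, h1, ctr_ι_mul, hx, map_sub, map_mul, map_smul]
      exact congrArg (fun z => _ - z * _) (ExteriorAlgebra.map_apply_ι _ _).symm
  rw [← hx, key, pm_pm, Finset.inter_self]

end ExteriorModel

/-! ### The signs `ε_{t,M}`. -/

section Signs

variable {k : ℕ}

lemma signIn_eq_prod (t : Fin k) (M : Finset (Fin k)) :
    signIn t M = ∏ u ∈ M, if u < t then (-1 : ℂ) else 1 := by
  rw [signIn, Finset.prod_ite, Finset.prod_const, Finset.prod_const_one, mul_one]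

lemma signIn_mul_self (t : Fin k) (M : Finset (Fin k)) : signIn t M * signIn t M = 1 := by
  rw [signIn, ← mul_pow]; simp

lemma signIn_insert_self (t : Fin k) (M : Finset (Fin k)) :
    signIn t (insert t M) = signIn t M := by
  by_cases h : t ∈ M
  · rw [Finset.insert_eq_of_mem h]
  · rw [signIn_eq_prod, signIn_eq_prod, Finset.prod_insert h, if_neg (lt_irrefl _), one_mul]

lemma signIn_erase_self (t : Fin k) (M : Finset (Fin k)) :
    signIn t (M.erase t) = signIn t M := by
  rw [← signIn_insert_self t (M.erase t), ← signIn_insert_self t M]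
  congr 1
  ext u
  by_cases h : u = t <;> simp [h]

lemma signIn_insert {t u : Fin k} {M : Finset (Fin k)} (h : u ∉ M) :
    signIn t (insert u M) = (if u < t then (-1 : ℂ) else 1) * signIn t M := by
  rw [signIn_eq_prod, signIn_eq_prod, Finset.prod_insert h]

/-- Removing two elements in the two possible orders changes exactly one of the two signs, namely
that of the larger element. This is what makes the differential square to zero. -/
lemma signIn_mul_erase {t u : Fin k} {M : Finset (Fin k)} (ht : t ∈ M) (hu : u ∈ M) (h : t ≠ u) :
    signIn t M * signIn u (M.erase t) = - (signIn u M * signIn t (M.erase u)) := by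
  have e1 : signIn t M = (if u < t then (-1 : ℂ) else 1) * signIn t (M.erase u) := by
    rw [← signIn_insert (Finset.notMem_erase u M), Finset.insert_erase hu]
  have e2 : signIn u M = (if t < u then (-1 : ℂ) else 1) * signIn u (M.erase t) := by
    rw [← signIn_insert (Finset.notMem_erase t M), Finset.insert_erase ht]
  rw [e1, e2]
  rcases lt_or_gt_of_ne h with h | h
  · rw [if_pos h, if_neg h.not_gt]; ring
  · rw [if_pos h, if_neg h.not_gt]; ring

end Signs

/-! ### The cube complex: faces as words, differential, homotopies, exactness. -/

section Words

variable {k : ℕ}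

/-- Words with letters `0`, `1` and `*`, indexing the faces of a cube. -/
abbrev Word (k : ℕ) : Type := Fin k → Option (Fin 2)

/-- The positions of the stars of a word. -/
def st (w : Word k) : Finset (Fin k) := Finset.univ.filter fun t => w t = none

lemma mem_st {w : Word k} {t : Fin k} : t ∈ st w ↔ w t = none := by simp [st]

lemma st_update_some (w : Word k) (t : Fin k) (i : Fin 2) :
    st (Function.update w t (some i)) = (st w).erase t := by
  ext u
  by_cases h : u = t
  · subst h; simp [mem_st]
  · simp [mem_st, h]

lemma st_update_none (w : Word k) (t : Fin k) :
    st (Function.update w t none) = insert t (st w) := by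
  ext u
  by_cases h : u = t
  · subst h; simp [mem_st]
  · simp [mem_st, h]

/-- The words with letter `0` outside `S`. -/
def Normal (S : Finset (Fin k)) (w : Word k) : Prop := ∀ t, t ∉ S → w t = some 0

lemma Normal.update {S : Finset (Fin k)} {w : Word k} {t : Fin k} (ht : t ∈ S) {i : Option (Fin 2)} :
    Normal S (Function.update w t i) ↔ Normal S w := by
  refine forall₂_congr fun u hu => ?_
  rw [Function.update_of_ne]
  rintro rfl; exact hu ht

lemma Normal.st_subset {S : Finset (Fin k)} {w : Word k} (h : Normal S w) : st w ⊆ S := by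
  intro t ht
  by_contra hS
  have := h t hS
  rw [mem_st.1 ht] at this
  simp at this

/-- The elements of degree `p`, supported on the words with `r` stars, of the double complex. -/
structure Cube (S : Finset (Fin k)) (p r : ℕ) (z : Word k → Ext k) : Prop where
  mem (w : Word k) : z w ∈ ⋀[ℂ]^p (Fin k → ℂ)
  supp (w : Word k) : pm (st w) (z w) = z w
  normal (w : Word k) : z w ≠ 0 → Normal S w ∧ (st w).card = r

variable {S : Finset (Fin k)} {p r : ℕ} {z z' : Word k → Ext k}

lemma Cube.sub (h : Cube S p r z) (h' : Cube S p r z') : Cube S p r (z - z') where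
  mem w := Submodule.sub_mem _ (h.mem w) (h'.mem w)
  supp w := by rw [Pi.sub_apply, map_sub, h.supp, h'.supp]
  normal w hw := by
    by_cases h1 : z w = 0
    · refine h'.normal w fun h2 => hw ?_
      rw [Pi.sub_apply, h1, h2, sub_zero]
    · exact h.normal w h1

lemma Cube.zero : Cube S p r 0 where
  mem w := Submodule.zero_mem _
  supp w := map_zero _
  normal w hw := (hw rfl).elim

lemma Cube.neg (h : Cube S p r z) : Cube S p r (-z) := by
  simpa using Cube.zero.sub h

lemma Cube.add (h : Cube S p r z) (h' : Cube S p r z') : Cube S p r (z + z') := by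
  simpa using h.sub h'.neg

/-- The differential of the cube. -/
def dW (S : Finset (Fin k)) (z : Word k → Ext k) (w : Word k) : Ext k :=
  ∑ t ∈ (st w).filter (· ∈ S), signIn t (st w) •
    (z (Function.update w t (some 0)) - z (Function.update w t (some 1)))

lemma dW_sub (z z' : Word k → Ext k) : dW S (z - z') = dW S z - dW S z' := by
  funext w
  simp only [dW, Pi.sub_apply, ← Finset.sum_sub_distrib, ← smul_sub]
  refine Finset.sum_congr rfl fun t _ => congrArg _ ?_
  abel

lemma dW_add (z z' : Word k → Ext k) : dW S (z + z') = dW S z + dW S z' := by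
  funext w
  simp only [dW, Pi.add_apply, ← Finset.sum_add_distrib, ← smul_add]
  refine Finset.sum_congr rfl fun t _ => congrArg _ ?_
  abel

lemma dW_ctr (z : Word k → Ext k) : dW S (fun w => ctr (z w)) = fun w => ctr (dW S z w) := by
  funext w
  simp only [dW, map_sum, map_smul, map_sub]

/-- The second differences in the directions `t` and `u` are symmetric, while the product of the
signs is antisymmetric by `signIn_mul_erase`. -/
lemma dW_dW (z : Word k → Ext k) : dW S (dW S z) = 0 := by
  funext w
  let y : Fin k → Fin k → Ext k := fun t u =>
    (z (Function.update (Function.update w t (some 0)) u (some 0)) -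
      z (Function.update (Function.update w t (some 0)) u (some 1))) -
    (z (Function.update (Function.update w t (some 1)) u (some 0)) -
      z (Function.update (Function.update w t (some 1)) u (some 1)))
  let A := (st w).filter (· ∈ S)
  let F : Fin k → Fin k → Ext k := fun t u =>
    if t = u then 0 else (signIn t (st w) * signIn u ((st w).erase t)) • y t u
  have e : dW S (dW S z) w = ∑ t ∈ A, ∑ u ∈ A, F t u := by
    refine Finset.sum_congr rfl fun t ht => ?_
    have hA : ∀ i, ((st (Function.update w t (some i))).filter (· ∈ S)) = A.erase t := by
      intro i
      rw [st_update_some]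
      ext u; simp [A]; tauto
    rw [dW, dW, hA, hA, st_update_some, st_update_some, ← Finset.sum_sub_distrib, Finset.smul_sum,
      ← Finset.add_sum_erase A _ ht]
    rw [show F t t = 0 from if_pos rfl, zero_add]
    refine Finset.sum_congr rfl fun u hu => ?_
    rw [show F t u = _ from if_neg (Finset.ne_of_mem_erase hu).symm, ← smul_sub, smul_smul]
  have hF : ∀ t ∈ A, ∀ u ∈ A, F t u = - F u t := by
    intro t ht u hu
    by_cases h : t = u
    · subst h; simp [F]
    · have hy : y u t = y t u := by
        have hc : ∀ i j, Function.update (Function.update w u (some i)) t (some j) =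
            Function.update (Function.update w t (some j)) u (some i) :=
          fun i j => Function.update_comm (Ne.symm h) _ _ _
        simp only [y, hc]
        abel
      simp only [F, if_neg h, if_neg (Ne.symm h), hy]
      rw [signIn_mul_erase (Finset.mem_filter.1 ht).1 (Finset.mem_filter.1 hu).1 h, neg_smul]
  have e2 : (∑ t ∈ A, ∑ u ∈ A, F t u) = - ∑ t ∈ A, ∑ u ∈ A, F t u := by
    conv_lhs => rw [Finset.sum_comm]
    rw [← Finset.sum_neg_distrib]
    refine Finset.sum_congr rfl fun t ht => ?_
    rw [← Finset.sum_neg_distrib]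
    exact Finset.sum_congr rfl fun u hu => hF u hu t ht
  rw [e]
  -- The double sum equals its own negative; the diagonal terms were set to zero in `F`. Dividing by
  -- `2` finishes the argument.
  have e3 : (2 : ℂ) • (∑ t ∈ A, ∑ u ∈ A, F t u) = 0 := by
    rw [two_smul]
    nth_rw 1 [e2]
    exact neg_add_cancel _
  exact (smul_eq_zero.1 e3).resolve_left two_ne_zero

lemma Cube.dW (h : Cube S p r z) : Cube S p (r + 1) (dW S z) where
  mem w := Submodule.sum_mem _ fun t _ => Submodule.smul_mem _ _
    (Submodule.sub_mem _ (h.mem _) (h.mem _))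
  supp w := by
    rw [LongDiag.dW, map_sum]
    refine Finset.sum_congr rfl fun t _ => ?_
    have key : ∀ i, pm (st w) (z (Function.update w t (some i))) =
        z (Function.update w t (some i)) := by
      intro i
      rw [← h.supp, st_update_some, pm_pm, Finset.inter_eq_right.2 (Finset.erase_subset _ _)]
    rw [map_smul, map_sub, key, key]
  normal w hw := by
    obtain ⟨t, ht, h0⟩ := Finset.exists_ne_zero_of_sum_ne_zero hw
    obtain ⟨ht, htS⟩ := Finset.mem_filter.1 ht
    have key : ∀ i, z (Function.update w t (some i)) ≠ 0 → Normal S w ∧ (st w).card = r + 1 := by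
      intro i hi
      obtain ⟨h1, h2⟩ := h.normal _ hi
      rw [st_update_some] at h2
      exact ⟨(Normal.update htS).1 h1, by rw [← h2, Finset.card_erase_add_one ht]⟩
    by_cases h1 : z (Function.update w t (some 0)) = 0
    · refine key 1 fun h2 => h0 ?_
      rw [h1, h2, sub_zero, smul_zero]
    · exact key 0 h1

/-- The contracting homotopy of the cube in the direction `t`. -/
def homot (t : Fin k) (z : Word k → Ext k) (w : Word k) : Ext k :=
  if w t = some 0 then signIn t (st w) • pm {t}ᶜ (z (Function.update w t none)) else 0

lemma Cube.homot {t : Fin k} (ht : t ∈ S) (h : Cube S p (r + 1) z) : Cube S p r (homot t z) where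
  mem w := by
    rw [LongDiag.homot]
    split_ifs
    · exact Submodule.smul_mem _ _ (pm_mem _ (h.mem _))
    · exact Submodule.zero_mem _
  supp w := by
    rw [LongDiag.homot]
    split_ifs with hw
    · have : t ∉ st w := by rw [mem_st, hw]; simp
      have e := h.supp (Function.update w t none)
      rw [st_update_none] at e
      rw [map_smul, ← e]
      simp only [pm_pm]
      congr 3
      ext u
      by_cases hu : u = t
      · subst hu; simp [this]
      · simp [hu]
    · exact map_zero _
  normal w hw := by
    rw [LongDiag.homot] at hw
    split_ifs at hw with hw'
    · have h0 : z (Function.update w t none) ≠ 0 := fun h0 => hw (by rw [h0, map_zero, smul_zero])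
      obtain ⟨h1, h2⟩ := h.normal _ h0
      have : t ∉ st w := by rw [mem_st, hw']; simp
      rw [st_update_none, Finset.card_insert_of_notMem this] at h2
      exact ⟨(Normal.update ht).1 h1, by omega⟩
    · exact (hw rfl).elim

/-- On the faces with a star at `t`, subtracting `dW S (homot t z)` removes exactly the part of `z`
that does not involve `e_t`. Only the summand in the direction `t` contributes, since the homotopy
lives on words with letter `0` at `t`. -/
lemma dW_homot_none (t : Fin k) (ht : t ∈ S) (z : Word k → Ext k) (w : Word k) (hw : w t = none) :
    dW S (homot t z) w = pm {t}ᶜ (z w) := by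
  have htw : t ∈ (st w).filter (· ∈ S) := Finset.mem_filter.2 ⟨mem_st.2 hw, ht⟩
  rw [dW, Finset.sum_eq_single_of_mem t htw]
  · simp only [homot, Function.update_self, Function.update_idem, if_true, st_update_some]
    rw [if_neg (by simp), sub_zero, smul_smul, signIn_erase_self, signIn_mul_self, one_smul, ← hw,
      Function.update_eq_self]
  · intro u _ hut
    simp [homot, Function.update_of_ne (Ne.symm hut), hw]

lemma dW_homot_one (t : Fin k) (z : Word k → Ext k) (w : Word k) (hw : w t = some 1) :
    dW S (homot t z) w = 0 := by
  refine Finset.sum_eq_zero fun u hu => ?_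
  have hut : t ≠ u := by
    rintro rfl
    have := mem_st.1 (Finset.mem_filter.1 hu).1
    rw [hw] at this; simp at this
  simp [homot, Function.update_of_ne hut, hw]

/-- The cocycle condition on the face with a star at `t`, projected away from `e_t`, expresses `z w
- z (w with 1 at t)` by the summands in the other directions. These are the terms of the
differential of the homotopy. After subtraction the cocycle takes equal values at the letters `0`
and `1` at `t`. -/
lemma dW_homot_zero (t : Fin k) (ht : t ∈ S) (h : Cube S p r z) (hd : dW S z = 0) (w : Word k)
    (hw : w t = some 0) : dW S (homot t z) w = z w - z (Function.update w t (some 1)) := by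
  have htw : t ∉ st w := by rw [mem_st, hw]; simp
  set w' := Function.update w t none with hw'
  have hst : st w' = insert t (st w) := st_update_none w t
  have e := congrFun hd w'
  rw [Pi.zero_apply, dW, hst, Finset.filter_insert, if_pos ht, Finset.sum_insert (by simp [htw])] at e
  rw [hw', Function.update_idem, Function.update_idem, ← hw', ← hw, Function.update_eq_self] at e
  have e' := congrArg (fun y => signIn t (insert t (st w)) • pm {t}ᶜ y) e
  simp only [map_add, map_smul, map_zero, smul_zero, smul_add, smul_smul, signIn_mul_self, one_smul,
    map_sub, map_sum, Finset.smul_sum] at e'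
  have k1 : ∀ w₁ : Word k, t ∉ st w₁ → pm {t}ᶜ (z w₁) = z w₁ := by
    intro w₁ h₁
    rw [← h.supp, pm_pm]
    congr 2
    ext u
    by_cases hu : u = t
    · subst hu; simp [h₁]
    · simp [hu]
  rw [k1 w htw, k1 _ (by rw [st_update_some]; exact Finset.notMem_erase _ _), hw] at e'
  rw [eq_neg_of_add_eq_zero_left e', dW, ← Finset.sum_neg_distrib]
  refine Finset.sum_congr rfl fun u hu => ?_
  have huw := (Finset.mem_filter.1 hu).1
  have hut : t ≠ u := by rintro rfl; exact htw huw
  have k2 : ∀ i, homot t z (Function.update w u (some i)) = signIn t ((st w).erase u) •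
      pm {t}ᶜ (z (Function.update w' u (some i))) := by
    intro i
    rw [homot, Function.update_of_ne hut, if_pos hw, st_update_some, Function.update_comm hut.symm]
  rw [k2, k2, ← smul_sub, smul_smul, ← neg_smul]
  congr 1
  have := signIn_mul_erase (Finset.mem_insert_self t (st w)) (Finset.mem_insert_of_mem huw) hut
  rw [Finset.erase_insert htw, Finset.erase_insert_of_ne hut, signIn_insert_self t ((st w).erase u)]
    at this
  have h3 : signIn u (insert t (st w)) = (if t < u then (-1 : ℂ) else 1) * signIn u (st w) :=
    signIn_insert htw
  have h4 : signIn t (st w) = (if u < t then (-1 : ℂ) else 1) * signIn t ((st w).erase u) := by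
    rw [← signIn_insert (Finset.notMem_erase u _), Finset.insert_erase huw]
  rw [signIn_insert_self, h3, h4]
  rcases lt_or_gt_of_ne hut with h | h
  · rw [if_pos h, if_neg h.not_gt]; ring
  · rw [if_pos h, if_neg h.not_gt]; ring

/-- The homotopies are applied in all directions of `S`, one after the other. What remains at a word
`w` involves `e_t` for every star `t` of `w`; as there are `r + 1 > p` stars and the degree is `p`,
it is zero. -/
lemma Cube.exists_dW_eq (h : Cube S p (r + 1) z) (hp : p < r + 1) (hd : LongDiag.dW S z = 0) :
    ∃ z₀, Cube S p r z₀ ∧ LongDiag.dW S z₀ = z := by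
  have key : ∀ T : Finset (Fin k), T ⊆ S → ∃ z₀, Cube S p r z₀ ∧ ∀ t ∈ T, ∀ w : Word k, w t = none →
      pm {t}ᶜ ((z - LongDiag.dW S z₀) w) = 0 := by
    intro T
    induction T using Finset.induction_on with
    | empty => exact fun _ => ⟨0, Cube.zero, by simp⟩
    | insert t T htT ih =>
      intro hT
      have htS : t ∈ S := hT (Finset.mem_insert_self _ _)
      obtain ⟨z₀, hz₀, h₀⟩ := ih ((Finset.subset_insert _ _).trans hT)
      set x := z - LongDiag.dW S z₀ with hx
      have hxC : Cube S p (r + 1) x := h.sub hz₀.dW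
      have hxd : LongDiag.dW S x = 0 := by rw [hx, dW_sub, dW_dW, hd, sub_zero]
      refine ⟨z₀ + LongDiag.homot t x, hz₀.add (hxC.homot htS), fun u hu w hw => ?_⟩
      have e : (z - LongDiag.dW S (z₀ + LongDiag.homot t x)) w =
          x w - LongDiag.dW S (LongDiag.homot t x) w := by
        rw [dW_add, hx]; simp only [Pi.sub_apply, Pi.add_apply]; abel
      rw [e]
      by_cases hut : u = t
      · subst hut
        rw [dW_homot_none u htS x w hw, map_sub, pm_pm, Finset.inter_self, sub_self]
      · have huT : u ∈ T := (Finset.mem_insert.1 hu).resolve_left hut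
        -- The correction in the direction `t` keeps the vanishing already obtained for `u ∈ T`:
        -- with a star at `t` it is a commuting projection, with letter `0` it replaces the value by
        -- the one at letter `1`, and with letter `1` it changes nothing.
        rcases hwt : w t with _ | i
        · rw [dW_homot_none t htS x w hwt, map_sub, pm_pm, Finset.inter_comm, ← pm_pm,
            h₀ u huT w hw, map_zero, sub_zero]
        · have h2 : i = 0 ∨ i = 1 := by omega
          rcases h2 with rfl | rfl
          · rw [dW_homot_zero t htS hxC hxd w hwt, sub_sub_cancel]
            exact h₀ u huT _ (by rw [Function.update_of_ne hut, hw])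
          · rw [dW_homot_one t x w hwt, sub_zero]
            exact h₀ u huT w hw
  obtain ⟨z₀, hz₀, h₀⟩ := key S subset_rfl
  refine ⟨z₀, hz₀, (sub_eq_zero.1 ?_).symm⟩
  have hxC : Cube S p (r + 1) (z - LongDiag.dW S z₀) := h.sub hz₀.dW
  funext w
  by_contra hw
  obtain ⟨h1, h2⟩ := hxC.normal w hw
  exact hw (eq_zero_of_pm_compl (hxC.mem w) (st w) (by omega)
    fun t ht => h₀ t (h1.st_subset ht) w (mem_st.1 ht))

lemma Cube.ctr (h : Cube S (p + 1) r z) : Cube S p r fun w => ctr (z w) where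
  mem w := ctr_mem (h.mem w)
  supp w := pm_ctr _ (h.supp w)
  normal w hw := h.normal w fun h0 => hw (by simp only [h0, map_zero])

/-- Koszul exactness: for any star `t` of `w`, the identity `ctr (e_t z) = z - e_t ctr z` shows that
multiplication by `e_t` inverts the contraction on its kernel. At least one star is needed, hence
the index `r + 1`. -/
lemma Cube.exists_ctr_eq (h : Cube S p (r + 1) z) (hc : ∀ w, LongDiag.ctr (z w) = 0) :
    ∃ z', Cube S (p + 1) (r + 1) z' ∧ ∀ w, LongDiag.ctr (z' w) = z w := by
  classical
  refine ⟨fun w => if hw : (st w).Nonempty then eV hw.choose * z w else 0, ⟨fun w => ?_, fun w => ?_,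
    fun w hw => ?_⟩, fun w => ?_⟩
  · split_ifs
    · exact eV_mul_mem _ (h.mem w)
    · exact Submodule.zero_mem _
  · split_ifs with hw
    · rw [map_mul, pm_eV, if_pos hw.choose_spec, h.supp]
    · exact map_zero _
  · split_ifs at hw with hw'
    · exact h.normal w fun h0 => hw (by rw [h0, mul_zero])
    · exact (hw rfl).elim
  · beta_reduce
    split_ifs with hw
    · rw [ctr_eV_mul, hc, mul_zero, sub_zero]
    · rw [map_zero]
      by_contra h0
      have := (h.normal w (Ne.symm h0)).2
      rw [Finset.not_nonempty_iff_eq_empty.1 hw] at this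
      simp at this

/-- Exactness of the kernel of the contraction. -/
lemma Cube.exists_dW_eq_of_ctr {r : ℕ} {z : Word k → Ext k} (h : Cube S p (r + 1) z)
    (hp : p < r) (hd : LongDiag.dW S z = 0) (hc : ∀ w, LongDiag.ctr (z w) = 0) :
    ∃ z₀, Cube S p r z₀ ∧ LongDiag.dW S z₀ = z ∧ ∀ w, LongDiag.ctr (z₀ w) = 0 := by
  induction p generalizing r z with
  | zero =>
    obtain ⟨z₀, h₀, e⟩ := h.exists_dW_eq (by omega) hd
    exact ⟨z₀, h₀, e, fun w => ctr_eq_zero (h₀.mem w)⟩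
  | succ p ih =>
    obtain ⟨w₀, h₀, e⟩ := h.exists_dW_eq (by omega) hd
    obtain ⟨r, rfl⟩ : ∃ r', r = r' + 1 := ⟨r - 1, by omega⟩
    -- A primitive `w₀` need not be killed by `ctr`, but `ctr w₀` is a cocycle of smaller degree
    -- that is, so it is a boundary `dW w₁` by induction. Writing `w₁ = ctr w₂`, the correction `w₀
    -- - dW w₂` is killed by `ctr` and has the same differential.
    obtain ⟨w₁, h₁, e₁, c₁⟩ := ih h₀.ctr (by omega)
      (by rw [dW_ctr, e]; exact funext hc) (fun w => ctr_ctr _)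
    -- The hypothesis on the degree leaves at least one star after two steps to the left, as
    -- `Cube.exists_ctr_eq` requires.
    obtain ⟨r, rfl⟩ : ∃ r', r = r' + 1 := ⟨r - 1, by omega⟩
    obtain ⟨w₂, h₂, e₂⟩ := h₁.exists_ctr_eq c₁
    refine ⟨w₀ - LongDiag.dW S w₂, h₀.sub h₂.dW, by rw [dW_sub, dW_dW, e, sub_zero], fun w => ?_⟩
    rw [Pi.sub_apply, map_sub, sub_eq_zero, ← congrFun (dW_ctr w₂) w, funext e₂, e₁]

end Words

/-! ### Alternating sums over the faces of a cube. -/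

section CubeSums

variable {k : ℕ} {S : Finset (Fin k)} {A : Type} [CommRing A]

/-- The kernel of the alternating sums over the faces of the cube, for one letter. -/
def letter (A : Type) [CommRing A] : Option (Fin 2) → Fin 2 → A
  | none, c => (-1) ^ (c : ℕ)
  | some i, c => if i = c then 1 else 0

lemma letter_none (c : Fin 2) : letter A none c = letter A (some 0) c - letter A (some 1) c := by
  fin_cases c <;> simp [letter]

/-- The alternating sum of a function over the vertices of the face of a cube given by a word. -/
def DW (S : Finset (Fin k)) (w : Word k) (F : ({t : Fin k // t ∈ S} → Fin 2) → A) : A :=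
  ∑ c, (∏ t : {t : Fin k // t ∈ S}, letter A (w t.1) (c t)) * F c

lemma DW_none {w : Word k} {t : Fin k} (ht : t ∈ S) (hw : w t = none)
    (F : ({t : Fin k // t ∈ S} → Fin 2) → A) :
    DW S w F = DW S (Function.update w t (some 0)) F - DW S (Function.update w t (some 1)) F := by
  classical
  rw [DW, DW, DW, ← Finset.sum_sub_distrib]
  refine Finset.sum_congr rfl fun c _ => ?_
  rw [← sub_mul]
  congr 1
  have key : ∀ v : Word k, (∀ u, u ≠ t → v u = w u) →
      ∏ u : {t : Fin k // t ∈ S}, letter A (v u.1) (c u) = letter A (v t) (c ⟨t, ht⟩) *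
        ∏ u ∈ Finset.univ.erase (⟨t, ht⟩ : {t : Fin k // t ∈ S}), letter A (w u.1) (c u) := by
    intro v hv
    rw [← Finset.mul_prod_erase _ _ (Finset.mem_univ (⟨t, ht⟩ : {t : Fin k // t ∈ S}))]
    congr 1
    refine Finset.prod_congr rfl fun u hu => ?_
    rw [hv u.1 fun h => Finset.ne_of_mem_erase hu (Subtype.ext h)]
  rw [key w fun _ _ => rfl, key _ fun u hu => Function.update_of_ne hu _ _,
    key _ fun u hu => Function.update_of_ne hu _ _, ← sub_mul, Function.update_self,
    Function.update_self, hw, letter_none]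

lemma DW_vertex {w : Word k} (c : {t : Fin k // t ∈ S} → Fin 2) (hw : ∀ t, w t.1 = some (c t))
    (F : ({t : Fin k // t ∈ S} → Fin 2) → A) : DW S w F = F c := by
  rw [DW, Finset.sum_eq_single c]
  · simp [hw, letter]
  · intro c' _ hc'
    obtain ⟨t, ht⟩ := Function.ne_iff.1 hc'
    rw [Finset.prod_eq_zero (Finset.mem_univ t), zero_mul]
    rw [hw, letter, if_neg (Ne.symm ht)]
  · simp

/-- A function of one coordinate can be pulled out of an alternating sum over a face on which this
coordinate is constant. -/
lemma DW_mul_of_some {w : Word k} {t : {t : Fin k // t ∈ S}} {i : Fin 2} (hw : w t.1 = some i)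
    (u : Fin 2 → A) (F : ({t : Fin k // t ∈ S} → Fin 2) → A) :
    DW S w (fun c => u (c t) * F c) = u i * DW S w F := by
  rw [DW, DW, Finset.mul_sum]
  refine Finset.sum_congr rfl fun c _ => ?_
  by_cases h : i = c t
  · rw [h]; ring
  · rw [Finset.prod_eq_zero (Finset.mem_univ t) (by rw [hw, letter, if_neg h])]; ring

/-- The discrete Leibniz rule: the second term carries the difference of `u` and one difference of
`F` less. With `u 0 - u 1` in an ideal, the loss of one order is compensated. -/
lemma DW_mul_of_none {w : Word k} {t : {t : Fin k // t ∈ S}} (hw : w t.1 = none)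
    (u : Fin 2 → A) (F : ({t : Fin k // t ∈ S} → Fin 2) → A) :
    DW S w (fun c => u (c t) * F c) = u 0 * DW S w F +
      (u 0 - u 1) * DW S (Function.update w t.1 (some 1)) F := by
  rw [DW_none t.2 hw, DW_none t.2 hw, DW_mul_of_some (i := 0) (Function.update_self _ _ _),
    DW_mul_of_some (i := 1) (Function.update_self _ _ _)]
  ring

/-- The word of `(M; a)`, with the value `0` outside `S`. -/
def Idx.wd {r : ℕ} (x : Idx S r) : Word k := fun t =>
  if h : t ∈ S then (if h' : t ∈ x.M then none else some (x.a ⟨t, Finset.mem_sdiff.2 ⟨h, h'⟩⟩))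
  else some 0

lemma Idx.st_wd {r : ℕ} (x : Idx S r) : st x.wd = x.M := by
  ext t
  rw [mem_st, Idx.wd]
  split_ifs with h h'
  · simpa using h'
  · simpa using h'
  · simp only [false_iff]
    exact fun h' => h (x.2.1 h')

lemma Idx.normal_wd {r : ℕ} (x : Idx S r) : Normal S x.wd := fun t ht => by
  rw [Idx.wd, dif_neg ht]

lemma Idx.card_wd {r : ℕ} (x : Idx S r) : (st x.wd).card = r := by
  rw [Idx.st_wd]; exact x.2.2

lemma Idx.wd_of_mem {r : ℕ} (x : Idx S r) {t : Fin k} (h : t ∈ x.M) : x.wd t = none := by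
  rw [← mem_st, Idx.st_wd]; exact h

lemma Idx.wd_of_notMem {r : ℕ} (x : Idx S r) {t : Fin k} (h : t ∈ S) (h' : t ∉ x.M) :
    x.wd t = some (x.a ⟨t, Finset.mem_sdiff.2 ⟨h, h'⟩⟩) := by
  rw [Idx.wd, dif_pos h, dif_neg h']

lemma Idx.wd_injective {r : ℕ} : Function.Injective (Idx.wd : Idx S r → Word k) := by
  intro x y h
  have hM : x.M = y.M := by rw [← Idx.st_wd, ← Idx.st_wd, h]
  have ha : ∀ t (hx : t ∈ S \ x.M) (hy : t ∈ S \ y.M), x.a ⟨t, hx⟩ = y.a ⟨t, hy⟩ := by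
    intro t hx hy
    have := congrFun h t
    rw [x.wd_of_notMem (Finset.mem_sdiff.1 hx).1 (Finset.mem_sdiff.1 hx).2,
      y.wd_of_notMem (Finset.mem_sdiff.1 hy).1 (Finset.mem_sdiff.1 hy).2] at this
    exact Option.some_injective _ this
  obtain ⟨⟨M, a⟩, hx⟩ := x
  obtain ⟨⟨M', a'⟩, hy⟩ := y
  change M = M' at hM
  subst hM
  have : a = a' := funext fun t => ha t.1 t.2 t.2
  subst this
  rfl

lemma Idx.exists_wd {r : ℕ} {w : Word k} (h : Normal S w) (hr : (st w).card = r) :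
    ∃ x : Idx S r, x.wd = w := by
  let x : Idx S r := ⟨⟨st w, fun t => (w t.1).getD 0⟩, h.st_subset, hr⟩
  refine ⟨x, funext fun t => ?_⟩
  have hx : x.M = st w := rfl
  simp only [Idx.wd, hx]
  split_ifs with h1 h2
  · exact (mem_st.1 h2).symm
  · have h3 : w t ≠ none := fun h3 => h2 (mem_st.2 h3)
    obtain ⟨i, hi⟩ := Option.ne_none_iff_exists'.1 h3
    rw [hi]
    change some ((w t).getD 0) = _
    rw [hi]; rfl
  · exact (h t h1).symm

lemma Idx.wd_erase {r : ℕ} (x : Idx S (r + 1)) (m : {m : Fin k // m ∈ x.M}) (v : Fin 2) :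
    (x.erase m v).wd = Function.update x.wd m.1 (some v) := by
  funext t
  have hM : (x.erase m v).M = x.M.erase m.1 := rfl
  by_cases htm : t = m.1
  · subst htm
    rw [Function.update_self, Idx.wd_of_notMem _ (x.2.1 m.2) (by rw [hM]; simp)]
    exact congrArg some (dif_pos rfl)
  · rw [Function.update_of_ne htm]
    by_cases hS : t ∈ S
    · by_cases hx : t ∈ x.M
      · rw [Idx.wd_of_mem _ (by rw [hM]; simp [htm, hx]), Idx.wd_of_mem _ hx]
      · rw [Idx.wd_of_notMem _ hS (by rw [hM]; simp [hx]), Idx.wd_of_notMem _ hS hx]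
        exact congrArg some (dif_neg htm)
    · rw [Idx.normal_wd _ t hS, Idx.normal_wd _ t hS]

/-- The alternating sum over the face given by `(M; a)`. -/
def Idx.D {r : ℕ} (x : Idx S r) (F : ({t : Fin k // t ∈ S} → Fin 2) → A) : A :=
  ∑ b : {t : Fin k // t ∈ x.M} → Fin 2,
    (-1) ^ (Finset.univ.filter fun t => b t = 1).card * F (x.glue b)

/-- The weights vanish off the face of `(M; a)`, whose vertices are the maps `a ⊎ b`, and on the
face they multiply to the sign of `b`. The form with words allows a change of one letter at a time.
-/
lemma Idx.D_eq_DW {r : ℕ} (x : Idx S r) (F : ({t : Fin k // t ∈ S} → Fin 2) → A) :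
    x.D F = DW S x.wd F := by
  classical
  refine Finset.sum_of_injOn x.glue (fun b _ b' _ h => ?_) (fun _ _ => by simp) (fun c _ hc => ?_)
    (fun b _ => ?_)
  · funext t
    have := congrFun h ⟨t.1, x.2.1 t.2⟩
    simpa [Idx.glue, t.2] using this
  · obtain ⟨t, ht, htc⟩ : ∃ t : {t : Fin k // t ∈ S}, ∃ h : t.1 ∉ x.M,
        x.a ⟨t.1, Finset.mem_sdiff.2 ⟨t.2, h⟩⟩ ≠ c t := by
      by_contra! h
      refine hc ⟨fun t => c ⟨t.1, x.2.1 t.2⟩, by simp, funext fun t => ?_⟩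
      rw [Idx.glue]
      split_ifs with h'
      · rfl
      · exact h t h'
    rw [Finset.prod_eq_zero (Finset.mem_univ t), zero_mul]
    rw [x.wd_of_notMem t.2 ht, letter, if_neg htc]
  · congr 1
    have e : ∀ t : {t : Fin k // t ∈ S}, letter A (x.wd t.1) (x.glue b t) =
        if h : t.1 ∈ x.M then (if b ⟨t.1, h⟩ = 1 then -1 else 1) else 1 := by
      intro t
      split_ifs with h h1
      · rw [x.wd_of_mem h, Idx.glue, dif_pos h, h1]; simp [letter]
      · have : b ⟨t.1, h⟩ = 0 := by omega
        rw [x.wd_of_mem h, Idx.glue, dif_pos h, this]; simp [letter]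
      · rw [x.wd_of_notMem t.2 h, Idx.glue, dif_neg h, letter, if_pos rfl]
    rw [Finset.prod_congr rfl fun t _ => e t]
    rw [← Finset.prod_const, Finset.prod_filter]
    refine Finset.prod_of_injOn (fun t => ⟨t.1, x.2.1 t.2⟩) (fun t _ t' _ h => ?_) (by simp)
      (fun t _ ht => ?_) (fun t _ => ?_)
    · have h' := congrArg Subtype.val h
      exact Subtype.ext h'
    · rw [dif_neg]
      intro h
      exact ht ⟨⟨t.1, h⟩, by simp, rfl⟩
    · rw [dif_pos t.2]

lemma Idx.D_eq_sub {r : ℕ} (x : Idx S (r + 1)) (m : {m : Fin k // m ∈ x.M})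
    (F : ({t : Fin k // t ∈ S} → Fin 2) → A) : x.D F = (x.erase m 0).D F - (x.erase m 1).D F := by
  rw [Idx.D_eq_DW, Idx.D_eq_DW, Idx.D_eq_DW, Idx.wd_erase, Idx.wd_erase,
    DW_none (x.2.1 m.2) (x.wd_of_mem m.2)]

end CubeSums

/-! ### Cocycles in the lowest degree come from functions on the vertices. -/

section Base

variable {k : ℕ} {S : Finset (Fin k)} {p q : ℕ} (F : ({t : Fin k // t ∈ S} → Fin 2) → ℂ)

open Classical in
/-- The element of top degree of the cube given by a function on the vertices. -/
def omegaW (q : ℕ) (w : Word k) : Ext k :=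
  if Normal S w ∧ (st w).card = q then DW S w F • eM (st w) else 0

lemma cube_omegaW : Cube S q q (omegaW F q) where
  mem w := by
    rw [omegaW]
    split_ifs with h
    · have := eM_mem (st w)
      rw [h.2] at this
      exact Submodule.smul_mem _ _ this
    · exact Submodule.zero_mem _
  supp w := by
    rw [omegaW]
    split_ifs with h
    · rw [map_smul, pm_eM, if_pos subset_rfl]
    · exact map_zero _
  normal w hw := by
    by_contra h
    exact hw (if_neg h)

/-- Both sides are `∑ ε_{t,M} e_{M \ t}` times the alternating sum over the face: on the left the
differences of the coefficients in the direction `t` give that sum, on the right the contraction of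
`e_M` gives the monomials. -/
lemma dW_omegaW : dW S (omegaW F q) = fun w => ctr (omegaW F (q + 1) w) := by
  funext w
  by_cases h : Normal S w ∧ (st w).card = q + 1
  · rw [omegaW, if_pos h, map_smul, ctr_eM, dW, Finset.filter_true_of_mem fun t ht => h.1.st_subset ht,
      Finset.smul_sum]
    refine Finset.sum_congr rfl fun t ht => ?_
    have key : ∀ i, omegaW F q (Function.update w t (some i)) =
        DW S (Function.update w t (some i)) F • eM ((st w).erase t) := by
      intro i
      rw [omegaW, if_pos, st_update_some]
      refine ⟨(Normal.update (h.1.st_subset ht)).2 h.1, ?_⟩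
      rw [st_update_some, Finset.card_erase_of_mem ht, h.2]; rfl
    rw [key, key, ← sub_smul, ← DW_none (h.1.st_subset ht) (mem_st.1 ht), smul_comm]
  · rw [omegaW, if_neg h, map_zero]
    by_contra h0
    exact h ((cube_omegaW F).dW.normal w h0)

/-- Induction on `p`. A primitive `w₀` of `z` has `p` stars in degree `p`, and its contraction falls
under the case `p - 1`, which provides `F`. The difference of `w₀` and `omegaW F p` is shown to
vanish, and `dW_omegaW` computes the differential. For `p = 0` the primitive is a scalar at each
vertex, and these scalars are `F`. -/
lemma Cube.exists_eq_ctr_omegaW {z : Word k → Ext k} (h : Cube S p (p + 1) z) (hd : LongDiag.dW S z = 0)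
    (hc : ∀ w, LongDiag.ctr (z w) = 0) :
    ∃ F : ({t : Fin k // t ∈ S} → Fin 2) → ℂ, z = fun w => LongDiag.ctr (omegaW F (p + 1) w) := by
  induction p generalizing z with
  | zero =>
    obtain ⟨w₀, h₀, e⟩ := h.exists_dW_eq (by omega) hd
    have hs : ∀ w, ∃ x, algebraMap ℂ (Ext k) x = w₀ w := fun w => by
      simpa [Submodule.mem_one] using h₀.mem w
    choose f hf using hs
    refine ⟨fun c => f fun t => if h : t ∈ S then some (c ⟨t, h⟩) else some 0, ?_⟩
    rw [← dW_omegaW, ← e]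
    congr 1
    funext w
    rw [omegaW]
    split_ifs with hw
    · have hst : st w = ∅ := Finset.card_eq_zero.1 hw.2
      have hw' : ∀ t, w t ≠ none := fun t ht => by
        have := mem_st.2 ht
        rw [hst] at this
        simp at this
      rw [hst, eM_empty, ← Algebra.algebraMap_eq_smul_one,
        DW_vertex (fun t => (w t.1).getD 0) fun t => ?_, ← hf]
      · congr 2
        funext t
        split_ifs with ht
        · obtain ⟨i, hi⟩ := Option.ne_none_iff_exists'.1 (hw' t)
          simp [hi]
        · exact hw.1 t ht
      · obtain ⟨i, hi⟩ := Option.ne_none_iff_exists'.1 (hw' t)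
        rw [hi]; rfl
    · by_contra h0
      exact hw (h₀.normal w h0)
  | succ p ih =>
    obtain ⟨w₀, h₀, e⟩ := h.exists_dW_eq (by omega) hd
    obtain ⟨F, hF⟩ := ih h₀.ctr (by rw [dW_ctr, e]; exact funext hc) (fun w => ctr_ctr _)
    refine ⟨F, ?_⟩
    rw [← dW_omegaW, ← e]
    congr 1
    refine sub_eq_zero.1 (funext fun w => ?_)
    have hC : Cube S (p + 1) (p + 1) (w₀ - omegaW F (p + 1)) := h₀.sub (cube_omegaW F)
    have hc0 : LongDiag.ctr ((w₀ - omegaW F (p + 1)) w) = 0 := by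
      rw [Pi.sub_apply, map_sub, sub_eq_zero]
      exact congrFun hF w
    -- The difference is killed by `ctr`, so it is the contraction of an element whose degree
    -- exceeds the number of stars by one; such an element is zero.
    obtain ⟨z', h', e'⟩ := hC.exists_ctr_eq (r := p) (fun w => by
      rw [Pi.sub_apply, map_sub, sub_eq_zero]
      exact congrFun hF w)
    rw [← e' w]
    have : z' w = 0 := by
      by_contra h0
      exact h0 (eq_zero_of_card_lt (h'.mem w) (st w) (by rw [(h'.normal w h0).2]; omega) (h'.supp w))
    rw [this, map_zero]; rfl

end Base

/-! ### From the exterior algebra of `ℂ^k` to the complexes `R_ℓ^•`. -/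

section Transfer

variable {k : ℕ} {S : Finset (Fin k)} {p r : ℕ}

/-- The exterior power of `ρ_M` inside of the exterior algebra of `ℂ^k`. -/
def extIncl (M : Finset (Fin k)) (p : ℕ) : ⋀[ℂ]^p (rho M) →ₗ[ℂ] Ext k :=
  (ExteriorAlgebra.map (rho M).subtype).toLinearMap ∘ₗ (⋀[ℂ]^p (rho M)).subtype

lemma extIncl_ιMulti (M : Finset (Fin k)) (v : Fin p → rho M) :
    extIncl M p (exteriorPower.ιMulti ℂ p v) = ExteriorAlgebra.ιMulti ℂ p fun i => (v i).1 :=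
  ExteriorAlgebra.map_apply_ιMulti _ _

lemma extIncl_injective (M : Finset (Fin k)) (p : ℕ) : Function.Injective (extIncl M p) :=
  (ExteriorAlgebra.map_injective_field (Submodule.ker_subtype _)).comp Subtype.val_injective

lemma extIncl_map {M N : Finset (Fin k)} (h : M ⊆ N) (x : ⋀[ℂ]^p (rho M)) :
    extIncl N p (exteriorPower.map p (Submodule.inclusion (rho_mono h)) x) = extIncl M p x := by
  rw [← LinearMap.comp_apply]
  congr 1
  refine exteriorPower.linearMap_ext ?_
  ext v
  simp only [LinearMap.compAlternatingMap_apply, LinearMap.comp_apply,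
    exteriorPower.map_apply_ιMulti, extIncl_ιMulti]
  rfl

lemma ctr_prod_mul {p : ℕ} (v : Fin p → (Fin k → ℂ)) (hv : ∀ i, ∑ t, v i t = 0) (x : Ext k) :
    ctr ((List.ofFn fun i => ExteriorAlgebra.ι ℂ (v i)).prod * x) =
      (-1 : ℂ) ^ p • ((List.ofFn fun i => ExteriorAlgebra.ι ℂ (v i)).prod * ctr x) := by
  induction p with
  | zero => simp
  | succ p ih =>
    rw [List.ofFn_succ, List.prod_cons, mul_assoc, ctr_ι_mul, sumForm_apply, hv, zero_smul, zero_sub,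
      ih (fun i => v i.succ) fun i => hv _, pow_succ, mul_smul_comm, ← smul_neg, mul_assoc, mul_smul,
      neg_one_smul]

lemma ctr_extIncl (M : Finset (Fin k)) (x : ⋀[ℂ]^p (rho M)) : ctr (extIncl M p x) = 0 := by
  suffices h : ctr ∘ₗ extIncl M p = 0 from LinearMap.congr_fun h x
  refine exteriorPower.linearMap_ext ?_
  ext v
  simp only [LinearMap.compAlternatingMap_apply, LinearMap.comp_apply, extIncl_ιMulti,
    ExteriorAlgebra.ιMulti_apply, LinearMap.zero_apply]
  have := ctr_prod_mul (fun i => (v i).1) (fun i => (v i).2.2) (1 : Ext k)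
  simpa [ctr_one] using this

lemma pm_extIncl (M : Finset (Fin k)) (x : ⋀[ℂ]^p (rho M)) :
    pm M (extIncl M p x) = extIncl M p x := by
  suffices h : (pm M).toLinearMap ∘ₗ extIncl M p = extIncl M p from LinearMap.congr_fun h x
  refine exteriorPower.linearMap_ext ?_
  ext v
  simp only [LinearMap.compAlternatingMap_apply, LinearMap.comp_apply, extIncl_ιMulti]
  refine (ExteriorAlgebra.map_apply_ιMulti _ _).trans ?_
  congr 1
  funext i
  ext t
  refine (projM_apply _ _ _).trans ?_
  split_ifs with ht
  · rfl
  · exact ((v i).2.1 t ht).symm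

lemma map_mem_exteriorPower {V W : Type} [AddCommGroup V] [Module ℂ V] [AddCommGroup W] [Module ℂ W]
    (f : V →ₗ[ℂ] W) {x : ExteriorAlgebra ℂ V} (hx : x ∈ ⋀[ℂ]^p V) :
    ExteriorAlgebra.map f x ∈ ⋀[ℂ]^p W := by
  have := Submodule.mem_map_of_mem (f := (ExteriorAlgebra.map f).toLinearMap) hx
  rw [ExteriorAlgebra.exteriorPower, Submodule.map_pow] at this
  refine (pow_le_pow_left' (a := Submodule.map _ _) (b := LinearMap.range (ExteriorAlgebra.ι ℂ)) ?_
    p : _ ≤ _) this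
  rintro _ ⟨_, ⟨v, rfl⟩, rfl⟩
  exact ⟨f v, (ExteriorAlgebra.map_apply_ι _ _).symm⟩

lemma extIncl_mem (M : Finset (Fin k)) (x : ⋀[ℂ]^p (rho M)) :
    extIncl M p x ∈ ⋀[ℂ]^p (Fin k → ℂ) := map_mem_exteriorPower _ x.2

/-- The map `v ↦ v - σ(v) e_t`, where `σ` is the sum of the coordinates. -/
def reflMap (t : Fin k) : (Fin k → ℂ) →ₗ[ℂ] (Fin k → ℂ) :=
  LinearMap.id - (sumForm k).smulRight (Pi.single t 1)

/-- Modulo elements killed by the contraction this is the identity; it supplies a projection of the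
exterior algebra onto the kernel of `ctr`, used in `exists_extIncl_eq`. -/
lemma map_reflMap (t : Fin k) (x : Ext k) :
    ExteriorAlgebra.map (reflMap t) x = x - eV t * ctr x := by
  induction x using CliffordAlgebra.left_induction with
  | algebraMap r =>
    have : ctr (algebraMap ℂ (CliffordAlgebra (0 : QuadraticForm ℂ (Fin k → ℂ))) r) = 0 :=
      ctr_algebraMap r
    rw [this, mul_zero, sub_zero]
    exact AlgHom.commutes _ _
  | add x y hx hy => rw [map_add, hx, hy, map_add, mul_add]; abel
  | ι_mul x v hx =>
    have e1 : ctr (CliffordAlgebra.ι 0 v * x) = sumForm k v • x - ExteriorAlgebra.ι ℂ v * ctr x :=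
      ctr_ι_mul v x
    have e2 : ExteriorAlgebra.map (reflMap t) (CliffordAlgebra.ι 0 v) =
        ExteriorAlgebra.ι ℂ v - sumForm k v • eV t := by
      refine (ExteriorAlgebra.map_apply_ι _ _).trans ?_
      rw [reflMap, LinearMap.sub_apply, map_sub, LinearMap.smulRight_apply, map_smul]; rfl
    have e3 : eV t * (eV t * ctr x) = 0 := by rw [← mul_assoc, eV_mul_self, zero_mul]
    have e4 : eV t * (ExteriorAlgebra.ι ℂ v * ctr x) = -(ExteriorAlgebra.ι ℂ v * (eV t * ctr x)) := by
      rw [← mul_assoc, ← mul_assoc, ← neg_mul]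
      congr 1
      exact eq_neg_of_add_eq_zero_left (ExteriorAlgebra.ι_add_mul_swap _ _)
    rw [map_mul, hx, e1, e2, sub_mul, mul_sub, mul_sub, smul_mul_assoc, smul_mul_assoc, e3, smul_zero,
      sub_zero, mul_sub, mul_smul_comm, e4]
    change ExteriorAlgebra.ι ℂ v * x - _ - _ = ExteriorAlgebra.ι ℂ v * x - _
    abel

/-- For `t ∈ M` the map `v ↦ v - σ(v) e_t`, with `σ` the sum of the coordinates, carries vectors
supported in `M` into `ρ_M`. On exterior algebras it is `x ↦ x - e_t ctr x`, which fixes `x` when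
`ctr x = 0`. -/
lemma exists_extIncl_eq {M : Finset (Fin k)} (hM : M.Nonempty) {x : Ext k}
    (hx : x ∈ ⋀[ℂ]^p (Fin k → ℂ)) (hs : pm M x = x) (hc : ctr x = 0) :
    ∃ y : ⋀[ℂ]^p (rho M), extIncl M p y = x := by
  obtain ⟨t, ht⟩ := hM
  let f : (Fin k → ℂ) →ₗ[ℂ] rho M := LinearMap.codRestrict (rho M) (reflMap t ∘ₗ projM M) fun v => by
    have h1 : ∀ u, (reflMap t ∘ₗ projM M) v u = projM M v u -
        (sumForm k (projM M v)) * (Pi.single t 1 : Fin k → ℂ) u := fun u => rfl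
    refine ⟨fun u hu => ?_, ?_⟩
    · rw [h1, projM_apply, if_neg hu, Pi.single_eq_of_ne, mul_zero, sub_zero]
      rintro rfl; exact hu ht
    · refine (Finset.sum_congr rfl fun u _ => h1 u).trans ?_
      rw [Finset.sum_sub_distrib, ← Finset.mul_sum, ← sumForm_apply]
      simp
  refine ⟨⟨ExteriorAlgebra.map f x, map_mem_exteriorPower f hx⟩, ?_⟩
  change ExteriorAlgebra.map _ (ExteriorAlgebra.map f x) = x
  rw [← AlgHom.comp_apply, ExteriorAlgebra.map_comp_map]
  change ExteriorAlgebra.map (reflMap t ∘ₗ projM M) x = x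
  rw [← ExteriorAlgebra.map_comp_map, AlgHom.comp_apply]
  change ExteriorAlgebra.map (reflMap t) (pm M x) = x
  rw [hs, map_reflMap, hc, mul_zero, sub_zero]

/-- A family of elements of exterior powers, as a function on words. -/
def toW (y : (x : Idx S r) → ⋀[ℂ]^p (rho x.M)) (w : Word k) : Ext k :=
  ∑ x : Idx S r, if x.wd = w then (extIncl x.M p : _ → Ext k) (y x) else 0

lemma toW_wd (y : (x : Idx S r) → ⋀[ℂ]^p (rho x.M)) (x : Idx S r) :
    toW y x.wd = extIncl x.M p (y x) := by
  rw [toW, Finset.sum_eq_single x]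
  · rw [if_pos rfl]
  · intro x' _ h
    rw [if_neg fun h' => h (Idx.wd_injective h')]
  · simp

lemma toW_eq_zero (y : (x : Idx S r) → ⋀[ℂ]^p (rho x.M)) {w : Word k} (h : ∀ x : Idx S r, x.wd ≠ w) :
    toW y w = 0 := Finset.sum_eq_zero fun x _ => if_neg (h x)

lemma toW_injective : Function.Injective (toW : ((x : Idx S r) → ⋀[ℂ]^p (rho x.M)) → _) :=
  fun y y' h => funext fun x => extIncl_injective _ _ (by rw [← toW_wd, ← toW_wd, h])

lemma toW_cases {P : Ext k → Word k → Prop} (y : (x : Idx S r) → ⋀[ℂ]^p (rho x.M))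
    (h0 : ∀ w, P 0 w) (h1 : ∀ x : Idx S r, P (extIncl x.M p (y x)) x.wd) (w : Word k) :
    P (toW y w) w := by
  by_cases h : ∃ x : Idx S r, x.wd = w
  · obtain ⟨x, rfl⟩ := h
    rw [toW_wd]; exact h1 x
  · rw [toW_eq_zero y (by simpa using h)]; exact h0 w

lemma cube_toW (y : (x : Idx S r) → ⋀[ℂ]^p (rho x.M)) : Cube S p r (toW y) where
  mem := toW_cases (P := fun z _ => z ∈ _) y (fun _ => Submodule.zero_mem _)
    fun x => extIncl_mem _ _
  supp := toW_cases (P := fun z w => pm (st w) z = z) y (fun _ => map_zero _)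
    fun x => by rw [Idx.st_wd, pm_extIncl]
  normal := toW_cases (P := fun z w => z ≠ 0 → Normal S w ∧ (st w).card = r) y (fun _ h => (h rfl).elim)
    fun x _ => ⟨x.normal_wd, x.card_wd⟩

lemma ctr_toW (y : (x : Idx S r) → ⋀[ℂ]^p (rho x.M)) (w : Word k) : ctr (toW y w) = 0 :=
  toW_cases (P := fun z _ => ctr z = 0) y (fun _ => map_zero _) (fun x => ctr_extIncl _ _) w

lemma exists_toW_eq {z : Word k → Ext k} (h : Cube S p (r + 1) z) (hc : ∀ w, ctr (z w) = 0) :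
    ∃ y : (x : Idx S (r + 1)) → ⋀[ℂ]^p (rho x.M), toW y = z := by
  have : ∀ x : Idx S (r + 1), ∃ y : ⋀[ℂ]^p (rho x.M), extIncl x.M p y = z x.wd := fun x => by
    refine exists_extIncl_eq (Finset.card_pos.1 ?_) (h.mem _) ?_ (hc _)
    · rw [← x.st_wd, x.card_wd]; omega
    · rw [← x.st_wd]; exact h.supp _
  choose y hy using this
  refine ⟨y, funext fun w => ?_⟩
  by_cases hw : z w = 0
  · rw [hw]
    by_cases h : ∃ x : Idx S (r + 1), x.wd = w
    · obtain ⟨x, rfl⟩ := h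
      rw [toW_wd, hy, hw]
    · exact toW_eq_zero y (by simpa using h)
  · obtain ⟨h1, h2⟩ := h.normal w hw
    obtain ⟨x, rfl⟩ := Idx.exists_wd h1 h2
    rw [toW_wd, hy]

/-- Inside the common algebra `Ext k` the inclusions of the exterior powers of `ρ_{M \ m}` into
those of `ρ_M` become identities, and the signs are the same. -/
lemma toW_dR (ℓ i : ℕ) (y : R S ℓ i) :
    toW (r := ℓ + i + 1) (dR S ℓ i y) = dW S (toW y) := by
  funext w
  by_cases h : ∃ x : Idx S (ℓ + i + 1), x.wd = w
  · obtain ⟨x, rfl⟩ := h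
    rw [toW_wd, dW, x.st_wd, Finset.filter_true_of_mem (s := x.M) fun t ht => x.2.1 ht, dR, LinearMap.pi_apply,
      LinearMap.sum_apply, map_sum, ← Finset.sum_coe_sort x.M]
    refine Finset.sum_congr rfl fun m _ => ?_
    rw [LinearMap.smul_apply, map_smul, LinearMap.sub_apply, map_sub]
    have e : ∀ v, toW y (Function.update x.wd m.1 (some v)) =
        extIncl x.M (ℓ - 1) (exteriorPower.map (ℓ - 1)
          (Submodule.inclusion (rho_mono (Finset.erase_subset m.1 x.M)))
            (y (Idx.erase (r := ℓ + i) x m v))) := by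
      intro v
      refine Eq.trans ?_ (extIncl_map (Finset.erase_subset m.1 x.M) _).symm
      rw [← Idx.wd_erase (r := ℓ + i), toW_wd]
      rfl
    rw [e, e]
    rfl
  · rw [toW_eq_zero _ (by simpa using h)]
    by_contra h0
    obtain ⟨h1, h2⟩ := (cube_toW y).dW.normal w (Ne.symm h0)
    exact h (Idx.exists_wd h1 h2)

/-- Since `toW` is injective with image the elements killed by `ctr`, this is
`Cube.exists_dW_eq_of_ctr` in degree `ℓ - 1`, at words with `ℓ + i + 1` stars. -/
lemma exact_dR (ℓ i : ℕ) (hℓ : 1 ≤ ℓ) : Function.Exact (dR S ℓ i) (dR S ℓ (i + 1)) := by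
  intro y
  constructor
  · intro hy
    have hd : dW S (toW y) = 0 := by
      rw [← toW_dR ℓ (i + 1), hy]
      funext w
      exact Finset.sum_eq_zero fun x _ => by split_ifs <;> simp
    obtain ⟨z₀, h₀, e, c₀⟩ := (cube_toW (r := ℓ + i + 1) y).exists_dW_eq_of_ctr (by omega) hd
      (ctr_toW y)
    have : ℓ + i = (ℓ + i - 1) + 1 := by omega
    have h2 : ∃ y₀ : (x : Idx S (ℓ + i)) → ⋀[ℂ]^(ℓ - 1) (rho x.M), toW y₀ = z₀ := by
      rw [this] at h₀ ⊢
      exact exists_toW_eq h₀ c₀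
    obtain ⟨y₀, rfl⟩ := h2
    exact ⟨y₀, toW_injective (r := ℓ + i + 1) (by rw [toW_dR, e])⟩
  · rintro ⟨y₀, rfl⟩
    refine toW_injective (r := ℓ + (i + 1) + 1) ?_
    rw [toW_dR ℓ (i + 1), show toW (dR S ℓ i y₀) = dW S (toW y₀) from toW_dR ℓ i y₀, dW_dW]
    funext w
    exact (Finset.sum_eq_zero fun x _ => by split_ifs <;> simp).symm

/-- Read from the right, the subtracted vector in each factor is repeated at the start of the
product that follows it, so it is killed and only the first vector of each difference survives. -/
lemma prod_sub_mul_last {p : ℕ} (t : Fin (p + 1) → Fin k) :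
    (List.ofFn fun i : Fin p => eV (t i.castSucc) - eV (t i.succ)).prod * eV (t (Fin.last p)) =
      (List.ofFn fun i => eV (t i)).prod := by
  induction p with
  | zero => simp
  | succ p ih =>
    have e := ih fun i => t i.succ
    rw [List.ofFn_succ, List.prod_cons, List.ofFn_succ (n := p + 1), List.prod_cons, mul_assoc]
    simp only [Fin.succ_last, ← Fin.castSucc_succ] at e ⊢
    rw [e, sub_mul, Fin.castSucc_zero]
    nth_rw 2 [List.ofFn_succ]
    rw [List.prod_cons, ← mul_assoc (eV (t (Fin.succ 0))), eV_mul_self, zero_mul, sub_zero]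

/-- By `prod_sub_mul_last`, `e_M` is the product of the `ζ_M^r` with the last basis vector. The
contraction passes the `ζ_M^r`, whose coordinate sum is zero, with a sign each, and takes the last
vector to `1`. -/
lemma extIncl_eR {ℓ : ℕ} (hℓ : 1 ≤ ℓ) (x : Idx S ℓ) :
    extIncl x.M (ℓ - 1) (exteriorPower.ιMulti ℂ (ℓ - 1) fun r : Fin (ℓ - 1) =>
      zeta (x.M.orderIsoOfFin x.2.2 ⟨r.1, by omega⟩) (x.M.orderIsoOfFin x.2.2 ⟨r.1 + 1, by omega⟩)) =
      (-1 : ℂ) ^ (ℓ - 1) • ctr (eM x.M) := by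
  obtain ⟨p, rfl⟩ : ∃ p, ℓ = p + 1 := ⟨ℓ - 1, by omega⟩
  let t : Fin (p + 1) → Fin k := fun i => x.M.orderEmbOfFin x.2.2 i
  have e1 : eM x.M = (List.ofFn fun i => eV (t i)).prod := by
    rw [eM, ← Finset.listMap_orderEmbOfFin_finRange x.M x.2.2, List.map_map, ← List.ofFn_eq_map]
    rfl
  have e2 := ctr_prod_mul (fun i : Fin p => (Pi.single (t i.castSucc) 1 - Pi.single (t i.succ) 1 :
    Fin k → ℂ)) (fun i => by simp) (eV (t (Fin.last p)))
  have e3 : ctr (eV (t (Fin.last p))) = 1 := by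
    have := ctr_eV_mul (t (Fin.last p)) 1
    rwa [mul_one, ctr_one, mul_zero, sub_zero] at this
  rw [e3, mul_one] at e2
  have e4 := prod_sub_mul_last t
  simp only [map_sub] at e2
  change ctr ((List.ofFn fun i : Fin p => eV (t i.castSucc) - eV (t i.succ)).prod * _) = _ at e2
  rw [e1, ← e4, e2, smul_smul, ← pow_add, extIncl_ιMulti, ExteriorAlgebra.ιMulti_apply]
  have : (-1 : ℂ) ^ (p + 1 - 1 + p) = 1 := by
    rw [Nat.add_sub_cancel]; exact Even.neg_one_pow ⟨p, rfl⟩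
  rw [this, one_smul]
  simp only [zeta, map_sub]
  rfl

lemma toW_eR {ℓ : ℕ} (hℓ : 1 ≤ ℓ) (c : Idx S ℓ → ℂ) (x : Idx S ℓ) :
    toW (r := ℓ) (∑ ξ, c ξ • eR S ℓ ξ) x.wd = c x • (-1 : ℂ) ^ (ℓ - 1) • ctr (eM x.M) := by
  rw [toW_wd, ← extIncl_eR hℓ x, ← map_smul]
  congr 1
  rw [Finset.sum_apply, Finset.sum_eq_single x]
  · rw [Pi.smul_apply, eR]
    exact congrArg _ (Pi.single_eq_same (M := fun x : Idx S (ℓ + 0) => ⋀[ℂ]^(ℓ - 1) (rho x.M)) x _)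
  · intro y _ hy
    rw [Pi.smul_apply, eR]
    exact (congrArg _ (Pi.single_eq_of_ne (M := fun x : Idx S (ℓ + 0) => ⋀[ℂ]^(ℓ - 1) (rho x.M))
      (Ne.symm hy) _)).trans (smul_zero _)
  · simp

lemma ctr_eM_ne_zero {M : Finset (Fin k)} (hM : M.Nonempty) : ctr (eM M) ≠ 0 := by
  intro h
  obtain ⟨t, ht⟩ := hM
  have h1 := ctr_eV_mul t (eM M)
  have h2 : eV t * eM M = 0 := by
    refine eq_zero_of_card_lt (eV_mul_mem t (eM_mem M)) M (Nat.lt_succ_self _) ?_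
    rw [map_mul, pm_eV, if_pos ht, pm_eM, if_pos subset_rfl]
  rw [h2, h, map_zero, mul_zero, sub_zero] at h1
  exact eM_ne_zero M h1.symm

/-- The linear forms dual to the vectors `e_{(M; a)}`. -/
lemma exists_dual_eR {ℓ : ℕ} (hℓ : 1 ≤ ℓ) (x : Idx S ℓ) :
    ∃ l : R S ℓ 0 →ₗ[ℂ] ℂ, ∀ y, l (eR S ℓ y) = if x = y then 1 else 0 := by
  let T : R S ℓ 0 →ₗ[ℂ] Ext k := extIncl x.M (ℓ - 1) ∘ₗ
    (LinearMap.proj x : ((x : Idx S (ℓ + 0)) → ⋀[ℂ]^(ℓ - 1) (rho x.M)) →ₗ[ℂ] _)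
  have hT : ∀ y, T (eR S ℓ y) = if x = y then (-1 : ℂ) ^ (ℓ - 1) • ctr (eM x.M) else 0 := by
    intro y
    have e : T (eR S ℓ y) = toW (r := ℓ) (eR S ℓ y) x.wd :=
      (toW_wd (r := ℓ) (eR S ℓ y) x).symm
    have e2 := toW_eR hℓ (Pi.single y 1) x
    rw [Finset.sum_eq_single y (by intro z _ hz; simp [hz]) (by simp), Pi.single_eq_same, one_smul]
      at e2
    rw [e, e2, Pi.single_apply]
    split_ifs <;> simp
  have hne : (-1 : ℂ) ^ (ℓ - 1) • ctr (eM x.M) ≠ 0 := by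
    refine smul_ne_zero (pow_ne_zero _ (by simp)) (ctr_eM_ne_zero (Finset.card_pos.1 ?_))
    rw [← x.st_wd, x.card_wd]; omega
  obtain ⟨φ, hφ⟩ : ∃ φ : Module.Dual ℂ (Ext k), φ ((-1 : ℂ) ^ (ℓ - 1) • ctr (eM x.M)) ≠ 0 := by
    by_contra! h
    exact hne ((Module.forall_dual_apply_eq_zero_iff ℂ _).1 h)
  refine ⟨(φ ((-1 : ℂ) ^ (ℓ - 1) • ctr (eM x.M)))⁻¹ • φ ∘ₗ T, fun y => ?_⟩
  rw [LinearMap.smul_apply, LinearMap.comp_apply, hT]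
  split_ifs
  · rw [smul_eq_mul, inv_mul_cancel₀ hφ]
  · rw [map_zero, smul_zero]

/-- The alternating sums over the faces of a function on the vertices of the cube, as an element of
`R_ℓ^0`. -/
def Theta (S : Finset (Fin k)) (ℓ : ℕ) : (({t : Fin k // t ∈ S} → Fin 2) → ℂ) →ₗ[ℂ] R S ℓ 0 where
  toFun F := ∑ ξ : Idx S ℓ, ξ.D F • eR S ℓ ξ
  map_add' F G := by
    rw [← Finset.sum_add_distrib]
    refine Finset.sum_congr rfl fun ξ _ => ?_
    rw [← add_smul]
    congr 1
    simp only [Idx.D, Pi.add_apply, mul_add, Finset.sum_add_distrib]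
  map_smul' z F := by
    rw [RingHom.id_apply, Finset.smul_sum]
    refine Finset.sum_congr rfl fun ξ _ => ?_
    rw [smul_smul]
    congr 1
    simp only [Idx.D, Pi.smul_apply, smul_eq_mul, Finset.mul_sum]
    exact Finset.sum_congr rfl fun _ _ => by ring

lemma Theta_apply (ℓ : ℕ) (F : ({t : Fin k // t ∈ S} → Fin 2) → ℂ) :
    Theta S ℓ F = ∑ ξ : Idx S ℓ, ξ.D F • eR S ℓ ξ := rfl

lemma toW_Theta {ℓ : ℕ} (hℓ : 1 ≤ ℓ) (F : ({t : Fin k // t ∈ S} → Fin 2) → ℂ) :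
    toW (r := ℓ) (Theta S ℓ F) = fun w => ctr (omegaW ((-1 : ℂ) ^ (ℓ - 1) • F) ℓ w) := by
  funext w
  by_cases h : ∃ x : Idx S ℓ, x.wd = w
  · obtain ⟨x, rfl⟩ := h
    rw [Theta_apply, toW_eR hℓ, omegaW, if_pos ⟨x.normal_wd, x.card_wd⟩, x.st_wd, map_smul, smul_smul,
      Idx.D_eq_DW]
    congr 1
    simp only [DW, Pi.smul_apply, smul_eq_mul, Finset.sum_mul]
    exact Finset.sum_congr rfl fun _ _ => by ring
  · rw [toW_eq_zero _ (by simpa using h), omegaW, if_neg, map_zero]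
    intro h'
    exact h (Idx.exists_wd h'.1 h'.2)

/-- By `toW_Theta` the image of `Theta` consists, up to the sign `(-1)^(ℓ-1)`, which is absorbed in
`F`, of the contractions of the elements `omegaW F ℓ`. By `Cube.exists_eq_ctr_omegaW` these are all
the cocycles. -/
lemma exact_Theta {ℓ : ℕ} (hℓ : 1 ≤ ℓ) : Function.Exact (Theta S ℓ) (dR S ℓ 0) := by
  intro y
  constructor
  · intro hy
    have hd : dW S (toW (r := ℓ) y) = 0 := by
      refine (toW_dR ℓ 0 y).symm.trans ?_
      rw [hy]
      funext w
      exact Finset.sum_eq_zero fun x _ => by split_ifs <;> simp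
    obtain ⟨p, rfl⟩ : ∃ p, ℓ = p + 1 := ⟨ℓ - 1, by omega⟩
    obtain ⟨F, hF⟩ := (cube_toW (r := p + 1) y).exists_eq_ctr_omegaW hd (ctr_toW y)
    refine ⟨(-1 : ℂ) ^ (p + 1 - 1) • F, toW_injective (r := p + 1) ?_⟩
    rw [toW_Theta hℓ, smul_smul, ← pow_add, Even.neg_one_pow ⟨_, rfl⟩, one_smul]
    exact hF.symm
  · rintro ⟨F, rfl⟩
    refine toW_injective (r := ℓ + 0 + 1) ?_
    refine (toW_dR ℓ 0 _).trans ?_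
    rw [show toW (r := ℓ) (Theta S ℓ F) = _ from toW_Theta hℓ F, dW_ctr]
    obtain ⟨p, rfl⟩ : ∃ p, ℓ = p + 1 := ⟨ℓ - 1, by omega⟩
    rw [dW_omegaW]
    funext w
    rw [ctr_ctr]
    exact (Finset.sum_eq_zero fun x _ => by split_ifs <;> simp).symm

/-- Tuples `c_{(M; a)}` for which `c_{(M \ m; a, m ↦ 1)} - c_{(M \ m; a, m ↦ 2)}` does not depend on
`m ∈ M` give cocycles. -/
lemma dR_sum_eR {ℓ : ℕ} (hℓ : 1 ≤ ℓ) (c : Idx S ℓ → ℂ)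
    (hc : ∀ (x : Idx S (ℓ + 1)) (m m' : {m : Fin k // m ∈ x.M}),
      c (x.erase m 0) - c (x.erase m 1) = c (x.erase m' 0) - c (x.erase m' 1)) :
    dR S ℓ 0 (∑ ξ, c ξ • eR S ℓ ξ) = 0 := by
  refine toW_injective (r := ℓ + 0 + 1) ?_
  refine (toW_dR ℓ 0 _).trans ?_
  have h0 : toW (r := ℓ + 0 + 1) (0 : R S ℓ 1) = 0 :=
    funext fun w => Finset.sum_eq_zero fun x _ => by split_ifs <;> simp
  rw [h0]
  funext w
  by_cases h : ∃ x : Idx S (ℓ + 1), x.wd = w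
  · obtain ⟨x, rfl⟩ := h
    rw [dW, x.st_wd, Finset.filter_true_of_mem (s := x.M) fun t ht => x.2.1 ht, ← Finset.sum_coe_sort x.M]
    obtain ⟨m₀, hm₀⟩ : x.M.Nonempty := Finset.card_pos.1 (by rw [← x.st_wd, x.card_wd]; omega)
    have e : ∀ m : {m : Fin k // m ∈ x.M}, signIn m.1 x.M •
        (toW (r := ℓ) (∑ ξ, c ξ • eR S ℓ ξ) (Function.update x.wd m.1 (some 0)) -
          toW (r := ℓ) (∑ ξ, c ξ • eR S ℓ ξ) (Function.update x.wd m.1 (some 1))) =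
        ((c (x.erase ⟨m₀, hm₀⟩ 0) - c (x.erase ⟨m₀, hm₀⟩ 1)) * (-1 : ℂ) ^ (ℓ - 1)) •
          ctr (signIn m.1 x.M • eM (x.M.erase m.1)) := by
      intro m
      rw [← hc x m ⟨m₀, hm₀⟩, ← Idx.wd_erase, ← Idx.wd_erase, toW_eR hℓ, toW_eR hℓ, map_smul,
        show (x.erase m 0).M = x.M.erase m.1 from rfl, show (x.erase m 1).M = x.M.erase m.1 from rfl,
        ← sub_smul, smul_smul, smul_smul, smul_smul]
      congr 1
      ring
    -- The common difference factors out, and what remains is `ctr (ctr e_M) = 0`.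
    refine (Finset.sum_congr rfl fun m _ => e m).trans ?_
    rw [← Finset.smul_sum, ← map_sum, Finset.sum_coe_sort x.M fun m => signIn m x.M • eM (x.M.erase m),
      ← ctr_eM, ctr_ctr, smul_zero]; rfl
  · by_contra h0
    obtain ⟨h1, h2⟩ := (cube_toW (r := ℓ) _).dW.normal w h0
    exact h (Idx.exists_wd h1 h2)

lemma isEmpty_idx {r : ℕ} (h : S.card < r) : IsEmpty (Idx S r) :=
  ⟨fun x => absurd (Finset.card_le_card x.2.1) (by rw [x.2.2]; omega)⟩

end Transfer

/-! ### The homogeneous components of the symmetric algebra and its augmentation ideal. -/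

section SymmetricProjection

variable {A N : Type} [CommRing A] [AddCommGroup N] [Module A N]

/-- The projection of the tensor algebra to a symmetric power. -/
def tensorProj (m : ℕ) : TensorAlgebra A N →ₗ[A] SymmetricPower A (Fin m) N :=
  SymmetricPower.mk A (Fin m) N ∘ₗ DirectSum.component A ℕ (fun n => ⨂[A]^n N) m ∘ₗ
    TensorAlgebra.toDirectSum.toLinearMap

lemma tensorProj_tprod_self (m : ℕ) (v : Fin m → N) :
    tensorProj m (TensorAlgebra.tprod A N m v) = SymmetricPower.tprod A v := by
  rw [tensorProj, LinearMap.comp_apply, LinearMap.comp_apply, AlgHom.toLinearMap_apply,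
    TensorAlgebra.toDirectSum_tensorPower_tprod, ← DirectSum.lof_eq_of A, DirectSum.component.of, dif_pos rfl]
  rfl

lemma tensorProj_tprod_of_ne {m n : ℕ} (h : n ≠ m) (v : Fin n → N) :
    tensorProj m (TensorAlgebra.tprod A N n v) = 0 := by
  rw [tensorProj, LinearMap.comp_apply, LinearMap.comp_apply, AlgHom.toLinearMap_apply,
    TensorAlgebra.toDirectSum_tensorPower_tprod, ← DirectSum.lof_eq_of A, DirectSum.component.of, dif_neg h, map_zero]

/-- The product of a list of vectors in the tensor algebra. -/
def listProd (L : List N) : TensorAlgebra A N := (L.map (TensorAlgebra.ι A)).prod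

lemma listProd_append (L L' : List N) :
    listProd (A := A) (L ++ L') = listProd L * listProd L' := by simp [listProd]

lemma listProd_eq_tprod (L : List N) : listProd (A := A) L = TensorAlgebra.tprod A N L.length L.get := by
  rw [TensorAlgebra.tprod_apply, listProd]
  congr 1
  conv_lhs => rw [← List.ofFn_get L, List.map_ofFn]
  rfl

lemma listProd_ofFn {n : ℕ} (v : Fin n → N) :
    listProd (A := A) (List.ofFn v) = TensorAlgebra.tprod A N n v := by
  rw [TensorAlgebra.tprod_apply, listProd, List.map_ofFn]
  rfl

lemma tensorProj_listProd_of_length_ne {m : ℕ} (L : List N) (h : L.length ≠ m) :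
    tensorProj m (listProd (A := A) L) = 0 := by
  rw [listProd_eq_tprod, tensorProj_tprod_of_ne h]

lemma span_listProd : Submodule.span A (Set.range (listProd : List N → TensorAlgebra A N)) = ⊤ := by
  refine eq_top_iff.2 fun x _ => ?_
  induction x using TensorAlgebra.induction with
  | algebraMap r =>
    rw [Algebra.algebraMap_eq_smul_one]
    exact Submodule.smul_mem _ _ (Submodule.subset_span ⟨[], by simp [listProd]⟩)
  | ι x => exact Submodule.subset_span ⟨[x], by simp [listProd]⟩
  | mul a b ha hb =>
    have := Submodule.mul_mem_mul (ha trivial) (hb trivial)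
    rw [Submodule.span_mul_span] at this
    refine Submodule.span_mono ?_ this
    rintro _ ⟨_, ⟨L, rfl⟩, _, ⟨L', rfl⟩, rfl⟩
    exact ⟨L ++ L', listProd_append L L'⟩
  | add a b ha hb => exact Submodule.add_mem _ (ha trivial) (hb trivial)

/-- The two lists differ by a transposition of positions, which is a defining relation of the
symmetric power; lists of the wrong length project to zero. -/
lemma tensorProj_swap (m : ℕ) (L L' : List N) (x y : N) :
    tensorProj m (listProd (A := A) (L ++ x :: y :: L')) =
      tensorProj m (listProd (A := A) (L ++ y :: x :: L')) := by
  by_cases h : (L ++ x :: y :: L').length = m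
  · subst h
    have hl : (L ++ y :: x :: L').length = (L ++ x :: y :: L').length := by simp
    let σ : Equiv.Perm (Fin (L ++ x :: y :: L').length) :=
      Equiv.swap ⟨L.length, by simp⟩ ⟨L.length + 1, by simp⟩
    have e : List.ofFn (fun i => (L ++ x :: y :: L').get (σ i)) = L ++ y :: x :: L' := by
      refine List.ext_getElem (by rw [List.length_ofFn, hl]) fun i h1 h2 => ?_
      rw [List.getElem_ofFn, List.get_eq_getElem]
      simp only [σ, Equiv.swap_apply_def, Fin.mk.injEq]
      split_ifs with h3 h4
      · subst h3; simp
      · subst h4; simp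
      · simp only [List.getElem_append]
        split_ifs with h5
        · rfl
        · obtain ⟨j, rfl⟩ : ∃ j, i = L.length + 2 + j := ⟨i - (L.length + 2), by omega⟩
          have : L.length + 2 + j - L.length = j + 2 := by omega
          simp [this]
    rw [← e, listProd_ofFn, listProd_eq_tprod, tensorProj_tprod_self, tensorProj_tprod_self]
    exact (SymmetricPower.tprod_equiv σ _).symm
  · rw [tensorProj_listProd_of_length_ne _ h, tensorProj_listProd_of_length_ne]
    simpa using h

/-- Elements of the tensor algebra which have the same products in symmetric powers. -/
def symCon (m : ℕ) : RingCon (TensorAlgebra A N) where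
  r x y := ∀ a b, tensorProj m (a * x * b) = tensorProj m (a * y * b)
  iseqv := ⟨fun _ _ _ => rfl, fun h a b => (h a b).symm, fun h h' a b => (h a b).trans (h' a b)⟩
  add' h h' a b := by simp only [mul_add, add_mul, map_add, h a b, h' a b]
  mul' {w x y z} h h' a b := by
    rw [← mul_assoc, mul_assoc _ y b, h a (y * b), ← mul_assoc, h' (a * x) b, ← mul_assoc]

/-- `symCon m` is a ring congruence, so only the generating relations have to be checked. By
linearity the two outer factors may be taken to be products of vectors, which is the case of
`tensorProj_swap`. Hence `tensorProj m` descends to the symmetric algebra. -/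
lemma symRingCon_le (m : ℕ) : TensorAlgebra.symRingCon A N ≤ symCon (A := A) (N := N) m := by
  rw [TensorAlgebra.symRingCon]
  refine RingCon.ringConGen_le.2 ?_
  rintro _ _ ⟨x, y⟩ a b
  have key : ∀ a b : TensorAlgebra A N,
      tensorProj (A := A) (N := N) m (a * (TensorAlgebra.ι A x * TensorAlgebra.ι A y) * b) =
      tensorProj (A := A) (N := N) m (a * (TensorAlgebra.ι A y * TensorAlgebra.ι A x) * b) := by
    intro a b
    have ha : a ∈ Submodule.span A (Set.range (listProd : List N → TensorAlgebra A N)) :=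
      by rw [span_listProd]; exact Submodule.mem_top
    have hb : b ∈ Submodule.span A (Set.range (listProd : List N → TensorAlgebra A N)) :=
      by rw [span_listProd]; exact Submodule.mem_top
    induction ha using Submodule.span_induction with
    | zero => simp only [zero_mul]
    | add a a' _ _ h h' => simp only [add_mul, map_add, h, h']
    | smul r a _ h => simp only [smul_mul_assoc, map_smul, h]
    | mem a ha =>
      obtain ⟨L, rfl⟩ := ha
      induction hb using Submodule.span_induction with
      | zero => simp only [mul_zero]
      | add a a' _ _ h h' => simp only [mul_add, map_add, h, h']
      | smul r a _ h => simp only [mul_smul_comm, map_smul, h]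
      | mem b hb =>
        obtain ⟨L', rfl⟩ := hb
        have := tensorProj_swap (A := A) m L L' x y
        simpa [listProd, mul_assoc] using this
  exact key a b

/-- The projection of the symmetric algebra to a symmetric power. -/
def symProj (m : ℕ) : SymmetricAlgebra A N →+ SymmetricPower A (Fin m) N where
  toFun := Quotient.lift (fun x => tensorProj (A := A) (N := N) m x) (fun x y h => by
    simpa using symRingCon_le m h 1 1)
  map_zero' := map_zero (tensorProj m)
  map_add' := by
    rintro ⟨x⟩ ⟨y⟩
    exact map_add (tensorProj m) x y

lemma symProj_algHom (m : ℕ) (x : TensorAlgebra A N) :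
    symProj m (SymmetricAlgebra.algHom A N x) = tensorProj m x := rfl

lemma symProj_algebraMap_mul (m : ℕ) (r : A) (x : SymmetricAlgebra A N) :
    symProj m (algebraMap A _ r * x) = r • symProj m x := by
  obtain ⟨x, rfl⟩ := SymmetricAlgebra.algHom_surjective A N x
  rw [← AlgHom.commutes (SymmetricAlgebra.algHom A N), ← map_mul, symProj_algHom, symProj_algHom,
    ← Algebra.smul_def, map_smul]

lemma symProj_prod (m : ℕ) (v : Fin m → N) :
    symProj m (∏ i, SymmetricAlgebra.ι A N (v i)) = SymmetricPower.tprod A v := by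
  rw [← tensorProj_tprod_self, ← symProj_algHom, TensorAlgebra.tprod_apply, map_list_prod,
    List.map_ofFn, List.prod_ofFn]
  rfl

/-- The augmentation ideal of the symmetric algebra. -/
def augIdeal (A N : Type) [CommRing A] [AddCommGroup N] [Module A N] : Ideal (SymmetricAlgebra A N) :=
  Ideal.span (Set.range (SymmetricAlgebra.ι A N))

lemma ι_mem_augIdeal (n : N) : SymmetricAlgebra.ι A N n ∈ augIdeal A N := Ideal.subset_span ⟨n, rfl⟩

/-- The elements of the symmetric algebra of order at least `n`. -/
def degGE (A N : Type) [CommRing A] [AddCommGroup N] [Module A N] (n : ℕ) :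
    Submodule A (SymmetricAlgebra A N) :=
  Submodule.span A {x | ∃ L : List N, n ≤ L.length ∧ SymmetricAlgebra.algHom A N (listProd L) = x}

lemma mem_degGE_zero (x : SymmetricAlgebra A N) : x ∈ degGE A N 0 := by
  obtain ⟨x, rfl⟩ := SymmetricAlgebra.algHom_surjective A N x
  have hx : x ∈ Submodule.span A (Set.range (listProd : List N → TensorAlgebra A N)) :=
    by rw [span_listProd]; exact Submodule.mem_top
  induction hx using Submodule.span_induction with
  | zero => rw [map_zero]; exact Submodule.zero_mem _
  | add a b _ _ ha hb => rw [map_add]; exact Submodule.add_mem _ ha hb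
  | smul r a _ ha => rw [map_smul]; exact Submodule.smul_mem _ _ ha
  | mem x hx =>
    obtain ⟨L, rfl⟩ := hx
    exact Submodule.subset_span ⟨L, Nat.zero_le _, rfl⟩

lemma mul_mem_degGE {m n : ℕ} {x y : SymmetricAlgebra A N} (hx : x ∈ degGE A N m)
    (hy : y ∈ degGE A N n) : x * y ∈ degGE A N (m + n) := by
  have := Submodule.mul_mem_mul hx hy
  rw [degGE, degGE, Submodule.span_mul_span] at this
  refine Submodule.span_mono ?_ this
  rintro _ ⟨_, ⟨L, hL, rfl⟩, _, ⟨L', hL', rfl⟩, rfl⟩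
  refine ⟨L ++ L', by rw [List.length_append]; omega, ?_⟩
  rw [listProd_append, map_mul]

lemma augIdeal_le {x : SymmetricAlgebra A N} (hx : x ∈ augIdeal A N) : x ∈ degGE A N 1 := by
  induction hx using Submodule.span_induction with
  | zero => exact Submodule.zero_mem _
  | add a b _ _ ha hb => exact Submodule.add_mem _ ha hb
  | smul r a _ ha => rw [smul_eq_mul]; simpa using mul_mem_degGE (mem_degGE_zero r) ha
  | mem x hx =>
    obtain ⟨n, rfl⟩ := hx
    refine Submodule.subset_span ⟨([n] : List N), by simp, ?_⟩
    simp [listProd, SymmetricAlgebra.ι]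

lemma augIdeal_pow_le (n : ℕ) {x : SymmetricAlgebra A N} (hx : x ∈ augIdeal A N ^ n) :
    x ∈ degGE A N n := by
  induction n generalizing x with
  | zero => exact mem_degGE_zero x
  | succ n ih =>
    rw [pow_succ] at hx
    induction hx using Submodule.mul_induction_on' with
    | mem_mul_mem a ha b hb => exact mul_mem_degGE (ih ha) (augIdeal_le hb)
    | add a _ b _ ha hb => exact Submodule.add_mem _ ha hb

/-- The power `m + 1` of the augmentation ideal is spanned by products of more than `m` vectors,
which have no component of degree `m`. -/
lemma symProj_eq_zero {m : ℕ} {x : SymmetricAlgebra A N} (hx : x ∈ augIdeal A N ^ (m + 1)) :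
    symProj m x = 0 := by
  have := augIdeal_pow_le _ hx
  clear hx
  induction this using Submodule.span_induction with
  | zero => exact map_zero _
  | add a b _ _ ha hb => rw [map_add, ha, hb, add_zero]
  | smul r a _ ha => rw [Algebra.smul_def, symProj_algebraMap_mul, ha, smul_zero]
  | mem x hx =>
    obtain ⟨L, hL, rfl⟩ := hx
    rw [symProj_algHom, tensorProj_listProd_of_length_ne _ (by omega)]

end SymmetricProjection

/-! ### Formal smoothness and the class of a function in `S^m(I/I²)`. -/

section ClassMap

/-- Ring homomorphisms from a formally smooth algebra to `S / I²` lift to all orders. -/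
lemma exists_lift_mod {k P S : Type} [CommRing k] [CommRing P] [CommRing S] [Algebra k P]
    [Algebra k S] [Algebra.FormallySmooth k P] (I : Ideal S) (f : P →ₐ[k] S ⧸ I ^ 2) (m : ℕ) :
    ∃ g : P → S, (∀ p p', g (p + p') - (g p + g p') ∈ I ^ m) ∧
      (∀ p p', g (p * p') - g p * g p' ∈ I ^ m) ∧ ∀ p, Ideal.Quotient.mk (I ^ 2) (g p) = f p := by
  -- The exponent `m + 2` lies above both `2`, so that there is a thickening of `S ⧸ I ^ 2` to lift
  -- along, and `m`, the required precision.
  have hle : I ^ (m + 2) ≤ I ^ 2 := Ideal.pow_le_pow_right (by omega)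
  have hle' : I ^ (m + 2) ≤ I ^ m := Ideal.pow_le_pow_right (by omega)
  let φ : S ⧸ I ^ (m + 2) →ₐ[k] S ⧸ I ^ 2 := Ideal.Quotient.factorₐ k hle
  have hφ : Function.Surjective φ := Ideal.Quotient.factor_surjective hle
  have hn : IsNilpotent (RingHom.ker (φ : S ⧸ I ^ (m + 2) →+* S ⧸ I ^ 2)) := by
    refine ⟨m + 2, ?_⟩
    have hk : RingHom.ker (φ : S ⧸ I ^ (m + 2) →+* S ⧸ I ^ 2) ≤
        (I ^ 2).map (Ideal.Quotient.mk (I ^ (m + 2))) := by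
      intro x hx
      obtain ⟨x, rfl⟩ := Ideal.Quotient.mk_surjective x
      exact Ideal.mem_map_of_mem _ (Ideal.Quotient.eq_zero_iff_mem.1 hx)
    refine le_bot_iff.1 ((Ideal.pow_right_mono hk _).trans ?_)
    rw [← Ideal.map_pow, ← pow_mul]
    refine (Ideal.map_mono (Ideal.pow_le_pow_right (by omega : m + 2 ≤ 2 * (m + 2)))).trans ?_
    rw [Ideal.map_quotient_self]
  let G := Algebra.FormallySmooth.liftOfSurjective f φ hφ hn
  have hG : ∀ p, φ (G p) = f p := Algebra.FormallySmooth.liftOfSurjective_apply f φ hφ hn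
  choose rep hrep using Ideal.Quotient.mk_surjective (I := I ^ (m + 2))
  refine ⟨fun p => rep (G p), fun p p' => hle' ?_, fun p p' => hle' ?_, fun p => ?_⟩
  · rw [← Ideal.Quotient.eq_zero_iff_mem, map_sub, map_add, hrep, hrep, hrep, map_add, sub_self]
  · rw [← Ideal.Quotient.eq_zero_iff_mem, map_sub, map_mul, hrep, hrep, hrep, map_mul, sub_self]
  · have h : φ (Ideal.Quotient.mk _ (rep (G p))) = f p := by rw [hrep, hG]
    exact h

/-- Replacing one factor changes the product by an element of `I²` times the remaining factors,
which lie in `I`; one order is gained. -/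
lemma prod_sub_prod_mem {S ι : Type} [CommRing S] (I : Ideal S) (s : Finset ι) (x y : ι → S)
    (hy : ∀ i, y i ∈ I) (h : ∀ i, x i - y i ∈ I ^ 2) :
    ∏ i ∈ s, x i - ∏ i ∈ s, y i ∈ I ^ (s.card + 1) ∧ ∏ i ∈ s, y i ∈ I ^ s.card := by
  classical
  induction s using Finset.induction_on with
  | empty => simp
  | insert a s ha ih =>
    rw [Finset.prod_insert ha, Finset.prod_insert ha, Finset.card_insert_of_notMem ha]
    have hx : x a ∈ I := by
      have := I.add_mem (Ideal.pow_le_self two_ne_zero (h a)) (hy a)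
      simpa using this
    constructor
    · have e : x a * ∏ i ∈ s, x i - y a * ∏ i ∈ s, y i =
          x a * (∏ i ∈ s, x i - ∏ i ∈ s, y i) + (x a - y a) * ∏ i ∈ s, y i := by ring
      rw [e]
      refine Ideal.add_mem _ ?_ ?_
      · rw [pow_succ']; exact Ideal.mul_mem_mul hx ih.1
      · have := Ideal.mul_mem_mul (h a) ih.2
        rwa [← pow_add, add_comm 2] at this
    · rw [pow_succ']; exact Ideal.mul_mem_mul (hy a) ih.2

variable {k P A N : Type} [CommRing k] [CommRing P] [CommRing A] [Algebra k P] [Algebra k A]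
  [AddCommGroup N] [Module A N] (q : P →ₐ[k] A) (δ : RingHom.ker q →+ N)

/-- For `a` and `b` in the kernel, semilinearity gives `δ (ab) = q(a) δ(b) = 0`. -/
lemma eq_zero_of_mem_ker_sq (hδ : ∀ (p : P) (u : RingHom.ker q), δ (p • u) = q p • δ u)
    (u : RingHom.ker q) (hu : (u : P) ∈ RingHom.ker q ^ 2) : δ u = 0 := by
  suffices h : ∀ x ∈ RingHom.ker q ^ 2, ∃ hx : x ∈ RingHom.ker q, δ ⟨x, hx⟩ = 0 by
    obtain ⟨_, h⟩ := h _ hu; exact h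
  intro x hx
  rw [pow_two] at hx
  induction hx using Submodule.mul_induction_on' with
  | mem_mul_mem a ha b hb =>
    refine ⟨Ideal.mul_mem_left _ _ hb, (hδ a ⟨b, hb⟩).trans ?_⟩
    rw [RingHom.mem_ker.1 ha, zero_smul]
  | add a _ b _ ha hb =>
    obtain ⟨ha, ha'⟩ := ha
    obtain ⟨hb, hb'⟩ := hb
    refine ⟨Ideal.add_mem _ ha hb, ?_⟩
    have := map_add δ ⟨a, ha⟩ ⟨b, hb⟩
    rwa [ha', hb', add_zero] at this

/-- A linear map on the ideal of a formally smooth quotient extends to a derivation. -/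
lemma exists_derivation_of_ideal [Algebra.FormallySmooth k A] (hq : Function.Surjective q)
    (hδ : ∀ (p : P) (u : RingHom.ker q), δ (p • u) = q p • δ u) :
    ∃ D : P →+ N, (∀ p p', D (p * p') = q p • D p' + q p' • D p) ∧
      (∀ r : k, D (algebraMap k P r) = 0) ∧ ∀ u : RingHom.ker q, D u = δ u := by
  let I : Ideal P := RingHom.ker q
  let φ : P ⧸ I ^ 2 →ₐ[k] A := Ideal.Quotient.liftₐ (I ^ 2) q fun a ha => Ideal.pow_le_self two_ne_zero ha
  have hφ : Function.Surjective φ := fun a => by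
    obtain ⟨p, rfl⟩ := hq a
    exact ⟨Ideal.Quotient.mk _ p, rfl⟩
  have hn : IsNilpotent (RingHom.ker (φ : P ⧸ I ^ 2 →+* A)) := by
    refine ⟨2, ?_⟩
    have hk : RingHom.ker (φ : P ⧸ I ^ 2 →+* A) ≤ I.map (Ideal.Quotient.mk (I ^ 2)) := by
      intro x hx
      obtain ⟨x, rfl⟩ := Ideal.Quotient.mk_surjective x
      exact Ideal.mem_map_of_mem _ hx
    refine le_bot_iff.1 ((Ideal.pow_right_mono hk _).trans ?_)
    rw [← Ideal.map_pow, Ideal.map_quotient_self]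
  -- Formal smoothness of `A` splits `P/I² → A`. The derivation is `p ↦ δ(p - σ(q p))`; the choice
  -- of representatives modulo `I²` is immaterial because `δ` kills `I²`.
  let σ := Algebra.FormallySmooth.liftOfSurjective (AlgHom.id k A) φ hφ hn
  have hσ : ∀ a, φ (σ a) = a :=
    Algebra.FormallySmooth.liftOfSurjective_apply (AlgHom.id k A) φ hφ hn
  choose rep hrep using fun a => Ideal.Quotient.mk_surjective (σ a)
  have hrep' : ∀ a, q (rep a) = a := fun a => by
    have h : φ (Ideal.Quotient.mk _ (rep a)) = a := by rw [hrep, hσ]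
    exact h
  have hI : ∀ p, p - rep (q p) ∈ I := fun p => by
    rw [RingHom.mem_ker, map_sub, hrep', sub_self]
  have hwd : ∀ u v : I, Ideal.Quotient.mk (I ^ 2) (u : P) = Ideal.Quotient.mk (I ^ 2) (v : P) →
      δ u = δ v := fun u v huv => by
    rw [← sub_eq_zero, ← map_sub]
    exact eq_zero_of_mem_ker_sq q δ hδ _ (Ideal.Quotient.eq.1 huv)
  have key : ∀ p (u : I), Ideal.Quotient.mk (I ^ 2) (u : P) = Ideal.Quotient.mk (I ^ 2) p - σ (q p) →
      δ ⟨p - rep (q p), hI p⟩ = δ u := fun p u hu => hwd _ _ (by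
    rw [hu, map_sub, hrep])
  refine ⟨AddMonoidHom.mk' (fun p => δ ⟨p - rep (q p), hI p⟩) fun p p' => ?_, fun p p' => ?_,
    fun r => ?_, fun u => ?_⟩
  · rw [← map_add]
    refine key _ _ ?_
    change Ideal.Quotient.mk (I ^ 2) ((p - rep (q p)) + (p' - rep (q p'))) = _
    simp only [map_add, map_sub, hrep]
    ring
  · change δ _ = q p • δ _ + q p' • δ _
    have h : δ (p • ⟨p' - rep (q p'), hI p'⟩ + rep (q p') • ⟨p - rep (q p), hI p⟩) =
        q p • δ ⟨p' - rep (q p'), hI p'⟩ + q p' • δ ⟨p - rep (q p), hI p⟩ := by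
      rw [map_add, hδ, hδ, hrep']
    refine (key _ _ ?_).trans h
    change Ideal.Quotient.mk (I ^ 2) (p * (p' - rep (q p')) + rep (q p') * (p - rep (q p))) = _
    simp only [map_add, map_sub, map_mul, hrep]
    ring
  · refine (key _ 0 ?_).trans (map_zero δ)
    rw [AlgHom.commutes, AlgHom.commutes]
    simp only [ZeroMemClass.coe_zero, map_zero]
    exact (sub_self _).symm
  · refine key _ _ ?_
    rw [RingHom.mem_ker.1 u.2, map_zero, sub_zero]

/-- The map which sends `c u_1 ⋯ u_m` with `u_i` in the ideal `I` of a smooth quotient to the product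
of the classes of the `u_i`, extended to a map on the whole ring. -/
theorem exists_classMap [Algebra.FormallySmooth k P] [Algebra.FormallySmooth k A]
    (hq : Function.Surjective q)
    (hδ : ∀ (p : P) (u : RingHom.ker q), δ (p • u) = q p • δ u) (m : ℕ) :
    ∃ Cl : P →+ SymmetricPower A (Fin m) N, ∀ (c : P) (u : Fin m → RingHom.ker q),
      Cl (c * ∏ i, (u i : P)) = q c • SymmetricPower.tprod A fun i => δ (u i) := by
  obtain ⟨D, hDm, hDk, hDδ⟩ := exists_derivation_of_ideal q δ hq hδ
  let _ : Algebra k (SymmetricAlgebra A N) := ((algebraMap A (SymmetricAlgebra A N)).comp (algebraMap k A)).toAlgebra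
  let I : Ideal (SymmetricAlgebra A N) := augIdeal A N
  have hI : ∀ n : N, SymmetricAlgebra.ι A N n ∈ I := ι_mem_augIdeal
  -- The first order Taylor expansion along the subscheme; multiplicativity modulo `I²` is the
  -- Leibniz rule for `D`.
  let f : P →ₐ[k] SymmetricAlgebra A N ⧸ I ^ 2 :=
    { toFun := fun p => Ideal.Quotient.mk (I ^ 2) (algebraMap A (SymmetricAlgebra A N) (q p) + SymmetricAlgebra.ι A N (D p))
      map_one' := by
        have h1 : D 1 = 0 := by simpa using hDk 1
        simp [h1]
      map_zero' := by simp
      map_add' := fun p p' => by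
        simp only [map_add]
        ring
      map_mul' := fun p p' => by
        rw [← map_mul, Ideal.Quotient.eq, hDm, map_mul q, map_mul, map_add, map_smul, map_smul,
          Algebra.smul_def, Algebra.smul_def]
        have h : SymmetricAlgebra.ι A N (D p) * SymmetricAlgebra.ι A N (D p') ∈ I ^ 2 := by
          rw [pow_two]; exact Ideal.mul_mem_mul (hI _) (hI _)
        convert (Ideal.neg_mem_iff _).2 h using 1
        ring
      commutes' := fun r => by
        rw [hDk, AlgHom.commutes, map_zero, add_zero]
        rfl }
  -- Formal smoothness of `P` gives an expansion that is additive and multiplicative modulo degree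
  -- `m + 1`. Its component of degree `m` is the class map.
  obtain ⟨g, gadd, gmul, gf⟩ := exists_lift_mod I f (m + 1)
  have hsp : ∀ x y : SymmetricAlgebra A N, x - y ∈ I ^ (m + 1) → symProj (A := A) (N := N) m x = symProj m y :=
    fun x y h => by rw [← sub_eq_zero, ← map_sub]; exact symProj_eq_zero h
  refine ⟨AddMonoidHom.mk' (fun p => symProj (A := A) (N := N) m (g p)) fun p p' => ?_,
    fun c u => ?_⟩
  · rw [← map_add]; exact hsp _ _ (gadd p p')
  · change symProj (A := A) (N := N) m (g _) = _
    have gprod : ∀ s : Finset (Fin m),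
        g (c * ∏ i ∈ s, (u i : P)) - g c * ∏ i ∈ s, g (u i) ∈ I ^ (m + 1) := by
      intro s
      induction s using Finset.induction_on with
      | empty => simp
      | insert a s ha ih =>
        have h := gmul (c * ∏ i ∈ s, (u i : P)) (u a)
        have h' := Ideal.mul_mem_right (g (u a)) _ ih
        have h'' := Ideal.add_mem _ h h'
        rw [Finset.prod_insert ha, Finset.prod_insert ha, mul_comm (u a : P), ← mul_assoc]
        convert h'' using 1
        ring
    have hgc : g c - algebraMap A (SymmetricAlgebra A N) (q c) ∈ I := by
      have : g c - (algebraMap A (SymmetricAlgebra A N) (q c) + SymmetricAlgebra.ι A N (D c)) ∈ I ^ 2 :=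
        Ideal.Quotient.eq.1 (gf c)
      have := I.add_mem (Ideal.pow_le_self two_ne_zero this) (hI (D c))
      simpa [sub_add_eq_sub_sub] using this
    have hgu : ∀ i, g (u i) - SymmetricAlgebra.ι A N (δ (u i)) ∈ I ^ 2 := fun i => by
      have : g (u i) - (algebraMap A (SymmetricAlgebra A N) (q (u i)) + SymmetricAlgebra.ι A N (D (u i))) ∈ I ^ 2 :=
        Ideal.Quotient.eq.1 (gf (u i))
      rwa [RingHom.mem_ker.1 (u i).2, map_zero, zero_add, hDδ] at this
    obtain ⟨h1, h2⟩ := prod_sub_prod_mem I Finset.univ (fun i => g (u i))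
      (fun i => SymmetricAlgebra.ι A N (δ (u i))) (fun i => hI _) hgu
    rw [Finset.card_univ, Fintype.card_fin] at h1 h2
    rw [← symProj_prod, ← symProj_algebraMap_mul]
    refine hsp _ _ ?_
    -- Three errors of order `m + 1` are collected: from the multiplicativity of `g`, from replacing
    -- each `g (u i)` by `δ (u i)`, and from replacing `g c` by `q c` in front of a product of order
    -- `m`.
    have h3 : (g c - algebraMap A (SymmetricAlgebra A N) (q c)) * ∏ i, SymmetricAlgebra.ι A N (δ (u i)) ∈ I ^ (m + 1) := by
      rw [pow_succ']; exact Ideal.mul_mem_mul hgc h2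
    have h4 := Ideal.add_mem _ (Ideal.add_mem _ (gprod Finset.univ) (Ideal.mul_mem_left _ (g c) h1)) h3
    convert h4 using 1
    ring

end ClassMap

/-! ### The ideal sheaf, its stalks and its powers. -/

section IdealSheaf

variable {Y Z : Scheme.{0}} (ι : Z ⟶ Y)

/-- The map `𝒪_Y → ι_* 𝒪_Z`, as a morphism of sheaves of modules. -/
abbrev unitMap : (SheafOfModules.unit Y.ringCatSheaf : Y.Modules) ⟶
    ((Scheme.Modules.pushforward ι).obj (SheafOfModules.unit Z.ringCatSheaf) : Y.Modules) :=
  SheafOfModules.unitToPushforwardObjUnit ι.toRingCatSheafHom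

variable {ι} {U V : Y.Opens}

lemma idealFun_add (u u' : Γ(idealSheaf ι, U)) : idealFun ι (u + u') = idealFun ι u + idealFun ι u' :=
  map_add (Scheme.Modules.Hom.app (kernel.ι (C := Y.Modules) (unitMap ι)) U).hom u u'

lemma idealFun_zero : idealFun ι (0 : Γ(idealSheaf ι, U)) = 0 :=
  map_zero (Scheme.Modules.Hom.app (kernel.ι (C := Y.Modules) (unitMap ι)) U).hom

lemma idealFun_smul (r : Γ(Y, U)) (u : Γ(idealSheaf ι, U)) :
    idealFun ι (r • u) = r * idealFun ι u :=
  Scheme.Modules.Hom.app_smul (kernel.ι (C := Y.Modules) (unitMap ι)) r u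

lemma idealFun_rst (h : V ≤ U) (u : Γ(idealSheaf ι, U)) :
    idealFun ι (rst h u) = rstO h (idealFun ι u) :=
  app_rst (kernel.ι (C := Y.Modules) (unitMap ι)) h u

lemma idealFun_injective : Function.Injective (idealFun ι (U := U)) :=
  have : Mono (C := Y.Modules) (kernel.ι (C := Y.Modules) (unitMap ι)) := equalizer.ι_mono
  injective_of_mono (kernel.ι (C := Y.Modules) (unitMap ι)) U

lemma app_idealFun (u : Γ(idealSheaf ι, U)) : ι.app U (idealFun ι u) = 0 :=
  kernel_ι_app (unitMap ι) u

lemma exists_idealFun (f : Γ(Y, U)) (hf : ι.app U f = 0) :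
    ∃ u : Γ(idealSheaf ι, U), idealFun ι u = f :=
  exists_kernel_section (unitMap ι) f hf

lemma mem_inf_opens {y : Y} (h : y ∈ U) (h' : y ∈ V) : y ∈ U ⊓ V := ⟨h, h'⟩

lemma exists_germ {y : Y} (a : Y.presheaf.stalk y) : ∃ (W : Y.Opens) (hy : y ∈ W) (f : Γ(Y, W)),
    Y.presheaf.germ W y hy f = a := Y.presheaf.exists_germ_eq a

variable (ι) in
/-- The ideal of a closed subscheme in a local ring of the ambient scheme. -/
def stalkIdeal (y : Y) : Ideal (Y.presheaf.stalk y) where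
  carrier := {a | ∃ (W : Y.Opens) (hy : y ∈ W) (u : Γ(idealSheaf ι, W)),
    Y.presheaf.germ W y hy (idealFun ι u) = a}
  zero_mem' := ⟨⊤, trivial, 0, by rw [idealFun_zero, map_zero]⟩
  add_mem' := by
    rintro _ _ ⟨W, hy, u, rfl⟩ ⟨W', hy', u', rfl⟩
    refine ⟨W ⊓ W', mem_inf_opens hy hy', rst inf_le_left u + rst inf_le_right u', ?_⟩
    rw [idealFun_add, map_add, idealFun_rst, idealFun_rst, germ_rstO, germ_rstO]
  smul_mem' := by
    rintro r _ ⟨W, hy, u, rfl⟩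
    obtain ⟨W', hy', r, rfl⟩ := exists_germ r
    refine ⟨W ⊓ W', mem_inf_opens hy hy', (rstO inf_le_right r : Γ(Y, W ⊓ W')) •
      (rst inf_le_left u : Γ(idealSheaf ι, W ⊓ W')), ?_⟩
    rw [idealFun_smul, map_mul, idealFun_rst, germ_rstO, germ_rstO]
    rfl

lemma germ_idealFun_mem {y : Y} (hy : y ∈ U) (u : Γ(idealSheaf ι, U)) :
    Y.presheaf.germ U y hy (idealFun ι u) ∈ stalkIdeal ι y := ⟨U, hy, u, rfl⟩

lemma germ_mem_stalkIdeal {y : Y} (hy : y ∈ U) (f : Γ(Y, U)) (hf : ι.app U f = 0) :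
    Y.presheaf.germ U y hy f ∈ stalkIdeal ι y := by
  obtain ⟨u, rfl⟩ := exists_idealFun f hf
  exact germ_idealFun_mem hy u

/-- Over an open set missing the subscheme the function `1` lies in the ideal. All filtration
conditions are therefore vacuous away from the diagonal. -/
lemma stalkIdeal_eq_top {y : Y} (hy : y ∈ U) (hU : ι ⁻¹ᵁ U = ⊥) : stalkIdeal ι y = ⊤ := by
  refine (Ideal.eq_top_iff_one _).2 ?_
  rw [← map_one (Y.presheaf.germ U y hy).hom]
  refine germ_mem_stalkIdeal hy 1 ?_
  have : Subsingleton Γ(Z, ι ⁻¹ᵁ U) := by rw [hU]; infer_instance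
  exact Subsingleton.elim _ _

lemma stalkIdeal_le_ker (z : Z) : stalkIdeal ι (ι z) ≤ RingHom.ker (ι.stalkMap z).hom := by
  rintro _ ⟨W, hy, u, rfl⟩
  rw [RingHom.mem_ker]
  refine (Scheme.Hom.germ_stalkMap_apply ι W z hy _).trans ?_
  rw [app_idealFun, map_zero]

lemma exists_preimage_le [IsClosedImmersion ι] (z : Z) (O : Z.Opens) (hz : z ∈ O) (U : Y.Opens)
    (hU : ι z ∈ U) : ∃ W : Y.Opens, W ≤ U ∧ ι z ∈ W ∧ ι ⁻¹ᵁ W ≤ O := by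
  obtain ⟨W, hW, e⟩ := (IsClosedImmersion.isClosedEmbedding ι).isInducing.isOpen_iff.1 O.isOpen
  refine ⟨U ⊓ ⟨W, hW⟩, inf_le_left, ⟨hU, ?_⟩, fun x hx => ?_⟩
  · change z ∈ ι ⁻¹' W
    rw [e]; exact hz
  · have : x ∈ ι ⁻¹' W := hx.2
    rw [e] at this; exact this

/-- A function whose germ vanishes on the subscheme vanishes on a neighbourhood there, and for a
closed immersion such a neighbourhood contains the preimage of a neighbourhood in `Y`. -/
lemma stalkIdeal_eq_ker [IsClosedImmersion ι] (z : Z) :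
    stalkIdeal ι (ι z) = RingHom.ker (ι.stalkMap z).hom := by
  refine le_antisymm (stalkIdeal_le_ker z) fun a ha => ?_
  obtain ⟨W, hy, f, rfl⟩ := exists_germ a
  rw [RingHom.mem_ker] at ha
  have h0 : Z.presheaf.germ (ι ⁻¹ᵁ W) z hy (ι.app W f) = Z.presheaf.germ (ι ⁻¹ᵁ W) z hy 0 := by
    rw [map_zero]
    exact (Scheme.Hom.germ_stalkMap_apply ι W z hy _).symm.trans ha
  obtain ⟨O, hO, i₁, i₂, h⟩ := TopCat.Presheaf.germ_eq Z.presheaf z hy hy _ _ h0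
  obtain ⟨W', hW', hz, hle⟩ := exists_preimage_le z O hO W hy
  rw [← germ_rstO hW' hz]
  refine germ_mem_stalkIdeal hz _ ?_
  have h1 := ConcreteCategory.congr_hom (ι.naturality (homOfLE hW').op) f
  refine h1.trans ?_
  have h2 : rstO hle (Z.presheaf.map i₁.op (ι.app W f)) = rstO hle (Z.presheaf.map i₂.op 0) := by
    rw [h]
  rw [map_zero, ← rstHom_apply, ← rstHom_apply, map_zero] at h2
  refine Eq.trans ?_ h2
  exact (rstO_rstO (Y := Z) i₁.le hle (ι.app W f)).symm

variable (ι) in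
/-- The functions on `U` which are sums of products `c u_1 ⋯ u_m` with `u_p` in the ideal. -/
def powFun (m : ℕ) (U : Y.Opens) : AddSubgroup Γ(Y, U) :=
  AddSubgroup.closure {F | ∃ (c : Γ(Y, U)) (u : Fin m → Γ(idealSheaf ι, U)),
    F = c * ∏ p, idealFun ι (u p)}

lemma rstO_mem_powFun {m : ℕ} (h : V ≤ U) {F : Γ(Y, U)} (hF : F ∈ powFun ι m U) :
    rstO h F ∈ powFun ι m V := by
  induction hF using AddSubgroup.closure_induction with
  | mem F hF =>
    obtain ⟨c, u, rfl⟩ := hF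
    refine AddSubgroup.subset_closure ⟨rstO h c, fun p => rst h (u p), ?_⟩
    rw [← rstHom_apply, map_mul, map_prod]
    simp only [rstHom_apply, idealFun_rst]
  | zero => rw [← rstHom_apply, map_zero]; exact zero_mem _
  | add F F' _ _ h h' => rw [← rstHom_apply, map_add]; exact add_mem h h'
  | neg F _ h => rw [← rstHom_apply, map_neg]; exact neg_mem h

lemma germ_mem_of_powFun {m : ℕ} {y : Y} (hy : y ∈ U) {F : Γ(Y, U)} (hF : F ∈ powFun ι m U) :
    Y.presheaf.germ U y hy F ∈ stalkIdeal ι y ^ m := by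
  induction hF using AddSubgroup.closure_induction with
  | mem F hF =>
    obtain ⟨c, u, rfl⟩ := hF
    rw [map_mul, map_prod]
    refine Ideal.mul_mem_left _ _ ?_
    have := Ideal.prod_mem_prod (s := Finset.univ) (I := fun _ : Fin m => stalkIdeal ι y)
      fun p _ => germ_idealFun_mem hy (u p)
    simpa using this
  | zero => rw [map_zero]; exact zero_mem _
  | add F F' _ _ h h' => rw [map_add]; exact add_mem h h'
  | neg F _ h => rw [map_neg]; exact neg_mem h

lemma mul_idealFun_mem_powFun {m : ℕ} {F : Γ(Y, U)} (hF : F ∈ powFun ι m U)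
    (u : Γ(idealSheaf ι, U)) : F * idealFun ι u ∈ powFun ι (m + 1) U := by
  induction hF using AddSubgroup.closure_induction with
  | mem F hF =>
    obtain ⟨c, v, rfl⟩ := hF
    refine AddSubgroup.subset_closure ⟨c, Fin.cons u v, ?_⟩
    rw [Fin.prod_univ_succ, Fin.cons_zero]
    simp only [Fin.cons_succ]
    ring
  | zero => rw [zero_mul]; exact zero_mem _
  | add F F' _ _ h h' => rw [add_mul]; exact add_mem h h'
  | neg F _ h => rw [neg_mul]; exact neg_mem h

lemma exists_powFun_germ {m : ℕ} {y : Y} {a : Y.presheaf.stalk y} (ha : a ∈ stalkIdeal ι y ^ m) :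
    ∃ (W : Y.Opens) (hy : y ∈ W) (F : Γ(Y, W)), F ∈ powFun ι m W ∧ Y.presheaf.germ W y hy F = a := by
  induction m generalizing a with
  | zero =>
    obtain ⟨W, hy, f, rfl⟩ := exists_germ a
    exact ⟨W, hy, f, AddSubgroup.subset_closure ⟨f, Fin.elim0, by simp⟩, rfl⟩
  | succ m ih =>
    rw [pow_succ] at ha
    induction ha using Submodule.mul_induction_on' with
    | mem_mul_mem a ha b hb =>
      obtain ⟨W, hy, F, hF, rfl⟩ := ih ha
      obtain ⟨W', hy', u, rfl⟩ := hb
      refine ⟨W ⊓ W', mem_inf_opens hy hy', rstO inf_le_left F * idealFun ι (rst inf_le_right u),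
        mul_idealFun_mem_powFun (rstO_mem_powFun _ hF) _, ?_⟩
      rw [map_mul, idealFun_rst, germ_rstO, germ_rstO]
    | add a _ b _ ha hb =>
      obtain ⟨W, hy, F, hF, rfl⟩ := ha
      obtain ⟨W', hy', F', hF', rfl⟩ := hb
      refine ⟨W ⊓ W', mem_inf_opens hy hy', rstO inf_le_left F + rstO inf_le_right F',
        add_mem (rstO_mem_powFun _ hF) (rstO_mem_powFun _ hF'), ?_⟩
      rw [map_add, germ_rstO, germ_rstO]

lemma exists_rstO_mem_powFun {m : ℕ} {y : Y} (hy : y ∈ U) {F : Γ(Y, U)}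
    (hF : Y.presheaf.germ U y hy F ∈ stalkIdeal ι y ^ m) :
    ∃ (W : Y.Opens) (h : W ≤ U), y ∈ W ∧ rstO h F ∈ powFun ι m W := by
  obtain ⟨W, hy', F', hF', e⟩ := exists_powFun_germ hF
  obtain ⟨O, hO, i₁, i₂, h⟩ := TopCat.Presheaf.germ_eq Y.presheaf y hy hy' _ _ e.symm
  refine ⟨O, i₁.le, hO, ?_⟩
  have h' : rstO i₁.le F = rstO i₂.le F' := h
  rw [h']
  exact rstO_mem_powFun _ hF'

end IdealSheaf

/-! ### The sheaves `ι_*(S^m(I/I²) ⊗ Q)` and class maps on affine open sets. -/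

section ClassSheaf

variable {Y Z : Scheme.{0}} (ι : Z ⟶ Y)

/-- A closed immersion for which the classes in `I^m / I^{m+1}` of functions in `I^m` define sections
of `S^m(I/I²)`. -/
structure HasClassMap : Prop where
  closed : IsClosedImmersion ι
  cl (m : ℕ) (W : Y.Opens) (hW : IsAffineOpen W) :
    ∃ Cl : Γ(Y, W) →+ (symPow m (pre (conormal ι))).obj (op (ι ⁻¹ᵁ W)),
      ∀ (c : Γ(Y, W)) (u : Fin m → Γ(idealSheaf ι, W)),
        Cl (c * ∏ p, idealFun ι (u p)) = (show (OO Z).obj (op (ι ⁻¹ᵁ W)) from ι.app W c) •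
          symProd (pre (conormal ι)) (U := op (ι ⁻¹ᵁ W))
            (fun p => pull ι (idealSheaf ι) (u p) le_rfl)

/-- Over an affine open set both coordinate rings are smooth over the base ring and restriction is
surjective, so `exists_classMap` applies with `δ` the map to the sections of the conormal sheaf. -/
lemma hasClassMap_of_smooth {S : Scheme.{0}} (hS : IsAffineOpen (⊤ : S.Opens)) (sY : Y ⟶ S)
    [Smooth sY] (hZ : Smooth (ι ≫ sY)) [IsClosedImmersion ι] : HasClassMap ι where
  closed := inferInstance
  cl m W hW := by
    let P : Type := Γ(Y, W)
    let A : Type := Γ(Z, ι ⁻¹ᵁ W)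
    let k : Type := Γ(S, ⊤)
    let _ : Algebra k P := (sY.appLE ⊤ W le_top).hom.toAlgebra
    let _ : Algebra k A := ((ι ≫ sY).appLE ⊤ (ι ⁻¹ᵁ W) le_top).hom.toAlgebra
    have hP : Algebra.Smooth k P := sY.smooth_appLE hS hW le_top
    have hA : Algebra.Smooth k A := (ι ≫ sY).smooth_appLE hS (hW.preimage ι) le_top
    have := hP.formallySmooth
    have := hA.formallySmooth
    let q : P →ₐ[k] A :=
      { (ι.app W).hom with
        commutes' := fun r => by
          have h := Scheme.Hom.appLE_comp_appLE ι sY ⊤ W (ι ⁻¹ᵁ W) le_top le_rfl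
          rw [← Scheme.Hom.app_eq_appLE] at h
          exact ConcreteCategory.congr_hom h r }
    have hq : Function.Surjective q := ι.app_surjective W hW
    -- Elements of the kernel ideal of the coordinate rings correspond to unique sections of the
    -- ideal sheaf, by injectivity of `idealFun`; hence `δ` is additive and semilinear.
    choose lift hlift using fun u : RingHom.ker q => exists_idealFun (ι := ι) (U := W) u.1 u.2
    let δ : RingHom.ker q →+ Γ(conormal ι, ι ⁻¹ᵁ W) := AddMonoidHom.mk'
      (fun u => pull ι (idealSheaf ι) (lift u) le_rfl) fun u u' => by
        refine Eq.trans (congrArg (fun v => pull ι (idealSheaf ι) v le_rfl) ?_)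
          (pull_add ι le_rfl (lift u) (lift u'))
        exact idealFun_injective (by rw [idealFun_add, hlift, hlift, hlift]; rfl)
    have hδ : ∀ (p : P) (u : RingHom.ker q), δ (p • u) = (show Γ(Z, ι ⁻¹ᵁ W) from q p) • δ u := by
      intro p u
      have e : lift (p • u) = (show Γ(Y, W) from p) • lift u :=
        idealFun_injective (by rw [idealFun_smul, hlift, hlift]; rfl)
      change pull ι (idealSheaf ι) (lift (p • u)) le_rfl = _
      rw [e, pull_smul, ← Scheme.Hom.app_eq_appLE]
      rfl
    obtain ⟨Cl, hCl⟩ := exists_classMap (k := k) (P := P) (A := A) (N := Γ(conormal ι, ι ⁻¹ᵁ W))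
      q δ hq hδ m
    refine ⟨Cl, fun c u => ?_⟩
    have hu : ∀ p, idealFun ι (u p) ∈ RingHom.ker q := fun p => app_idealFun (u p)
    have hl : ∀ p, lift ⟨_, hu p⟩ = u p := fun p => idealFun_injective (hlift _)
    refine (hCl c fun p => ⟨_, hu p⟩).trans ?_
    refine congrArg (fun v => (show (OO Z).obj (op (ι ⁻¹ᵁ W)) from ι.app W c) •
      symProd (pre (conormal ι)) (U := op (ι ⁻¹ᵁ W)) v) (funext fun p => ?_)
    exact congrArg (fun v => pull ι (idealSheaf ι) v le_rfl) (hl p)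

variable (m : ℕ) (Q : PreMod Z)

/-- The presheaf `S^m(I/I²) ⊗ Q`. -/
abbrev HSPre : PreMod Z := tensorObj (C := PreMod Z) (symPow m (pre (conormal ι))) Q

/-- The sheaf `ι_*(S^m(I/I²) ⊗ Q)`. -/
def HS : Y.Modules := (Scheme.Modules.pushforward ι).obj (shf (HSPre ι m Q))

variable {ι m Q} {U V W : Y.Opens}

/-- The section `x ⊗ w`. -/
def hten (x : (symPow m (pre (conormal ι))).obj (op (ι ⁻¹ᵁ W))) (w : Q.obj (op (ι ⁻¹ᵁ W))) :
    Γ(HS ι m Q, W) :=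
  toShf (HSPre ι m Q) (x ⊗ₜ[(OO Z).obj (op (ι ⁻¹ᵁ W))] w)

/-- The section `u_1 ⋯ u_m ⊗ w`. -/
def hgen (u : Fin m → Γ(idealSheaf ι, W)) (w : Q.obj (op (ι ⁻¹ᵁ W))) : Γ(HS ι m Q, W) :=
  hten (symProd (pre (conormal ι)) (U := op (ι ⁻¹ᵁ W))
    fun p => pull ι (idealSheaf ι) (u p) le_rfl) w

lemma hten_add_left (x x' : (symPow m (pre (conormal ι))).obj (op (ι ⁻¹ᵁ W)))
    (w : Q.obj (op (ι ⁻¹ᵁ W))) : hten (x + x') w = hten x w + hten x' w := by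
  refine Eq.trans (congrArg (toShf _) ?_) (toShf_add (HSPre ι m Q) _ _)
  exact TensorProduct.add_tmul x x' w

lemma hten_add_right (x : (symPow m (pre (conormal ι))).obj (op (ι ⁻¹ᵁ W)))
    (w w' : Q.obj (op (ι ⁻¹ᵁ W))) : hten x (w + w') = hten x w + hten x w' := by
  refine Eq.trans (congrArg (toShf _) ?_) (toShf_add (HSPre ι m Q) _ _)
  exact TensorProduct.tmul_add x w w'

lemma hten_zero_left (w : Q.obj (op (ι ⁻¹ᵁ W))) :
    hten (0 : (symPow m (pre (conormal ι))).obj (op (ι ⁻¹ᵁ W))) w = 0 := by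
  refine Eq.trans (congrArg (toShf _) ?_) (toShf_zero (HSPre ι m Q))
  exact TensorProduct.zero_tmul _ w

lemma hten_zero_right (x : (symPow m (pre (conormal ι))).obj (op (ι ⁻¹ᵁ W))) :
    hten x (0 : Q.obj (op (ι ⁻¹ᵁ W))) = 0 := by
  refine Eq.trans (congrArg (toShf _) ?_) (toShf_zero (HSPre ι m Q))
  exact TensorProduct.tmul_zero _ x

lemma hten_smul_left (r : Γ(Y, W)) (x : (symPow m (pre (conormal ι))).obj (op (ι ⁻¹ᵁ W)))
    (w : Q.obj (op (ι ⁻¹ᵁ W))) :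
    hten ((show (OO Z).obj (op (ι ⁻¹ᵁ W)) from ι.app W r) • x) w = r • hten x w := by
  refine Eq.trans (congrArg (toShf _) ?_) (toShf_smul (HSPre ι m Q) (ι.app W r) _)
  exact (TensorProduct.smul_tmul' (R := (OO Z).obj (op (ι ⁻¹ᵁ W)))
    (show (OO Z).obj (op (ι ⁻¹ᵁ W)) from ι.app W r) x w).symm

lemma hten_smul_right (r : Γ(Y, W)) (x : (symPow m (pre (conormal ι))).obj (op (ι ⁻¹ᵁ W)))
    (w : Q.obj (op (ι ⁻¹ᵁ W))) :
    hten x ((show (OO Z).obj (op (ι ⁻¹ᵁ W)) from ι.app W r) • w) = r • hten x w := by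
  refine Eq.trans (congrArg (toShf _) ?_) (toShf_smul (HSPre ι m Q) (ι.app W r) _)
  exact TensorProduct.tmul_smul (R := (OO Z).obj (op (ι ⁻¹ᵁ W)))
    (show (OO Z).obj (op (ι ⁻¹ᵁ W)) from ι.app W r) x w

lemma preim_le (h : V ≤ W) : ι ⁻¹ᵁ V ≤ ι ⁻¹ᵁ W := fun _ hx => h hx

variable (ι) in
/-- Restriction of sections of `Q` over preimages. -/
def rQ {Q : PreMod Z} (h : V ≤ W) (w : Q.obj (op (ι ⁻¹ᵁ W))) : Q.obj (op (ι ⁻¹ᵁ V)) :=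
  Q.restrictₛₗ (homOfLE (preim_le h)).op w

lemma rQ_rQ (h : V ≤ W) (h' : U ≤ V) (w : Q.obj (op (ι ⁻¹ᵁ W))) :
    rQ ι h' (rQ ι h w) = rQ ι (h'.trans h) w :=
  (res_comp Q (homOfLE (preim_le h)).op (homOfLE (preim_le h')).op w).symm

lemma rQ_add (h : V ≤ W) (w w' : Q.obj (op (ι ⁻¹ᵁ W))) :
    rQ ι h (w + w') = rQ ι h w + rQ ι h w' := map_add (Q.restrictₛₗ _) w w'

lemma rQ_zero (h : V ≤ W) : rQ ι h (0 : Q.obj (op (ι ⁻¹ᵁ W))) = 0 := map_zero (Q.restrictₛₗ _)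

lemma rQ_smul (h : V ≤ W) (r : Γ(Y, W)) (w : Q.obj (op (ι ⁻¹ᵁ W))) :
    rQ ι h ((show (OO Z).obj (op (ι ⁻¹ᵁ W)) from ι.app W r) • w) =
      (show (OO Z).obj (op (ι ⁻¹ᵁ V)) from ι.app V (rstO h r)) • rQ ι h w := by
  refine ((Q.restrictₛₗ (homOfLE (preim_le h)).op).map_smulₛₗ _ w).trans ?_
  refine congrArg (fun a : (OO Z).obj (op (ι ⁻¹ᵁ V)) => a • rQ ι h w) ?_
  exact (ConcreteCategory.congr_hom (ι.naturality (homOfLE h).op) r).symm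

lemma rst_hten (h : V ≤ W) (x : (symPow m (pre (conormal ι))).obj (op (ι ⁻¹ᵁ W)))
    (w : Q.obj (op (ι ⁻¹ᵁ W))) : rst h (hten x w) =
      hten ((symPow m (pre (conormal ι))).restrictₛₗ (homOfLE (preim_le h)).op x) (rQ ι h w) :=
  toShf_rst (HSPre ι m Q) (preim_le h) _

lemma rst_hgen (h : V ≤ W) (u : Fin m → Γ(idealSheaf ι, W)) (w : Q.obj (op (ι ⁻¹ᵁ W))) :
    rst h (hgen u w) = hgen (fun p => rst h (u p)) (rQ ι h w) := by
  refine (rst_hten h _ w).trans (congrArg (fun x => hten x (rQ ι h w)) ?_)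
  refine (congrArg (SymmetricPower.mk _ _ _) (piMap_tprod _ _ _)).trans ?_
  refine congrArg (symProd (pre (conormal ι)) (U := op (ι ⁻¹ᵁ V))) (funext fun p => ?_)
  refine (rst_pull ι le_rfl (preim_le h) (u p)).trans ?_
  rw [pull_rst]

end ClassSheaf

/-! ### The class relation between functions in `I^m` and sections of `ι_*(S^m(I/I²) ⊗ Q)`. -/

section Classes

variable {Y Z : Scheme.{0}} {ι : Z ⟶ Y} {m : ℕ} {Q : PreMod Z} {U V W : Y.Opens}

/-- The pairs of a function `∑ c u_1 ⋯ u_m` and the section `∑ c [u_1] ⋯ [u_m] ⊗ w`. -/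
def clPairs (m : ℕ) (w : Q.obj (op (ι ⁻¹ᵁ W))) : AddSubgroup (Γ(Y, W) × Γ(HS ι m Q, W)) :=
  AddSubgroup.closure {a | ∃ (c : Γ(Y, W)) (u : Fin m → Γ(idealSheaf ι, W)),
    a = (c * ∏ p, idealFun ι (u p), c • hgen u w)}

lemma clPairs_induction {w : Q.obj (op (ι ⁻¹ᵁ W))} {p : Γ(Y, W) → Γ(HS ι m Q, W) → Prop}
    (hgen : ∀ (c : Γ(Y, W)) (u : Fin m → Γ(idealSheaf ι, W)),
      p (c * ∏ p, idealFun ι (u p)) (c • hgen u w)) (hzero : p 0 0)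
    (hadd : ∀ F F' h h', p F h → p F' h' → p (F + F') (h + h'))
    {F : Γ(Y, W)} {h : Γ(HS ι m Q, W)} (hF : (F, h) ∈ clPairs m w) : p F h := by
  have key : ∀ a ∈ clPairs m w, p a.1 a.2 ∧ p (-a.1) (-a.2) := fun a ha => by
    induction ha using AddSubgroup.closure_induction with
    | mem a ha =>
      obtain ⟨c, u, rfl⟩ := ha
      refine ⟨hgen c u, ?_⟩
      have := hgen (-c) u
      rwa [neg_mul, neg_smul] at this
    | zero => exact ⟨hzero, by simpa using hzero⟩
    | add a b _ _ ha hb =>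
      exact ⟨hadd _ _ _ _ ha.1 hb.1, by
        have := hadd _ _ _ _ ha.2 hb.2
        rwa [← neg_add, ← neg_add] at this⟩
    | neg a _ ha => exact ⟨ha.2, by simpa using ha.1⟩
  exact (key _ hF).1

lemma gen_mem_clPairs (w : Q.obj (op (ι ⁻¹ᵁ W))) (c : Γ(Y, W))
    (u : Fin m → Γ(idealSheaf ι, W)) :
    (c * ∏ p, idealFun ι (u p), c • hgen u w) ∈ clPairs m w :=
  AddSubgroup.subset_closure ⟨c, u, rfl⟩

lemma exists_sum_of_clPairs {w : Q.obj (op (ι ⁻¹ᵁ W))} {F : Γ(Y, W)} {h : Γ(HS ι m Q, W)}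
    (hF : (F, h) ∈ clPairs m w) : ∃ (N : ℕ) (c : Fin N → Γ(Y, W))
      (u : Fin N → Fin m → Γ(idealSheaf ι, W)),
      F = ∑ ν, c ν * ∏ p, idealFun ι (u ν p) ∧ h = ∑ ν, c ν • hgen (u ν) w := by
  refine clPairs_induction (p := fun F h => ∃ (N : ℕ) (c : Fin N → Γ(Y, W))
      (u : Fin N → Fin m → Γ(idealSheaf ι, W)),
      F = ∑ ν, c ν * ∏ p, idealFun ι (u ν p) ∧ h = ∑ ν, c ν • hgen (u ν) w)
    (fun c u => ?_) ?_ (fun F F' h h' ha hb => ?_) hF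
  · exact ⟨1, fun _ => c, fun _ => u, by simp, by simp⟩
  · exact ⟨0, Fin.elim0, Fin.elim0, by simp, by simp⟩
  · obtain ⟨N, c, u, rfl, rfl⟩ := ha
    obtain ⟨N', c', u', rfl, rfl⟩ := hb
    refine ⟨N + N', Fin.append c c', Fin.append u u', ?_, ?_⟩ <;>
      simp [Fin.sum_univ_add]

lemma sum_mem_clPairs (w : Q.obj (op (ι ⁻¹ᵁ W))) {κ : Type} (s : Finset κ) (c : κ → Γ(Y, W))
    (u : κ → Fin m → Γ(idealSheaf ι, W)) :
    (∑ ν ∈ s, c ν * ∏ p, idealFun ι (u ν p), ∑ ν ∈ s, c ν • hgen (u ν) w) ∈ clPairs m w := by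
  have : (∑ ν ∈ s, c ν * ∏ p, idealFun ι (u ν p), ∑ ν ∈ s, c ν • hgen (u ν) w) =
      ∑ ν ∈ s, (c ν * ∏ p, idealFun ι (u ν p), c ν • hgen (u ν) w) := by
    rw [Prod.ext_iff, Prod.fst_sum, Prod.snd_sum]
    exact ⟨rfl, rfl⟩
  rw [this]
  exact sum_mem fun ν _ => gen_mem_clPairs w (c ν) (u ν)

lemma rst_mem_clPairs {w : Q.obj (op (ι ⁻¹ᵁ W))} {F : Γ(Y, W)} {h : Γ(HS ι m Q, W)}
    (hF : (F, h) ∈ clPairs m w) (hV : V ≤ W) : (rstO hV F, rst hV h) ∈ clPairs m (rQ ι hV w) := by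
  refine clPairs_induction (p := fun F h => (rstO hV F, rst hV h) ∈ clPairs m (rQ ι hV w))
    (fun c u => ?_) ?_ (fun F F' h h' ha hb => ?_) hF
  · have := gen_mem_clPairs (rQ ι hV w) (rstO hV c) fun p => rst hV (u p)
    rw [← rst_hgen, ← rst_smul] at this
    simp only [idealFun_rst] at this
    convert this using 2
    rw [← rstHom_apply, map_mul, map_prod]
    rfl
  · rw [rst_zero, rstO_zero]; exact zero_mem _
  · rw [rst_add, rstO_add]; exact add_mem ha hb

lemma smul_mem_clPairs {w : Q.obj (op (ι ⁻¹ᵁ W))} {F : Γ(Y, W)} {h : Γ(HS ι m Q, W)}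
    (hF : (F, h) ∈ clPairs m w) (r : Γ(Y, W)) : (r * F, r • h) ∈ clPairs m w := by
  refine clPairs_induction (p := fun F h => (r * F, r • h) ∈ clPairs m w)
    (fun c u => ?_) ?_ (fun F F' h h' ha hb => ?_) hF
  · rw [← mul_assoc, ← mul_smul]; exact gen_mem_clPairs w (r * c) u
  · rw [mul_zero, smul_zero]; exact zero_mem _
  · rw [mul_add, smul_add]; exact add_mem ha hb

lemma powFun_of_clPairs {w : Q.obj (op (ι ⁻¹ᵁ W))} {F : Γ(Y, W)} {h : Γ(HS ι m Q, W)}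
    (hF : (F, h) ∈ clPairs m w) : F ∈ powFun ι m W := by
  refine clPairs_induction (p := fun F _ => F ∈ powFun ι m W)
    (fun c u => ?_) ?_ (fun F F' h h' ha hb => ?_) hF
  · exact AddSubgroup.subset_closure ⟨c, u, rfl⟩
  · exact zero_mem _
  · exact add_mem ha hb

lemma exists_clPairs_of_powFun (w : Q.obj (op (ι ⁻¹ᵁ W))) {F : Γ(Y, W)}
    (hF : F ∈ powFun ι m W) : ∃ h, (F, h) ∈ clPairs m w := by
  induction hF using AddSubgroup.closure_induction with
  | mem F hF =>
    obtain ⟨c, u, rfl⟩ := hF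
    exact ⟨_, gen_mem_clPairs w c u⟩
  | zero => exact ⟨0, zero_mem _⟩
  | add F F' _ _ h h' =>
    obtain ⟨h, hh⟩ := h
    obtain ⟨h', hh'⟩ := h'
    exact ⟨_, add_mem hh hh'⟩
  | neg F _ h =>
    obtain ⟨h, hh⟩ := h
    exact ⟨_, neg_mem hh⟩

lemma idealFun_smul_eq_zero (u : Γ(idealSheaf ι, W)) (h : Γ(HS ι m Q, W)) :
    idealFun ι u • h = 0 := by
  have e : idealFun ι u • h = (show Γ(HS ι m Q, W) from
    (ι.app W (idealFun ι u) • (show Γ(shf (HSPre ι m Q), ι ⁻¹ᵁ W) from h))) := rfl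
  rw [e, app_idealFun, zero_smul]
  rfl

/-- In a product of `m + 1` elements of the ideal one factor can be moved into the coefficient, and
the ideal annihilates sections pushed forward from the subscheme. -/
lemma zero_mem_clPairs_of_powFun_succ (w : Q.obj (op (ι ⁻¹ᵁ W))) {F : Γ(Y, W)}
    (hF : F ∈ powFun ι (m + 1) W) : (F, (0 : Γ(HS ι m Q, W))) ∈ clPairs m w := by
  induction hF using AddSubgroup.closure_induction with
  | mem F hF =>
    obtain ⟨c, u, rfl⟩ := hF
    have := smul_mem_clPairs (gen_mem_clPairs w (idealFun ι (u 0)) fun p => u p.succ) c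
    rw [idealFun_smul_eq_zero, smul_zero, ← Fin.prod_univ_succ fun p => idealFun ι (u p)] at this
    exact this
  | zero => exact zero_mem _
  | add F F' _ _ h h' => simpa using add_mem h h'
  | neg F _ h => simpa using neg_mem h

/-- The section `h` is the class of the function `F` in `I^m`, tensored with `w`. -/
def IsCl (w : Q.obj (op (ι ⁻¹ᵁ W))) (F : Γ(Y, W)) (h : Γ(HS ι m Q, W)) : Prop :=
  ∀ y ∈ W, ∃ (W' : Y.Opens) (hW : W' ≤ W), y ∈ W' ∧
    (rstO hW F, rst hW h) ∈ clPairs m (rQ ι hW w)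

namespace IsCl

variable {w w' : Q.obj (op (ι ⁻¹ᵁ W))} {F F' : Γ(Y, W)} {h h' : Γ(HS ι m Q, W)}

lemma of_clPairs (hF : (F, h) ∈ clPairs m w) : IsCl w F h :=
  fun _ hy => ⟨W, le_rfl, hy, rst_mem_clPairs hF le_rfl⟩

lemma rst (hF : IsCl w F h) (hV : V ≤ W) :
    IsCl (rQ ι hV w) (rstO hV F) (LongDiag.rst hV h) := fun y hy => by
  obtain ⟨W', hW, hy', hc⟩ := hF y (hV hy)
  refine ⟨W' ⊓ V, inf_le_right, ⟨hy', hy⟩, ?_⟩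
  have := rst_mem_clPairs hc (inf_le_left : W' ⊓ V ≤ W')
  rw [rstO_rstO, rst_rst, rQ_rQ] at this ⊢
  exact this

lemma exists_affine (hF : IsCl w F h) (hF' : IsCl w' F' h') {y : Y} (hy : y ∈ W) :
    ∃ (W' : Y.Opens) (hW : W' ≤ W), y ∈ W' ∧ IsAffineOpen W' ∧
      (rstO hW F, LongDiag.rst hW h) ∈ clPairs m (rQ ι hW w) ∧
      (rstO hW F', LongDiag.rst hW h') ∈ clPairs m (rQ ι hW w') := by
  obtain ⟨W₁, hW₁, hy₁, h₁⟩ := hF y hy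
  obtain ⟨W₂, hW₂, hy₂, h₂⟩ := hF' y hy
  obtain ⟨W', hW', hy', hle⟩ := exists_isAffineOpen_mem_and_subset (X := Y) (x := y) (U := W₁ ⊓ W₂)
    ⟨hy₁, hy₂⟩
  have hle : W' ≤ W₁ ⊓ W₂ := hle
  refine ⟨W', (hle.trans inf_le_left).trans hW₁, hy', hW', ?_, ?_⟩
  · have := rst_mem_clPairs h₁ (hle.trans inf_le_left)
    rwa [rstO_rstO, rst_rst, rQ_rQ] at this
  · have := rst_mem_clPairs h₂ (hle.trans inf_le_right)
    rwa [rstO_rstO, rst_rst, rQ_rQ] at this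

lemma zero : IsCl w 0 (0 : Γ(HS ι m Q, W)) := of_clPairs (zero_mem _)

lemma add (hF : IsCl w F h) (hF' : IsCl w F' h') : IsCl w (F + F') (h + h') := fun y hy => by
  obtain ⟨W', hW, hy', _, h₁, h₂⟩ := exists_affine hF hF' hy
  refine ⟨W', hW, hy', ?_⟩
  rw [rst_add, rstO_add]
  exact add_mem h₁ h₂

lemma smul (hF : IsCl w F h) (r : Γ(Y, W)) : IsCl w (r * F) (r • h) := fun y hy => by
  obtain ⟨W', hW, hy', h₁⟩ := hF y hy
  refine ⟨W', hW, hy', ?_⟩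
  rw [rst_smul, rstO_mul]
  exact smul_mem_clPairs h₁ _

lemma neg (hF : IsCl w F h) : IsCl w (-F) (-h) := by simpa using hF.smul (-1)

lemma sub (hF : IsCl w F h) (hF' : IsCl w F' h') : IsCl w (F - F') (h - h') := by
  rw [sub_eq_add_neg, sub_eq_add_neg]; exact hF.add hF'.neg

lemma sum {κ : Type} (s : Finset κ) {F : κ → Γ(Y, W)} {h : κ → Γ(HS ι m Q, W)}
    (hF : ∀ a ∈ s, IsCl w (F a) (h a)) : IsCl w (∑ a ∈ s, F a) (∑ a ∈ s, h a) := by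
  classical
  induction s using Finset.induction_on with
  | empty => exact zero
  | insert a s ha ih =>
    rw [Finset.sum_insert ha, Finset.sum_insert ha]
    exact (hF a (Finset.mem_insert_self _ _)).add (ih fun b hb => hF b (Finset.mem_insert_of_mem hb))

lemma germ_mem (hF : IsCl w F h) {y : Y} (hy : y ∈ W) :
    Y.presheaf.germ W y hy F ∈ stalkIdeal ι y ^ m := by
  obtain ⟨W', hW, hy', h₁⟩ := hF y hy
  rw [← germ_rstO hW hy']
  exact germ_mem_of_powFun hy' (powFun_of_clPairs h₁)

lemma of_germ_mem_succ (hF : ∀ y (hy : y ∈ W), Y.presheaf.germ W y hy F ∈ stalkIdeal ι y ^ (m + 1)) :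
    IsCl w F (0 : Γ(HS ι m Q, W)) := fun y hy => by
  obtain ⟨W', hW, hy', h₁⟩ := exists_rstO_mem_powFun hy (hF y hy)
  refine ⟨W', hW, hy', ?_⟩
  rw [rst_zero]
  exact zero_mem_clPairs_of_powFun_succ _ h₁

variable (hι : HasClassMap ι)
include hι

/-- One map `Cl` serves every `w` at once. Writing the class as `Cl F ⊗ w` makes it visibly unique
and linear in `w`. -/
lemma exists_eq_hten (hW : IsAffineOpen W) (m : ℕ) : ∃ Cl : Γ(Y, W) →+
    (symPow m (pre (conormal ι))).obj (op (ι ⁻¹ᵁ W)), ∀ (w : Q.obj (op (ι ⁻¹ᵁ W))) (F) (h),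
      (F, h) ∈ clPairs m w → h = hten (Cl F) w := by
  obtain ⟨Cl, hCl⟩ := hι.cl m W hW
  refine ⟨Cl, fun w F h hF => ?_⟩
  refine clPairs_induction (p := fun F h => h = hten (Cl F) w)
    (fun c u => ?_) ?_ (fun F F' h h' ha hb => ?_) hF
  · rw [hCl, hten_smul_left]; rfl
  · rw [map_zero, hten_zero_left]
  · rw [map_add, hten_add_left, ha, hb]

lemma unique (hF : IsCl w F h) (hF' : IsCl w F h') : h = h' := by
  refine section_ext fun y hy => ?_
  obtain ⟨W', hW, hy', ha, h₁, h₂⟩ := exists_affine hF hF' hy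
  obtain ⟨Cl, hCl⟩ := exists_eq_hten (Q := Q) hι ha m
  exact ⟨W', hW, hy', (hCl _ _ _ h₁).trans (hCl _ _ _ h₂).symm⟩

/-- The definition fixes `w`, so additivity in `w` is not formal: the presentations of `F` used for
`w` and `w'` may differ. The form `Cl F ⊗ w` removes this dependence. -/
lemma add_right (hF : IsCl w F h) (hF' : IsCl w' F h') : IsCl (w + w') F (h + h') := fun y hy => by
  obtain ⟨W', hW, hy', ha, h₁, h₂⟩ := exists_affine hF hF' hy
  obtain ⟨Cl, hCl⟩ := exists_eq_hten (Q := Q) hι ha m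
  obtain ⟨h'', h₃⟩ := exists_clPairs_of_powFun (rQ ι hW (w + w')) (powFun_of_clPairs h₁)
  refine ⟨W', hW, hy', ?_⟩
  rw [rst_add, hCl _ _ _ h₁, hCl _ _ _ h₂, ← hten_add_right, ← rQ_add, ← hCl _ _ _ h₃]
  exact h₃

lemma smul_right (hF : IsCl w F h) (r : Γ(Y, W)) :
    IsCl ((show (OO Z).obj (op (ι ⁻¹ᵁ W)) from ι.app W r) • w) F (r • h) := fun y hy => by
  obtain ⟨W', hW, hy', ha, h₁, -⟩ := exists_affine hF hF hy
  obtain ⟨Cl, hCl⟩ := exists_eq_hten (Q := Q) hι ha m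
  obtain ⟨h'', h₃⟩ := exists_clPairs_of_powFun (rQ ι hW ((show (OO Z).obj (op (ι ⁻¹ᵁ W)) from
    ι.app W r) • w)) (powFun_of_clPairs h₁)
  refine ⟨W', hW, hy', ?_⟩
  rw [rst_smul, hCl _ _ _ h₁, ← hten_smul_right, ← rQ_smul, ← hCl _ _ _ h₃]
  exact h₃

lemma zero_right (hF : ∀ y (hy : y ∈ W), Y.presheaf.germ W y hy F ∈ stalkIdeal ι y ^ m) :
    IsCl (0 : Q.obj (op (ι ⁻¹ᵁ W))) F (0 : Γ(HS ι m Q, W)) := fun y hy => by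
  obtain ⟨W₁, hW₁, hy₁, h₁⟩ := exists_rstO_mem_powFun hy (hF y hy)
  obtain ⟨W', hW', hy', hle⟩ := exists_isAffineOpen_mem_and_subset (X := Y) (x := y) (U := W₁) hy₁
  have hle : W' ≤ W₁ := hle
  refine ⟨W', hle.trans hW₁, hy', ?_⟩
  have h₂ := rstO_mem_powFun hle h₁
  rw [rstO_rstO] at h₂
  obtain ⟨h, h₃⟩ := exists_clPairs_of_powFun (Q := Q) (rQ ι (hle.trans hW₁) 0) h₂
  obtain ⟨Cl, hCl⟩ := exists_eq_hten (Q := Q) hι hW' m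
  have h₄ := hCl _ _ _ h₃
  rw [rQ_zero, hten_zero_right] at h₄
  rw [rst_zero, ← h₄]
  exact h₃

lemma sum_right {κ : Type} (s : Finset κ) {w : κ → Q.obj (op (ι ⁻¹ᵁ W))}
    {h : κ → Γ(HS ι m Q, W)}
    (hF : ∀ y (hy : y ∈ W), Y.presheaf.germ W y hy F ∈ stalkIdeal ι y ^ m)
    (hs : ∀ a ∈ s, IsCl (w a) F (h a)) : IsCl (∑ a ∈ s, w a) F (∑ a ∈ s, h a) := by
  classical
  induction s using Finset.induction_on with
  | empty => exact zero_right hι hF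
  | insert a s ha ih =>
    rw [Finset.sum_insert ha, Finset.sum_insert ha]
    exact (hs a (Finset.mem_insert_self _ _)).add_right hι
      (ih fun b hb => hs b (Finset.mem_insert_of_mem hb))

/-- A function in `I^m` has a class. -/
theorem exists_isCl (w : Q.obj (op (ι ⁻¹ᵁ W)))
    (hF : ∀ y (hy : y ∈ W), Y.presheaf.germ W y hy F ∈ stalkIdeal ι y ^ m) :
    ∃ h : Γ(HS ι m Q, W), IsCl w F h := by
  choose V hV hy hp using fun y : {y // y ∈ W} => exists_rstO_mem_powFun y.2 (hF y.1 y.2)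
  choose h hh using fun y => exists_clPairs_of_powFun (rQ ι (hV y) w) (hp y)
  obtain ⟨g, hg⟩ := exists_gluing V hV (fun p hp => ⟨⟨p, hp⟩, hy ⟨p, hp⟩⟩) h
    fun i j O hi hj => by
      have h₁ := (of_clPairs (hh i)).rst hi
      have h₂ := (of_clPairs (hh j)).rst hj
      rw [rstO_rstO, rQ_rQ] at h₁ h₂
      exact h₁.unique hι h₂
  exact ⟨g, fun y hy' => ⟨V ⟨y, hy'⟩, hV _, hy _, by rw [hg]; exact hh _⟩⟩

end IsCl

end Classes

/-! ### The associated graded ring of an ideal, from its Rees algebra. -/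

section GradedRing

open Polynomial

variable {B : Type} [CommRing B] (J : Ideal B)

/-- The associated graded ring of an ideal. -/
def GrRing : Type := reesAlgebra J ⧸ J.map (algebraMap B (reesAlgebra J))

instance : CommRing (GrRing J) :=
  inferInstanceAs (CommRing (reesAlgebra J ⧸ J.map (algebraMap B (reesAlgebra J))))

/-- The map from the Rees algebra to the graded ring. -/
def reesToGr : reesAlgebra J →+* GrRing J :=
  Ideal.Quotient.mk (J.map (algebraMap B (reesAlgebra J)))

/-- The class in the graded ring of an element of `J^m`. -/
def grMk (m : ℕ) (a : B) (ha : a ∈ J ^ m) : GrRing J :=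
  reesToGr J ⟨monomial m a, reesAlgebra.monomial_mem.2 ha⟩

/-- The map from a ring to its graded ring. -/
def toGr : B →+* GrRing J := (reesToGr J).comp (algebraMap B (reesAlgebra J))

variable {J}

lemma toGr_eq_zero {a : B} (ha : a ∈ J) : toGr J a = 0 :=
  Ideal.Quotient.eq_zero_iff_mem.2 (Ideal.mem_map_of_mem _ ha)

lemma grMk_congr {m : ℕ} {a b : B} (h : a = b) (ha : a ∈ J ^ m) (hb : b ∈ J ^ m) :
    grMk J m a ha = grMk J m b hb := by subst h; rfl

lemma grMk_zero (m : ℕ) (h : (0 : B) ∈ J ^ m) : grMk J m 0 h = 0 := by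
  rw [← map_zero (reesToGr J)]
  exact congrArg _ (Subtype.ext (monomial_zero_right m))

lemma grMk_add {m : ℕ} {a b : B} (ha : a ∈ J ^ m) (hb : b ∈ J ^ m) :
    grMk J m (a + b) (add_mem ha hb) = grMk J m a ha + grMk J m b hb := by
  rw [grMk, grMk, grMk, ← map_add]
  exact congrArg _ (Subtype.ext (map_add (monomial m) a b))

lemma toGr_mul_grMk {m : ℕ} (c : B) {a : B} (ha : a ∈ J ^ m) :
    toGr J c * grMk J m a ha = grMk J m (c * a) (Ideal.mul_mem_left _ c ha) := by
  rw [toGr, RingHom.comp_apply, grMk, ← map_mul]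
  refine congrArg _ (Subtype.ext ?_)
  exact C_mul_monomial

lemma prod_grMk_one {m : ℕ} (u : Fin m → B) (hu : ∀ p, u p ∈ J ^ 1) (h : ∏ p, u p ∈ J ^ m) :
    ∏ p, grMk J 1 (u p) (hu p) = grMk J m (∏ p, u p) h := by
  have e : ∀ p, grMk J 1 (u p) (hu p) =
    reesToGr J (⟨monomial 1 (u p), reesAlgebra.monomial_mem.2 (hu p)⟩ : reesAlgebra J) :=
    fun p => rfl
  simp only [e]
  rw [← map_prod, grMk]
  refine congrArg _ (Subtype.ext ?_)
  refine (map_prod (reesAlgebra J).val _ _).trans ?_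
  change ∏ p, monomial 1 (u p) = monomial m (∏ p, u p)
  simp only [← C_mul_X_pow_eq_monomial, pow_one]
  rw [Finset.prod_mul_distrib, map_prod]
  simp

/-- An element of the extension of `J` to the Rees algebra has its coefficient of degree `n` in
`J^{n+1}`, one order better than required. -/
lemma mem_of_grMk_eq_zero {m : ℕ} {a : B} (ha : a ∈ J ^ m) (h : grMk J m a ha = 0) :
    a ∈ J ^ (m + 1) := by
  have key : ∀ x ∈ J.map (algebraMap B (reesAlgebra J)), ∀ n,
      (x : B[X]).coeff n ∈ J ^ (n + 1) := by
    intro x hx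
    induction hx using Submodule.span_induction with
    | mem x hx =>
      intro n
      obtain ⟨j, hj, rfl⟩ := hx
      have e : ((algebraMap B (reesAlgebra J) j : reesAlgebra J) : B[X]) = C j := rfl
      rw [e, coeff_C]
      split_ifs with h0
      · subst h0; simpa using hj
      · exact zero_mem _
    | zero => exact fun n => zero_mem _
    | add x y _ _ hx hy =>
      exact fun n => (congrArg (· ∈ J ^ (n + 1)) (coeff_add (x : B[X]) y n)).mpr
        (add_mem (hx n) (hy n))
    | smul r x _ hx =>
      intro n
      have e : ((r • x : reesAlgebra J) : B[X]) = (r : B[X]) * (x : B[X]) := rfl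
      rw [e, coeff_mul]
      refine sum_mem fun p hp => ?_
      have h1 := Ideal.mul_mem_mul ((mem_reesAlgebra_iff J (r : B[X])).1 r.2 p.1) (hx p.2)
      rw [← pow_add, ← add_assoc, Finset.HasAntidiagonal.mem_antidiagonal.1 hp] at h1
      exact h1
  have := key _ (Ideal.Quotient.eq_zero_iff_mem.1 h) m
  rwa [coeff_monomial_same] at this

end GradedRing

/-! ### Functionals with values in the graded ring detect the class of a function. -/

section Detection

variable {Y Z : Scheme.{0}} {ι : Z ⟶ Y} (hι : IsClosedImmersion ι) (z : Z)
include hι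

/-- The map from the local ring of the subscheme to the graded ring. -/
def grHom : Z.presheaf.stalk z →+* GrRing (stalkIdeal ι (ι z)) :=
  (ι.stalkMap z).hom.liftOfSurjective (ι.stalkMap_surjective z) ⟨toGr _, by
    rw [← stalkIdeal_eq_ker]
    exact fun a ha => toGr_eq_zero ha⟩

lemma grHom_stalkMap (a : Y.presheaf.stalk (ι z)) : grHom hι z (ι.stalkMap z a) = toGr _ a :=
  RingHom.liftOfSurjective_comp_apply _ _ _ _

/-- The class of a section of the ideal sheaf in the graded ring. -/
def idealPFun : PFun ((grHom hι z).comp (ι.stalkMap z).hom) (pre (idealSheaf ι)) where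
  toFun U h :=
    { toFun := fun u => grMk (stalkIdeal ι (ι z)) 1 (Y.presheaf.germ (unop U) (ι z) h
        (idealFun ι (U := unop U) u)) (by rw [pow_one]; exact germ_idealFun_mem h _)
      map_add' := fun u u' => by
        rw [← grMk_add]
        refine grMk_congr ?_ _ _
        rw [← map_add]
        exact congrArg _ (idealFun_add (U := unop U) u u')
      map_smul' := fun r u => by
        change _ = atStalk ((grHom hι z).comp (ι.stalkMap z).hom) U h r * _
        rw [atStalk_apply, RingHom.comp_apply]
        refine Eq.trans ?_ (congrArg (· * _) (grHom_stalkMap hι z _).symm)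
        rw [toGr_mul_grMk]
        refine grMk_congr ?_ _ _
        rw [← map_mul]
        exact congrArg _ (idealFun_smul (U := unop U) r u) }
  res {U V} f h u := by
    refine grMk_congr (m := 1) ?_ (by rw [pow_one]; exact germ_idealFun_mem h _)
      (by rw [pow_one]; exact germ_idealFun_mem (U := unop U) (f.unop.le h) _)
    refine (congrArg _ (idealFun_rst f.unop.le u)).trans ?_
    exact germ_rstO f.unop.le h _

/-- The functional on `S^m(I/I²)` given by the graded ring. -/
def symPFun (m : ℕ) : PFun (grHom hι z) (symPow m (pre (conormal ι))) :=
  PFun.sym m (PFun.pullback (f := ι) (E := idealSheaf ι) (idealPFun hι z))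

variable {m : ℕ} {Q : PreMod Z} {W : Y.Opens}

lemma symPFun_symProd (hz : ι z ∈ W) (u : Fin m → Γ(idealSheaf ι, W))
    (h : Y.presheaf.germ W (ι z) hz (∏ p, idealFun ι (u p)) ∈ stalkIdeal ι (ι z) ^ m) :
    (symPFun hι z m).toFun (op (ι ⁻¹ᵁ W)) hz (symProd (pre (conormal ι)) (U := op (ι ⁻¹ᵁ W))
      fun p => pull ι (idealSheaf ι) (u p) le_rfl) = grMk _ m _ h := by
  refine (PFun.sym_symProd m _ (U := op (ι ⁻¹ᵁ W)) hz _).trans ?_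
  refine Eq.trans (Finset.prod_congr rfl fun p _ =>
    PFun.pullback_pull (idealPFun hι z) (u p) le_rfl hz) ?_
  have h' : ∏ p, Y.presheaf.germ W (ι z) hz (idealFun ι (u p)) ∈ stalkIdeal ι (ι z) ^ m := by
    rw [← map_prod]; exact h
  refine (prod_grMk_one (fun p => Y.presheaf.germ W (ι z) hz (idealFun ι (u p)))
    (fun p => by rw [pow_one]; exact germ_idealFun_mem hz _) h').trans ?_
  exact grMk_congr (map_prod _ _ _).symm _ _

/-- The functional on `S^m(I/I²) ⊗ Q` given by the graded ring and a functional on `Q`. -/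
def clPFun (m : ℕ) (Ψ : PFun (grHom hι z) Q) :
    PFun ((grHom hι z).comp (ι.stalkMap z).hom) (pre (HS ι m Q)) :=
  ((symPFun hι z m).tensor Ψ).shf.push ι

/-- On a generator the functional multiplies the classes of degree one of the `u_p` in the graded
ring, which gives the class of `c u_1 ⋯ u_m`. Both sides are additive. Hence a vanishing class
forces one more order of vanishing. -/
lemma clPFun_of_clPairs (Ψ : PFun (grHom hι z) Q) (hz : ι z ∈ W) {w : Q.obj (op (ι ⁻¹ᵁ W))}
    {F : Γ(Y, W)} {h : Γ(HS ι m Q, W)} (hF : (F, h) ∈ clPairs m w)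
    (hm : Y.presheaf.germ W (ι z) hz F ∈ stalkIdeal ι (ι z) ^ m) :
    (clPFun hι z m Ψ).ev hz h = grMk _ m _ hm * Ψ.toFun (op (ι ⁻¹ᵁ W)) hz w := by
  suffices key : ∃ hm : Y.presheaf.germ W (ι z) hz F ∈ stalkIdeal ι (ι z) ^ m,
      (clPFun hι z m Ψ).ev hz h = grMk _ m _ hm * Ψ.toFun (op (ι ⁻¹ᵁ W)) hz w from key.2
  refine clPairs_induction (p := fun F h =>
    ∃ hm : Y.presheaf.germ W (ι z) hz F ∈ stalkIdeal ι (ι z) ^ m,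
      (clPFun hι z m Ψ).ev hz h = grMk _ m _ hm * Ψ.toFun (op (ι ⁻¹ᵁ W)) hz w)
    (fun c u => ?_) ?_ (fun F F' h h' ha hb => ?_) hF
  · have h1 : Y.presheaf.germ W (ι z) hz (∏ p, idealFun ι (u p)) ∈ stalkIdeal ι (ι z) ^ m :=
      germ_mem_of_powFun hz (AddSubgroup.subset_closure ⟨1, u, (one_mul _).symm⟩)
    refine ⟨germ_mem_of_powFun hz (AddSubgroup.subset_closure ⟨c, u, rfl⟩), ?_⟩
    rw [PFun.ev_smul]
    have h2 : (clPFun hι z m Ψ).ev hz (hgen u w) =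
        grMk _ m _ h1 * Ψ.toFun (op (ι ⁻¹ᵁ W)) hz w := by
      refine (PFun.ev_shf_toShf ((symPFun hι z m).tensor Ψ) (U := ι ⁻¹ᵁ W) hz _).trans ?_
      refine (PFun.tensor_tmul _ _ (U := op (ι ⁻¹ᵁ W)) hz _ _).trans ?_
      exact congrArg (· * _) (symPFun_symProd hι z hz u h1)
    rw [h2, ← mul_assoc, RingHom.comp_apply]
    refine congrArg (· * _) ?_
    refine (congrArg (· * _) (grHom_stalkMap hι z _)).trans ?_
    rw [toGr_mul_grMk]
    exact grMk_congr (map_mul _ _ _).symm _ _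
  · refine ⟨by rw [map_zero]; exact zero_mem _, ?_⟩
    rw [map_zero, grMk_congr (map_zero _) _ (zero_mem _), grMk_zero, zero_mul]
  · obtain ⟨h1, h2⟩ := ha
    obtain ⟨h3, h4⟩ := hb
    refine ⟨by rw [map_add]; exact add_mem h1 h3, ?_⟩
    rw [map_add, h2, h4, grMk_congr (map_add _ F F') _ (add_mem h1 h3), grMk_add, add_mul]

lemma IsCl.clPFun_ev (Ψ : PFun (grHom hι z) Q) (hz : ι z ∈ W) {w : Q.obj (op (ι ⁻¹ᵁ W))}
    {F : Γ(Y, W)} {h : Γ(HS ι m Q, W)} (hF : IsCl w F h) :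
    (clPFun hι z m Ψ).ev hz h = grMk _ m _ (hF.germ_mem hz) * Ψ.toFun (op (ι ⁻¹ᵁ W)) hz w := by
  obtain ⟨W', hW, hz', hc⟩ := hF _ hz
  rw [← PFun.ev_rst _ hW hz']
  have hm := germ_mem_of_powFun hz' (powFun_of_clPairs hc)
  refine (clPFun_of_clPairs hι z Ψ hz' hc hm).trans ?_
  refine congrArg₂ (· * ·) (grMk_congr (germ_rstO hW hz' F) _ _) ?_
  exact Ψ.res (homOfLE (preim_le hW)).op hz' w

end Detection

/-! ### The filtration of functions on a cube by the order of their differences. -/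

section Filtration

variable {k : ℕ} {S : Finset (Fin k)} {A : Type} [CommRing A] {r p : ℕ}

lemma Idx.D_add (ξ : Idx S r) (F F' : ({t : Fin k // t ∈ S} → Fin 2) → A) :
    ξ.D (fun g => F g + F' g) = ξ.D F + ξ.D F' := by
  simp [Idx.D, mul_add, Finset.sum_add_distrib]

lemma Idx.D_mul (ξ : Idx S r) (a : A) (F : ({t : Fin k // t ∈ S} → Fin 2) → A) :
    ξ.D (fun g => a * F g) = a * ξ.D F := by
  simp only [Idx.D, Finset.mul_sum]
  exact Finset.sum_congr rfl fun _ _ => by ring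

lemma Idx.D_sum {κ : Type} (s : Finset κ) (ξ : Idx S r)
    (F : κ → ({t : Fin k // t ∈ S} → Fin 2) → A) :
    ξ.D (fun g => ∑ a ∈ s, F a g) = ∑ a ∈ s, ξ.D (F a) := by
  simp only [Idx.D, Finset.mul_sum]
  exact Finset.sum_comm

lemma Idx.map_D {B : Type} [CommRing B] (φ : A →+* B) (ξ : Idx S r)
    (F : ({t : Fin k // t ∈ S} → Fin 2) → A) : φ (ξ.D F) = ξ.D fun g => φ (F g) := by
  simp [Idx.D]

/-- The function `F` on the vertices of the cube has differences of order `r` in `J^r`, for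
`r ≤ p`. -/
def FilAt (J : Ideal A) (p : ℕ) (F : ({t : Fin k // t ∈ S} → Fin 2) → A) : Prop :=
  ∀ r ≤ p, ∀ ξ : Idx S r, ξ.D F ∈ J ^ r

variable {J : Ideal A} {F F' : ({t : Fin k // t ∈ S} → Fin 2) → A}

lemma FilAt.mono {q : ℕ} (h : FilAt J p F) (hq : q ≤ p) : FilAt J q F := fun r hr => h r (hr.trans hq)

lemma FilAt.zero_right : FilAt J 0 F := fun r hr ξ => by
  obtain rfl : r = 0 := by omega
  simp

lemma FilAt.sum {κ : Type} (s : Finset κ) {F : κ → ({t : Fin k // t ∈ S} → Fin 2) → A}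
    (h : ∀ a ∈ s, FilAt J p (F a)) : FilAt J p fun g => ∑ a ∈ s, F a g := fun r hr ξ => by
  rw [ξ.D_sum]; exact sum_mem fun a ha => h a ha r hr ξ

lemma FilAt.mul_left (h : FilAt J p F) (a : A) : FilAt J p fun g => a * F g := fun r hr ξ => by
  rw [ξ.D_mul]; exact Ideal.mul_mem_left _ _ (h r hr ξ)

lemma FilAt.of_top : FilAt ⊤ p F := fun r _ ξ => by rw [Ideal.top_pow]; trivial

lemma FilAt.of_mem (h : ∀ g, F g ∈ J ^ p) : FilAt J p F := fun r hr ξ => by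
  refine Ideal.pow_le_pow_right hr ?_
  exact sum_mem fun b _ => Ideal.mul_mem_left _ _ (h _)

lemma FilAt.succ_iff : FilAt J (p + 1) F ↔ FilAt J p F ∧ ∀ ξ : Idx S (p + 1), ξ.D F ∈ J ^ (p + 1) := by
  refine ⟨fun h => ⟨h.mono (Nat.le_succ p), h _ le_rfl⟩, fun h r hr ξ => ?_⟩
  rcases Nat.lt_or_eq_of_le hr with hr | rfl
  · exact h.1 r (by omega) ξ
  · exact h.2 ξ

/-- A `(p+1)`-face has two opposite `p`-faces whose alternating sums it compares; this is why the
values of `φ_{p+1}` make sense. -/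
lemma FilAt.D_mem (h : FilAt J p F) (ξ : Idx S (p + 1)) : ξ.D F ∈ J ^ p := by
  have hc : ξ.M.card = p + 1 := ξ.2.2
  obtain ⟨m, hm⟩ : ξ.M.Nonempty := Finset.card_pos.1 (by omega)
  rw [ξ.D_eq_sub ⟨m, hm⟩]
  exact sub_mem (h p le_rfl _) (h p le_rfl _)

lemma FilAt.DW_mem (h : FilAt J p F) {w : Word k} (hw : Normal S w) (hp : (st w).card ≤ p) :
    DW S w F ∈ J ^ (st w).card := by
  obtain ⟨x, hx⟩ := Idx.exists_wd hw rfl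
  have := h _ hp x
  rwa [x.D_eq_DW, hx] at this

/-- The vertex of a face at which all of the free coordinates are `0`. -/
def base (w : Word k) (t : Fin k) : Fin 2 := (w t).getD 0

/-- In the Leibniz rule the error is `u 0 - u 1 ∈ J` times a sum over a face of dimension one less.
That is why faces of dimension `p + 1` are allowed although `F` is only controlled up to order `p`.
-/
lemma FilAt.DW_mul_sub_mem (h : FilAt J p F) (t : {t : Fin k // t ∈ S}) (u : Fin 2 → A)
    (hu : u 0 - u 1 ∈ J) {w : Word k} (hw : Normal S w) (hp : (st w).card ≤ p + 1) :
    DW S w (fun g => u (g t) * F g) - u (base w t.1) * DW S w F ∈ J ^ (st w).card := by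
  cases hwt : w t.1 with
  | some i =>
    rw [DW_mul_of_some hwt, base, hwt, Option.getD_some, sub_self]
    exact zero_mem _
  | none =>
    rw [DW_mul_of_none hwt, base, hwt, Option.getD_none, add_sub_cancel_left]
    have hc : (st (Function.update w t.1 (some 1))).card = (st w).card - 1 := by
      rw [st_update_some, Finset.card_erase_of_mem (mem_st.2 hwt)]
    have hpos : 0 < (st w).card := Finset.card_pos.2 ⟨_, mem_st.2 hwt⟩
    have := h.DW_mem ((Normal.update t.2).2 hw) (w := Function.update w t.1 (some 1)) (by omega)
    rw [hc] at this
    have h2 := Ideal.mul_mem_mul hu this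
    rwa [← pow_succ', Nat.sub_add_cancel hpos] at h2

lemma FilAt.mul_fun (h : FilAt J p F) (t : {t : Fin k // t ∈ S}) (u : Fin 2 → A)
    (hu : u 0 - u 1 ∈ J) : FilAt J p fun g => u (g t) * F g := fun r hr ξ => by
  have h1 := h.DW_mul_sub_mem t u hu ξ.normal_wd (by rw [ξ.card_wd]; omega)
  have h2 := Ideal.mul_mem_left _ (u (base ξ.wd t.1)) (h r hr ξ)
  rw [ξ.card_wd, ← ξ.D_eq_DW, ← ξ.D_eq_DW] at h1
  simpa using add_mem h1 h2

lemma FilAt.prod_mul_aux (h : FilAt J p F) (u : {t : Fin k // t ∈ S} → Fin 2 → A)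
    (hu : ∀ t, u t 0 - u t 1 ∈ J) (T : Finset {t : Fin k // t ∈ S}) :
    FilAt J p (fun g => (∏ t ∈ T, u t (g t)) * F g) ∧ ∀ w : Word k, Normal S w →
      (st w).card ≤ p + 1 → DW S w (fun g => (∏ t ∈ T, u t (g t)) * F g) -
        (∏ t ∈ T, u t (base w t.1)) * DW S w F ∈ J ^ (st w).card := by
  classical
  induction T using Finset.induction_on with
  | empty => simpa using h
  | insert a T ha ih =>
    have e : (fun g : {t : Fin k // t ∈ S} → Fin 2 => (∏ t ∈ insert a T, u t (g t)) * F g) =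
        fun g => u a (g a) * ((∏ t ∈ T, u t (g t)) * F g) := by
      funext g
      rw [Finset.prod_insert ha, mul_assoc]
    rw [e]
    refine ⟨ih.1.mul_fun a (u a) (hu a), fun w hw hp => ?_⟩
    have h1 := ih.1.DW_mul_sub_mem a (u a) (hu a) hw hp
    have h2 := Ideal.mul_mem_left _ (u a (base w a.1)) (ih.2 w hw hp)
    have h3 := add_mem h1 h2
    rw [Finset.prod_insert ha]
    convert h3 using 1
    ring

lemma FilAt.prod_mul (h : FilAt J p F) (u : {t : Fin k // t ∈ S} → Fin 2 → A)
    (hu : ∀ t, u t 0 - u t 1 ∈ J) : FilAt J p fun g => (∏ t, u t (g t)) * F g :=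
  (h.prod_mul_aux u hu Finset.univ).1

/-- For `r = p + 1` this is the independence of `φ_{p+1}` of the frames: modulo `J^{p+1}` a
multiplier acts on the alternating sum through its value at one vertex, and on the diagonal all
vertices give the same value. -/
lemma FilAt.D_prod_mul_sub_mem (h : FilAt J p F) (u : {t : Fin k // t ∈ S} → Fin 2 → A)
    (hu : ∀ t, u t 0 - u t 1 ∈ J) (ξ : Idx S r) (hr : r ≤ p + 1) :
    ξ.D (fun g => (∏ t, u t (g t)) * F g) - (∏ t, u t (base ξ.wd t.1)) * ξ.D F ∈ J ^ r := by
  have := (h.prod_mul_aux u hu Finset.univ).2 ξ.wd ξ.normal_wd (by rw [ξ.card_wd]; exact hr)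
  rwa [ξ.card_wd, ← ξ.D_eq_DW, ← ξ.D_eq_DW] at this

end Filtration

/-! ### The values of `φ_ℓ` on one block, in terms of frames and classes. -/

section Blocks

variable {X : Scheme.{0}} {s : X ⟶ Spec (.of ℂ)} {k n : ℕ}

lemma exists_common_open {Y : Scheme.{0}} {κ : Type} [Finite κ] {W : Y.Opens} {y : Y} (hy : y ∈ W)
    (P : κ → Y.Opens → Prop) (hP : ∀ i V V', V' ≤ V → P i V → P i V')
    (h : ∀ i, ∃ V ≤ W, y ∈ V ∧ P i V) : ∃ V ≤ W, y ∈ V ∧ ∀ i, P i V := by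
  classical
  have := Fintype.ofFinite κ
  suffices h : ∀ T : Finset κ, ∃ V ≤ W, y ∈ V ∧ ∀ i ∈ T, P i V by
    obtain ⟨V, hV, hy, h⟩ := h Finset.univ
    exact ⟨V, hV, hy, fun i => h i (Finset.mem_univ i)⟩
  intro T
  induction T using Finset.induction_on with
  | empty => exact ⟨W, le_rfl, hy, by simp⟩
  | insert a T ha ih =>
    obtain ⟨V, hV, hy, hT⟩ := ih
    obtain ⟨V', hV', hy', ha⟩ := h a
    refine ⟨V ⊓ V', inf_le_left.trans hV, ⟨hy, hy'⟩, fun i hi => ?_⟩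
    rcases Finset.mem_insert.1 hi with rfl | hi
    · exact hP _ _ _ inf_le_right ha
    · exact hP _ _ _ inf_le_left (hT i hi)

lemma exists_sum_of_clPairs_of_le {Y Z : Scheme.{0}} {ι : Z ⟶ Y} {m : ℕ} {Q : PreMod Z} {W : Y.Opens}
    {w : Q.obj (op (ι ⁻¹ᵁ W))} {F : Γ(Y, W)} {h : Γ(HS ι m Q, W)}
    (hF : (F, h) ∈ clPairs m w) : ∃ N₀ : ℕ, ∀ N, N₀ ≤ N → ∃ (c : Fin N → Γ(Y, W))
      (u : Fin N → Fin m → Γ(idealSheaf ι, W)),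
      F = ∑ ν, c ν * ∏ p, idealFun ι (u ν p) ∧ h = ∑ ν, c ν • hgen (u ν) w := by
  obtain ⟨N₀, c, u, h₁, h₂⟩ := exists_sum_of_clPairs hF
  refine ⟨N₀, fun N hN => ?_⟩
  induction N, hN using Nat.le_induction with
  | base => exact ⟨c, u, h₁, h₂⟩
  | succ N _ ih =>
    obtain ⟨c, u, h₁, h₂⟩ := ih
    refine ⟨Fin.cons 0 c, Fin.cons 0 u, ?_, ?_⟩
    · rw [Fin.sum_univ_succ]; simpa using h₁
    · rw [Fin.sum_univ_succ]; simpa using h₂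

/-- Local frames for a family of sheaves. -/
structure Fr (E : Fin k → X.Modules) where
  /-- the open subsets -/
  V : Fin k → X.Opens
  /-- the ranks -/
  r : Fin k → ℕ
  /-- the frames -/
  e : ∀ t, Fin (r t) → Γ(E t, V t)
  frame : ∀ t, IsFrame (E t) (e t)

/-- The multiindices for the frames of a tensor product. -/
abbrev Fr.Ix {E : Fin k → X.Modules} (Φ : Fr E) : Type := ∀ t, Fin (Φ.r t)

namespace Block

variable (B : Block s k n) (E : Fin k → X.Modules)

/-- The presheaf `⨂_t q_t^* E_t`. -/
abbrev Q : PreMod B.Z := piTensor fun t => pre ((Scheme.Modules.pullback (B.q t)).obj (E t))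

/-- The properties of the blocks which we use. -/
structure Good : Prop where
  cl : HasClassMap B.ι
  q_eq : ∀ g t, B.ι ≫ pr s n (B.col g t) = B.q t
  ne : B.i ≠ B.j

variable {B E} {U W : (Pow s n).Opens} {m : ℕ} {V : Type} [AddCommGroup V] [Module ℂ V]

variable (B E) in
/-- The section `h ⊗ v` of `H ⊗_ℂ V`. -/
def tm (h : Γ(HS B.ι m (B.Q E), W)) (v : V) : Γ(B.HV E m V, W) := B.tmul E (m := m) h v

lemma tm_add_left (h h' : Γ(HS B.ι m (B.Q E), W)) (v : V) :
    B.tm E (h + h') v = B.tm E h v + B.tm E h' v :=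
  (congrArg (toShf _) (TensorProduct.add_tmul (R := ℂ) (M := CMod (str s n) (pre (B.H E m)) (op W))
    h h' v)).trans (toShf_add (scPre (str s n) (pre (B.H E m)) V) _ _)

lemma tm_add_right (h : Γ(HS B.ι m (B.Q E), W)) (v v' : V) :
    B.tm E h (v + v') = B.tm E h v + B.tm E h v' :=
  (congrArg (toShf _) (TensorProduct.tmul_add (R := ℂ) (M := CMod (str s n) (pre (B.H E m)) (op W))
    h v v')).trans (toShf_add (scPre (str s n) (pre (B.H E m)) V) _ _)

lemma tm_smul_left (r : Γ(Pow s n, W)) (h : Γ(HS B.ι m (B.Q E), W)) (v : V) :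
    B.tm E (r • h) v = r • B.tm E h v :=
  toShf_smul (scPre (str s n) (pre (B.H E m)) V) r (scTmul (M := pre (B.H E m)) (str s n) h v)

lemma tm_zero_left (v : V) : B.tm E (0 : Γ(HS B.ι m (B.Q E), W)) v = 0 :=
  (congrArg (toShf _) (TensorProduct.zero_tmul (R := ℂ) (CMod (str s n) (pre (B.H E m)) (op W))
    v)).trans (toShf_zero (scPre (str s n) (pre (B.H E m)) V))

lemma tm_zero_right (h : Γ(HS B.ι m (B.Q E), W)) : B.tm E h (0 : V) = 0 :=
  (congrArg (toShf _) (TensorProduct.tmul_zero (R := ℂ) (M := CMod (str s n) (pre (B.H E m)) (op W))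
    V h)).trans (toShf_zero (scPre (str s n) (pre (B.H E m)) V))

lemma tm_sum_left {κ : Type} (T : Finset κ) (h : κ → Γ(HS B.ι m (B.Q E), W)) (v : V) :
    B.tm E (∑ a ∈ T, h a) v = ∑ a ∈ T, B.tm E (h a) v := by
  classical
  induction T using Finset.induction_on with
  | empty => exact tm_zero_left v
  | insert a T ha ih => rw [Finset.sum_insert ha, Finset.sum_insert ha, tm_add_left, ih]

lemma tm_sum_right {κ : Type} (T : Finset κ) (h : Γ(HS B.ι m (B.Q E), W)) (v : κ → V) :
    B.tm E h (∑ a ∈ T, v a) = ∑ a ∈ T, B.tm E h (v a) := by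
  classical
  induction T using Finset.induction_on with
  | empty => exact tm_zero_right h
  | insert a T ha ih => rw [Finset.sum_insert ha, Finset.sum_insert ha, tm_add_right, ih]

lemma rst_tm (hU : U ≤ W) (h : Γ(HS B.ι m (B.Q E), W)) (v : V) :
    rst hU (B.tm E h v) = B.tm E (rst hU h) v :=
  toShf_rst (scPre (str s n) (pre (B.H E m)) V) hU _

lemma d_tm (ℓ i : ℕ) (h : Γ(HS B.ι (ℓ - 1) (B.Q E), W)) (v : R B.S ℓ i) :
    Scheme.Modules.Hom.app (B.d E ℓ i) W (B.tm E h v) = B.tm E h (dR B.S ℓ i v) := by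
  refine (sheafify_map_toShf (scPreMap (str s n) (pre (B.H E (ℓ - 1))) (dR B.S ℓ i)) _).trans ?_
  refine congrArg (toShf _) ?_
  exact (ScTensor.map_tmul (str s n) (𝟙 (op W)) (dR B.S ℓ i) _ v).trans
    (congrArg (fun y => scTmul (str s n) y (dR B.S ℓ i v)) (res_id (pre (B.H E (ℓ - 1))) (op W) h))

variable (B E) in
/-- The section `∑ h_{ξ,α} ⊗ e_ξ` of `T_ℓ^0`. -/
def phiSum {κ : Type} [Fintype κ] (ℓ : ℕ) (h : Idx B.S ℓ → κ → Γ(HS B.ι (ℓ - 1) (B.Q E), W)) :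
    Γ(B.T E ℓ 0, W) :=
  (∑ ξ, ∑ α, B.tm E (h ξ α) (eR B.S ℓ ξ) : Γ(B.HV E (ℓ - 1) (R B.S ℓ 0), W))

variable {κ : Type} [Fintype κ] {ℓ : ℕ}

lemma rst_phiSum (hU : U ≤ W) (h : Idx B.S ℓ → κ → Γ(HS B.ι (ℓ - 1) (B.Q E), W)) :
    rst hU (B.phiSum E ℓ h) = B.phiSum E ℓ fun ξ α => rst hU (h ξ α) := by
  change rst (M := B.HV E (ℓ - 1) (R B.S ℓ 0)) hU (∑ ξ, ∑ α, B.tm E (h ξ α) (eR B.S ℓ ξ)) = _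
  rw [rst_sum]
  refine Finset.sum_congr rfl fun ξ _ => ?_
  rw [rst_sum]
  exact Finset.sum_congr rfl fun α _ => rst_tm hU _ _

lemma phiSum_add (h h' : Idx B.S ℓ → κ → Γ(HS B.ι (ℓ - 1) (B.Q E), W)) :
    B.phiSum E ℓ (fun ξ α => h ξ α + h' ξ α) = B.phiSum E ℓ h + B.phiSum E ℓ h' := by
  refine Eq.trans (Finset.sum_congr rfl fun ξ _ => ?_) Finset.sum_add_distrib
  refine Eq.trans (Finset.sum_congr rfl fun α _ => ?_) Finset.sum_add_distrib
  exact tm_add_left _ _ _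

lemma phiSum_smul (r : Γ(Pow s n, W)) (h : Idx B.S ℓ → κ → Γ(HS B.ι (ℓ - 1) (B.Q E), W)) :
    B.phiSum E ℓ (fun ξ α => r • h ξ α) = r • B.phiSum E ℓ h := by
  have e : (r • ∑ ξ, ∑ α, B.tm E (h ξ α) (eR B.S ℓ ξ) : Γ(B.HV E (ℓ - 1) (R B.S ℓ 0), W)) =
      ∑ ξ, ∑ α, B.tm E (r • h ξ α) (eR B.S ℓ ξ) := by
    rw [Finset.smul_sum]
    refine Finset.sum_congr rfl fun ξ _ => ?_
    rw [Finset.smul_sum]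
    exact Finset.sum_congr rfl fun α _ => (tm_smul_left _ _ _).symm
  exact e.symm

variable {Φ : Fr E}

variable (B) in
/-- The frames are defined on an open subset of `X^n`. -/
def Dom (Φ : Fr E) (W : (Pow s n).Opens) : Prop := ∀ g t, W ≤ pr s n (B.col g t) ⁻¹ᵁ Φ.V t

variable (B) in
/-- The frames are defined on the preimage of an open subset of `X^n` in the diagonal. -/
def ZDom (Φ : Fr E) (W : (Pow s n).Opens) : Prop := ∀ t, B.ι ⁻¹ᵁ W ≤ B.q t ⁻¹ᵁ Φ.V t

lemma Dom.mono (hW : B.Dom Φ W) (h : U ≤ W) : B.Dom Φ U := fun g t => h.trans (hW g t)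

lemma ZDom.mono (hW : B.ZDom Φ W) (h : U ≤ W) : B.ZDom Φ U := fun t => (preim_le h).trans (hW t)

lemma Good.zDom (hB : B.Good) (hW : B.Dom Φ W) : B.ZDom Φ W := fun t => by
  rw [← hB.q_eq (fun _ => 0) t]
  exact preim_le (hW (fun _ => 0) t)

variable (B Φ) in
/-- The section `⨂_t q_t^* e_t`. -/
def wt (hW : B.ZDom Φ W) (α : Φ.Ix) : (B.Q E).obj (op (B.ι ⁻¹ᵁ W)) :=
  pureTensor (fun t => pre ((Scheme.Modules.pullback (B.q t)).obj (E t))) (U := op (B.ι ⁻¹ᵁ W))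
    fun t => pull (B.q t) (E t) (Φ.e t (α t)) (hW t)

lemma rQ_wt (hW : B.ZDom Φ W) (h : U ≤ W) (α : Φ.Ix) :
    rQ B.ι h (B.wt Φ hW α) = B.wt Φ (hW.mono h) α := by
  refine (pureTensor_restrict (fun t => pre ((Scheme.Modules.pullback (B.q t)).obj (E t)))
    (homOfLE (preim_le h)).op _).trans ?_
  exact congrArg (pureTensor (fun t => pre ((Scheme.Modules.pullback (B.q t)).obj (E t))))
    (funext fun t => rst_pull (B.q t) (hW t) (preim_le h) _)

variable (B Φ) in
/-- The functions `f` are the coordinates of the section `x`. -/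
def IsCoord (hW : B.Dom Φ W) (x : Γ(K₀ s E n, W))
    (f : ({t : Fin k // t ∈ B.S} → Fin 2) → Φ.Ix → Γ(Pow s n, W)) : Prop :=
  ∀ g, comp s E n (B.col g) x =
    ∑ α, f g α • pureSec E (fun t => Φ.e t (α t)) (B.col g) (hW g)

variable (B Φ) in
/-- The section `τ` is the value of `φ_ℓ` at the section with coordinates `f`. -/
def IsVal (ℓ : ℕ) (hW : B.ZDom Φ W)
    (f : ({t : Fin k // t ∈ B.S} → Fin 2) → Φ.Ix → Γ(Pow s n, W)) (τ : Γ(B.T E ℓ 0, W)) : Prop :=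
  ∃ h : Idx B.S ℓ → Φ.Ix → Γ(HS B.ι (ℓ - 1) (B.Q E), W),
    (∀ ξ α, IsCl (ι := B.ι) (Q := B.Q E) (m := ℓ - 1) (B.wt Φ hW α) (ξ.D fun g => f g α) (h ξ α)) ∧
      τ = B.phiSum E ℓ h

lemma rstO_D {r : ℕ} (hU : U ≤ W) (ξ : Idx B.S r)
    (F : ({t : Fin k // t ∈ B.S} → Fin 2) → Γ(Pow s n, W)) :
    rstO hU (ξ.D F) = ξ.D fun g => rstO hU (F g) := ξ.map_D (rstHom hU) F

namespace IsVal

variable {ℓ : ℕ} {hW : B.ZDom Φ W}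
  {f f' : ({t : Fin k // t ∈ B.S} → Fin 2) → Φ.Ix → Γ(Pow s n, W)} {τ τ' : Γ(B.T E ℓ 0, W)}

lemma unique (hB : B.Good) (h : B.IsVal Φ ℓ hW f τ) (h' : B.IsVal Φ ℓ hW f τ') : τ = τ' := by
  obtain ⟨h, hh, rfl⟩ := h
  obtain ⟨h', hh', rfl⟩ := h'
  have e : h = h' := funext fun ξ => funext fun α => (hh ξ α).unique hB.cl (hh' ξ α)
  rw [e]

lemma rst (h : B.IsVal Φ ℓ hW f τ) (hU : U ≤ W) :
    B.IsVal Φ ℓ (hW.mono hU) (fun g α => rstO hU (f g α)) (rst hU τ) := by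
  obtain ⟨h, hh, rfl⟩ := h
  refine ⟨fun ξ α => LongDiag.rst hU (h ξ α), fun ξ α => ?_, ?_⟩
  · have := (hh ξ α).rst hU
    rwa [rQ_wt, rstO_D] at this
  · exact rst_phiSum hU h

lemma add (h : B.IsVal Φ ℓ hW f τ) (h' : B.IsVal Φ ℓ hW f' τ') :
    B.IsVal Φ ℓ hW (fun g α => f g α + f' g α) (τ + τ') := by
  obtain ⟨h, hh, rfl⟩ := h
  obtain ⟨h', hh', rfl⟩ := h'
  refine ⟨fun ξ α => h ξ α + h' ξ α, fun ξ α => ?_, ?_⟩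
  · rw [ξ.D_add]; exact (hh ξ α).add (hh' ξ α)
  · exact (phiSum_add h h').symm

lemma smul (h : B.IsVal Φ ℓ hW f τ) (r : Γ(Pow s n, W)) :
    B.IsVal Φ ℓ hW (fun g α => r * f g α) (r • τ) := by
  obtain ⟨h, hh, rfl⟩ := h
  refine ⟨fun ξ α => r • h ξ α, fun ξ α => ?_, ?_⟩
  · rw [ξ.D_mul]; exact (hh ξ α).smul r
  · exact (phiSum_smul r h).symm

lemma germ_mem (h : B.IsVal Φ ℓ hW f τ) (ξ : Idx B.S ℓ) (α : Φ.Ix) {y : Pow s n} (hy : y ∈ W) :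
    (Pow s n).presheaf.germ W y hy (ξ.D fun g => f g α) ∈ stalkIdeal B.ι y ^ (ℓ - 1) := by
  obtain ⟨h, hh, rfl⟩ := h
  exact (hh ξ α).germ_mem hy

lemma exists_isVal (hB : B.Good) (hf : ∀ (ξ : Idx B.S ℓ) (α : Φ.Ix) (y : Pow s n) (hy : y ∈ W),
    (Pow s n).presheaf.germ W y hy (ξ.D fun g => f g α) ∈ stalkIdeal B.ι y ^ (ℓ - 1)) :
    ∃ τ, B.IsVal Φ ℓ hW f τ := by
  choose h hh using fun ξ α => IsCl.exists_isCl (Q := B.Q E) hB.cl (B.wt Φ hW α) (hf ξ α)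
  exact ⟨_, h, hh, rfl⟩

end IsVal

/-- Replaces the explicit local presentations by the relation `IsVal`. Uniqueness of classes shows
that the glued class agrees with any presentation; conversely presentations exist locally by the
definition of `IsCl`. -/
lemma isPhi_iff (hB : B.Good) (ℓ : ℕ) {K : (Pow s n).Modules} (j : K ⟶ K₀ s E n)
    (ψ : K ⟶ B.T E ℓ 0) : B.IsPhi E ℓ j ψ ↔ ∀ (Φ : Fr E) (W : (Pow s n).Opens) (hW : B.Dom Φ W)
      (x : Γ(K, W)) (f : ({t : Fin k // t ∈ B.S} → Fin 2) → Φ.Ix → Γ(Pow s n, W)),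
      B.IsCoord Φ hW (Scheme.Modules.Hom.app j W x) f →
      B.IsVal Φ ℓ (hB.zDom hW) f (Scheme.Modules.Hom.app ψ W x) := by
  constructor
  · intro H Φ W hW x f hf
    have hloc := H Φ.V Φ.r Φ.e Φ.frame W hW (hB.zDom hW) x f hf
    choose W' hW' N c u hy hD hψ using hloc
    have hcl : ∀ y hy ξ α, IsCl (ι := B.ι) (Q := B.Q E) (m := ℓ - 1)
        (B.wt Φ ((hB.zDom hW).mono (hW' y hy)) α) (rstO (hW' y hy) (ξ.D fun g => f g α))
        (∑ ν, c y hy ξ α ν • hgen (u y hy ξ α ν) (B.wt Φ ((hB.zDom hW).mono (hW' y hy)) α)) := by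
      intro y hy ξ α
      rw [rstO_D]
      have e : ξ.D (fun g => rstO (hW' y hy) (f g α)) =
        ∑ ν, c y hy ξ α ν * ∏ p, idealFun B.ι (u y hy ξ α ν p) := hD y hy ξ α
      rw [e]
      exact IsCl.of_clPairs (sum_mem_clPairs _ _ _ _)
    obtain ⟨τ, hτ⟩ := IsVal.exists_isVal (E := E) (f := f) (hW := hB.zDom hW) (ℓ := ℓ) hB
      fun ξ α y hy' => by
        rw [← germ_rstO (hW' y hy') (hy y hy')]
        exact (hcl y hy' ξ α).germ_mem (hy y hy')
    suffices e : Scheme.Modules.Hom.app ψ W x = τ by rwa [e]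
    obtain ⟨h, hh, rfl⟩ := hτ
    refine section_ext fun y hy' => ⟨W' y hy', hW' y hy', hy y hy', (hψ y hy').trans ?_⟩
    refine Eq.trans ?_ (rst_phiSum (hW' y hy') h).symm
    refine Finset.sum_congr rfl fun ξ _ => Finset.sum_congr rfl fun α _ => ?_
    refine congrArg (fun a => B.tm E a (eR B.S ℓ ξ)) ?_
    have h1 := (hh ξ α).rst (hW' y hy')
    rw [rQ_wt] at h1
    exact (hcl y hy' ξ α).unique hB.cl h1
  · intro H V r e he W hW hZ x f hf y hy
    obtain ⟨h, hh, hψ⟩ := H ⟨V, r, e, he⟩ W hW x f hf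
    obtain ⟨W', hW', hy', hc⟩ := exists_common_open (κ := Idx B.S ℓ × (∀ t, Fin (r t))) hy
      (fun a O => ∃ hO : O ≤ W, (rstO hO (a.1.D fun g => f g a.2), rst hO (h a.1 a.2)) ∈
        clPairs (ι := B.ι) (Q := B.Q E) (ℓ - 1)
          (B.wt ⟨V, r, e, he⟩ (ZDom.mono (Φ := ⟨V, r, e, he⟩) hZ hO) a.2))
      (fun a O O' hle ⟨hO, hp⟩ => ⟨hle.trans hO, by
        have := rst_mem_clPairs hp hle
        rwa [rstO_rstO, rst_rst, rQ_wt] at this⟩)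
      (fun a => by
        obtain ⟨O, hO, hyO, hp⟩ := hh a.1 a.2 y hy
        rw [rQ_wt] at hp
        exact ⟨O, hO, hyO, hO, hp⟩)
    -- The number of terms must be the same for all `(ξ, α)`. Presentations may be padded with zero
    -- terms, and the sum of the minimal lengths bounds each of them.
    choose N₀ hN₀ using fun a => exists_sum_of_clPairs_of_le (hc a).2
    choose c u h₁ h₂ using fun a => hN₀ a (∑ a, N₀ a)
      (Finset.single_le_sum (fun _ _ => Nat.zero_le _) (Finset.mem_univ a))
    refine ⟨W', hW', _, fun ξ α => c (ξ, α), fun ξ α => u (ξ, α), hy', fun ξ α => ?_, ?_⟩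
    · exact (rstO_D hW' ξ _).symm.trans (h₁ (ξ, α))
    · rw [hψ]
      refine (rst_phiSum hW' h).trans ?_
      refine Finset.sum_congr rfl fun ξ _ => Finset.sum_congr rfl fun α _ => ?_
      exact congrArg (fun a => B.tm E a (eR B.S ℓ ξ)) (h₂ (ξ, α))

end Block

end Blocks

/-! ### Change of frames. -/

section Transition

variable {X : Scheme.{0}} {s : X ⟶ Spec (.of ℂ)} {k n : ℕ} {E : Fin k → X.Modules}

lemma pureTensor_sum_smul {Y : Scheme.{0}} {ι : Type} [Fintype ι] [DecidableEq ι] (M : ι → PreMod Y)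
    {U : Y.Opensᵒᵖ} {κ : ι → Type} [∀ t, Fintype (κ t)] [∀ t, DecidableEq (κ t)]
    (c : ∀ t, κ t → (OO Y).obj U) (v : ∀ t, κ t → (M t).obj U) :
    pureTensor M (fun t => ∑ α, c t α • v t α) =
      ∑ α : (∀ t, κ t), (show Γ(Y, unop U) from ∏ t, (show Γ(Y, unop U) from c t (α t))) •
        pureTensor M fun t => v t (α t) := by
  refine (MultilinearMap.map_sum (R := Γ(Y, unop U)) (PiTensorProduct.tprod Γ(Y, unop U))
    fun t α => c t α • v t α).trans ?_
  refine Finset.sum_congr rfl fun α _ => ?_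
  exact MultilinearMap.map_smul_univ (R := Γ(Y, unop U)) (PiTensorProduct.tprod Γ(Y, unop U))
    (fun t => c t (α t)) fun t => v t (α t)

/-- The change of frames. -/
lemma Fr.exists_transition (Φ Φ' : Fr E) :
    ∃ G : ∀ t, Fin (Φ.r t) → Fin (Φ'.r t) → Γ(X, Φ.V t ⊓ Φ'.V t),
      ∀ (t : Fin k) (A : Scheme.{0}) (f : A ⟶ X) (U : A.Opens) (h : U ≤ f ⁻¹ᵁ Φ.V t)
        (h' : U ≤ f ⁻¹ᵁ Φ'.V t) (β : Fin (Φ.r t)),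
        pull f (E t) (Φ.e t β) h = ∑ α, (f.appLE (Φ.V t ⊓ Φ'.V t) U (le_inf h h') (G t β α)) •
          pull f (E t) (Φ'.e t α) h' := by
  have hf := fun t => (Φ'.frame t).isFrameOn
  refine ⟨fun t β => (hf t).coord inf_le_right (rst inf_le_left (Φ.e t β)),
    fun t A f U h h' β => ?_⟩
  have e := (hf t).eq_sum (inf_le_right : Φ.V t ⊓ Φ'.V t ≤ Φ'.V t) (rst inf_le_left (Φ.e t β))
  have hU : U ≤ f ⁻¹ᵁ (Φ.V t ⊓ Φ'.V t) := le_inf h h'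
  have e' := congrArg (fun x => pull f (E t) x hU) e
  refine (pull_rst f inf_le_left hU (Φ.e t β)).symm.trans (e'.trans ?_)
  refine (pull_sum f hU _ _).trans (Finset.sum_congr rfl fun α _ => ?_)
  refine (pull_smul f hU _ _).trans ?_
  exact congrArg _ (pull_rst f inf_le_right hU (Φ'.e t α))

namespace Block

variable {B : Block s k n} {Φ Φ' : Fr E} {W : (Pow s n).Opens} {ℓ : ℕ}

lemma comp_sum {κ : Type} (T : Finset κ) (c : Fin k → Fin n) (x : κ → Γ(K₀ s E n, W)) :
    comp s E n c (∑ a ∈ T, x a) = ∑ a ∈ T, comp s E n c (x a) := app_sum _ _ _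

lemma isFrameOn_pureSec (hW : B.Dom Φ W) (g : {t : Fin k // t ∈ B.S} → Fin 2) :
    IsFrameOn (shf (piTensor fun t => pre ((Scheme.Modules.pullback (pr s n (B.col g t))).obj (E t))))
      fun α : Φ.Ix => pureSec E (fun t => Φ.e t (α t)) (B.col g) (hW g) :=
  isFrameOn_pureTensor (fun t α => pull (pr s n (B.col g t)) (E t) (Φ.e t α) (hW g t))
    fun t => (Φ.frame t).isFrameOn.pull _ _

lemma IsCoord.unique {hW : B.Dom Φ W} {x : Γ(K₀ s E n, W)}
    {f f' : ({t : Fin k // t ∈ B.S} → Fin 2) → Φ.Ix → Γ(Pow s n, W)}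
    (h : B.IsCoord Φ hW x f) (h' : B.IsCoord Φ hW x f') : f = f' := funext fun g => by
  have hF := isFrameOn_pureSec hW g
  rw [← hF.coord_eq le_rfl (comp s E n (B.col g) x) (f g) (by simpa only [rst_self] using h g),
    ← hF.coord_eq le_rfl (comp s E n (B.col g) x) (f' g) (by simpa only [rst_self] using h' g)]

lemma exists_isCoord (hW : B.Dom Φ W) (x : Γ(K₀ s E n, W)) : ∃ f, B.IsCoord Φ hW x f :=
  ⟨fun g => (isFrameOn_pureSec hW g).coord le_rfl (comp s E n (B.col g) x), fun g => by
    have := (isFrameOn_pureSec hW g).eq_sum le_rfl (comp s E n (B.col g) x)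
    simpa only [rst_self] using this⟩

lemma rst_pureSec {U : (Pow s n).Opens} (hU : U ≤ W) {V : Fin k → X.Opens} (e : ∀ t, Γ(E t, V t))
    (c : Fin k → Fin n) (hW : ∀ t, W ≤ pr s n (c t) ⁻¹ᵁ V t) :
    rst hU (pureSec E e c hW) = pureSec E e c (fun t => hU.trans (hW t)) := by
  refine (rst_toShf_pureTensor hU _).trans ?_
  simp only [rst_pull]
  rfl

lemma IsCoord.rst {U : (Pow s n).Opens} {hW : B.Dom Φ W} {x : Γ(K₀ s E n, W)}
    {f : ({t : Fin k // t ∈ B.S} → Fin 2) → Φ.Ix → Γ(Pow s n, W)}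
    (h : B.IsCoord Φ hW x f) (hU : U ≤ W) :
    B.IsCoord Φ (hW.mono hU) (LongDiag.rst hU x) fun g α => rstO hU (f g α) := fun g => by
  have e : comp s E n (B.col g) (LongDiag.rst hU x) = LongDiag.rst hU (comp s E n (B.col g) x) :=
    app_rst _ hU x
  rw [e, h g, rst_sum]
  refine Finset.sum_congr rfl fun α _ => ?_
  rw [rst_smul, rst_pureSec]

lemma IsCoord.add {hW : B.Dom Φ W} {x x' : Γ(K₀ s E n, W)}
    {f f' : ({t : Fin k // t ∈ B.S} → Fin 2) → Φ.Ix → Γ(Pow s n, W)}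
    (h : B.IsCoord Φ hW x f) (h' : B.IsCoord Φ hW x' f') :
    B.IsCoord Φ hW (x + x') fun g α => f g α + f' g α := fun g => by
  have e : comp s E n (B.col g) (x + x') = comp s E n (B.col g) x + comp s E n (B.col g) x' :=
    app_add _ _ _
  rw [e, h g, h' g, ← Finset.sum_add_distrib]
  exact Finset.sum_congr rfl fun α _ => (add_smul _ _ _).symm

lemma IsCoord.smul {hW : B.Dom Φ W} {x : Γ(K₀ s E n, W)}
    {f : ({t : Fin k // t ∈ B.S} → Fin 2) → Φ.Ix → Γ(Pow s n, W)}
    (h : B.IsCoord Φ hW x f) (r : Γ(Pow s n, W)) :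
    B.IsCoord Φ hW (r • x) fun g α => r * f g α := fun g => by
  have e : comp s E n (B.col g) (r • x) = r • comp s E n (B.col g) x :=
    Scheme.Modules.Hom.app_smul _ r x
  rw [e, h g, Finset.smul_sum]
  exact Finset.sum_congr rfl fun α _ => (mul_smul _ _ _).symm

/-- The matrix which describes the change of coordinates for the sections of `K_0`. -/
structure TransData (B : Block s k n) (Φ Φ' : Fr E) (W : (Pow s n).Opens) where
  /-- the entries for one factor, pulled back along the two projections -/
  u : ∀ (_ : {t : Fin k // t ∈ B.S}) (_ : Φ.Ix) (_ : Φ'.Ix), Fin 2 → Γ(Pow s n, W)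
  /-- the contribution of the other factors -/
  c : Φ.Ix → Φ'.Ix → Γ(Pow s n, W)
  mem : ∀ t β α, B.ι.app W (u t β α 0 - u t β α 1) = 0
  coord : ∀ (hW : B.Dom Φ W) (hW' : B.Dom Φ' W) (x : Γ(K₀ s E n, W))
    (f : ({t : Fin k // t ∈ B.S} → Fin 2) → Φ.Ix → Γ(Pow s n, W)), B.IsCoord Φ hW x f →
    B.IsCoord Φ' hW' x fun g α => ∑ β, (∏ t, u t β α (g t)) * (c β α * f g β)
  wt : ∀ (hW : B.ZDom Φ W) (hW' : B.ZDom Φ' W) (g : {t : Fin k // t ∈ B.S} → Fin 2) (β : Φ.Ix),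
    B.wt Φ hW β = ∑ α, (show (OO B.Z).obj (op (B.ι ⁻¹ᵁ W)) from
      B.ι.app W ((∏ t, u t β α (g t)) * c β α)) • B.wt Φ' hW' α

lemma col_of_mem (g : {t : Fin k // t ∈ B.S} → Fin 2) (t : {t : Fin k // t ∈ B.S}) :
    B.col g t.1 = if g t = 0 then B.i else B.j := dif_pos t.2

lemma col_of_notMem (g : {t : Fin k // t ∈ B.S} → Fin 2) {t : Fin k} (ht : t ∉ B.S) :
    B.col g t = B.c t := dif_neg ht

/-- The transition functions on `X` are pulled back along `pr_i` or `pr_j` for the factors in `S`,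
and along a fixed projection for the others. Both pullbacks restrict to the pullback along `q_t`, so
their difference vanishes on the diagonal. -/
lemma exists_transData (hB : B.Good) (hW : B.Dom Φ W) (hW' : B.Dom Φ' W) :
    Nonempty (TransData B Φ Φ' W) := by
  obtain ⟨G, hG⟩ := Fr.exists_transition Φ Φ'
  let a : ∀ (g : {t : Fin k // t ∈ B.S} → Fin 2) (t : Fin k), Fin (Φ.r t) → Fin (Φ'.r t) →
      Γ(Pow s n, W) := fun g t β α =>
    (pr s n (B.col g t)).appLE (Φ.V t ⊓ Φ'.V t) W (le_inf (hW g t) (hW' g t)) (G t β α)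
  have ha : ∀ g g' t (β : Fin (Φ.r t)) (α : Fin (Φ'.r t)), B.col g t = B.col g' t →
      a g t β α = a g' t β α := by
    intro g g' t β α h
    have key : ∀ (c c' : Fin n) (hc : W ≤ pr s n c ⁻¹ᵁ (Φ.V t ⊓ Φ'.V t))
        (hc' : W ≤ pr s n c' ⁻¹ᵁ (Φ.V t ⊓ Φ'.V t)), c = c' →
        (pr s n c).appLE (Φ.V t ⊓ Φ'.V t) W hc (G t β α) =
          (pr s n c').appLE (Φ.V t ⊓ Φ'.V t) W hc' (G t β α) := by
      rintro c c' hc hc' rfl; rfl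
    exact key _ _ _ _ h
  have hq : ∀ g t (β : Fin (Φ.r t)) (α : Fin (Φ'.r t)), B.ι.app W (a g t β α) =
      (B.q t).appLE (Φ.V t ⊓ Φ'.V t) (B.ι ⁻¹ᵁ W) (le_inf (hB.zDom hW t) (hB.zDom hW' t))
        (G t β α) := by
    intro g t β α
    have h := Scheme.Hom.appLE_comp_appLE B.ι (pr s n (B.col g t)) (Φ.V t ⊓ Φ'.V t) W (B.ι ⁻¹ᵁ W)
      (le_inf (hW g t) (hW' g t)) le_rfl
    rw [← Scheme.Hom.app_eq_appLE] at h
    have h' := ConcreteCategory.congr_hom h (G t β α)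
    refine h'.trans ?_
    have key : ∀ (f f' : B.Z ⟶ X) (hf) (hf'), f = f' →
        f.appLE (Φ.V t ⊓ Φ'.V t) (B.ι ⁻¹ᵁ W) hf (G t β α) =
          f'.appLE (Φ.V t ⊓ Φ'.V t) (B.ι ⁻¹ᵁ W) hf' (G t β α) := by
      rintro f f' hf hf' rfl; rfl
    exact key _ _ _ _ (hB.q_eq g t)
  have hprod : ∀ (g : {t : Fin k // t ∈ B.S} → Fin 2) (β : Φ.Ix) (α : Φ'.Ix),
      (∏ t : {t : Fin k // t ∈ B.S}, a (fun _ => g t) t.1 (β t.1) (α t.1)) *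
        ∏ t : {t : Fin k // ¬ t ∈ B.S}, a (fun _ => 0) t.1 (β t.1) (α t.1) =
      ∏ t, a g t (β t) (α t) := by
    intro g β α
    rw [← Fintype.prod_subtype_mul_prod_subtype (fun t => t ∈ B.S)]
    congr 1
    · refine Finset.prod_congr (by ext; simp) fun t _ => ha _ _ _ _ _ ?_
      rw [col_of_mem _ t, col_of_mem _ t]
    · exact Finset.prod_congr rfl fun t _ => ha _ _ _ _ _ (by
        rw [col_of_notMem _ t.2, col_of_notMem _ t.2])
  refine ⟨{
    u := fun t β α v => a (fun _ => v) t.1 (β t.1) (α t.1)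
    c := fun β α => ∏ t : {t : Fin k // ¬ t ∈ B.S}, a (fun _ => 0) t.1 (β t.1) (α t.1)
    mem := fun t β α => by rw [map_sub, hq, hq, sub_self]
    coord := fun hW hW' x f hf g => ?_
    wt := fun hZ hZ' g β => ?_ }⟩
  · have e : ∀ β : Φ.Ix, pureSec E (fun t => Φ.e t (β t)) (B.col g) (hW g) =
        ∑ α : Φ'.Ix, (∏ t, a g t (β t) (α t)) •
          pureSec E (fun t => Φ'.e t (α t)) (B.col g) (hW' g) := by
      intro β
      have h1 : (fun t => pull (pr s n (B.col g t)) (E t) (Φ.e t (β t)) (hW g t)) =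
          fun t => ∑ α, a g t (β t) α • pull (pr s n (B.col g t)) (E t) (Φ'.e t α) (hW' g t) :=
        funext fun t => hG t _ _ W (hW g t) (hW' g t) (β t)
      unfold pureSec
      rw [h1]
      refine (congrArg (toShf _) (pureTensor_sum_smul (U := op W)
        (fun t => pre ((Scheme.Modules.pullback (pr s n (B.col g t))).obj (E t)))
        (fun t α => a g t (β t) α)
        (fun t α => pull (pr s n (B.col g t)) (E t) (Φ'.e t α) (hW' g t)))).trans ?_
      rw [toShf_sum]
      exact Finset.sum_congr rfl fun α _ => toShf_smul _ _ _
    rw [hf g]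
    simp only [e, Finset.smul_sum, Finset.sum_smul]
    rw [Finset.sum_comm]
    refine Finset.sum_congr rfl fun α _ => Finset.sum_congr rfl fun β _ => ?_
    rw [← hprod, ← mul_smul]
    congr 1
    ring
  · have h1 : (fun t => pull (B.q t) (E t) (Φ.e t (β t)) (hZ t)) =
        fun t => ∑ α, B.ι.app W (a g t (β t) α) • pull (B.q t) (E t) (Φ'.e t α) (hZ' t) :=
      funext fun t => by
        simp only [hq]
        exact hG t _ _ _ (hZ t) (hZ' t) (β t)
    unfold Block.wt
    rw [h1]
    refine (pureTensor_sum_smul (U := op (B.ι ⁻¹ᵁ W))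
        (fun t => pre ((Scheme.Modules.pullback (B.q t)).obj (E t)))
        (fun t α => B.ι.app W (a g t (β t) α))
        (fun t α => pull (B.q t) (E t) (Φ'.e t α) (hZ' t))).trans ?_
    refine Finset.sum_congr rfl fun α _ => ?_
    rw [hprod, map_prod]

end Block

end Transition

/-! ### Independence of the frames, for the filtration and for the values of `φ_ℓ`. -/

section FrameIndependence

variable {X : Scheme.{0}} {s : X ⟶ Spec (.of ℂ)} {k n : ℕ} {E : Fin k → X.Modules}

namespace Block

variable {B : Block s k n} {Φ Φ' : Fr E} {W U : (Pow s n).Opens} {ℓ p : ℕ}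

lemma germ_D {r : ℕ} (ξ : Idx B.S r) {y : Pow s n} (hy : y ∈ W)
    (F : ({t : Fin k // t ∈ B.S} → Fin 2) → Γ(Pow s n, W)) :
    (Pow s n).presheaf.germ W y hy (ξ.D F) = ξ.D fun g => (Pow s n).presheaf.germ W y hy (F g) :=
  ξ.map_D ((Pow s n).presheaf.germ W y hy).hom F

/-- The germs of the coordinates at `y` satisfy the filtration condition. -/
def FilCoord (p : ℕ) (f : ({t : Fin k // t ∈ B.S} → Fin 2) → Φ.Ix → Γ(Pow s n, W)) {y : Pow s n}
    (hy : y ∈ W) : Prop :=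
  ∀ α, FilAt (stalkIdeal B.ι y) p fun g => (Pow s n).presheaf.germ W y hy (f g α)

lemma filCoord_rst_iff {f : ({t : Fin k // t ∈ B.S} → Fin 2) → Φ.Ix → Γ(Pow s n, W)} {y : Pow s n}
    (hU : U ≤ W) (hy : y ∈ U) :
    FilCoord (B := B) p (fun g α => rstO hU (f g α)) hy ↔ FilCoord (B := B) p f (hU hy) := by
  simp only [FilCoord, germ_rstO]

namespace TransData

variable (D : TransData B Φ Φ' W)

lemma germ_mem (t) (β : Φ.Ix) (α : Φ'.Ix) {y : Pow s n} (hy : y ∈ W) :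
    (Pow s n).presheaf.germ W y hy (D.u t β α 0) - (Pow s n).presheaf.germ W y hy (D.u t β α 1) ∈
      stalkIdeal B.ι y := by
  rw [← map_sub]
  exact germ_mem_stalkIdeal hy _ (D.mem t β α)

lemma filCoord {f : ({t : Fin k // t ∈ B.S} → Fin 2) → Φ.Ix → Γ(Pow s n, W)} {y : Pow s n}
    {hy : y ∈ W} (h : FilCoord (B := B) p f hy) : FilCoord (B := B) (Φ := Φ') p
      (fun g α => ∑ β, (∏ t, D.u t β α (g t)) * (D.c β α * f g β)) hy := fun α => by
  simp only [map_sum, map_mul, map_prod]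
  exact FilAt.sum _ fun β _ => ((h β).mul_left _).prod_mul
    (fun t v => (Pow s n).presheaf.germ W y hy (D.u t β α v)) fun t => D.germ_mem t β α hy

/-- The functions change by multipliers of the kind treated in `FilAt.D_prod_mul_sub_mem`, and the
frame of the target changes by the restrictions of the same multipliers to the diagonal. Linearity
of classes in the frame vector matches the two. -/
lemma isVal (hB : B.Good) (hℓ : 1 ≤ ℓ) {hW : B.ZDom Φ W} (hW' : B.ZDom Φ' W)
    {f : ({t : Fin k // t ∈ B.S} → Fin 2) → Φ.Ix → Γ(Pow s n, W)}
    (hf : ∀ y (hy : y ∈ W), FilCoord (B := B) (ℓ - 1) f hy) {τ : Γ(B.T E ℓ 0, W)}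
    (h : B.IsVal Φ ℓ hW f τ) :
    B.IsVal Φ' ℓ hW' (fun g α => ∑ β, (∏ t, D.u t β α (g t)) * (D.c β α * f g β)) τ := by
  have hmem : ∀ (ξ : Idx B.S ℓ) (β : Φ.Ix) (y) (hy : y ∈ W),
      (Pow s n).presheaf.germ W y hy (ξ.D fun g => f g β) ∈ stalkIdeal B.ι y ^ (ℓ - 1) :=
    fun ξ β y hy => h.germ_mem ξ β hy
  obtain ⟨h, hh, rfl⟩ := h
  choose h₂ hh₂ using fun ξ β (α : Φ'.Ix) =>
    IsCl.exists_isCl (Q := B.Q E) hB.cl (B.wt Φ' hW' α) (hmem ξ β)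
  -- The transition matrix at the vertex where all free coordinates are `0`, the vertex that occurs
  -- in the Leibniz rule; on the diagonal any other vertex gives the same matrix.
  let b : Idx B.S ℓ → Φ.Ix → Φ'.Ix → Γ(Pow s n, W) := fun ξ β α =>
    (∏ t, D.u t β α (base ξ.wd t.1)) * D.c β α
  have hsum : ∀ ξ β, h ξ β = ∑ α, b ξ β α • h₂ ξ β α := fun ξ β => by
    refine (hh ξ β).unique hB.cl ?_
    rw [D.wt hW hW' (fun t => base ξ.wd t.1) β]
    exact IsCl.sum_right hB.cl _ (hmem ξ β) fun α _ => (hh₂ ξ β α).smul_right hB.cl (b ξ β α)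
  refine ⟨fun ξ α => ∑ β, b ξ β α • h₂ ξ β α, fun ξ α => ?_, ?_⟩
  · have h1 := IsCl.sum Finset.univ fun β (_ : β ∈ Finset.univ) => (hh₂ ξ β α).smul (b ξ β α)
    -- The error of the Leibniz rule lies in `I^ℓ`, so its class of degree `ℓ - 1` is zero.
    have h2 : IsCl (ι := B.ι) (m := ℓ - 1) (B.wt Φ' hW' α)
        ((ξ.D fun g => ∑ β, (∏ t, D.u t β α (g t)) * (D.c β α * f g β)) -
          ∑ β, b ξ β α * ξ.D fun g => f g β) 0 := IsCl.of_germ_mem_succ fun y hy => by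
      rw [ξ.D_sum, ← Finset.sum_sub_distrib, map_sum]
      refine sum_mem fun β _ => ?_
      have h3 := ((hf y hy β).mul_left ((Pow s n).presheaf.germ W y hy (D.c β α))).D_prod_mul_sub_mem
        (fun t v => (Pow s n).presheaf.germ W y hy (D.u t β α v)) (fun t => D.germ_mem t β α hy)
        ξ (by omega)
      rw [Nat.sub_add_cancel hℓ]
      convert h3 using 1
      rw [map_sub, germ_D, map_mul, germ_D, ξ.D_mul]
      simp only [map_mul, map_prod, b, mul_assoc]
    have h4 := h1.add h2
    rw [add_sub_cancel, add_zero] at h4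
    exact h4
  · refine Finset.sum_congr rfl fun ξ _ => ?_
    have e : ∀ β, B.tm E (h ξ β) (eR B.S ℓ ξ) =
        ∑ α, B.tm E (b ξ β α • h₂ ξ β α) (eR B.S ℓ ξ) := fun β => by
      rw [hsum ξ β, tm_sum_left]
    simp only [e, tm_sum_left]
    exact Finset.sum_comm

end TransData

variable {x : Γ(K₀ s E n, W)}

lemma IsVal.congr_frame (hB : B.Good) (hℓ : 1 ≤ ℓ) {hW : B.Dom Φ W} {hW' : B.Dom Φ' W}
    {f : ({t : Fin k // t ∈ B.S} → Fin 2) → Φ.Ix → Γ(Pow s n, W)}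
    {f' : ({t : Fin k // t ∈ B.S} → Fin 2) → Φ'.Ix → Γ(Pow s n, W)}
    (hx : B.IsCoord Φ hW x f) (hx' : B.IsCoord Φ' hW' x f')
    (hf : ∀ y (hy : y ∈ W), FilCoord (B := B) (ℓ - 1) f hy) {τ : Γ(B.T E ℓ 0, W)}
    (h : B.IsVal Φ ℓ (hB.zDom hW) f τ) : B.IsVal Φ' ℓ (hB.zDom hW') f' τ := by
  obtain ⟨D⟩ := exists_transData hB hW hW'
  rw [hx'.unique (D.coord hW hW' x f hx)]
  exact D.isVal hB hℓ _ hf h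

lemma FilCoord.congr_frame (hB : B.Good) {hW : B.Dom Φ W} {hW' : B.Dom Φ' W}
    {f : ({t : Fin k // t ∈ B.S} → Fin 2) → Φ.Ix → Γ(Pow s n, W)}
    {f' : ({t : Fin k // t ∈ B.S} → Fin 2) → Φ'.Ix → Γ(Pow s n, W)}
    (hx : B.IsCoord Φ hW x f) (hx' : B.IsCoord Φ' hW' x f') {y : Pow s n} {hy : y ∈ W}
    (h : FilCoord (B := B) p f hy) : FilCoord (B := B) p f' hy := by
  obtain ⟨D⟩ := exists_transData hB hW hW'
  rw [hx'.unique (D.coord hW hW' x f hx)]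
  exact D.filCoord h

variable (B) in
/-- The differences of order `r` of the coordinates of `x` lie in the `r`-th power of the ideal of
the diagonal at `y`, for `r ≤ p`. -/
def InFil (p : ℕ) (x : Γ(K₀ s E n, W)) (y : Pow s n) : Prop :=
  ∀ (Φ : Fr E) (U : (Pow s n).Opens) (hU : U ≤ W) (hΦ : B.Dom Φ U)
    (f : ({t : Fin k // t ∈ B.S} → Fin 2) → Φ.Ix → Γ(Pow s n, U)),
    B.IsCoord Φ hΦ (rst hU x) f → ∀ hy : y ∈ U, FilCoord (B := B) p f hy

lemma InFil.mono {q : ℕ} {y : Pow s n} (h : B.InFil p x y) (hq : q ≤ p) : B.InFil q x y :=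
  fun Φ U hU hΦ f hf hy α => (h Φ U hU hΦ f hf hy α).mono hq

/-- Two choices of frames are compared on the intersection of their domains, which suffices because
the condition only concerns germs at `y`. -/
lemma InFil.of_coord (hB : B.Good) {hU : U ≤ W} {hΦ : B.Dom Φ U}
    {f : ({t : Fin k // t ∈ B.S} → Fin 2) → Φ.Ix → Γ(Pow s n, U)}
    (hf : B.IsCoord Φ hΦ (LongDiag.rst hU x) f) {y : Pow s n} {hy : y ∈ U}
    (h : FilCoord (B := B) p f hy) : B.InFil p x y := fun Φ' V hV hΦ' f' hf' hy' => by
  have h1 := hf.rst (inf_le_left : U ⊓ V ≤ U)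
  have h2 := hf'.rst (inf_le_right : U ⊓ V ≤ V)
  rw [rst_rst] at h1 h2
  refine (filCoord_rst_iff inf_le_right (mem_inf_opens hy hy')).1 (FilCoord.congr_frame hB h1 h2 ?_)
  exact (filCoord_rst_iff inf_le_left (mem_inf_opens hy hy')).2 h

lemma InFil.of_stalkIdeal_eq_top {y : Pow s n} (hy : stalkIdeal B.ι y = ⊤) : B.InFil p x y :=
  fun _ _ _ _ _ _ _ _ => by rw [hy]; exact FilAt.of_top

lemma InFil.zero {y : Pow s n} : B.InFil 0 x y := fun _ _ _ _ _ _ _ _ => FilAt.zero_right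

variable (E) in
/-- Around every point of the diagonal, the sheaves `E_t` have frames. -/
lemma exists_frame (hB : B.Good) (hE : ∀ t, IsLocFree (E t)) (z : B.Z) {U : (Pow s n).Opens}
    (hU : B.ι z ∈ U) : ∃ (Φ : Fr E) (V : (Pow s n).Opens), V ≤ U ∧ B.ι z ∈ V ∧ B.Dom Φ V := by
  choose V r e hV he using fun t => hE t (B.q t z)
  let Φ : Fr E := ⟨V, r, e, he⟩
  obtain ⟨O, hO, hz, h⟩ := exists_common_open (κ := ({t : Fin k // t ∈ B.S} → Fin 2) × Fin k) hU
    (fun a O => O ≤ pr s n (B.col a.1 a.2) ⁻¹ᵁ V a.2) (fun a O O' hO h => hO.trans h) fun a => by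
      refine ⟨U ⊓ pr s n (B.col a.1 a.2) ⁻¹ᵁ V a.2, inf_le_left, mem_inf_opens hU ?_, inf_le_right⟩
      change (pr s n (B.col a.1 a.2)) (B.ι z) ∈ V a.2
      rw [← Scheme.Hom.comp_apply, hB.q_eq]
      exact hV a.2
  exact ⟨Φ, O, hO, hz, fun g t => h (g, t)⟩

lemma exists_disjoint (hB : B.Good) {y : Pow s n} (hy : y ∉ Set.range B.ι) (hyW : y ∈ W) :
    ∃ V ≤ W, y ∈ V ∧ B.ι ⁻¹ᵁ V = ⊥ := by
  have := hB.cl.closed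
  refine ⟨W ⊓ ⟨(Set.range B.ι)ᶜ, (IsClosedImmersion.isClosedEmbedding B.ι).isClosed_range.isOpen_compl⟩,
    inf_le_left, ⟨hyW, hy⟩, ?_⟩
  ext z
  simp

lemma HV_section_eq_zero {m : ℕ} {V : Type} [AddCommGroup V] [Module ℂ V] (hW : B.ι ⁻¹ᵁ W = ⊥)
    (τ : Γ(B.HV E m V, W)) : τ = 0 := by
  have hH : ∀ (O : (Pow s n).Opens) (_ : O ≤ W) (h : Γ(HS B.ι m (B.Q E), O)), h = 0 := by
    intro O hO h
    have hb : B.ι ⁻¹ᵁ O = ⊥ := le_bot_iff.1 (hW ▸ preim_le hO)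
    refine section_ext (M := shf (HSPre B.ι m (B.Q E))) (U := B.ι ⁻¹ᵁ O) fun z hz => ?_
    rw [hb] at hz
    exact hz.elim
  refine section_ext fun y hy => ?_
  obtain ⟨O, hO, τ', hyO, hτ⟩ := toShf_locally_surjective (scPre (str s n) (pre (B.H E m)) V) τ y hy
  refine ⟨O, hO, hyO, hτ.trans ?_⟩
  rw [rst_zero]
  clear hτ
  induction τ' using ScTensor.induction with
  | h h v =>
    have : h = (0 : Γ(HS B.ι m (B.Q E), O)) := hH O hO h
    subst this
    exact tm_zero_left v
  | h' a b ha hb =>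
    refine (toShf_add (scPre (str s n) (pre (B.H E m)) V) a b).trans ?_
    exact (congrArg₂ (· + ·) ha hb).trans (add_zero _)

lemma mem_range_or_eq_top (hB : B.Good) (y : Pow s n) : (∃ z, B.ι z = y) ∨ stalkIdeal B.ι y = ⊤ := by
  by_cases hy : y ∈ Set.range B.ι
  · exact .inl hy
  · obtain ⟨V, -, hyV, hV⟩ := exists_disjoint (W := ⊤) hB hy trivial
    exact .inr (stalkIdeal_eq_top hyV hV)

end Block

end FrameIndependence

/-! ### Existence, uniqueness and kernel of `φ_ℓ` on one block. -/

section Existence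

variable {X : Scheme.{0}} {s : X ⟶ Spec (.of ℂ)} {k n : ℕ} {E : Fin k → X.Modules}

namespace Block

variable {B : Block s k n} {Φ : Fr E} {W U : (Pow s n).Opens} {ℓ p : ℕ}

lemma IsVal.zero_of_filCoord {hW : B.ZDom Φ W}
    {f : ({t : Fin k // t ∈ B.S} → Fin 2) → Φ.Ix → Γ(Pow s n, W)} (hℓ : 1 ≤ ℓ)
    (hf : ∀ y (hy : y ∈ W), FilCoord (B := B) ℓ f hy) :
    B.IsVal Φ ℓ hW f (0 : Γ(B.T E ℓ 0, W)) := by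
  refine ⟨fun _ _ => 0, fun ξ α => IsCl.of_germ_mem_succ fun y hy => ?_, ?_⟩
  · rw [Nat.sub_add_cancel hℓ, germ_D]
    exact hf y hy α ℓ le_rfl ξ
  · exact (Finset.sum_eq_zero fun ξ _ => Finset.sum_eq_zero fun α _ => tm_zero_left _).symm

lemma exists_isVal_of_filCoord (hB : B.Good) (hℓ : 1 ≤ ℓ) {hW : B.ZDom Φ W}
    {f : ({t : Fin k // t ∈ B.S} → Fin 2) → Φ.Ix → Γ(Pow s n, W)}
    (hf : ∀ y (hy : y ∈ W), FilCoord (B := B) (ℓ - 1) f hy) :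
    ∃ τ : Γ(B.T E ℓ 0, W), B.IsVal Φ ℓ hW f τ := by
  obtain ⟨p, rfl⟩ : ∃ p, ℓ = p + 1 := ⟨ℓ - 1, by omega⟩
  refine IsVal.exists_isVal hB fun ξ α y hy => ?_
  rw [germ_D]
  exact (hf y hy α).D_mem ξ

/-- The section `τ` is the value of `φ_ℓ` at `x`. -/
def Rel (hB : B.Good) (ℓ : ℕ) (x : Γ(K₀ s E n, W)) (τ : Γ(B.T E ℓ 0, W)) : Prop :=
  ∀ (Φ : Fr E) (U : (Pow s n).Opens) (hU : U ≤ W) (hΦ : B.Dom Φ U)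
    (f : ({t : Fin k // t ∈ B.S} → Fin 2) → Φ.Ix → Γ(Pow s n, U)),
    B.IsCoord Φ hΦ (rst hU x) f → B.IsVal Φ ℓ (hB.zDom hΦ) f (rst hU τ)

variable {hB : B.Good} {x x' : Γ(K₀ s E n, W)} {τ τ' : Γ(B.T E ℓ 0, W)}

lemma Rel.rst (h : Rel hB ℓ x τ) (hU : U ≤ W) : Rel hB ℓ (rst hU x) (rst hU τ) :=
  fun Φ V hV hΦ f hf => by
    rw [rst_rst] at hf ⊢
    exact h Φ V _ hΦ f hf

/-- An induction principle: it suffices to consider the points of the diagonal, where there are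
frames, and open subsets which do not meet the diagonal. -/
lemma exists_frame_or_disjoint (hB : B.Good) (hE : ∀ t, IsLocFree (E t)) {y : Pow s n} (hy : y ∈ W) :
    (∃ (Φ : Fr E) (V : (Pow s n).Opens), V ≤ W ∧ y ∈ V ∧ B.Dom Φ V) ∨
      ∃ V ≤ W, y ∈ V ∧ B.ι ⁻¹ᵁ V = ⊥ := by
  by_cases h : y ∈ Set.range B.ι
  · obtain ⟨z, rfl⟩ := h
    exact .inl (exists_frame E hB hE z hy)
  · exact .inr (exists_disjoint hB h hy)

/-- At points of the diagonal frames exist and classes are unique; away from the diagonal the target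
has no nonzero sections. -/
lemma Rel.unique (hE : ∀ t, IsLocFree (E t)) (h : Rel hB ℓ x τ) (h' : Rel hB ℓ x τ') : τ = τ' := by
  refine section_ext fun y hy => ?_
  obtain ⟨Φ, V, hV, hyV, hΦ⟩ | ⟨V, hV, hyV, hb⟩ := exists_frame_or_disjoint hB hE hy
  · obtain ⟨f, hf⟩ := exists_isCoord hΦ (LongDiag.rst hV x)
    exact ⟨V, hV, hyV, (h Φ V hV hΦ f hf).unique hB (h' Φ V hV hΦ f hf)⟩
  · exact ⟨V, hV, hyV, (HV_section_eq_zero hb _).trans (HV_section_eq_zero hb _).symm⟩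

lemma Rel.of_isVal (hℓ : 1 ≤ ℓ) {hΦ : B.Dom Φ W}
    {f : ({t : Fin k // t ∈ B.S} → Fin 2) → Φ.Ix → Γ(Pow s n, W)} (hf : B.IsCoord Φ hΦ x f)
    (hx : ∀ y (hy : y ∈ W), FilCoord (B := B) (ℓ - 1) f hy)
    (h : B.IsVal Φ ℓ (hB.zDom hΦ) f τ) : Rel hB ℓ x τ := fun _ _ hU _ _ hf' =>
  IsVal.congr_frame hB hℓ (hf.rst hU) hf'
    (fun y hy => (filCoord_rst_iff hU hy).2 (hx y (hU hy))) (h.rst hU)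

lemma Rel.of_disjoint (hb : B.ι ⁻¹ᵁ W = ⊥) : Rel hB ℓ x τ := fun Φ U hU hΦ f hf => by
  have hbU : B.ι ⁻¹ᵁ U = ⊥ := le_bot_iff.1 (hb ▸ preim_le hU)
  obtain ⟨τ', h⟩ := IsVal.exists_isVal (E := E) (ℓ := ℓ) (hW := hB.zDom hΦ) (f := f) hB
    fun ξ α y hy => by rw [stalkIdeal_eq_top hy hbU, Ideal.top_pow]; trivial
  rwa [show LongDiag.rst hU τ = τ' from
    (HV_section_eq_zero hbU _).trans (HV_section_eq_zero hbU _).symm]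

lemma Rel.add (h : Rel hB ℓ x τ) (h' : Rel hB ℓ x' τ') : Rel hB ℓ (x + x') (τ + τ') :=
  fun Φ U hU hΦ f hf => by
    obtain ⟨f₁, h₁⟩ := exists_isCoord hΦ (LongDiag.rst hU x)
    obtain ⟨f₂, h₂⟩ := exists_isCoord hΦ (LongDiag.rst hU x')
    rw [rst_add] at hf ⊢
    rw [hf.unique (h₁.add h₂)]
    exact (h Φ U hU hΦ f₁ h₁).add (h' Φ U hU hΦ f₂ h₂)

lemma Rel.smul (h : Rel hB ℓ x τ) (r : Γ(Pow s n, W)) : Rel hB ℓ (r • x) (r • τ) :=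
  fun Φ U hU hΦ f hf => by
    obtain ⟨f₁, h₁⟩ := exists_isCoord hΦ (LongDiag.rst hU x)
    rw [rst_smul] at hf ⊢
    rw [hf.unique (h₁.smul _)]
    exact (h Φ U hU hΦ f₁ h₁).smul _

lemma Rel.zero (hℓ : 1 ≤ ℓ) (hx : ∀ y ∈ W, B.InFil ℓ x y) :
    Rel hB ℓ x (0 : Γ(B.T E ℓ 0, W)) := fun Φ U hU hΦ f hf => by
  rw [rst_zero]
  exact IsVal.zero_of_filCoord hℓ fun y hy => hx y (hU hy) Φ U hU hΦ f hf hy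

lemma Rel.exists_local (hB : B.Good) (hE : ∀ t, IsLocFree (E t)) (hℓ : 1 ≤ ℓ)
    (hx : ∀ y ∈ W, B.InFil (ℓ - 1) x y) {y : Pow s n} (hy : y ∈ W) :
    ∃ (V : (Pow s n).Opens) (hV : V ≤ W), y ∈ V ∧
      ∃ τ : Γ(B.T E ℓ 0, V), Rel hB ℓ (LongDiag.rst hV x) τ := by
  obtain ⟨Φ, V, hV, hyV, hΦ⟩ | ⟨V, hV, hyV, hb⟩ := exists_frame_or_disjoint hB hE hy
  · obtain ⟨f, hf⟩ := exists_isCoord hΦ (LongDiag.rst hV x)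
    have hf' : ∀ y (hy : y ∈ V), FilCoord (B := B) (ℓ - 1) f hy :=
      fun y hy => hx y (hV hy) Φ V hV hΦ f hf hy
    obtain ⟨τ, hτ⟩ := exists_isVal_of_filCoord (hW := hB.zDom hΦ) hB hℓ hf'
    exact ⟨V, hV, hyV, τ, Rel.of_isVal hℓ hf hf' hτ⟩
  · exact ⟨V, hV, hyV, 0, Rel.of_disjoint hb⟩

variable {K : (Pow s n).Modules} {j : K ⟶ K₀ s E n}

lemma isPhi_iff_rel (hB : B.Good) (ψ : K ⟶ B.T E ℓ 0) : B.IsPhi E ℓ j ψ ↔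
    ∀ (W : (Pow s n).Opens) (x : Γ(K, W)),
      Rel hB ℓ (Scheme.Modules.Hom.app j W x) (Scheme.Modules.Hom.app ψ W x) := by
  rw [isPhi_iff hB]
  constructor
  · intro H W x Φ U hU hΦ f hf
    rw [← app_rst] at hf ⊢
    exact H Φ U hΦ _ f hf
  · intro H Φ W hW x f hf
    have := H W x Φ W le_rfl hW f (by rwa [rst_self])
    rwa [rst_self] at this

/-- The relation `Rel` is compatible with restriction, linear and functional; the filtration
condition makes it locally total. It is therefore the graph of a morphism. -/
theorem exists_isPhi (hB : B.Good) (hE : ∀ t, IsLocFree (E t)) (hℓ : 1 ≤ ℓ) (j : K ⟶ K₀ s E n)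
    (hj : ∀ (W : (Pow s n).Opens) (x : Γ(K, W)), ∀ y ∈ W,
      B.InFil (ℓ - 1) (Scheme.Modules.Hom.app j W x) y) :
    ∃ ψ : K ⟶ B.T E ℓ 0, B.IsPhi E ℓ j ψ := by
  obtain ⟨ψ, hψ⟩ := exists_hom_of_relation
    (fun W (x : Γ(K, W)) (τ : Γ(B.T E ℓ 0, W)) => Rel hB ℓ (Scheme.Modules.Hom.app j W x) τ)
    (fun W V h x z hz => by rw [app_rst]; exact hz.rst h)
    (fun W x y hy => by
      simp only [app_rst]
      exact Rel.exists_local hB hE hℓ (hj W x) hy)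
    (fun W x z z' h h' => h.unique hE h')
    (fun W x x' z z' h h' => by rw [app_add]; exact h.add h')
    (fun W r x z h => by rw [Scheme.Modules.Hom.app_smul]; exact h.smul r)
  refine ⟨ψ, (isPhi_iff_rel hB ψ).2 fun W x Φ U hU hΦ f hf => ?_⟩
  have hf' : ∀ y (hy : y ∈ U), FilCoord (B := B) (ℓ - 1) f hy :=
    fun y hy => hj W x y (hU hy) Φ U hU hΦ f hf hy
  obtain ⟨τ, hτ⟩ := exists_isVal_of_filCoord (hW := hB.zDom hΦ) hB hℓ hf'
  have := hψ U (LongDiag.rst hU x) τ (by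
    rw [app_rst]
    exact Rel.of_isVal hℓ hf hf' hτ)
  rw [← app_rst, this]
  exact hτ

theorem isPhi_unique (hB : B.Good) (hE : ∀ t, IsLocFree (E t)) {ψ ψ' : K ⟶ B.T E ℓ 0}
    (h : B.IsPhi E ℓ j ψ) (h' : B.IsPhi E ℓ j ψ') : ψ = ψ' :=
  hom_ext_sections fun W x =>
    ((isPhi_iff_rel hB ψ).1 h W x).unique hE ((isPhi_iff_rel hB ψ').1 h' W x)

/-- Functionals which detect the components of a section of `T_ℓ^0`. -/
lemma IsVal.mem_of_eq_zero (hB : B.Good) (hℓ : 1 ≤ ℓ) {hΦ : B.ZDom Φ W}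
    {f : ({t : Fin k // t ∈ B.S} → Fin 2) → Φ.Ix → Γ(Pow s n, W)}
    (h : B.IsVal Φ ℓ hΦ f (0 : Γ(B.T E ℓ 0, W))) {y : Pow s n} (hy : y ∈ W) (ξ : Idx B.S ℓ)
    (α : Φ.Ix) : (Pow s n).presheaf.germ W y hy (ξ.D fun g => f g α) ∈ stalkIdeal B.ι y ^ ℓ := by
  classical
  obtain ⟨z, rfl⟩ | htop := mem_range_or_eq_top hB y
  swap
  · rw [htop, Ideal.top_pow]; trivial
  have hι := hB.cl.closed
  obtain ⟨h, hh, h0⟩ := h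
  obtain ⟨l, hl⟩ := exists_dual_eR hℓ ξ
  have hfr := fun t => (Φ.frame t).isFrameOn
  have hz : ∀ t, B.q t z ∈ Φ.V t := fun t => hΦ t hy
  -- The coordinate functional for the multiindex `α`, with values in the graded ring.
  let Ψ : PFun (grHom hι z) (B.Q E) := PFun.pi fun t =>
    ((hfr t).pfun (hz t) ((grHom hι z).comp ((B.q t).stalkMap z).hom) (α t)).pullback
  have hΨ : ∀ β, Ψ.toFun (op (B.ι ⁻¹ᵁ W)) hy (B.wt Φ hΦ β) = if α = β then 1 else 0 := by
    intro β
    refine (PFun.pi_pureTensor _ (U := op (B.ι ⁻¹ᵁ W)) hy _).trans ?_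
    have e : ∀ t, (((hfr t).pfun (hz t) ((grHom hι z).comp ((B.q t).stalkMap z).hom)
        (α t)).pullback).toFun (op (B.ι ⁻¹ᵁ W)) hy (pull (B.q t) (E t) (Φ.e t (β t)) (hΦ t)) =
        if α t = β t then 1 else 0 := fun t => by
      refine (PFun.pullback_pull _ (Φ.e t (β t)) (hΦ t) hy).trans ?_
      have := (hfr t).pfun_frame (hz t) ((grHom hι z).comp ((B.q t).stalkMap z).hom) (α t) (β t)
        le_rfl (hz t)
      rwa [rst_self] at this
    refine (Finset.prod_congr rfl fun t _ => e t).trans ?_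
    split_ifs with hαβ
    · subst hαβ; simp
    · obtain ⟨t, ht⟩ := Function.ne_iff.1 hαβ
      exact Finset.prod_eq_zero (Finset.mem_univ t) (if_neg ht)
  -- Combined with the form dual to `e_ξ`, this functional extracts from a value of `φ_ℓ` the class
  -- of its alternating sum for `(ξ, α)` in degree `ℓ - 1` of the graded ring.
  let T : PFun ((grHom hι z).comp (B.ι.stalkMap z).hom) (pre (B.HV E (ℓ - 1) (R B.S ℓ 0))) :=
    ((clPFun hι z (ℓ - 1) Ψ).scal (str s n) l).shf
  have hT : ∀ ξ' β, T.ev hy (B.tm E (h ξ' β) (eR B.S ℓ ξ')) =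
      if ξ = ξ' ∧ α = β then grMk _ (ℓ - 1) _ ((hh ξ β).germ_mem hy) else 0 := by
    intro ξ' β
    refine (PFun.ev_shf_toShf _ (U := W) hy _).trans ?_
    refine (PFun.scal_scTmul (M := pre (HS B.ι (ℓ - 1) (B.Q E))) (str s n)
      (clPFun hι z (ℓ - 1) Ψ) l (U := op W) hy (h ξ' β) (eR B.S ℓ ξ')).trans ?_
    refine (congrArg (_ * ·) ((hh ξ' β).clPFun_ev hι z Ψ hy)).trans ?_
    rw [hΨ, hl]
    by_cases h1 : ξ = ξ'
    · subst h1
      by_cases h2 : α = β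
      · subst h2; simp
      · simp [h2]
    · simp [h1]
  have e := congrArg (T.ev hy) h0
  have e2 : T.ev hy (∑ ξ', ∑ β, B.tm E (h ξ' β) (eR B.S ℓ ξ')) =
      grMk _ (ℓ - 1) _ ((hh ξ α).germ_mem hy) := by
    simp only [map_sum, hT]
    rw [Finset.sum_eq_single ξ, Finset.sum_eq_single α]
    · simp
    · intro β _ hβ; rw [if_neg]; exact fun h => hβ h.2.symm
    · simp
    · intro ξ' _ hξ
      refine Finset.sum_eq_zero fun β _ => if_neg fun h => hξ h.1.symm
    · simp
  have := mem_of_grMk_eq_zero ((hh ξ α).germ_mem hy) (e2.symm.trans (e.symm.trans (map_zero (T.ev hy))))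
  rwa [Nat.sub_add_cancel hℓ] at this

/-- If the value vanishes, the functionals of `IsVal.mem_of_eq_zero` give the condition of order
`ℓ`, the lower orders being assumed. Conversely, if all conditions hold, zero is a value, and values
are unique. -/
theorem IsPhi.app_eq_zero_iff (hB : B.Good) (hE : ∀ t, IsLocFree (E t)) (hℓ : 1 ≤ ℓ)
    {ψ : K ⟶ B.T E ℓ 0} (h : B.IsPhi E ℓ j ψ) (x : Γ(K, W))
    (hx : ∀ y ∈ W, B.InFil (ℓ - 1) (Scheme.Modules.Hom.app j W x) y) :
    Scheme.Modules.Hom.app ψ W x = 0 ↔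
      ∀ y ∈ W, B.InFil ℓ (Scheme.Modules.Hom.app j W x) y := by
  have hrel := (isPhi_iff_rel hB ψ).1 h W x
  constructor
  · intro h0 y hy Φ U hU hΦ f hf hyU α
    rw [h0] at hrel
    have hval := hrel Φ U hU hΦ f hf
    rw [rst_zero] at hval
    obtain ⟨p, rfl⟩ : ∃ p, ℓ = p + 1 := ⟨ℓ - 1, by omega⟩
    refine FilAt.succ_iff.2 ⟨hx y hy Φ U hU hΦ f hf hyU α, fun ξ => ?_⟩
    rw [← germ_D]
    exact hval.mem_of_eq_zero hB hℓ hyU ξ α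
  · exact fun h0 => hrel.unique hE (Rel.zero hℓ h0)

end Block

end Existence

/-! ### Tensor products with complexes of complex vector spaces. -/

section ScalarExact

/-- Coordinates in a complex basis of `A` reduce this to scalar coefficients, that is, to
`dR_sum_eR`. -/
lemma sum_tmul_dR {k : ℕ} {S : Finset (Fin k)} {ℓ : ℕ} (hℓ : 1 ≤ ℓ) {A : Type} [AddCommGroup A]
    [Module ℂ A] (h : Idx S ℓ → A)
    (hh : ∀ (x : Idx S (ℓ + 1)) (m m' : {m : Fin k // m ∈ x.M}),
      h (x.erase m 0) - h (x.erase m 1) = h (x.erase m' 0) - h (x.erase m' 1)) :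
    ∑ ξ, h ξ ⊗ₜ[ℂ] dR S ℓ 0 (eR S ℓ ξ) = 0 := by
  classical
  let b := Module.Basis.ofVectorSpace ℂ A
  apply (TensorProduct.equivFinsuppOfBasisLeft (N := R S ℓ (0 + 1)) b).injective
  rw [map_zero, map_sum]
  ext1 i
  rw [Finsupp.finsetSum_apply, Finsupp.zero_apply]
  simp only [TensorProduct.equivFinsuppOfBasisLeft_apply_tmul_apply]
  have := dR_sum_eR hℓ (fun ξ => b.repr (h ξ) i) fun x m m' => by
    have := congrArg (fun a => b.repr a i) (hh x m m')
    simpa using this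
  rw [map_sum] at this
  simpa only [map_smul] using this

variable {Y : Scheme.{0}} (s : Y ⟶ Spec (.of ℂ)) {M : PreMod Y} {V V' V'' : Type} [AddCommGroup V]
  [Module ℂ V] [AddCommGroup V'] [Module ℂ V'] [AddCommGroup V''] [Module ℂ V'']

lemma ScTensor.map_id_eq {U : Y.Opensᵒᵖ} (g : V →ₗ[ℂ] V') (x : ScTensor s M V U) :
    ScTensor.map s (𝟙 U) g x = LinearMap.lTensor (CMod s M U) g x := by
  have e : cRes s M (𝟙 U) = LinearMap.id := LinearMap.ext fun x => res_id M U x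
  change TensorProduct.map (cRes s M (𝟙 U)) g x = _
  rw [e]
  rfl

lemma exists_scTensor {W : Y.Opens} (τ : Γ(shf (scPre s M V), W)) {p : Y} (hp : p ∈ W) :
    ∃ (O : Y.Opens) (hO : O ≤ W) (τ' : ScTensor s M V (op O)), p ∈ O ∧
      rst hO τ = toShf (scPre s M V) τ' :=
  toShf_locally_surjective (scPre s M V) τ p hp

lemma scPreMap_toShf (g : V →ₗ[ℂ] V') {O : Y.Opens} (x : ScTensor s M V (op O)) :
    Scheme.Modules.Hom.app ((sheafify Y).map (scPreMap s M g)) O (toShf (scPre s M V) x) =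
      toShf (scPre s M V') (LinearMap.lTensor (CMod s M (op O)) g x) :=
  (sheafify_map_toShf (scPreMap s M g) x).trans
    (congrArg (toShf (scPre s M V')) (ScTensor.map_id_eq s g x))

/-- After shrinking, the section comes from the presheaf and its image is zero already there.
Flatness over `ℂ` then provides a preimage in the presheaf, which is what the construction of local
lifts needs. -/
lemma exists_scTensor_preimage {f : V →ₗ[ℂ] V'} {g : V' →ₗ[ℂ] V''} (h : Function.Exact f g)
    {W : Y.Opens} (τ : Γ(shf (scPre s M V'), W))
    (hτ : Scheme.Modules.Hom.app ((sheafify Y).map (scPreMap s M g)) W τ = 0) {p : Y} (hp : p ∈ W) :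
    ∃ (O : Y.Opens) (hO : O ≤ W), p ∈ O ∧ ∃ σ : ScTensor s M V (op O),
      rst hO τ = toShf (scPre s M V') (LinearMap.lTensor (CMod s M (op O)) f σ) := by
  obtain ⟨O, hO, τ', hpO, e⟩ := exists_scTensor s τ hp
  have e1 : toShf (scPre s M V'') (LinearMap.lTensor (CMod s M (op O)) g τ') = 0 := by
    rw [← scPreMap_toShf, ← e, app_rst, hτ, rst_zero]
  obtain ⟨O', hO', hpO', e2⟩ := toShf_locally_injective (scPre s M V'') _ e1 p hpO
  have e3 : LinearMap.lTensor (CMod s M (op O')) g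
      (ScTensor.map s (homOfLE hO').op LinearMap.id τ') = 0 := by
    have e4 : ScTensor.map s (homOfLE hO').op LinearMap.id
        (LinearMap.lTensor (CMod s M (op O)) g τ') = 0 := e2
    rw [← ScTensor.map_id_eq, ScTensor.map_comp] at e4 ⊢
    exact e4
  obtain ⟨σ, hσ⟩ := (Module.Flat.lTensor_exact (CMod s M (op O')) h _).1 e3
  refine ⟨O', hO'.trans hO, hpO', σ, ?_⟩
  rw [hσ, ← rst_rst hO hO', e]
  exact toShf_rst (scPre s M V') hO' τ'

lemma locExactOn_scPreMap {f : V →ₗ[ℂ] V'} {g : V' →ₗ[ℂ] V''} (h : Function.Exact f g) :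
    LocExactOn ⊤ ((sheafify Y).map (scPreMap s M f)) ((sheafify Y).map (scPreMap s M g)) := by
  constructor
  · intro U _ τ
    refine section_ext fun p hp => ?_
    obtain ⟨O, hO, τ', hpO, e⟩ := exists_scTensor s τ hp
    refine ⟨O, hO, hpO, ?_⟩
    rw [rst_zero, ← app_rst, ← app_rst, e, scPreMap_toShf, scPreMap_toShf, ← LinearMap.comp_apply,
      ← LinearMap.lTensor_comp, h.linearMap_comp_eq_zero, LinearMap.lTensor_zero,
      LinearMap.zero_apply]
    exact toShf_zero (scPre s M V'')
  · intro U _ τ hτ p hp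
    obtain ⟨O, hO, hpO, σ, e⟩ := exists_scTensor_preimage s h τ hτ hp
    exact ⟨O, hO, hpO, toShf (scPre s M V) σ, (scPreMap_toShf s f σ).trans e.symm⟩

lemma ScTensor.exists_eq_sum {κ : Type} [Fintype κ] [DecidableEq κ] {U : Y.Opensᵒᵖ}
    (x : ScTensor s M (κ → ℂ) U) : ∃ h : κ → M.obj U, x = ∑ g, scTmul s (h g) (Pi.single g 1) := by
  induction x using ScTensor.induction with
  | h x v =>
    refine ⟨fun g => const s U (v g) • x, ?_⟩
    have e : v = ∑ g, v g • (Pi.single g 1 : κ → ℂ) := by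
      funext g
      simp [Finset.sum_apply, Pi.single_apply]
    conv_lhs => rw [e]
    refine (TensorProduct.tmul_sum (R := ℂ) (M := CMod s M U) _ _ _).trans ?_
    refine Finset.sum_congr rfl fun g _ => ?_
    exact (TensorProduct.smul_tmul (R := ℂ) (M := CMod s M U) (v g) x _).symm
  | h' x y hx hy =>
    obtain ⟨h, rfl⟩ := hx
    obtain ⟨h', rfl⟩ := hy
    refine ⟨fun g => h g + h' g, ?_⟩
    rw [← Finset.sum_add_distrib]
    exact Finset.sum_congr rfl fun g _ =>
      (TensorProduct.add_tmul (R := ℂ) (M := CMod s M U) (h g) (h' g) _).symm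

end ScalarExact

/-! ### Sections of `S^m(I/I²)` are locally classes of functions. -/

section Generation

variable {Y Z : Scheme.{0}} {ι : Z ⟶ Y} {m : ℕ} {z : Z}

/-- Near `z`, the sections `a ⊗ w` are classes of a function in the `m`-th power of the ideal. -/
def IsClassNear (ι : Z ⟶ Y) (z : Z) {O : Z.Opens} (a : (symPow m (pre (conormal ι))).obj (op O)) :
    Prop :=
  ∃ (W : Y.Opens) (h : ι ⁻¹ᵁ W ≤ O) (F : Γ(Y, W)), ι z ∈ W ∧ ∀ (W' : Y.Opens) (h' : W' ≤ W)
    (Q : PreMod Z) (w : Q.obj (op (ι ⁻¹ᵁ W'))), IsCl (ι := ι) (m := m) w (rstO h' F)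
      (hten ((symPow m (pre (conormal ι))).restrictₛₗ (homOfLE ((preim_le h').trans h)).op a) w)

lemma IsClassNear.add {O : Z.Opens} {a a' : (symPow m (pre (conormal ι))).obj (op O)}
    (h : IsClassNear ι z a) (h' : IsClassNear ι z a') : IsClassNear ι z (a + a') := by
  obtain ⟨W, h, F, hz, hF⟩ := h
  obtain ⟨W', h', F', hz', hF'⟩ := h'
  refine ⟨W ⊓ W', (preim_le inf_le_left).trans h, rstO inf_le_left F + rstO inf_le_right F',
    ⟨hz, hz'⟩, fun W'' hW Q w => ?_⟩
  have h1 := (hF W'' (hW.trans inf_le_left) Q w).add (hF' W'' (hW.trans inf_le_right) Q w)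
  rw [← hten_add_left] at h1
  rw [rstO_add, rstO_rstO, rstO_rstO]
  refine (congrArg (fun c => IsCl (ι := ι) w _ (hten c w)) ?_).mp h1
  exact (map_add ((symPow m (pre (conormal ι))).restrictₛₗ _) a a').symm

lemma IsClassNear.of_restrict {O O' : Z.Opens} (hO : O' ≤ O)
    {a : (symPow m (pre (conormal ι))).obj (op O)}
    (h : IsClassNear ι z ((symPow m (pre (conormal ι))).restrictₛₗ (homOfLE hO).op a)) :
    IsClassNear ι z a := by
  obtain ⟨W, h, F, hz, hF⟩ := h
  refine ⟨W, h.trans hO, F, hz, fun W' h' Q w => ?_⟩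
  have h1 := hF W' h' Q w
  rw [← res_comp] at h1
  exact h1

/-- The coefficient is a function on the subscheme; over an affine open set of `Y` it lifts to a
function `f`, and `f F` has the required class. -/
lemma IsClassNear.smul [IsClosedImmersion ι] {O : Z.Opens}
    {a : (symPow m (pre (conormal ι))).obj (op O)} (h : IsClassNear ι z a) (r : (OO Z).obj (op O)) :
    IsClassNear ι z (r • a) := by
  obtain ⟨W, h, F, hz, hF⟩ := h
  obtain ⟨W₁, hW₁, hz₁, hle⟩ := exists_isAffineOpen_mem_and_subset (X := Y) (x := ι z) (U := W) hz
  have hle : W₁ ≤ W := hle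
  obtain ⟨f, hf⟩ := ι.app_surjective W₁ hW₁ (rstO ((preim_le hle).trans h) (show Γ(Z, O) from r))
  refine ⟨W₁, (preim_le hle).trans h, f * rstO hle F, hz₁, fun W' h' Q w => ?_⟩
  have h1 := (hF W' (h'.trans hle) Q w).smul (rstO h' f)
  rw [rstO_mul, rstO_rstO]
  rw [← hten_smul_left] at h1
  refine (congrArg (fun c => IsCl (ι := ι) w _ (hten c w)) ?_).mp h1
  refine Eq.trans ?_ (((symPow m (pre (conormal ι))).restrictₛₗ
    (homOfLE ((preim_le h').trans ((preim_le hle).trans h))).op).map_smulₛₗ r a).symm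
  refine congrArg (fun c : (OO Z).obj (op (ι ⁻¹ᵁ W')) => c • _) ?_
  refine (ConcreteCategory.congr_hom (ι.naturality (homOfLE h').op) f).trans ?_
  refine (congrArg (rstO (preim_le h')) hf).trans ?_
  exact rstO_rstO (Y := Z) _ (preim_le h') (show Γ(Z, O) from r)

lemma IsClassNear.zero {O : Z.Opens} [IsClosedImmersion ι] (hz : z ∈ O) :
    IsClassNear ι z (0 : (symPow m (pre (conormal ι))).obj (op O)) := by
  obtain ⟨W, -, hzW, hle⟩ := exists_preimage_le (ι := ι) z O hz ⊤ trivial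
  refine ⟨W, hle, 0, hzW, fun W' h' Q w => ?_⟩
  have e : hten ((symPow m (pre (conormal ι))).restrictₛₗ (homOfLE ((preim_le h').trans hle)).op 0)
      w = 0 := by
    rw [map_zero]; exact hten_zero_left w
  rw [e, ← rstHom_apply, map_zero]
  exact IsCl.zero

lemma IsClassNear.sum [IsClosedImmersion ι] {κ : Type} (T : Finset κ) {O : Z.Opens} (hz : z ∈ O)
    {a : κ → (symPow m (pre (conormal ι))).obj (op O)} (h : ∀ i ∈ T, IsClassNear ι z (a i)) :
    IsClassNear ι z (∑ i ∈ T, a i) := by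
  classical
  induction T using Finset.induction_on with
  | empty => exact .zero hz
  | insert b T hb ih =>
    rw [Finset.sum_insert hb]
    exact (h b (Finset.mem_insert_self _ _)).add
      (ih fun i hi => h i (Finset.mem_insert_of_mem hi))

lemma symPow_restrict_symProd {M : PreMod Z} {U U' : Z.Opensᵒᵖ} (f : U ⟶ U') (v : Fin m → M.obj U) :
    (symPow m M).restrictₛₗ f (symProd M v) = symProd M fun p => M.restrictₛₗ f (v p) :=
  congrArg (SymmetricPower.mk _ _ _) (piMap_tprod _ _ _)

lemma isClassNear_symProd_pull [IsClosedImmersion ι] {O : Z.Opens} (hz : z ∈ O)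
    (V : Fin m → Y.Opens) (hV : ∀ p, O ≤ ι ⁻¹ᵁ V p) (u : ∀ p, Γ(idealSheaf ι, V p)) :
    IsClassNear ι z (symProd (pre (conormal ι)) (U := op O)
      fun p => pull ι (idealSheaf ι) (u p) (hV p)) := by
  obtain ⟨W₀, -, hz₀, hW₀⟩ := exists_common_open (W := (⊤ : Y.Opens)) (y := ι z) trivial
    (fun p W => W ≤ V p) (fun _ _ _ h h' => h.trans h')
    (fun p => ⟨V p, le_top, hV p hz, le_rfl⟩)
  obtain ⟨W, hW, hzW, hle⟩ := exists_preimage_le (ι := ι) z O hz W₀ hz₀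
  have hWV : ∀ p, W ≤ V p := fun p => hW.trans (hW₀ p)
  refine ⟨W, hle, ∏ p, idealFun ι (rst (hWV p) (u p)), hzW, fun W' h' Q w => ?_⟩
  have h1 := IsCl.of_clPairs (gen_mem_clPairs w 1 fun p => rst (h'.trans (hWV p)) (u p))
  rw [one_mul, one_smul] at h1
  have e : rstO h' (∏ p, idealFun ι (rst (hWV p) (u p))) =
      ∏ p, idealFun ι (rst (h'.trans (hWV p)) (u p)) := by
    rw [← rstHom_apply, map_prod]
    refine Finset.prod_congr rfl fun p _ => ?_
    rw [rstHom_apply, ← idealFun_rst, rst_rst]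
  rw [e]
  refine (congrArg (fun c => IsCl (ι := ι) w _ (hten c w)) ?_).mp h1
  refine Eq.trans ?_ (symPow_restrict_symProd (M := pre (conormal ι))
    (homOfLE ((preim_le h').trans hle)).op fun p => pull ι (idealSheaf ι) (u p) (hV p)).symm
  refine congrArg (symProd (pre (conormal ι)) (U := op (ι ⁻¹ᵁ W'))) (funext fun p => ?_)
  refine Eq.trans ?_ (rst_pull ι (hV p) ((preim_le h').trans hle) (u p)).symm
  exact pull_rst ι (h'.trans (hWV p)) le_rfl (u p)

/-- Conormal sections are locally combinations of pullbacks of sections of the ideal. Expanding the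
product multilinearly leaves products of such pullbacks, which are classes of products of functions.
-/
lemma isClassNear_symProd [IsClosedImmersion ι] {O : Z.Opens} (hz : z ∈ O)
    (v : Fin m → Γ((Scheme.Modules.pullback ι).obj (idealSheaf ι), O)) :
    IsClassNear ι z (symProd (pre (conormal ι)) (U := op O) v) := by
  obtain ⟨O', hO', hz', hv⟩ := exists_common_open hz
    (fun p O' => ∃ h : O' ≤ O, rst h (v p) ∈ pullSpan ι (idealSheaf ι) O')
    (fun p V V' hV ⟨h, h'⟩ => ⟨hV.trans h, by
      rw [← rst_rst h hV]; exact rst_mem_pullSpan ι hV h'⟩)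
    (fun p => by
      obtain ⟨V, hV, hzV, h⟩ := exists_mem_pullSpan ι (v p) z hz
      exact ⟨V, hV, hzV, hV, h⟩)
  refine .of_restrict hO' ?_
  refine (congrArg (IsClassNear ι z)
    (symPow_restrict_symProd (M := pre (conormal ι)) (homOfLE hO').op v)).mpr ?_
  choose N c x hx using fun p => Submodule.mem_span_set'.1 (hv p).2
  choose V hV u hu using fun p ν => (x p ν).2
  have e : (fun p => (pre (conormal ι)).restrictₛₗ (homOfLE hO').op (v p)) =
      fun p => ∑ ν, c p ν • pull ι (idealSheaf ι) (u p ν) (hV p ν) := funext fun p => by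
    exact (hx p).symm.trans (Finset.sum_congr rfl fun ν _ => congrArg (c p ν • ·) (hu p ν))
  have e2 : symProd (pre (conormal ι)) (U := op O')
      (fun p => ∑ ν, c p ν • pull ι (idealSheaf ι) (u p ν) (hV p ν)) =
      ∑ ν : (∀ p, Fin (N p)), (show (OO Z).obj (op O') from ∏ p, c p (ν p)) •
        symProd (pre (conormal ι)) (U := op O')
          fun p => pull ι (idealSheaf ι) (u p (ν p)) (hV p (ν p)) := by
    refine (congrArg (SymmetricPower.mk _ _ _) (pureTensor_sum_smul (U := op O')
      (fun _ => pre (conormal ι)) c fun p ν => pull ι (idealSheaf ι) (u p ν) (hV p ν))).trans ?_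
    refine (map_sum (SymmetricPower.mk _ _ _) _ _).trans ?_
    exact Finset.sum_congr rfl fun ν _ => map_smul (SymmetricPower.mk _ _ _) _ _
  refine (congrArg (IsClassNear ι z)
    ((congrArg (symProd (pre (conormal ι)) (U := op O')) e).trans e2)).mpr ?_
  exact .sum _ hz' fun ν _ => (isClassNear_symProd_pull hz' _ _ _).smul _

lemma isClassNear [IsClosedImmersion ι] {O : Z.Opens} (hz : z ∈ O)
    (a : (symPow m (pre (conormal ι))).obj (op O)) : IsClassNear ι z a := by
  obtain ⟨a, rfl⟩ := mk_surjective m a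
  induction a using PiTensorProduct.induction_on with
  | smul_tprod r v =>
    rw [map_smul]
    exact (isClassNear_symProd hz v).smul r
  | add a b ha hb => rw [map_add]; exact ha.add hb

end Generation

/-- Alternating sums have constant coefficients, equal to their values at the indicator functions of
the vertices. This links the alternating sums of functions with `Theta`, which is only defined over
`ℂ`. -/
lemma Idx.D_eq_sum_single {k r : ℕ} {S : Finset (Fin k)} {A : Type} [CommRing A] (φ : ℂ →+* A)
    (ξ : Idx S r) (F : ({t : Fin k // t ∈ S} → Fin 2) → A) :
    ξ.D F = ∑ g, φ (ξ.D (Pi.single g 1)) * F g := by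
  have e : F = fun g' => ∑ g, F g * φ ((Pi.single g 1 : ({t : Fin k // t ∈ S} → Fin 2) → ℂ) g') := by
    funext g'
    rw [Finset.sum_eq_single g']
    · simp
    · intro g _ hg; simp [Pi.single_eq_of_ne' hg]
    · simp
  conv_lhs => rw [e]
  rw [ξ.D_sum]
  refine Finset.sum_congr rfl fun g _ => ?_
  rw [ξ.D_mul, ξ.map_D, mul_comm]

/-! ### Sections given by the presheaf tensor product on the diagonal. -/

section OfPre

variable {Y Z : Scheme.{0}} {ι : Z ⟶ Y} {m : ℕ} {Q : PreMod Z} {V V' : Y.Opens} {O : Z.Opens}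

/-- The section of `ι_*(S^m(I/I²) ⊗ Q)` given by a section of the presheaf tensor product. -/
def ofPre (h : ι ⁻¹ᵁ V ≤ O) (t : (HSPre ι m Q).obj (op O)) : Γ(HS ι m Q, V) :=
  toShf (HSPre ι m Q) ((HSPre ι m Q).restrictₛₗ (homOfLE h).op t)

lemma ofPre_add (h : ι ⁻¹ᵁ V ≤ O) (t t' : (HSPre ι m Q).obj (op O)) :
    ofPre h (t + t') = ofPre h t + ofPre h t' :=
  (congrArg (toShf (HSPre ι m Q)) (map_add ((HSPre ι m Q).restrictₛₗ _) t t')).trans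
    (toShf_add (HSPre ι m Q) _ _)

lemma ofPre_sum (h : ι ⁻¹ᵁ V ≤ O) {κ : Type} (T : Finset κ) (t : κ → (HSPre ι m Q).obj (op O)) :
    ofPre h (∑ a ∈ T, t a) = ∑ a ∈ T, ofPre h (t a) :=
  (congrArg (toShf (HSPre ι m Q)) (map_sum ((HSPre ι m Q).restrictₛₗ _) t T)).trans
    (toShf_sum (HSPre ι m Q) _ _)

lemma ofPre_zero (h : ι ⁻¹ᵁ V ≤ O) : ofPre h (0 : (HSPre ι m Q).obj (op O)) = 0 :=
  (congrArg (toShf (HSPre ι m Q)) (map_zero ((HSPre ι m Q).restrictₛₗ _))).trans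
    (toShf_zero (HSPre ι m Q))

lemma rst_ofPre (h : ι ⁻¹ᵁ V ≤ O) (hV : V' ≤ V) (t : (HSPre ι m Q).obj (op O)) :
    rst hV (ofPre h t) = ofPre ((preim_le hV).trans h) t :=
  (toShf_rst (HSPre ι m Q) (preim_le hV) _).trans (congrArg (toShf (HSPre ι m Q))
    (res_comp (HSPre ι m Q) (homOfLE h).op (homOfLE (preim_le hV)).op t).symm)

lemma ofPre_tmul (h : ι ⁻¹ᵁ V ≤ O) (a : (symPow m (pre (conormal ι))).obj (op O))
    (w : Q.obj (op O)) : ofPre h (a ⊗ₜ[(OO Z).obj (op O)] w : (HSPre ι m Q).obj (op O)) =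
      hten ((symPow m (pre (conormal ι))).restrictₛₗ (homOfLE h).op a)
        (Q.restrictₛₗ (homOfLE h).op w) := rfl

lemma exists_ofPre {W : Y.Opens} {z : Z} (hz : ι z ∈ W) (h : Γ(HS ι m Q, W)) :
    ∃ (O : Z.Opens) (t : (HSPre ι m Q).obj (op O)), z ∈ O ∧
      ∀ (V : Y.Opens) (hV : V ≤ W) (hVO : ι ⁻¹ᵁ V ≤ O), rst hV h = ofPre hVO t := by
  obtain ⟨O, hO, t, hzO, ht⟩ := toShf_locally_surjective (HSPre ι m Q) (U := ι ⁻¹ᵁ W) h z hz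
  refine ⟨O, t, hzO, fun V hV hVO => ?_⟩
  refine (rst_rst (M := shf (HSPre ι m Q)) (U := ι ⁻¹ᵁ W) hO hVO h).symm.trans ?_
  exact (congrArg (rst hVO) ht).trans (toShf_rst (HSPre ι m Q) hVO t)

end OfPre

/-! ### Exactness of the complex of one block. -/

section Exactness

variable {X : Scheme.{0}} {s : X ⟶ Spec (.of ℂ)} {k n : ℕ} {E : Fin k → X.Modules}

namespace Block

variable {B : Block s k n} {Φ : Fr E} {W U : (Pow s n).Opens} {ℓ m : ℕ}

/-- Sections of `H` are locally sums of classes of functions. -/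
lemma exists_isCl_sum (hB : B.Good) (hW : B.ZDom Φ W) {z : B.Z} (hz : B.ι z ∈ W)
    (h : Γ(HS B.ι m (B.Q E), W)) : ∃ (V : (Pow s n).Opens) (hV : V ≤ W), B.ι z ∈ V ∧
      ∃ (F : Φ.Ix → Γ(Pow s n, V)) (h' : Φ.Ix → Γ(HS B.ι m (B.Q E), V)),
        (∀ α, IsCl (B.wt Φ (hW.mono hV) α) (F α) (h' α)) ∧ rst hV h = ∑ α, h' α := by
  have := hB.cl.closed
  obtain ⟨O, t, hzO, ht⟩ := exists_ofPre hz h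
  suffices key : ∃ (V : (Pow s n).Opens) (hV : V ≤ W) (hVO : B.ι ⁻¹ᵁ V ≤ O), B.ι z ∈ V ∧
      ∃ (F : Φ.Ix → Γ(Pow s n, V)) (h' : Φ.Ix → Γ(HS B.ι m (B.Q E), V)),
        (∀ α, IsCl (B.wt Φ (hW.mono hV) α) (F α) (h' α)) ∧ ofPre hVO t = ∑ α, h' α by
    obtain ⟨V, hV, hVO, hzV, F, h', hF, e⟩ := key
    exact ⟨V, hV, hzV, F, h', hF, (ht V hV hVO).trans e⟩
  clear ht
  obtain ⟨V₀, hV₀, hzV₀, hle₀⟩ := exists_preimage_le (ι := B.ι) z O hzO W hz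
  induction t using TensorProduct.induction_on with
  | zero =>
    refine ⟨V₀, hV₀, hle₀, hzV₀, 0, 0, fun α => IsCl.zero, ?_⟩
    exact (ofPre_zero hle₀).trans (Finset.sum_eq_zero fun α _ => rfl).symm
  | tmul a w =>
    let O' := O ⊓ B.ι ⁻¹ᵁ W
    have hO' : ∀ t, O' ≤ B.q t ⁻¹ᵁ Φ.V t := fun t => inf_le_right.trans (hW t)
    let w₀ : (⨂[Γ(B.Z, O')] t, Γ((Scheme.Modules.pullback (B.q t)).obj (E t), O')) :=
      (B.Q E).restrictₛₗ (homOfLE inf_le_left).op w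
    let a₀ : (symPow m (pre (conormal B.ι))).obj (op O') :=
      (symPow m (pre (conormal B.ι))).restrictₛₗ (homOfLE inf_le_left).op a
    -- The second tensor factor is expanded in the frame and its coefficients are moved to the first
    -- factor. Each term is then an element of the symmetric power tensored with one frame vector,
    -- to which `isClassNear` applies.
    obtain ⟨c, hc⟩ := tprod_mem_span (R := Γ(B.Z, O'))
      (A := fun t => Γ((Scheme.Modules.pullback (B.q t)).obj (E t), O'))
      (fun t α => rst le_rfl (pull (B.q t) (E t) (Φ.e t α) (hO' t)))
      (fun t x => ((Φ.frame t).isFrameOn.pull (B.q t) (hO' t) O' le_rfl x).exists) w₀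
    choose V' hV' F hzV' hF using fun α : Φ.Ix =>
      isClassNear (z := z) (mem_inf_opens hzO hz) ((show (OO B.Z).obj (op O') from c α) • a₀)
    obtain ⟨V, hVW, hzV, hV⟩ := exists_common_open hzV₀ (fun α V => V ≤ V' α)
      (fun _ _ _ h h' => h.trans h')
      (fun α => ⟨V₀ ⊓ V' α, inf_le_left, mem_inf_opens hzV₀ (hzV' α), inf_le_right⟩)
    have hVO' : B.ι ⁻¹ᵁ V ≤ O' :=
      le_inf ((preim_le hVW).trans hle₀) (preim_le (hVW.trans hV₀))
    refine ⟨V, hVW.trans hV₀, (preim_le hVW).trans hle₀, hzV, fun α => rstO (hV α) (F α), fun α =>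
      hten ((symPow m (pre (conormal B.ι))).restrictₛₗ (homOfLE hVO').op
        ((show (OO B.Z).obj (op O') from c α) • a₀)) (B.wt Φ (hW.mono (hVW.trans hV₀)) α),
      fun α => hF α V (hV α) _ _, ?_⟩
    let w' : Φ.Ix → (B.Q E).obj (op O') := fun α => pureTensor
      (fun t => pre ((Scheme.Modules.pullback (B.q t)).obj (E t))) (U := op O')
      fun t => rst le_rfl (pull (B.q t) (E t) (Φ.e t (α t)) (hO' t))
    have e0 : (show (B.Q E).obj (op O') from w₀) =
        ∑ α, (show (OO B.Z).obj (op O') from c α) • w' α := hc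
    have e1 : (a₀ ⊗ₜ[(OO B.Z).obj (op O')] (show (B.Q E).obj (op O') from w₀) :
          (HSPre B.ι m (B.Q E)).obj (op O')) =
        ∑ α, ((show (OO B.Z).obj (op O') from c α) • a₀) ⊗ₜ[(OO B.Z).obj (op O')] w' α := by
      refine (congrArg (fun w => a₀ ⊗ₜ[(OO B.Z).obj (op O')] w) e0).trans ?_
      refine (TensorProduct.tmul_sum _ _ _).trans (Finset.sum_congr rfl fun α _ => ?_)
      exact (TensorProduct.smul_tmul (R := (OO B.Z).obj (op O'))
        (show (OO B.Z).obj (op O') from c α) a₀ (w' α)).symm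
    have e2 : ofPre ((preim_le hVW).trans hle₀) (a ⊗ₜ[(OO B.Z).obj (op O)] w) =
        ofPre hVO' (a₀ ⊗ₜ[(OO B.Z).obj (op O')] (show (B.Q E).obj (op O') from w₀)) := by
      rw [ofPre_tmul, ofPre_tmul]
      exact congrArg₂ hten (res_comp (symPow m (pre (conormal B.ι))) (homOfLE inf_le_left).op
        (homOfLE hVO').op a) (res_comp (B.Q E) (homOfLE inf_le_left).op (homOfLE hVO').op w)
    refine e2.trans ((congrArg (ofPre hVO') e1).trans ((ofPre_sum hVO' _ _).trans ?_))
    refine Finset.sum_congr rfl fun α _ => ?_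
    rw [ofPre_tmul]
    refine congrArg (fun w => hten ((symPow m (pre (conormal B.ι))).restrictₛₗ (homOfLE hVO').op
        ((show (OO B.Z).obj (op O') from c α) • a₀)) w) ?_
    refine (pureTensor_restrict (fun t => pre ((Scheme.Modules.pullback (B.q t)).obj (E t)))
      (homOfLE hVO').op _).trans ?_
    refine congrArg (pureTensor (fun t => pre ((Scheme.Modules.pullback (B.q t)).obj (E t))))
      (funext fun t => ?_)
    refine (rst_rst le_rfl hVO' (pull (B.q t) (E t) (Φ.e t (α t)) (hO' t))).trans ?_
    exact rst_pull (B.q t) (hO' t) hVO' _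
  | add t t' ih ih' =>
    obtain ⟨V, hV, hVO, hzV, F, h', hF, e⟩ := ih
    obtain ⟨V', hV', hVO', hzV', F', h'', hF', e'⟩ := ih'
    refine ⟨V ⊓ V', inf_le_left.trans hV, (preim_le inf_le_left).trans hVO, ⟨hzV, hzV'⟩,
      fun α => rstO inf_le_left (F α) + rstO inf_le_right (F' α),
      fun α => rst inf_le_left (h' α) + rst inf_le_right (h'' α), fun α => ?_, ?_⟩
    · have h1 := (hF α).rst (inf_le_left : V ⊓ V' ≤ V)
      have h2 := (hF' α).rst (inf_le_right : V ⊓ V' ≤ V')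
      rw [rQ_wt] at h1 h2
      exact h1.add h2
    · rw [Finset.sum_add_distrib, ← rst_sum, ← rst_sum, ← e, ← e']
      exact (ofPre_add _ t t').trans
        (congrArg₂ (· + ·) (rst_ofPre hVO inf_le_left t).symm (rst_ofPre hVO' inf_le_right t').symm)

lemma sum_tm_eq_zero {V κ : Type} [AddCommGroup V] [Module ℂ V] (T : Finset κ)
    (h : κ → Γ(HS B.ι m (B.Q E), W)) (v : κ → V)
    (e : ∑ a ∈ T, scTmul (M := pre (B.H E m)) (str s n) (h a) (v a) = 0) :
    ∑ a ∈ T, B.tm E (h a) (v a) = 0 :=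
  (toShf_sum (scPre (str s n) (pre (B.H E m)) V) T
    fun a => scTmul (M := pre (B.H E m)) (str s n) (h a) (v a)).symm.trans
    ((congrArg (toShf (scPre (str s n) (pre (B.H E m)) V)) e).trans (toShf_zero _))

lemma toShf_lTensor_sum {V V' κ : Type} [AddCommGroup V] [Module ℂ V] [AddCommGroup V']
    [Module ℂ V'] (T : Finset κ) (f : V →ₗ[ℂ] V') (h : κ → Γ(HS B.ι m (B.Q E), W)) (v : κ → V) :
    toShf (scPre (str s n) (pre (B.H E m)) V') (U := W)
      (LinearMap.lTensor (CMod (str s n) (pre (B.H E m)) (op W)) f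
        (∑ a ∈ T, scTmul (M := pre (B.H E m)) (str s n) (h a) (v a))) =
      ∑ a ∈ T, B.tm E (h a) (f (v a)) :=
  (congrArg (toShf (scPre (str s n) (pre (B.H E m)) V')) (map_sum _ _ _)).trans
    (toShf_sum (scPre (str s n) (pre (B.H E m)) V') _ _)

lemma sum_tm_dR_eq_zero (hℓ : 1 ≤ ℓ) (h : Idx B.S ℓ → Γ(HS B.ι (ℓ - 1) (B.Q E), W))
    (hh : ∀ (x : Idx B.S (ℓ + 1)) (m m' : {m : Fin k // m ∈ x.M}),
      h (x.erase m 0) - h (x.erase m 1) = h (x.erase m' 0) - h (x.erase m' 1)) :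
    ∑ ξ, B.tm E (h ξ) (dR B.S ℓ 0 (eR B.S ℓ ξ)) = 0 :=
  sum_tm_eq_zero _ _ _
    (sum_tmul_dR hℓ (A := CMod (str s n) (pre (B.H E (ℓ - 1))) (op W)) h hh)

lemma d_phiSum {κ : Type} [Fintype κ] (h : Idx B.S ℓ → κ → Γ(HS B.ι (ℓ - 1) (B.Q E), W)) :
    Scheme.Modules.Hom.app (B.d E ℓ 0) W (B.phiSum E ℓ h) =
      ∑ ξ, ∑ α, B.tm E (h ξ α) (dR B.S ℓ 0 (eR B.S ℓ ξ)) := by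
  refine (app_sum (B.d E ℓ 0) _ _).trans (Finset.sum_congr rfl fun ξ _ => ?_)
  refine (app_sum (B.d E ℓ 0) _ _).trans (Finset.sum_congr rfl fun α _ => ?_)
  exact d_tm ℓ 0 (h ξ α) (eR B.S ℓ ξ)

lemma tm_const_smul {V : Type} [AddCommGroup V] [Module ℂ V] (c : ℂ)
    (h : Γ(HS B.ι m (B.Q E), W)) (v : V) :
    B.tm E ((show Γ(Pow s n, W) from const (str s n) (op W) c) • h) v = B.tm E h (c • v) :=
  congrArg (toShf (scPre (str s n) (pre (B.H E m)) V))
    (TensorProduct.smul_tmul (R := ℂ) (M := CMod (str s n) (pre (B.H E m)) (op W)) c h v)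

/-- For a face of dimension `ℓ + 1` and any direction `m` in it, the difference of the two classes
on the opposite `ℓ`-faces is the class of the alternating sum over the whole face. It does not
depend on `m`, which is the cocycle criterion. -/
lemma IsVal.d_eq_zero (hB : B.Good) (hℓ : 1 ≤ ℓ) {hW : B.ZDom Φ W}
    {f : ({t : Fin k // t ∈ B.S} → Fin 2) → Φ.Ix → Γ(Pow s n, W)} {τ : Γ(B.T E ℓ 0, W)}
    (h : B.IsVal Φ ℓ hW f τ) : Scheme.Modules.Hom.app (B.d E ℓ 0) W τ = 0 := by
  obtain ⟨h, hh, rfl⟩ := h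
  rw [d_phiSum h, Finset.sum_comm]
  refine Finset.sum_eq_zero fun α _ => sum_tm_dR_eq_zero hℓ (fun ξ => h ξ α) fun x m m' => ?_
  have h1 := (hh (x.erase m 0) α).sub (hh (x.erase m 1) α)
  have h2 := (hh (x.erase m' 0) α).sub (hh (x.erase m' 1) α)
  rw [← x.D_eq_sub] at h1 h2
  exact h1.unique hB.cl h2

theorem IsPhi.d_eq_zero (hB : B.Good) (hE : ∀ t, IsLocFree (E t)) (hℓ : 1 ≤ ℓ)
    {K : (Pow s n).Modules} {j : K ⟶ K₀ s E n} {ψ : K ⟶ B.T E ℓ 0} (h : B.IsPhi E ℓ j ψ)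
    (x : Γ(K, W)) : Scheme.Modules.Hom.app (B.d E ℓ 0) W (Scheme.Modules.Hom.app ψ W x) = 0 := by
  refine section_ext fun y hy => ?_
  obtain ⟨Φ, V, hV, hyV, hΦ⟩ | ⟨V, hV, hyV, hb⟩ := exists_frame_or_disjoint hB hE hy
  · obtain ⟨f, hf⟩ := exists_isCoord hΦ (rst hV (Scheme.Modules.Hom.app j W x))
    have := (isPhi_iff_rel hB ψ).1 h W x Φ V hV hΦ f hf
    refine ⟨V, hV, hyV, ?_⟩
    rw [← app_rst, this.d_eq_zero hB hℓ, rst_zero]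
  · exact ⟨V, hV, hyV, (HV_section_eq_zero hb _).trans (HV_section_eq_zero hb _).symm⟩

/-- The kernel of the first differential consists locally of values of `φ_ℓ`. -/
theorem exists_isVal_of_d_eq_zero (hB : B.Good) (hE : ∀ t, IsLocFree (E t)) (hℓ : 1 ≤ ℓ)
    (τ : Γ(B.T E ℓ 0, W)) (hτ : Scheme.Modules.Hom.app (B.d E ℓ 0) W τ = 0) {z : B.Z}
    (hz : B.ι z ∈ W) : ∃ (Φ : Fr E) (V : (Pow s n).Opens) (hV : V ≤ W) (hΦ : B.Dom Φ V)
      (f : ({t : Fin k // t ∈ B.S} → Fin 2) → Φ.Ix → Γ(Pow s n, V)), B.ι z ∈ V ∧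
        (∀ g α y (hy : y ∈ V), (Pow s n).presheaf.germ V y hy (f g α) ∈
          stalkIdeal B.ι y ^ (ℓ - 1)) ∧ B.IsVal Φ ℓ (hB.zDom hΦ) f (rst hV τ) := by
  -- By exactness of `Theta` the section comes from `H ⊗ ℂ^{vertices}`, that is, from one section `h
  -- g` of `H` for each vertex.
  obtain ⟨O, hO, hzO, σ, e⟩ := exists_scTensor_preimage (str s n) (exact_Theta hℓ) τ hτ hz
  obtain ⟨h, rfl⟩ : ∃ h : ({t : Fin k // t ∈ B.S} → Fin 2) → Γ(HS B.ι (ℓ - 1) (B.Q E), O),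
      σ = ∑ g, scTmul (M := pre (B.H E (ℓ - 1))) (str s n) (h g) (Pi.single g 1) :=
    ScTensor.exists_eq_sum (str s n) σ
  obtain ⟨Φ, V₀, hV₀, hzV₀, hΦ⟩ := exists_frame E hB hE z hzO
  obtain ⟨V, hV, hzV, hgen⟩ := exists_common_open (κ := {t : Fin k // t ∈ B.S} → Fin 2) hzV₀
    (fun g V => ∃ hV : V ≤ V₀, ∃ (F : Φ.Ix → Γ(Pow s n, V))
      (h' : Φ.Ix → Γ(HS B.ι (ℓ - 1) (B.Q E), V)),
      (∀ α, IsCl (B.wt Φ ((hB.zDom hΦ).mono hV) α) (F α) (h' α)) ∧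
        rst (hV.trans hV₀) (h g) = ∑ α, h' α)
    (fun g V V' hle ⟨hV, F, h', hF, e⟩ => ⟨hle.trans hV, fun α => rstO hle (F α),
      fun α => rst hle (h' α), fun α => by
        have := (hF α).rst hle
        rwa [rQ_wt] at this, by
        rw [← rst_sum, ← e, rst_rst]⟩)
    (fun g => by
      obtain ⟨V, hV, hzV, F, h', hF, e⟩ := exists_isCl_sum hB (hB.zDom hΦ) hzV₀
        (rst hV₀ (h g))
      exact ⟨V, hV, hzV, hV, F, h', hF, by rw [← e, rst_rst]⟩)
  choose hV' F h' hF hsum using hgen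
  -- The functions `F g α` representing the `h g` serve as the coordinates of the lift; their
  -- alternating sums have the same constant coefficients as the vectors `Theta (δ_g)`.
  have hC : ∀ (ξ : Idx B.S ℓ) (α : Φ.Ix), ξ.D (fun g => F g α) =
      ∑ g, (show Γ(Pow s n, V) from const (str s n) (op V) (ξ.D (Pi.single g 1))) * F g α :=
    fun ξ α => ξ.D_eq_sum_single (A := Γ(Pow s n, V)) (const (str s n) (op V)) fun g => F g α
  refine ⟨Φ, V, (hV.trans hV₀).trans hO, hΦ.mono hV, F, hzV, fun g α y hy => (hF g α).germ_mem hy,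
    fun ξ α => ∑ g, (show Γ(Pow s n, V) from const (str s n) (op V) (ξ.D (Pi.single g 1))) • h' g α,
    fun ξ α => ?_, ?_⟩
  · rw [hC]
    exact IsCl.sum _ fun g _ => (hF g α).smul _
  · rw [← rst_rst hO (hV.trans hV₀)]
    refine (congrArg (rst (M := B.HV E (ℓ - 1) (R B.S ℓ 0)) (hV.trans hV₀))
      (e.trans (toShf_lTensor_sum _ _ _ _))).trans ?_
    refine (rst_sum _ _ _).trans ?_
    have e2 : ∀ g, rst (hV.trans hV₀) (B.tm E (h g) (Theta B.S ℓ (Pi.single g 1))) =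
        ∑ ξ, ∑ α, B.tm E ((show Γ(Pow s n, V) from
          const (str s n) (op V) (ξ.D (Pi.single g 1))) • h' g α) (eR B.S ℓ ξ) := by
      intro g
      rw [rst_tm, hsum g, Theta_apply, tm_sum_right]
      refine Finset.sum_congr rfl fun ξ _ => ?_
      rw [tm_sum_left]
      exact Finset.sum_congr rfl fun α _ => (tm_const_smul _ _ _).symm
    refine (Finset.sum_congr rfl fun g _ => e2 g).trans ?_
    rw [Finset.sum_comm]
    refine Finset.sum_congr rfl fun ξ _ => ?_
    rw [Finset.sum_comm]
    exact Finset.sum_congr rfl fun α _ => (tm_sum_left _ _ _).symm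

theorem locExactOn_d (hℓ : 1 ≤ ℓ) (i : ℕ) : LocExactOn ⊤ (B.d E ℓ i) (B.d E ℓ (i + 1)) :=
  locExactOn_scPreMap (str s n) (exact_dR ℓ i hℓ)

lemma T_section_eq_zero {i : ℕ} (h : B.S.card < ℓ + i) (τ : Γ(B.T E ℓ i, W)) : τ = 0 := by
  have := isEmpty_idx h
  refine section_ext fun y hy => ?_
  obtain ⟨O, hO, τ', hyO, hτ⟩ := exists_scTensor (str s n) τ hy
  refine ⟨O, hO, hyO, hτ.trans ?_⟩
  rw [rst_zero, Subsingleton.elim τ' 0]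
  exact toShf_zero (scPre (str s n) (pre (B.H E (ℓ - 1))) (R B.S ℓ i))

end Block

end Exactness

/-! ### Sections of direct sums. -/

section Biproducts

variable {Y : Scheme.{0}} {W : Y.Opens}

lemma sum_app {A B : Y.Modules} {κ : Type} (T : Finset κ) (f : κ → (A ⟶ B)) (x : Γ(A, W)) :
    Scheme.Modules.Hom.app (∑ i ∈ T, f i) W x = ∑ i ∈ T, Scheme.Modules.Hom.app (f i) W x := by
  classical
  induction T using Finset.induction_on with
  | empty => rfl
  | insert a T ha ih => rw [Finset.sum_insert ha, Finset.sum_insert ha, ← ih]; rfl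

variable {κ : Type} [Finite κ] (M : κ → Y.Modules)

lemma biproduct_section_ext {x y : Γ((⨁ M : Y.Modules), W)}
    (h : ∀ i, Scheme.Modules.Hom.app (biproduct.π M i) W x =
      Scheme.Modules.Hom.app (biproduct.π M i) W y) : x = y := by
  have := Fintype.ofFinite κ
  have key : ∀ z : Γ((⨁ M : Y.Modules), W), z = ∑ i, Scheme.Modules.Hom.app (biproduct.ι M i) W
      (Scheme.Modules.Hom.app (biproduct.π M i) W z) := fun z => by
    refine (congrArg (fun φ => Scheme.Modules.Hom.app φ W z) (biproduct.total (f := M)).symm).trans ?_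
    exact sum_app _ _ _
  rw [key x, key y]
  simp only [h]

lemma exists_biproduct_section (v : ∀ i, Γ(M i, W)) :
    ∃ x : Γ((⨁ M : Y.Modules), W), ∀ i, Scheme.Modules.Hom.app (biproduct.π M i) W x = v i := by
  classical
  have := Fintype.ofFinite κ
  refine ⟨∑ i, Scheme.Modules.Hom.app (biproduct.ι M i) W (v i), fun i => ?_⟩
  rw [app_sum, Finset.sum_eq_single i]
  · rw [← app_comp, biproduct.ι_π_self]; rfl
  · intro j _ hj
    rw [← app_comp, biproduct.ι_π_ne M hj]; rfl
  · simp

end Biproducts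

/-! ### The sheaves `K_ℓ` for a family of blocks, and exactness at `T_ℓ^0`. -/

section Towers

variable {X : Scheme.{0}} {s : X ⟶ Spec (.of ℂ)} {k n : ℕ} {E : Fin k → X.Modules}

lemma Block.col_injective {B : Block s k n} (hB : B.Good) : Function.Injective B.col := by
  intro g g' h
  funext t
  have := congrFun h t.1
  rw [col_of_mem, col_of_mem] at this
  have h01 : ∀ a : Fin 2, a = 0 ∨ a = 1 := by decide
  rcases h01 (g t) with h0 | h0 <;> rcases h01 (g' t) with h1 | h1 <;>
    simp only [h0, h1] at this ⊢
  · exact absurd (by simpa using this) hB.ne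
  · exact absurd (by simpa using this.symm) hB.ne

variable {Λ : Type} {B : Λ → Block s k n} {T : ℕ → ℕ → (Pow s n).Modules}
  {d : ∀ ℓ i, T ℓ i ⟶ T ℓ (i + 1)} {π : ∀ b ℓ i, T ℓ i ⟶ (B b).T E ℓ i}

/-- The complexes `T` are the direct sums of the complexes of the blocks `B`. -/
structure IsBlockSum (B : Λ → Block s k n) (T : ℕ → ℕ → (Pow s n).Modules)
    (d : ∀ ℓ i, T ℓ i ⟶ T ℓ (i + 1)) (π : ∀ b ℓ i, T ℓ i ⟶ (B b).T E ℓ i) : Prop where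
  good : ∀ b, (B b).Good
  ext : ∀ {ℓ i} {W : (Pow s n).Opens} {τ τ' : Γ(T ℓ i, W)},
    (∀ b, Scheme.Modules.Hom.app (π b ℓ i) W τ = Scheme.Modules.Hom.app (π b ℓ i) W τ') → τ = τ'
  exists_section : ∀ {ℓ i} {W : (Pow s n).Opens} (t : ∀ b, Γ((B b).T E ℓ i, W)),
    ∃ τ, ∀ b, Scheme.Modules.Hom.app (π b ℓ i) W τ = t b
  exists_hom : ∀ {ℓ i} {K : (Pow s n).Modules} (ψ : ∀ b, K ⟶ (B b).T E ℓ i),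
    ∃ φ, ∀ b, φ ≫ π b ℓ i = ψ b
  comm : ∀ b ℓ i, d ℓ i ≫ π b ℓ (i + 1) = π b ℓ i ≫ (B b).d E ℓ i

namespace IsBlockSum

variable (h : IsBlockSum B T d π) (hE : ∀ t, IsLocFree (E t))

include h

lemma app_comm (b : Λ) (ℓ i : ℕ) {W : (Pow s n).Opens} (τ : Γ(T ℓ i, W)) :
    Scheme.Modules.Hom.app (π b ℓ (i + 1)) W (Scheme.Modules.Hom.app (d ℓ i) W τ) =
      Scheme.Modules.Hom.app ((B b).d E ℓ i) W (Scheme.Modules.Hom.app (π b ℓ i) W τ) :=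
  congrArg (fun φ => Scheme.Modules.Hom.app φ W τ) (h.comm b ℓ i)

theorem locExactOn_d [Finite Λ] {ℓ : ℕ} (hℓ : 1 ≤ ℓ) (i : ℕ) : LocExactOn ⊤ (d ℓ i) (d ℓ (i + 1)) := by
  refine ⟨fun U _ τ => h.ext fun b => ?_, fun U _ τ hτ y hy => ?_⟩
  · rw [h.app_comm, h.app_comm, (Block.locExactOn_d hℓ i).1 U le_top, app_zero]
  · have h0 : ∀ b, Scheme.Modules.Hom.app ((B b).d E ℓ (i + 1)) U
        (Scheme.Modules.Hom.app (π b ℓ (i + 1)) U τ) = 0 := fun b => by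
      rw [← h.app_comm, hτ, app_zero]
    obtain ⟨V, hV, hyV, ht⟩ := exists_common_open hy
      (fun b V => ∃ (hV : V ≤ U) (t : Γ((B b).T E ℓ i, V)),
        Scheme.Modules.Hom.app ((B b).d E ℓ i) V t =
          rst hV (Scheme.Modules.Hom.app (π b ℓ (i + 1)) U τ))
      (fun b V V' hle ⟨hV, t, ht⟩ => ⟨hle.trans hV, rst hle t, by rw [app_rst, ht, rst_rst]⟩)
      (fun b => by
        obtain ⟨V, hV, hyV, t, ht⟩ := (Block.locExactOn_d hℓ i).2 U le_top _ (h0 b) y hy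
        exact ⟨V, hV, hyV, hV, t, ht⟩)
    choose hV' t ht using ht
    obtain ⟨t', ht'⟩ := h.exists_section t
    refine ⟨V, hV, hyV, t', h.ext fun b => ?_⟩
    rw [h.app_comm, ht', ht, app_rst]

lemma section_eq_zero {ℓ i : ℕ} (hi : k < ℓ + i) {W : (Pow s n).Opens} (τ : Γ(T ℓ i, W)) : τ = 0 :=
  h.ext fun b => by
    rw [app_zero]
    refine Block.T_section_eq_zero (lt_of_le_of_lt ?_ hi) _
    simpa using Finset.card_le_univ (B b).S

/-- The subsheaf `A` of `K_0` is given by the filtration conditions of all of the blocks. -/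
def TowerSpec (_ : IsBlockSum B T d π) (ℓ : ℕ) (A : Over (K₀ s E n)) : Prop :=
  Mono A.hom ∧ ∀ (W : (Pow s n).Opens) (x : Γ(K₀ s E n, W)),
    (∃ a : Γ(A.left, W), Scheme.Modules.Hom.app A.hom W a = x) ↔
      ∀ b, ∀ y ∈ W, (B b).InFil ℓ x y

variable {h} {P : ∀ (ℓ : ℕ) (A : Over (K₀ s E n)), (A.left ⟶ T ℓ 0) → Prop}
  (hP : ∀ ℓ A ψ, P ℓ A ψ ↔ ∀ b, (B b).IsPhi E ℓ A.hom (ψ ≫ π b ℓ 0))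

lemma TowerSpec.inFil {ℓ : ℕ} {A : Over (K₀ s E n)} (hA : h.TowerSpec ℓ A) (b : Λ)
    {W : (Pow s n).Opens} (a : Γ(A.left, W)) {y : Pow s n} (hy : y ∈ W) :
    (B b).InFil ℓ (Scheme.Modules.Hom.app A.hom W a) y :=
  (hA.2 W _).1 ⟨a, rfl⟩ b y hy

include hE hP

/-- The defining property splits into one condition for each block. On each block the filtration of
order `ℓ`, known on `K_ℓ`, yields existence; uniqueness holds for arbitrary sheaves over `K_0`. -/
theorem TowerSpec.existsUnique {ℓ : ℕ} {A : Over (K₀ s E n)} (hA : h.TowerSpec ℓ A) :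
    ∃! ψ, P (ℓ + 1) A ψ := by
  choose ψ hψ using fun b => Block.exists_isPhi (ℓ := ℓ + 1) (h.good b) hE (by omega) A.hom
    fun W a y hy => hA.inFil b a hy
  obtain ⟨φ, hφ⟩ := h.exists_hom ψ
  refine ⟨φ, (hP _ _ _).2 fun b => by rw [hφ]; exact hψ b, fun φ' hφ' => ?_⟩
  refine hom_ext_sections fun W x => h.ext fun b => ?_
  have e : φ' ≫ π b (ℓ + 1) 0 = φ ≫ π b (ℓ + 1) 0 :=
    Block.isPhi_unique (h.good b) hE ((hP _ _ _).1 hφ' b) (by rw [hφ]; exact hψ b)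
  exact congrArg (fun φ => Scheme.Modules.Hom.app φ W x) e

lemma TowerSpec.pick {ℓ : ℕ} {A : Over (K₀ s E n)} (hA : h.TowerSpec ℓ A) (b : Λ) :
    (B b).IsPhi E (ℓ + 1) A.hom (pick (P (ℓ + 1) A) ≫ π b (ℓ + 1) 0) := by
  refine (hP _ _ _).1 ?_ b
  have hex := (hA.existsUnique hE hP).exists
  rw [LongDiag.pick, dif_pos hex]
  exact hex.choose_spec

/-- Induction on `ℓ`: a section of `K_ℓ` lies in the kernel of `φ_{ℓ+1}` exactly when its value
vanishes on each block, and by `IsPhi.app_eq_zero_iff` this is the filtration condition of order `ℓ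
+ 1`. -/
theorem towerSpec (ℓ : ℕ) : h.TowerSpec ℓ (tower P ℓ) := by
  induction ℓ with
  | zero =>
    refine ⟨inferInstanceAs (Mono (𝟙 (K₀ s E n))), fun W x => ⟨fun _ b y _ => Block.InFil.zero,
      fun _ => ⟨x, rfl⟩⟩⟩
  | succ ℓ ih =>
    have := ih.1
    have hb := ih.pick hE hP
    refine ⟨inferInstanceAs (Mono (kernel.ι (LongDiag.pick (P (ℓ + 1) (tower P ℓ))) ≫
      (tower P ℓ).hom)), fun W x => ⟨?_, fun hx => ?_⟩⟩
    · rintro ⟨a, rfl⟩ b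
      refine ((hb b).app_eq_zero_iff (W := W) (h.good b) hE (by omega)
        (Scheme.Modules.Hom.app (kernel.ι (LongDiag.pick (P (ℓ + 1) (tower P ℓ)))) W a)
        fun y hy => ih.inFil b _ hy).1 ?_
      exact (app_comp _ _ _).trans ((congrArg _ (kernel_ι_app (LongDiag.pick (P (ℓ + 1) (tower P ℓ)))
        (show Γ(kernel (LongDiag.pick (P (ℓ + 1) (tower P ℓ))), W) from a))).trans (app_zero _))
    · obtain ⟨a, rfl⟩ := (ih.2 W x).2 fun b y hy => (hx b y hy).mono (Nat.le_succ ℓ)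
      obtain ⟨a', ha'⟩ := exists_kernel_section (LongDiag.pick (P (ℓ + 1) (tower P ℓ))) a
        (h.ext fun b => by
          rw [app_zero, ← app_comp]
          exact ((hb b).app_eq_zero_iff (h.good b) hE (by omega) a
            fun y hy => ih.inFil b a hy).2 (hx b))
      exact ⟨a', congrArg (Scheme.Modules.Hom.app (tower P ℓ).hom W) ha'⟩

omit hE hP h in
lemma locExactOn_tower (P : ∀ (ℓ : ℕ) (A : Over (K₀ s E n)), (A.left ⟶ T ℓ 0) → Prop) (ℓ : ℕ) :
    LocExactOn ⊤ (towerι P ℓ) (towerφ P ℓ) :=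
  ⟨fun _ _ a => kernel_ι_app _ a, fun U _ a ha _ hy => by
    obtain ⟨a', ha'⟩ := exists_kernel_section _ a ha
    exact ⟨U, le_rfl, hy, a', by rw [rst_self]; exact ha'⟩⟩

/-- The sequence is exact at `T_ℓ^0` over an open subset on which the blocks do not interfere. -/
theorem locExactOn_towerφ [Finite Λ] {O : (Pow s n).Opens}
    (hsep : ∀ y ∈ O, ∀ b b', y ∈ Set.range (B b).ι → y ∈ Set.range (B b').ι →
      ∀ g g', (B b).col g = (B b').col g' → b = b') (ℓ : ℕ) :
    LocExactOn O (towerφ P ℓ) (d (ℓ + 1) 0) := by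
  classical
  have := Fintype.ofFinite Λ
  have hT := towerSpec (h := h) hE hP ℓ
  have hb := hT.pick hE hP
  refine ⟨fun U _ a => h.ext fun b => ?_, fun U hU τ hτ y hy => ?_⟩
  · rw [h.app_comm, app_zero, ← app_comp]
    exact (hb b).d_eq_zero (h.good b) hE (by omega) a
  have h0 : ∀ b, Scheme.Modules.Hom.app ((B b).d E (ℓ + 1) 0) U
      (Scheme.Modules.Hom.app (π b (ℓ + 1) 0) U τ) = 0 := fun b => by
    rw [← h.app_comm, hτ, app_zero]
  -- On a common neighbourhood `V` of `y`, each block either passes through `y` and has a local lift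
  -- with coordinates in the power `ℓ` of its ideal, or its diagonal misses `V` entirely.
  obtain ⟨V, hV, hyV, H⟩ := exists_common_open hy
    (fun b V => ∃ hV : V ≤ U, (y ∈ Set.range (B b).ι ∧ ∃ (Φ : Fr E) (hΦ : (B b).Dom Φ V)
        (f : ({t : Fin k // t ∈ (B b).S} → Fin 2) → Φ.Ix → Γ(Pow s n, V)),
        (∀ g α y (hy : y ∈ V), (Pow s n).presheaf.germ V y hy (f g α) ∈
          stalkIdeal (B b).ι y ^ ℓ) ∧ (B b).IsVal Φ (ℓ + 1) ((h.good b).zDom hΦ) f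
            (rst hV (Scheme.Modules.Hom.app (π b (ℓ + 1) 0) U τ))) ∨
      (y ∉ Set.range (B b).ι ∧ (B b).ι ⁻¹ᵁ V = ⊥))
    (fun b V V' hle ⟨hV, H⟩ => ⟨hle.trans hV, H.imp
      (fun ⟨hy, Φ, hΦ, f, hf, hv⟩ => ⟨hy, Φ, hΦ.mono hle, fun g α => rstO hle (f g α),
        fun g α y hy => by rw [germ_rstO]; exact hf g α y _, by
        have := hv.rst hle
        rwa [rst_rst] at this⟩)
      fun ⟨hy, hb⟩ => ⟨hy, le_bot_iff.1 (hb ▸ preim_le hle)⟩⟩)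
    (fun b => by
      by_cases hyb : y ∈ Set.range (B b).ι
      · obtain ⟨z, rfl⟩ := hyb
        obtain ⟨Φ, V, hV, hΦ, f, hyV, hf, hv⟩ :=
          Block.exists_isVal_of_d_eq_zero (h.good b) hE (by omega) _ (h0 b) hy
        exact ⟨V, hV, hyV, hV, .inl ⟨⟨z, rfl⟩, Φ, hΦ, f, hf, hv⟩⟩
      · obtain ⟨V, hV, hyV, hb⟩ := Block.exists_disjoint (h.good b) hyb hy
        exact ⟨V, hV, hyV, hV, .inr ⟨hyb, hb⟩⟩)
  choose hV' H using H
  -- The lift of a block is a section of `K_0` that is zero in all summands which the block does not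
  -- see.
  have hsec : ∀ b, ∃ x : Γ(K₀ s E n, V),
      (∀ c, (y ∉ Set.range (B b).ι ∨ c ∉ Set.range (B b).col) → comp s E n c x = 0) ∧
      (y ∈ Set.range (B b).ι → ∃ (Φ : Fr E) (hΦ : (B b).Dom Φ V)
        (f : ({t : Fin k // t ∈ (B b).S} → Fin 2) → Φ.Ix → Γ(Pow s n, V)),
        (∀ g α y (hy : y ∈ V), (Pow s n).presheaf.germ V y hy (f g α) ∈
          stalkIdeal (B b).ι y ^ ℓ) ∧ (B b).IsCoord Φ hΦ x f ∧
          (B b).IsVal Φ (ℓ + 1) ((h.good b).zDom hΦ) f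
            (rst (hV' b) (Scheme.Modules.Hom.app (π b (ℓ + 1) 0) U τ))) := by
    intro b
    rcases H b with ⟨hyb, Φ, hΦ, f, hf, hv⟩ | ⟨hyb, -⟩
    · obtain ⟨x, hx⟩ := exists_biproduct_section (W := V) (fun c : Fin k → Fin n =>
        shf (piTensor fun t => pre ((Scheme.Modules.pullback (pr s n (c t))).obj (E t))))
        fun c => if hc : ∃ g, (B b).col g = c then hc.choose_spec ▸
          (∑ α, f hc.choose α • Block.pureSec E (fun t => Φ.e t (α t)) ((B b).col hc.choose)
            (hΦ hc.choose)) else 0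
      refine ⟨x, fun c hc => (hx c).trans (dif_neg ?_), fun _ => ⟨Φ, hΦ, f, hf, fun g => ?_, hv⟩⟩
      · rintro ⟨g, hg⟩
        exact hc.elim (fun h => h hyb) fun h => h ⟨g, hg⟩
      · have hg : ∃ g', (B b).col g' = (B b).col g := ⟨g, rfl⟩
        refine (hx _).trans ((dif_pos hg).trans ?_)
        -- The component at `col g` was defined with a chosen vertex having the same colouring;
        -- injectivity of `col` identifies that vertex with `g`.
        have key : ∀ (g' : {t : Fin k // t ∈ (B b).S} → Fin 2) (e : (B b).col g' = (B b).col g),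
            g' = g → (e ▸ (∑ α, f g' α • Block.pureSec E (fun t => Φ.e t (α t)) ((B b).col g') (hΦ g')) :
              Γ(shf (piTensor fun t =>
                pre ((Scheme.Modules.pullback (pr s n ((B b).col g t))).obj (E t))), V)) =
            ∑ α, f g α • Block.pureSec E (fun t => Φ.e t (α t)) ((B b).col g) (hΦ g) := by
          rintro _ e rfl; rfl
        exact key _ hg.choose_spec (Block.col_injective (h.good b) hg.choose_spec)
    · exact ⟨0, fun c _ => app_zero _, fun h => absurd h hyb⟩
  choose x hx0 hx using hsec
  -- By the separation hypothesis no other block through `y` shares a summand with `b`, so adding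
  -- the other lifts does not disturb the components seen by `b`.
  have hcomp : ∀ b, y ∈ Set.range (B b).ι → ∀ g,
      comp s E n ((B b).col g) (∑ b', x b') = comp s E n ((B b).col g) (x b) := by
    intro b hyb g
    refine (Block.comp_sum _ _ _).trans (Finset.sum_eq_single b (fun b' _ hb' => ?_) (by simp))
    refine hx0 b' _ ?_
    by_cases hyb' : y ∈ Set.range (B b').ι
    · right
      rintro ⟨g', hg'⟩
      exact hb' (hsep y (hU hy) b' b hyb' hyb g' g hg')
    · exact .inl hyb'
  -- Coordinates in the power `ℓ` of the ideal satisfy all conditions of order at most `ℓ`; for a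
  -- block that misses `V` the conditions are vacuous. Hence the sum is a section of `K_ℓ`.
  have hfil : ∀ b, ∀ y' ∈ V, (B b).InFil ℓ (∑ b', x b') y' := by
    intro b y' hy'
    by_cases hyb : y ∈ Set.range (B b).ι
    · obtain ⟨Φ, hΦ, f, hf, hc, -⟩ := hx b hyb
      refine Block.InFil.of_coord (hU := le_rfl) (hΦ := hΦ) (f := f) (h.good b) ?_ (hy := hy')
        fun α => FilAt.of_mem fun g => hf g α y' hy'
      rw [rst_self]
      exact fun g => (hcomp b hyb g).trans (hc g)
    · rcases H b with ⟨hyb', -⟩ | ⟨-, hbot⟩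
      · exact absurd hyb' hyb
      · exact .of_stalkIdeal_eq_top (stalkIdeal_eq_top hy' hbot)
  obtain ⟨a, ha⟩ := (hT.2 V _).2 hfil
  refine ⟨V, hV, hyV, a, h.ext fun b => ?_⟩
  rw [app_rst]
  refine (app_comp (towerφ P ℓ) (π b (ℓ + 1) 0) a).symm.trans ?_
  by_cases hyb : y ∈ Set.range (B b).ι
  · obtain ⟨Φ, hΦ, f, hf, hc, hv⟩ := hx b hyb
    refine Block.IsVal.unique (h.good b) ?_ hv
    refine (Block.isPhi_iff (h.good b) _ _ _).1 (hb b) Φ V hΦ a f ?_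
    rw [ha]
    exact fun g => (hcomp b hyb g).trans (hc g)
  · rcases H b with ⟨hyb', -⟩ | ⟨-, hbot⟩
    · exact absurd hyb' hyb
    · exact (Block.HV_section_eq_zero hbot _).trans (Block.HV_section_eq_zero hbot _).symm

end IsBlockSum

end Towers

/-! ### Smoothness of fibre powers. -/

section FibrePower

variable {X Y Y' S : Scheme.{0}} {s : X ⟶ S}

/-- The morphisms `p j : Y ⟶ X` over `S` exhibit `Y` as the fibre power `X^J` over `S`. -/
structure IsFibrePower (s : X ⟶ S) {J : Type} (q : Y ⟶ S) (p : J → (Y ⟶ X)) : Prop where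
  w : ∀ j, p j ≫ s = q
  lift : ∀ {W : Scheme.{0}} (g : W ⟶ S) (h : J → (W ⟶ X)), (∀ j, h j ≫ s = g) →
    ∃ l : W ⟶ Y, l ≫ q = g ∧ ∀ j, l ≫ p j = h j
  ext : ∀ {W : Scheme.{0}} (l l' : W ⟶ Y), l ≫ q = l' ≫ q → (∀ j, l ≫ p j = l' ≫ p j) → l = l'

lemma IsFibrePower.smooth_of {J : Type} {q : Y ⟶ S} {p : J → (Y ⟶ X)} {q' : Y' ⟶ S}
    {p' : J → (Y' ⟶ X)} (h : IsFibrePower s q p) (h' : IsFibrePower s q' p') [Smooth q'] :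
    Smooth q := by
  obtain ⟨a, ha, ha'⟩ := h'.lift q p h.w
  obtain ⟨b, hb, hb'⟩ := h.lift q' p' h'.w
  have : IsIso a := ⟨b, h.ext _ _ (by simp [ha, hb]) (by simp [ha', hb']),
    h'.ext _ _ (by simp [ha, hb]) (by simp [ha', hb'])⟩
  rw [← ha]
  infer_instance

lemma isFibrePower_widePullback (s : X ⟶ S) (J : Type) [Finite J] :
    IsFibrePower s (WidePullback.base fun _ : J => s) (WidePullback.π fun _ : J => s) where
  w := WidePullback.π_arrow _
  lift g h hw := ⟨WidePullback.lift g h hw, WidePullback.lift_base _ _ _ _,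
    WidePullback.lift_π _ _ _ _⟩
  ext _ _ hb hp := WidePullback.hom_ext _ _ _ hp hb

lemma IsFibrePower.option {J : Type} {q : Y ⟶ S} {p : J → (Y ⟶ X)} (h : IsFibrePower s q p) :
    IsFibrePower s (pullback.snd s q ≫ q)
      (fun j : Option J => j.elim (pullback.fst s q) fun j => pullback.snd s q ≫ p j) where
  w j := by
    cases j with
    | none => exact pullback.condition
    | some j => simp [h.w]
  lift g f hf := by
    obtain ⟨l, hl, hl'⟩ := h.lift g (fun j => f (some j)) fun j => hf _
    refine ⟨pullback.lift (f none) l (by rw [hf, hl]), by rw [pullback.lift_snd_assoc, hl], fun j => ?_⟩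
    cases j with
    | none => exact pullback.lift_fst _ _ _
    | some j => exact (pullback.lift_snd_assoc _ _ _ _).trans (hl' j)
  ext l l' hb hp := by
    refine pullback.hom_ext (hp none) (h.ext _ _ (by simpa using hb) fun j => ?_)
    simpa using hp (some j)

/-- Induction on the index set. The universal property determines the fibre power up to isomorphism,
so it may be taken to be `X ×_S X^J`, whose projection to `X^J` is a base change of `s`. -/
theorem IsFibrePower.smooth [Smooth s] {J : Type} [Finite J] : ∀ {Y : Scheme.{0}} {q : Y ⟶ S}
    {p : J → (Y ⟶ X)}, IsFibrePower s q p → Smooth q := by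
  induction J using Finite.induction_empty_option with
  | of_equiv e ih =>
    intro Y q p h
    refine ih (p := fun j => p (e j)) ⟨fun j => h.w _, fun g f hf => ?_, fun l l' hb hp =>
      h.ext l l' hb fun j => by simpa using hp (e.symm j)⟩
    obtain ⟨l, hl, hl'⟩ := h.lift g (fun j => f (e.symm j)) fun j => hf _
    exact ⟨l, hl, fun j => by simpa using hl' (e j)⟩
  | h_empty =>
    intro Y q p h
    have h' : IsFibrePower s (𝟙 S) (fun j : PEmpty => j.elim) :=
      ⟨fun j => j.elim, fun g f _ => ⟨g, by simp, fun j => j.elim⟩, fun l l' hb _ => by simpa using hb⟩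
    exact h.smooth_of h'
  | @h_option J _ ih =>
    intro Y q p h
    have h₀ := isFibrePower_widePullback s J
    have := ih h₀
    exact h.smooth_of h₀.option

end FibrePower

/-! ### The diagonals are smooth and closed, and give blocks with the required properties. -/

section Diagonals

variable {X : Scheme.{0}} (s : X ⟶ Spec (.of ℂ)) {k n : ℕ}

lemma isFibrePower_pow : IsFibrePower s (str s n) (pr s n) := isFibrePower_widePullback s (Fin n)

/-- On `Δ_ij` the projection to the factor `j` is determined by the one to the factor `i`, so the
remaining `n - 1` projections exhibit the diagonal as a fibre power; it is therefore smooth. -/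
lemma isFibrePower_delta {i j : Fin n} (hij : i ≠ j) :
    IsFibrePower s (J := {t : Fin n // t ≠ j}) (deltaι s n i j ≫ str s n)
      (fun t => deltaι s n i j ≫ pr s n t.1) where
  w t := by rw [Category.assoc, (isFibrePower_pow s).w]
  lift g f hf := by
    classical
    obtain ⟨l, hl, hl'⟩ := (isFibrePower_pow s).lift g
      (fun t => if h : t = j then f ⟨i, hij⟩ else f ⟨t, h⟩) fun t => by split_ifs <;> exact hf _
    refine ⟨equalizer.lift l (by rw [hl', hl', dif_neg hij, dif_pos rfl]), ?_, fun t => ?_⟩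
    · rw [equalizer.lift_ι_assoc, hl]
    · rw [equalizer.lift_ι_assoc, hl', dif_neg t.2]
  ext l l' hb hp := by
    refine equalizer.hom_ext ((isFibrePower_pow s).ext _ _ (by simpa using hb) fun t => ?_)
    by_cases ht : t = j
    · subst ht
      rw [Category.assoc, Category.assoc, ← equalizer.condition]
      simpa using hp ⟨i, hij⟩
    · simpa using hp ⟨t, ht⟩

lemma diag_pr (i : Fin 2) : diag s ≫ pr s 2 i = 𝟙 X := WidePullback.lift_π _ _ _ _ _

lemma diag_str : diag s ≫ str s 2 = s := WidePullback.lift_base _ _ _ _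

/-- The diagonal of `X²` is the diagonal `Δ_{12}`. -/
def diagIso : X ≅ Delta s 2 0 1 where
  hom := equalizer.lift (diag s) (by rw [diag_pr, diag_pr])
  inv := deltaι s 2 0 1 ≫ pr s 2 0
  hom_inv_id := by rw [equalizer.lift_ι_assoc, diag_pr]
  inv_hom_id := by
    refine equalizer.hom_ext ((isFibrePower_pow s).ext _ _ ?_ fun t => ?_)
    · simp [diag_str, (isFibrePower_pow s).w]
    · fin_cases t
      · simp [diag_pr]
      · simpa [diag_pr] using equalizer.condition (pr s 2 0) (pr s 2 1)

lemma isClosedImmersion_deltaι [IsSeparated s] (i j : Fin n) :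
    IsClosedImmersion (deltaι s n i j) := by
  have : X.IsSeparated := ⟨by
    rw [← terminal.comp_from s]
    infer_instance⟩
  infer_instance

lemma isClosedImmersion_diag [IsSeparated s] : IsClosedImmersion (diag s) := by
  have := isClosedImmersion_deltaι s (0 : Fin 2) 1
  have h : diag s = (diagIso s).hom ≫ deltaι s 2 0 1 := (equalizer.lift_ι _ _).symm
  rw [h]
  infer_instance

variable [Smooth s] [IsSeparated s]

lemma good_block (x : Label k n) : (block s x).Good := by
  have hne : x.1.1.1 ≠ x.1.1.2 := x.2.1.ne
  have : IsClosedImmersion (block s x).ι := isClosedImmersion_deltaι s x.1.1.1 x.1.1.2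
  have := (isFibrePower_pow s (n := n)).smooth
  refine ⟨hasClassMap_of_smooth _ (isAffineOpen_top _) (str s n) (isFibrePower_delta s hne).smooth,
    fun g t => ?_, hne⟩
  change deltaι s n x.1.1.1 x.1.1.2 ≫ pr s n ((block s x).col g t) =
    deltaι s n x.1.1.1 x.1.1.2 ≫ pr s n (x.1.2 t)
  rw [Block.col]
  split_ifs with h h'
  · rw [(Finset.mem_filter.1 h).2]; rfl
  · rw [(Finset.mem_filter.1 h).2]; exact (equalizer.condition _ _).symm
  · rfl

lemma good_diagBlock : (diagBlock s k).Good := by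
  have : IsClosedImmersion (diagBlock s k).ι := isClosedImmersion_diag s
  have := (isFibrePower_pow s (n := 2)).smooth
  have hd : Smooth (diag s ≫ str s 2) := by rwa [diag_str]
  refine ⟨hasClassMap_of_smooth _ (isAffineOpen_top _) (str s 2) hd, fun g t => ?_, ?_⟩
  · exact diag_pr s _
  · exact (by decide : (0 : Fin 2) ≠ 1)

end Diagonals

/-! ### The direct sums of blocks on `X²` and on `X^n`. -/

section Sums

variable {X : Scheme.{0}} (s : X ⟶ Spec (.of ℂ)) [Smooth s] [IsSeparated s] {k : ℕ}
  (E : Fin k → X.Modules)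

lemma isBlockSum₂ : IsBlockSum (E := E) (fun _ : Unit => diagBlock s k) (T₂ s E) (d₂ s E)
    (fun _ _ _ => 𝟙 _) where
  good _ := good_diagBlock s
  ext h := h ()
  exists_section t := ⟨t (), fun _ => rfl⟩
  exists_hom ψ := ⟨ψ (), fun _ => Category.comp_id _⟩
  comm _ _ _ := (Category.comp_id _).trans (Category.id_comp _).symm

omit [Smooth s] [IsSeparated s] in
lemma isPhi₂_iff (ℓ : ℕ) (A : Over (K₀ s E 2)) (ψ : A.left ⟶ T₂ s E ℓ 0) :
    IsPhi₂ s E ℓ A ψ ↔ ∀ _ : Unit, (diagBlock s k).IsPhi E ℓ A.hom (ψ ≫ 𝟙 _) := by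
  have e : ψ ≫ 𝟙 ((diagBlock s k).T E ℓ 0) = ψ := Category.comp_id _
  exact ⟨fun h _ => e.symm ▸ h, fun h => e ▸ h ()⟩

lemma isBlockSumₙ (n : ℕ) : IsBlockSum (E := E) (block s (k := k) (n := n)) (Tₙ s E n) (dₙ s E n)
    (fun x ℓ i => biproduct.π (fun x : Label k n => (block s x).T E ℓ i) x) where
  good := good_block s
  ext {ℓ i _ τ τ'} h :=
    biproduct_section_ext (fun x : Label k n => (block s x).T E ℓ i) (x := τ) (y := τ') h
  exists_section {ℓ i _} t :=
    exists_biproduct_section (fun x : Label k n => (block s x).T E ℓ i) t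
  exists_hom {ℓ i _} ψ := ⟨biproduct.lift (f := fun x : Label k n => (block s x).T E ℓ i) ψ,
    fun b => biproduct.lift_π (f := fun x : Label k n => (block s x).T E ℓ i) ψ b⟩
  comm b ℓ i := biproduct.map_π (fun x : Label k n => (block s x).d E ℓ i) b

omit [Smooth s] in
-- A point of `X^n_{**}` lies on at most one diagonal, which fixes `i` and `j`. The map `c` of the
-- label is then recovered from the colouring by replacing the value `j` by `i`, as `c` itself never
-- takes the value `j`.
lemma eq_of_col_eq {n : ℕ} {y : Pow s n} (hy : y ∈ openStar s n) (x x' : Label k n)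
    (hx : y ∈ Set.range (block s x).ι) (hx' : y ∈ Set.range (block s x').ι)
    (g g') (h : (block s x).col g = (block s x').col g') : x = x' := by
  have hp : x.1.1 = x'.1.1 := by
    by_contra hne
    exact hy (Set.mem_iUnion.2 ⟨⟨(x.1.1, x'.1.1), x.2.1, x'.2.1, hne⟩, hx, hx'⟩)
  have key : ∀ (x : Label k n) g t,
      x.1.2 t = if (block s x).col g t = x.1.1.2 then x.1.1.1 else (block s x).col g t := by
    intro x g t
    have hi : (block s x).i = x.1.1.1 := rfl
    have hj : (block s x).j = x.1.1.2 := rfl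
    have hc : (block s x).c = x.1.2 := rfl
    rw [Block.col, hi, hj, hc]
    by_cases ht : t ∈ (block s x).S
    · rw [dif_pos ht, (Finset.mem_filter.1 ht).2]
      split_ifs <;> first | rfl | contradiction
    · rw [dif_neg ht, if_neg (x.2.2 t)]
  refine Subtype.ext (Prod.ext hp (funext fun t => ?_))
  rw [key x g, key x' g', h, hp]

end Sums

/-! ### Tensor products with line bundles. -/

section Twist

variable {Y : Scheme.{0}} {M M' M'' N : Y.Modules} {U V W : Y.Opens}

/-- The section `e` generates the line bundle `N` over `V`. -/
def IsGen (N : Y.Modules) {V : Y.Opens} (e : Γ(N, V)) : Prop :=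
  ∀ (U : Y.Opens) (h : U ≤ V), Function.Bijective fun c : Γ(Y, U) => c • rst h e

lemma IsGen.rst {e : Γ(N, V)} (he : IsGen N e) (h : U ≤ V) : IsGen N (LongDiag.rst h e) := by
  intro W hW
  simp only [rst_rst]
  exact he W _

lemma IsFrameOn.isGen {κ : Type} [Fintype κ] [Unique κ] {e : κ → Γ(N, V)} (he : IsFrameOn N e) :
    IsGen N (e default) := by
  refine fun U h => (Function.bijective_iff_existsUnique _).2 fun x => ?_
  obtain ⟨c, hc, hu⟩ := he U h x
  refine ⟨c default, by simpa using hc.symm, fun c' hc' => ?_⟩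
  exact congrFun (hu (fun _ => c') (by simpa using hc'.symm)) default

/-- The presheaf tensor product of the sheaves `M` and `N`. -/
abbrev tensPre (M N : Y.Modules) : PreMod Y := tensorObj (C := PreMod Y) (pre M) (pre N)

/-- The section `x ⊗ e` of the presheaf tensor product. -/
def preTens (x : Γ(M, U)) (e : Γ(N, U)) : (tensPre M N).obj (op U) :=
  (show (pre M).obj (op U) from x) ⊗ₜ[(OO Y).obj (op U)] (show (pre N).obj (op U) from e)

lemma restrict_preTens (h : V ≤ U) (x : Γ(M, U)) (e : Γ(N, U)) :
    (tensPre M N).restrictₛₗ (homOfLE h).op (preTens x e) = preTens (rst h x) (rst h e) := rfl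

/-- The section `x ⊗ e` of the tensor product. -/
def tens (x : Γ(M, U)) (e : Γ(N, U)) : Γ((tensorFunctor N).obj M, U) :=
  toShf (tensPre M N) (preTens x e)

lemma rst_tens (h : V ≤ U) (x : Γ(M, U)) (e : Γ(N, U)) :
    rst h (tens x e) = tens (rst h x) (rst h e) :=
  ((toShf_rst (tensPre M N) h (preTens x e)).trans
    (congrArg (toShf (tensPre M N)) (restrict_preTens h x e)) :)

lemma map_tens (φ : M ⟶ M') (x : Γ(M, U)) (e : Γ(N, U)) :
    Scheme.Modules.Hom.app ((tensorFunctor N).map φ) U (tens x e) =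
      tens (Scheme.Modules.Hom.app φ U x) e :=
  sheafify_map_toShf (P := tensPre M N) (Q := tensPre M' N)
    ((tensorRight (C := PreMod Y) (pre N)).map ((Scheme.Modules.toPresheafOfModules Y).map φ))
    (preTens x e)

lemma zero_tens (e : Γ(N, U)) : tens (0 : Γ(M, U)) e = 0 :=
  (congrArg (toShf (tensPre M N)) (TensorProduct.zero_tmul _ _)).trans (toShf_zero _)

/-- Where `N` is free of rank one, the presheaf tensor product is isomorphic to `M` section by
section, before any sheafification. -/
lemma IsGen.bijective_preTens {e : Γ(N, U)} (he : IsGen N e) :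
    Function.Bijective fun x : Γ(M, U) => preTens x e := by
  let R : Type := (OO Y).obj (op U)
  let A : Type := (pre M).obj (op U)
  let B : Type := (pre N).obj (op U)
  let e' : B := e
  have hb : Function.Bijective (LinearMap.toSpanSingleton R B e') := by
    have := he U le_rfl
    rw [rst_self] at this
    exact this
  let F : A ≃ₗ[R] A ⊗[R] B := (TensorProduct.rid R A).symm ≪≫ₗ
    TensorProduct.congr (LinearEquiv.refl R A) (LinearEquiv.ofBijective _ hb)
  have hF : ∀ x : A, F x = x ⊗ₜ[R] e' := fun x => by
    change x ⊗ₜ[R] ((1 : R) • e') = _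
    rw [one_smul]
  have : (fun x : A => x ⊗ₜ[R] e') = F := funext fun x => (hF x).symm
  change Function.Bijective fun x : A => x ⊗ₜ[R] e'
  rw [this]
  exact F.bijective

lemma IsGen.exists_eq_tens {e : Γ(N, V)} (he : IsGen N e) (z : Γ((tensorFunctor N).obj M, W))
    {y : Y} (hy : y ∈ W) (hyV : y ∈ V) : ∃ (U : Y.Opens) (hU : U ≤ W) (hV : U ≤ V) (x : Γ(M, U)),
      y ∈ U ∧ LongDiag.rst hU z = tens x (LongDiag.rst hV e) := by
  obtain ⟨U, hU, z', hyU, hz⟩ := toShf_locally_surjective (tensPre M N) z y hy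
  obtain ⟨x, hx⟩ := (he.rst (inf_le_right : U ⊓ V ≤ V)).bijective_preTens (M := M).2
    ((tensPre M N).map (homOfLE (inf_le_left : U ⊓ V ≤ U)).op z')
  refine ⟨U ⊓ V, inf_le_left.trans hU, inf_le_right, x, ⟨hyU, hyV⟩, ?_⟩
  refine (rst_rst (M := (tensorFunctor N).obj M) hU inf_le_left z).symm.trans
    ((congrArg _ hz).trans ?_)
  exact (toShf_rst (tensPre M N) inf_le_left z').trans
    (congrArg (toShf (tensPre M N)) hx.symm)

lemma IsGen.locally_zero {e : Γ(N, U)} (he : IsGen N e) {x : Γ(M, U)} (hx : tens x e = 0) {y : Y}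
    (hy : y ∈ U) : ∃ (U' : Y.Opens) (hU : U' ≤ U), y ∈ U' ∧ LongDiag.rst hU x = 0 := by
  obtain ⟨U', hU, hyU, h⟩ := toShf_locally_injective (tensPre M N) (preTens x e) hx y hy
  refine ⟨U', hU, hyU, (he.rst hU).bijective_preTens.1 ?_⟩
  exact (show preTens (LongDiag.rst hU x) (LongDiag.rst hU e) = 0 from h).trans
    (TensorProduct.zero_tmul _ _).symm

/-- The sheaf `N` is invertible. -/
def LocGen (N : Y.Modules) : Prop := ∀ y : Y, ∃ (V : Y.Opens) (e : Γ(N, V)), y ∈ V ∧ IsGen N e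

variable (hN : LocGen N)

include hN

/-- Locally every section of the tensor product is `x ⊗ e` with `e` a generator of `N`, and `e` can
be cancelled after shrinking; local exactness thus carries over. -/
theorem LocExactOn.tensor {f : M ⟶ M'} {g : M' ⟶ M''} (h : LocExactOn ⊤ f g) :
    LocExactOn ⊤ ((tensorFunctor N).map f) ((tensorFunctor N).map g) := by
  refine ⟨fun W _ z => section_ext fun y hy => ?_, fun W _ z hz y hy => ?_⟩
  · obtain ⟨V, e, hyV, he⟩ := hN y
    obtain ⟨U, hU, hV, x, hyU, hx⟩ := he.exists_eq_tens z hy hyV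
    refine ⟨U, hU, hyU, ?_⟩
    rw [rst_zero, ← app_rst, ← app_rst, hx, map_tens, map_tens, h.1 U le_top, zero_tens]
  · obtain ⟨V, e, hyV, he⟩ := hN y
    obtain ⟨U, hU, hV, x, hyU, hx⟩ := he.exists_eq_tens z hy hyV
    have h0 : tens (Scheme.Modules.Hom.app g U x) (rst hV e) = 0 := by
      rw [← map_tens, ← hx, app_rst, hz, rst_zero]
    obtain ⟨U', hU', hyU', h1⟩ := (he.rst hV).locally_zero h0 hyU
    rw [← app_rst] at h1
    obtain ⟨O, hO, hyO, w, hw⟩ := h.2 U' le_top _ h1 y hyU'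
    refine ⟨O, hO.trans (hU'.trans hU), hyO, tens w (rst (hO.trans (hU'.trans hV)) e), ?_⟩
    rw [map_tens, hw, rst_rst, ← rst_rst hU (hO.trans hU'), hx, rst_tens, rst_rst]

theorem mono_tensor (f : M ⟶ M') [Mono f] : Mono ((tensorFunctor N).map f) := by
  refine mono_of_injective_sections _ fun W => (injective_iff_map_eq_zero
    (Scheme.Modules.Hom.app ((tensorFunctor N).map f) W).hom).2 fun z hz => section_ext fun y hy => ?_
  obtain ⟨V, e, hyV, he⟩ := hN y
  obtain ⟨U, hU, hV, x, hyU, hx⟩ := he.exists_eq_tens z hy hyV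
  have h0 : tens (Scheme.Modules.Hom.app f U x) (rst hV e) = 0 := by
    rw [← map_tens, ← hx, app_rst]
    exact (congrArg _ hz).trans (rst_zero _)
  obtain ⟨U', hU', hyU', h1⟩ := (he.rst hV).locally_zero h0 hyU
  refine ⟨U', hU'.trans hU, hyU', ?_⟩
  have h2 : rst hU' x = 0 := injective_of_mono f U' (by rw [app_rst, h1, app_zero])
  rw [← rst_rst hU hU', hx, rst_tens, h2, zero_tens, rst_zero]

theorem isZero_tensor (h : ∀ (U : Y.Opens) (x : Γ(M, U)), x = 0) :
    IsZero ((tensorFunctor N).obj M) := by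
  refine isZero_of_sections fun W z => section_ext fun y hy => ?_
  obtain ⟨V, e, hyV, he⟩ := hN y
  obtain ⟨U, hU, hV, x, hyU, hx⟩ := he.exists_eq_tens z hy hyV
  exact ⟨U, hU, hyU, by rw [hx, h U x, zero_tens, rst_zero]⟩

omit hN

lemma locGen_boxSq {X : Scheme.{0}} (s : X ⟶ Spec (.of ℂ)) {L : X.Modules} (hL : IsLineBundle L) :
    LocGen (boxSq s L) := by
  intro y
  choose V e hyV he using fun i : Fin 2 => hL (pr s 2 i y)
  let W : (Pow s 2).Opens := pr s 2 0 ⁻¹ᵁ V 0 ⊓ pr s 2 1 ⁻¹ᵁ V 1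
  have hW : ∀ i, W ≤ pr s 2 i ⁻¹ᵁ V i := fun i => by
    fin_cases i
    · exact inf_le_left
    · exact inf_le_right
  have hf := isFrameOn_pureTensor (M := fun i => (Scheme.Modules.pullback (pr s 2 i)).obj L)
    (κ := fun _ => Fin 1) (W := W) (fun i α => pull (pr s 2 i) L (e i α) (hW i))
    fun i => (he i).isFrameOn.pull (pr s 2 i) (hW i)
  exact ⟨W, _, ⟨hyV 0, hyV 1⟩, hf.isGen⟩

end Twist

/-! ### Assembly of the long exact sequences. -/

section Sequences

variable {X : Scheme.{0}} {s : X ⟶ Spec (.of ℂ)} {k n : ℕ} {E : Fin k → X.Modules}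
  {Λ : Type} [Finite Λ] {B : Λ → Block s k n} {T : ℕ → ℕ → (Pow s n).Modules}
  {d : ∀ ℓ i, T ℓ i ⟶ T ℓ (i + 1)} {π : ∀ b ℓ i, T ℓ i ⟶ (B b).T E ℓ i}
  (h : IsBlockSum B T d π) (hE : ∀ t, IsLocFree (E t))
  {P : ∀ (ℓ : ℕ) (A : Over (K₀ s E n)), (A.left ⟶ T ℓ 0) → Prop}
  (hP : ∀ ℓ A ψ, P ℓ A ψ ↔ ∀ b, (B b).IsPhi E ℓ A.hom (ψ ≫ π b ℓ 0))

include h hE hP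

omit [Finite Λ] in
theorem existsUnique_tower (ℓ : ℕ) : ∃! ψ : (tower P ℓ).left ⟶ T (ℓ + 1) 0, P (ℓ + 1) (tower P ℓ) ψ :=
  IsBlockSum.TowerSpec.existsUnique (h := h) hE hP (IsBlockSum.towerSpec hE hP ℓ)

theorem isLongExact_tower (hsep : ∀ y : Pow s n, ∀ b b', y ∈ Set.range (B b).ι →
      y ∈ Set.range (B b').ι → ∀ g g', (B b).col g = (B b').col g' → b = b') (ℓ : ℕ) (hℓ : ℓ < k) :
    IsLongExact (T := T (ℓ + 1)) (towerι P ℓ) (towerφ P ℓ) (d (ℓ + 1)) (k - (ℓ + 1)) where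
  mono := inferInstanceAs (Mono (kernel.ι _))
  exact_left := (IsBlockSum.locExactOn_tower P ℓ).exact
  exact_zero := (IsBlockSum.locExactOn_towerφ (h := h) (O := ⊤) hE hP (fun y _ => hsep y) ℓ).exact
  exact_succ i _ := (h.locExactOn_d (Nat.le_add_left 1 ℓ) i).exact
  -- In position `k - (ℓ + 1) + 1` the index sets `M` would need `k + 1` elements.
  isZero := isZero_of_sections fun _ τ => h.section_eq_zero (by omega) τ

theorem isLongExactAfter_tensor {N : (Pow s n).Modules} (hN : LocGen N)
    (hsep : ∀ y : Pow s n, ∀ b b', y ∈ Set.range (B b).ι →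
      y ∈ Set.range (B b').ι → ∀ g g', (B b).col g = (B b').col g' → b = b') (ℓ : ℕ) (hℓ : ℓ < k) :
    IsLongExactAfter (T := T (ℓ + 1)) (tensorFunctor N) (towerι P ℓ) (towerφ P ℓ) (d (ℓ + 1))
      (k - (ℓ + 1)) where
  mono := by
    have : Mono (towerι P ℓ) := inferInstanceAs (Mono (kernel.ι _))
    exact mono_tensor hN _
  exact_left := ((IsBlockSum.locExactOn_tower P ℓ).tensor hN).exact
  exact_zero :=
    ((IsBlockSum.locExactOn_towerφ (h := h) (O := ⊤) hE hP (fun y _ => hsep y) ℓ).tensor hN).exact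
  exact_succ i _ := ((h.locExactOn_d (Nat.le_add_left 1 ℓ) i).tensor hN).exact
  isZero := isZero_tensor hN fun _ τ => h.section_eq_zero (by omega) τ

theorem isLongExactAfter_restrict {O : (Pow s n).Opens}
    (hsep : ∀ y ∈ O, ∀ b b', y ∈ Set.range (B b).ι → y ∈ Set.range (B b').ι →
      ∀ g g', (B b).col g = (B b').col g' → b = b') (ℓ : ℕ) (hℓ : ℓ < k) :
    IsLongExactAfter (T := T (ℓ + 1)) (Scheme.Modules.restrictFunctor O.ι) (towerι P ℓ)
      (towerφ P ℓ) (d (ℓ + 1)) (k - (ℓ + 1)) where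
  mono := by
    have : Mono (towerι P ℓ) := inferInstanceAs (Mono (kernel.ι _))
    exact mono_of_injective_sections _ fun U => injective_of_mono (towerι P ℓ) (O.ι ''ᵁ U)
  exact_left := ((IsBlockSum.locExactOn_tower P ℓ).mono le_top).restrict.exact
  exact_zero := (IsBlockSum.locExactOn_towerφ (h := h) hE hP hsep ℓ).restrict.exact
  exact_succ i _ := ((h.locExactOn_d (Nat.le_add_left 1 ℓ) i).mono le_top).restrict.exact
  isZero := isZero_of_sections fun U τ =>
    h.section_eq_zero (i := k - (ℓ + 1) + 1) (W := O.ι ''ᵁ U) (by omega) τ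

end Sequences
-- The blocks of the theorem.
section Main

variable {X : Scheme.{0}} (s : X ⟶ Spec (.of ℂ)) [Smooth s] [IsSeparated s] {k : ℕ}
  {E : Fin k → X.Modules} (hE : ∀ t, IsLocFree (E t))

include hE

lemma existsUnique_isPhi₂ (ℓ : ℕ) : ∃! ψ, IsPhi₂ s E (ℓ + 1) (tower (IsPhi₂ s E) ℓ) ψ :=
  existsUnique_tower (P := IsPhi₂ s E) (isBlockSum₂ s E) hE (isPhi₂_iff s E) ℓ

omit hE [Smooth s] [IsSeparated s] in
lemma isPhiₙ_iff {n : ℕ} (ℓ : ℕ) (A : Over (K₀ s E n)) (ψ : A.left ⟶ Tₙ s E n ℓ 0) :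
    IsPhiₙ s E n ℓ A ψ ↔ ∀ x : Label k n, (block s x).IsPhi E ℓ A.hom
      (ψ ≫ (fun x ℓ i => biproduct.π (fun x : Label k n => (block s x).T E ℓ i) x :
        ∀ (x : Label k n) ℓ i, Tₙ s E n ℓ i ⟶ (block s x).T E ℓ i) x ℓ 0) := Iff.rfl

lemma existsUnique_isPhiₙ (n ℓ : ℕ) :
    ∃! ψ, IsPhiₙ s E n (ℓ + 1) (tower (IsPhiₙ s E n) ℓ) ψ :=
  existsUnique_tower (P := IsPhiₙ s E n) (isBlockSumₙ s E n) hE (isPhiₙ_iff s) ℓ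

lemma isLongExactAfter_restrictₙ (n ℓ : ℕ) (hℓ : ℓ < k) :
    IsLongExactAfter (T := Tₙ s E n (ℓ + 1)) (Scheme.Modules.restrictFunctor (openStar s n).ι)
      (towerι (IsPhiₙ s E n) ℓ) (towerφ (IsPhiₙ s E n) ℓ) (dₙ s E n (ℓ + 1)) (k - (ℓ + 1)) :=
  isLongExactAfter_restrict (isBlockSumₙ s E n) hE (isPhiₙ_iff s)
    (fun _ hy x x' => eq_of_col_eq s hy x x') ℓ hℓ

end Main

end LongDiag

end

theorem proposition6p2 (X : Scheme.{0}) (s : X ⟶ Spec (.of ℂ))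
    [SmoothOfRelativeDimension 2 s] [IsSeparated s]
    (k : ℕ) (E : Fin k → X.Modules) (hE : ∀ t, IsLocFree (E t)) :
    (∀ ℓ < k,
      (∃! ψ, IsPhi₂ s E (ℓ + 1) (tower (IsPhi₂ s E) ℓ) ψ) ∧
      IsLongExact (T := T₂ s E (ℓ + 1)) (towerι (IsPhi₂ s E) ℓ) (towerφ (IsPhi₂ s E) ℓ)
        (d₂ s E (ℓ + 1)) (k - (ℓ + 1)) ∧
      ∀ L : X.Modules, IsLineBundle L →
        IsLongExactAfter (T := T₂ s E (ℓ + 1)) (tensorFunctor (boxSq s L))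
          (towerι (IsPhi₂ s E) ℓ) (towerφ (IsPhi₂ s E) ℓ) (d₂ s E (ℓ + 1)) (k - (ℓ + 1))) ∧
    (∀ n : ℕ, ∀ ℓ < k,
      (∃! ψ, IsPhiₙ s E n (ℓ + 1) (tower (IsPhiₙ s E n) ℓ) ψ) ∧
      IsLongExactAfter (T := Tₙ s E n (ℓ + 1))
        (Scheme.Modules.restrictFunctor (openStar s n).ι)
        (towerι (IsPhiₙ s E n) ℓ) (towerφ (IsPhiₙ s E n) ℓ) (dₙ s E n (ℓ + 1))
        (k - (ℓ + 1))) := by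
  have : Smooth s := SmoothOfRelativeDimension.smooth 2 s
  refine ⟨fun ℓ hℓ => ⟨?_, ?_, fun L hL => ?_⟩, fun n ℓ hℓ => ⟨?_, ?_⟩⟩
  · exact existsUnique_isPhi₂ s hE ℓ
  -- On `X²` there is a single block, so the separation of blocks holds trivially at every point,
  -- and no open set has to be removed.
  · exact isLongExact_tower (isBlockSum₂ s E) hE (isPhi₂_iff s E) (fun _ _ _ _ _ _ _ _ => rfl) ℓ hℓ
  · exact isLongExactAfter_tensor (isBlockSum₂ s E) hE (isPhi₂_iff s E) (locGen_boxSq s hL)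
      (fun _ _ _ _ _ _ _ _ => rfl) ℓ hℓ
  · exact existsUnique_isPhiₙ s hE n ℓ
  · exact isLongExactAfter_restrictₙ s hE n ℓ hℓ
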